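/- Let $f\in C^2(\mathbb R^2)$ be supported in $[-1,1]\times[-1,1]$ with $f(x,y)=f(-x,-y)$ for all $x,y$. Consider on the real line the system $$\omega_t+u\,\omega_x=\theta_x,\qquad \theta_t+u\,\theta_x=0,\qquad u(x,t)=\frac1\pi\int_{\mathbb R}\bigl(\log|x-y|+f(x,y)\bigr)\,\omega(y,t)\,dy .$$ A solution on $[0,T)$ is a pair $(\omega,\theta)$ such that $\omega$ and $\theta_x$ belong to $C([0,T);H^1(\mathbb R))$ and are compactly supported in $x$, uniformly for $t$ in compact subsets of $[0,T)$, the equation for $\theta$ holds pointwise, and the equation for $\omega$ holds in $L^2(\mathbb R)$ at each time $t\in[0,T)$, where $\omega_t$ is the derivative of $t\mapsto\omega(\cdot,t)\in L^2(\mathbb R)$. Then for all $0<\varepsilon\le 1$ and $M>0$ there are initial data $(\omega_0,\theta_0)$ whose solution blows up in finite time. More precisely: there are $\omega_0,\theta_0\in C^\infty(\mathbb R)$ such that $\omega_0$ and $\theta_0'$ are odd, non-negative on $[0,1]$ and supported in $[-\varepsilon,\varepsilon]$, $\theta_0(0)=0$ and $\|\theta_0\|_{L^\infty}\le M$, and there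 is a time $0<T^*<\infty$ and a solution $(\omega,\theta)$ on $[0,T^*)$ with these data, such that (i) it is unique and maximal: every solution with the same data on an interval $[0,T)$ satisfies $T\le T^*$ and coincides with $(\omega,\theta)$ on $[0,T)$; (ii) $\omega(\cdot,t)$ and $\theta_x(\cdot,t)$ are supported in $[-1,1]$ for all $t\in[0,T^*)$ (so that the integral defining $u$ may be taken over $[-1,1]$); (iii) $\int_0^t\|u_x(\cdot,\tau)\|_{L^\infty}\,d\tau<\infty$ for $t\in[0,T^*)$, and $$\lim_{t\nearrow T^*}\int_0^t\|u_x(\cdot,\tau)\|_{L^\infty}\,d\tau=\infty .$$ -/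

import Mathlib

open Set Filter Topology MeasureTheory
open scoped ENNReal

noncomputable section

namespace HouLuo

/-- The Biot-Savart law on the real line with kernel `(1/π) (log |x - y| + f (x, y))`:
`velocity f w x = (1/π) ∫ (log |x - y| + f (x, y)) w(y) dy`. It is only applied to continuous
compactly supported `w`, for which the integral converges absolutely. -/
def velocity (f : ℝ → ℝ → ℝ) (w : ℝ → ℝ) (x : ℝ) : ℝ :=
  (1 / Real.pi) * ∫ y, (Real.log |x - y| + f x y) * w y

/-- `w` is (the absolutely continuous representative of) an element of the Sobolev space
`H¹(ℝ) = W^{1,2}(ℝ)`, and `w'` is its weak derivative. -/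
structure IsH1 (w w' : ℝ → ℝ) : Prop where
  memLp : MemLp w 2 volume
  memLp_deriv : MemLp w' 2 volume
  integral_deriv : ∀ a b : ℝ, ∫ x in a..b, w' x = w b - w a

/-- `w ∈ C([0,T); H¹(ℝ))`, and `w' t` is the weak derivative of `w t`. The arguments of `w` are
time and space, in this order. -/
structure IsH1Curve (T : ℝ) (w w' : ℝ → ℝ → ℝ) : Prop where
  isH1 : ∀ t ∈ Ico 0 T, IsH1 (w t) (w' t)
  continuous : ∀ t ∈ Ico 0 T,
    Tendsto (fun s => eLpNorm (w s - w t) 2 volume) (𝓝[Ico 0 T] t) (𝓝 0)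
  continuous_deriv : ∀ t ∈ Ico 0 T,
    Tendsto (fun s => eLpNorm (w' s - w' t) 2 volume) (𝓝[Ico 0 T] t) (𝓝 0)

/-- `(ω, θ)` is a (strong) solution on the time interval `[0, T)` of
`ω_t + u ω_x = θ_x`, `θ_t + u θ_x = 0`, `u = velocity f ω`, with data `(ω₀, θ₀)`, in the class
`ω ∈ C([0,T); H¹)`, `θ_x ∈ C([0,T); H¹)`, with `ω` and `θ_x` compactly supported in space,
uniformly on compact time intervals. The equation for `θ` holds at every point; the equation for
`ω` holds in `L²(ℝ)` at every time, `ω_t` being the derivative of an `L²(ℝ)`-valued function.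
Time derivatives at `t = 0` are one-sided. -/
structure IsSolution (f : ℝ → ℝ → ℝ) (T : ℝ) (ω₀ θ₀ : ℝ → ℝ) (ω θ : ℝ → ℝ → ℝ) : Prop where
  init_vorticity : ω 0 = ω₀
  init_density : θ 0 = θ₀
  compact_support : ∀ S < T, ∃ R : ℝ, ∀ t ∈ Icc 0 S, ∀ x : ℝ, R < |x| →
    ω t x = 0 ∧ deriv (θ t) x = 0
  differentiable_density : ∀ t ∈ Ico 0 T, Differentiable ℝ (θ t)
  regular_density : ∃ θxx : ℝ → ℝ → ℝ, IsH1Curve T (fun t => deriv (θ t)) θxx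
  density_eq : ∀ t ∈ Ico 0 T, ∀ x : ℝ,
    HasDerivWithinAt (fun s => θ s x) (-(velocity f (ω t) x * deriv (θ t) x)) (Ico 0 T) t
  vorticity_eq : ∃ ωx : ℝ → ℝ → ℝ, IsH1Curve T ω ωx ∧ ∀ t ∈ Ico 0 T,
    Tendsto (fun s => eLpNorm (fun x => (ω s x - ω t x) / (s - t)
        - (deriv (θ t) x - velocity f (ω t) x * ωx t x)) 2 volume)
      (𝓝[Ico 0 T \ {t}] t) (𝓝 0)

/-- `∫_0^t ‖u_x(·, τ)‖_{L^∞} dτ` for `u = velocity f ω`, as an extended non-negative real. -/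
def gradientIntegral (f : ℝ → ℝ → ℝ) (ω : ℝ → ℝ → ℝ) (t : ℝ) : ℝ≥0∞ :=
  ∫⁻ τ in Ioc 0 t, eLpNorm (deriv (velocity f (ω τ))) ∞ volume

/-- The initial data: `ω₀` and `θ₀` are smooth, `ω₀` and `θ₀'` are odd, supported in `[-ε, ε]` and
non-negative on `[0, 1]`, `θ₀(0) = 0` and `‖θ₀‖_∞ ≤ M`. -/
structure IsAdmissible (ε M : ℝ) (ω₀ θ₀ : ℝ → ℝ) : Prop where
  smooth_vorticity : ContDiff ℝ (⊤ : ℕ∞) ω₀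
  smooth_density : ContDiff ℝ (⊤ : ℕ∞) θ₀
  odd_vorticity : ∀ x, ω₀ (-x) = -ω₀ x
  odd_density : ∀ x, deriv θ₀ (-x) = -deriv θ₀ x
  support_vorticity : Function.support ω₀ ⊆ Icc (-ε) ε
  support_density : Function.support (deriv θ₀) ⊆ Icc (-ε) ε
  nonneg_vorticity : ∀ x ∈ Icc (0 : ℝ) 1, 0 ≤ ω₀ x
  nonneg_density : ∀ x ∈ Icc (0 : ℝ) 1, 0 ≤ deriv θ₀ x
  density_zero : θ₀ 0 = 0
  density_le : ∀ x, |θ₀ x| ≤ M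

/-- `(ω, θ)` is the maximal solution with data `(ω₀, θ₀)`, and `Tstar` is its time of existence:
it solves the system on `[0, Tstar)`, and every solution with the same data, on any `[0, T)`, is a
restriction of it. -/
def IsMaximalSolution (f : ℝ → ℝ → ℝ) (Tstar : ℝ) (ω₀ θ₀ : ℝ → ℝ) (ω θ : ℝ → ℝ → ℝ) : Prop :=
  IsSolution f Tstar ω₀ θ₀ ω θ ∧
    ∀ (T : ℝ) (ω₁ θ₁ : ℝ → ℝ → ℝ), IsSolution f T ω₀ θ₀ ω₁ θ₁ →
      T ≤ Tstar ∧ ∀ t ∈ Ico 0 T, ω₁ t = ω t ∧ θ₁ t = θ t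

end HouLuo

end

noncomputable section

namespace HouLuo

/-! ### Square integrals -/

theorem eLpNorm_two_eq {f : ℝ → ℝ} {μ : Measure ℝ} (hf : MemLp f 2 μ) :
    eLpNorm f 2 μ = ENNReal.ofReal (√(∫ x, f x ^ 2 ∂μ)) := by
  rw [hf.eLpNorm_eq_integral_rpow_norm (by norm_num) (by norm_num), Real.sqrt_eq_rpow]
  simp

theorem eLpNorm_two_le_iff {f : ℝ → ℝ} {μ : Measure ℝ} (hf : MemLp f 2 μ) {K : ℝ} (hK : 0 ≤ K) :
    eLpNorm f 2 μ ≤ ENNReal.ofReal K ↔ ∫ x, f x ^ 2 ∂μ ≤ K ^ 2 := by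
  rw [eLpNorm_two_eq hf, ENNReal.ofReal_le_ofReal_iff hK, Real.sqrt_le_left hK]

theorem MemLp.intervalIntegrable_of_two {p : ℝ → ℝ} (hp : MemLp p 2 volume) (a b : ℝ) :
    IntervalIntegrable p volume a b := by
  rw [intervalIntegrable_iff]
  have : IsFiniteMeasure (volume.restrict (uIoc a b)) := ⟨by simp [uIoc]⟩
  exact (hp.restrict _).integrable (by norm_num)

theorem sq_intervalIntegral_le {p : ℝ → ℝ} (hp : MemLp p 2 volume) {a b : ℝ} (hab : a ≤ b) :
    (∫ x in a..b, p x) ^ 2 ≤ (b - a) * ∫ x in a..b, p x ^ 2 := by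
  rcases hab.eq_or_lt with rfl | hlt
  · simp
  have h1 : IntervalIntegrable p volume a b := MemLp.intervalIntegrable_of_two hp a b
  have h2 : IntervalIntegrable (fun x => p x ^ 2) volume a b :=
    hp.integrable_sq.intervalIntegrable
  set I := ∫ x in a..b, p x
  have hpos : 0 < b - a := by linarith
  have key : 0 ≤ ∫ x in a..b, (p x - I / (b - a)) ^ 2 :=
    intervalIntegral.integral_nonneg hab fun _ _ => sq_nonneg _
  have : ∫ x in a..b, (p x - I / (b - a)) ^ 2
      = (∫ x in a..b, p x ^ 2) - 2 * (I / (b - a)) * I + (I / (b - a)) ^ 2 * (b - a) := by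
    have e : ∀ x, (p x - I / (b - a)) ^ 2
        = (p x ^ 2 - 2 * (I / (b - a)) * p x) + (I / (b - a)) ^ 2 := fun x => by ring
    simp_rw [e]
    rw [intervalIntegral.integral_add (h2.sub (h1.const_mul _)) (by simp),
      intervalIntegral.integral_sub h2 (h1.const_mul _), intervalIntegral.integral_const_mul,
      intervalIntegral.integral_const, smul_eq_mul]
    ring
  rw [this] at key
  have e2 : (b - a) * ((∫ x in a..b, p x ^ 2) - 2 * (I / (b - a)) * I + (I / (b - a)) ^ 2 * (b - a))
      = (b - a) * (∫ x in a..b, p x ^ 2) - I ^ 2 := by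
    field_simp; ring
  nlinarith [mul_nonneg hpos.le key]

/-! ### The `H¹` seminorm in terms of increments -/

/-- The normalised increments of `h` over the intervals `[a i, b i]`. -/
def slopeVec (h : ℝ → ℝ) {n : ℕ} (a b : Fin n → ℝ) : EuclideanSpace ℝ (Fin n) :=
  WithLp.toLp 2 fun i => (h (b i) - h (a i)) / √(b i - a i)

/-- `EnergyLE h K` says that the `L²` norm of the derivative of `h` is at most `K`, expressed through
increments of `h` over disjoint intervals. -/
def EnergyLE (h : ℝ → ℝ) (K : ℝ) : Prop :=
  ∀ (n : ℕ) (a b : Fin n → ℝ), (∀ i, a i ≤ b i) →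
    (Pairwise fun i j => Disjoint (Ioc (a i) (b i)) (Ioc (a j) (b j))) → ‖slopeVec h a b‖ ≤ K

theorem norm_slopeVec_sq (h : ℝ → ℝ) {n : ℕ} (a b : Fin n → ℝ) (hab : ∀ i, a i ≤ b i) :
    ‖slopeVec h a b‖ ^ 2 = ∑ i, (h (b i) - h (a i)) ^ 2 / (b i - a i) := by
  rw [EuclideanSpace.real_norm_sq_eq]
  refine Finset.sum_congr rfl fun i _ => ?_
  simp only [slopeVec, div_pow]
  rw [Real.sq_sqrt (by linarith [hab i])]

namespace EnergyLE

variable {h g : ℝ → ℝ} {K L : ℝ}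

theorem nonneg (hh : EnergyLE h K) : 0 ≤ K := by
  have := hh 0 Fin.elim0 Fin.elim0 (fun i => i.elim0) (fun i => i.elim0)
  exact (norm_nonneg _).trans this

theorem mono (hh : EnergyLE h K) (hKL : K ≤ L) : EnergyLE h L :=
  fun n a b hab hd => (hh n a b hab hd).trans hKL

theorem add (hh : EnergyLE h K) (hg : EnergyLE g L) : EnergyLE (fun x => h x + g x) (K + L) := by
  intro n a b hab hd
  have : slopeVec (fun x => h x + g x) a b = slopeVec h a b + slopeVec g a b := by
    ext i; simp [slopeVec]; ring
  rw [this]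
  exact (norm_add_le _ _).trans (add_le_add (hh n a b hab hd) (hg n a b hab hd))

theorem const_mul (hh : EnergyLE h K) (c : ℝ) : EnergyLE (fun x => c * h x) (|c| * K) := by
  intro n a b hab hd
  have : slopeVec (fun x => c * h x) a b = c • slopeVec h a b := by
    ext i; simp [slopeVec]; ring
  rw [this, norm_smul, Real.norm_eq_abs]
  exact mul_le_mul_of_nonneg_left (hh n a b hab hd) (abs_nonneg _)

theorem neg (hh : EnergyLE h K) : EnergyLE (fun x => -h x) K := by
  simpa using hh.const_mul (-1)

theorem sub (hh : EnergyLE h K) (hg : EnergyLE g L) : EnergyLE (fun x => h x - g x) (K + L) := by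
  simpa [sub_eq_add_neg] using hh.add hg.neg

theorem of_tendsto {ι : Type*} {l : Filter ι} [l.NeBot] {F : ι → ℝ → ℝ}
    (hF : ∀ᶠ i in l, EnergyLE (F i) K) (hlim : ∀ x, Tendsto (fun i => F i x) l (𝓝 (h x))) :
    EnergyLE h K := by
  intro n a b hab hd
  have : Tendsto (fun i => slopeVec (F i) a b) l (𝓝 (slopeVec h a b)) := by
    refine ((PiLp.continuous_toLp 2 _).tendsto _).comp ?_
    refine tendsto_pi_nhds.2 fun i => ?_
    exact ((hlim _).sub (hlim _)).div_const _
  exact le_of_tendsto this.norm (hF.mono fun i hi => hi n a b hab hd)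

theorem of_abs_sub_le {k : ℝ → ℝ} {c d : ℝ} (hc : 0 ≤ c) (hd : 0 ≤ d) (hh : EnergyLE h K)
    (hg : EnergyLE g L)
    (hk : ∀ x y, x ≤ y → |k y - k x| ≤ c * |h y - h x| + d * |g y - g x|) :
    EnergyLE k (c * K + d * L) := by
  intro n a b hab hdis
  let H : EuclideanSpace ℝ (Fin n) := WithLp.toLp 2 fun i => |slopeVec h a b i|
  let G : EuclideanSpace ℝ (Fin n) := WithLp.toLp 2 fun i => |slopeVec g a b i|
  have hH : ‖H‖ = ‖slopeVec h a b‖ := by simp [EuclideanSpace.norm_eq, H]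
  have hG : ‖G‖ = ‖slopeVec g a b‖ := by simp [EuclideanSpace.norm_eq, G]
  have key : ‖slopeVec k a b‖ ≤ ‖c • H + d • G‖ := by
    rw [EuclideanSpace.norm_eq, EuclideanSpace.norm_eq]
    refine Real.sqrt_le_sqrt (Finset.sum_le_sum fun i _ => ?_)
    refine pow_le_pow_left₀ (norm_nonneg _) ?_ 2
    have e1 : ‖slopeVec k a b i‖ = |k (b i) - k (a i)| / √(b i - a i) := by
      simp [slopeVec, abs_of_nonneg (Real.sqrt_nonneg _)]
    have e2 : (c • H + d • G) i
        = (c * |h (b i) - h (a i)| + d * |g (b i) - g (a i)|) / √(b i - a i) := by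
      simp [H, G, slopeVec, abs_div, abs_of_nonneg (Real.sqrt_nonneg _)]; ring
    rw [e1, e2]
    refine (div_le_div_of_nonneg_right (hk _ _ (hab i)) (Real.sqrt_nonneg _)).trans ?_
    exact le_abs_self _
  refine key.trans ((norm_add_le _ _).trans ?_)
  rw [norm_smul, norm_smul, hH, hG, Real.norm_of_nonneg hc, Real.norm_of_nonneg hd]
  exact add_le_add (mul_le_mul_of_nonneg_left (hh n a b hab hdis) hc)
    (mul_le_mul_of_nonneg_left (hg n a b hab hdis) hd)

theorem of_abs_sub_le' {k : ℝ → ℝ} {c : ℝ} (hc : 0 ≤ c) (hh : EnergyLE h K)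
    (hk : ∀ x y, x ≤ y → |k y - k x| ≤ c * |h y - h x|) :
    EnergyLE k (c * K) := by
  simpa using of_abs_sub_le hc le_rfl hh hh (by simpa using hk)

theorem comp_monotone {Φ : ℝ → ℝ} {Λ : ℝ} (hh : EnergyLE h K) (hΦ : Monotone Φ)
    (hΛ : 0 ≤ Λ) (hlip : ∀ x y, x ≤ y → Φ y - Φ x ≤ Λ ^ 2 * (y - x)) :
    EnergyLE (fun x => h (Φ x)) (Λ * K) := by
  intro n a b hab hd
  have hab' : ∀ i, Φ (a i) ≤ Φ (b i) := fun i => hΦ (hab i)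
  have hd' : Pairwise fun i j => Disjoint (Ioc (Φ (a i)) (Φ (b i))) (Ioc (Φ (a j)) (Φ (b j))) := by
    intro i j hij
    have : Disjoint (Ioc (a i) (b i)) (Ioc (a j) (b j)) := hd hij
    rw [Set.Ioc_disjoint_Ioc] at this ⊢
    rcases le_total (b i) (b j) with h1 | h1 <;> rcases le_total (a i) (a j) with h2 | h2
    · rw [min_eq_left h1, max_eq_right h2] at this
      exact (min_le_left _ _).trans ((hΦ this).trans (le_max_right _ _))
    · rw [min_eq_left h1, max_eq_left h2] at this
      exact (min_le_left _ _).trans ((hΦ this).trans (le_max_left _ _))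
    · rw [min_eq_right h1, max_eq_right h2] at this
      exact (min_le_right _ _).trans ((hΦ this).trans (le_max_right _ _))
    · rw [min_eq_right h1, max_eq_left h2] at this
      exact (min_le_right _ _).trans ((hΦ this).trans (le_max_left _ _))
  have h1 := hh n (fun i => Φ (a i)) (fun i => Φ (b i)) hab' hd'
  have h2 : ‖slopeVec (fun x => h (Φ x)) a b‖ ^ 2
      ≤ (Λ * ‖slopeVec h (fun i => Φ (a i)) (fun i => Φ (b i))‖) ^ 2 := by
    rw [mul_pow, norm_slopeVec_sq _ _ _ hab, norm_slopeVec_sq _ _ _ hab', Finset.mul_sum]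
    refine Finset.sum_le_sum fun i _ => ?_
    rcases (hab' i).eq_or_lt with he | hlt
    · simp [he]
    · have hlt' : a i < b i := (hab i).lt_of_ne fun e => by rw [e] at hlt; exact lt_irrefl _ hlt
      rw [mul_div_assoc', div_le_div_iff₀ (by linarith) (by linarith)]
      have := hlip _ _ (hab i)
      nlinarith [mul_le_mul_of_nonneg_left this (sq_nonneg (h (Φ (b i)) - h (Φ (a i))))]
  exact (abs_le_of_sq_le_sq' h2 (by positivity)).2.trans (mul_le_mul_of_nonneg_left h1 hΛ)

theorem abs_sub_le (hh : EnergyLE h K) (x y : ℝ) : |h y - h x| ≤ K * √|y - x| := by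
  wlog hxy : x ≤ y generalizing x y
  · rw [abs_sub_comm, abs_sub_comm y x]; exact this y x (le_of_not_ge hxy)
  rcases hxy.eq_or_lt with rfl | hlt
  · simp
  have h0 := hh 1 (fun _ => x) (fun _ => y) (fun _ => hxy) (fun i j hij => (hij (Subsingleton.elim _ _)).elim)
  rw [EuclideanSpace.norm_eq] at h0
  simp only [slopeVec, Finset.univ_unique, Finset.sum_singleton, Real.norm_eq_abs, sq_abs] at h0
  rw [Real.sqrt_sq_eq_abs, abs_div, abs_of_nonneg (Real.sqrt_nonneg _),
    div_le_iff₀ (Real.sqrt_pos.2 (by linarith))] at h0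
  rwa [abs_of_nonneg (by linarith : 0 ≤ y - x)]

theorem continuous (hh : EnergyLE h K) : Continuous h := by
  rw [continuous_iff_continuousAt]
  intro x
  rw [ContinuousAt, tendsto_iff_dist_tendsto_zero]
  have : Tendsto (fun y => K * √|y - x|) (𝓝 x) (𝓝 0) := by
    have : Continuous fun y : ℝ => K * √|y - x| := by fun_prop
    simpa using this.tendsto x
  exact squeeze_zero (fun _ => dist_nonneg) (fun y => by
    rw [Real.dist_eq]; exact hh.abs_sub_le x y) this

theorem sum_abs_sub_le (hh : EnergyLE h K) {n : ℕ} (a b : Fin n → ℝ) (hab : ∀ i, a i ≤ b i)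
    (hd : Pairwise fun i j => Disjoint (Ioc (a i) (b i)) (Ioc (a j) (b j))) :
    ∑ i, |h (b i) - h (a i)| ≤ K * √(∑ i, (b i - a i)) := by
  have h1 := hh n a b hab hd
  have hpos : ∀ i, 0 ≤ b i - a i := fun i => by linarith [hab i]
  have cs := Finset.sum_mul_sq_le_sq_mul_sq Finset.univ (fun i => |slopeVec h a b i|)
    (fun i => √(b i - a i))
  have e1 : ∀ i, |slopeVec h a b i| * √(b i - a i) = |h (b i) - h (a i)| := by
    intro i
    rcases (hab i).eq_or_lt with he | hlt
    · simp [he]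
    · have : 0 < √(b i - a i) := Real.sqrt_pos.2 (by linarith)
      simp only [slopeVec]
      rw [abs_div, abs_of_pos this]; field_simp
  have e2 : ∑ i, |slopeVec h a b i| ^ 2 = ‖slopeVec h a b‖ ^ 2 := by
    rw [EuclideanSpace.real_norm_sq_eq]; simp
  have e3 : ∑ i, √(b i - a i) ^ 2 = ∑ i, (b i - a i) :=
    Finset.sum_congr rfl fun i _ => Real.sq_sqrt (hpos i)
  simp only [e1, e2, e3] at cs
  have hs : 0 ≤ ∑ i, (b i - a i) := Finset.sum_nonneg fun i _ => hpos i
  refine abs_le_of_sq_le_sq' (cs.trans ?_) (mul_nonneg hh.nonneg (Real.sqrt_nonneg _)) |>.2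
  rw [mul_pow, Real.sq_sqrt hs]
  exact mul_le_mul_of_nonneg_right (pow_le_pow_left₀ (norm_nonneg _) h1 2) hs

theorem absolutelyContinuous (hh : EnergyLE h K) (c d : ℝ) :
    AbsolutelyContinuousOnInterval h c d := by
  rw [absolutelyContinuousOnInterval_iff]
  intro ε hε
  refine ⟨(ε / (K + 1)) ^ 2, by have := hh.nonneg; positivity, ?_⟩
  rintro ⟨n, E⟩ ⟨-, hE2⟩ hlen
  simp only at *
  have hK := hh.nonneg
  rw [← Fin.sum_univ_eq_sum_range (fun i => dist (E i).1 (E i).2)] at hlen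
  rw [← Fin.sum_univ_eq_sum_range (fun i => dist (h (E i).1) (h (E i).2))]
  have key := hh.sum_abs_sub_le (n := n) (fun i => min (E i).1 (E i).2) (fun i => max (E i).1 (E i).2)
    (fun i => min_le_max) (by
      intro i j hij
      have := hE2 (Finset.mem_coe.2 (Finset.mem_range.2 i.2)) (Finset.mem_coe.2 (Finset.mem_range.2 j.2))
        (fun e => hij (Fin.ext e))
      exact this)
  have e1 : ∀ i : Fin n, |h (max (E i).1 (E i).2) - h (min (E i).1 (E i).2)|
      = dist (h (E i).1) (h (E i).2) := by
    intro i
    rcases le_total (E i).1 (E i).2 with hl | hl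
    · rw [max_eq_right hl, min_eq_left hl, Real.dist_eq, abs_sub_comm]
    · rw [max_eq_left hl, min_eq_right hl, Real.dist_eq]
  have e2 : ∀ i : Fin n, max (E i).1 (E i).2 - min (E i).1 (E i).2 = dist (E i).1 (E i).2 := by
    intro i
    rw [max_sub_min_eq_abs, Real.dist_eq, abs_sub_comm]
  simp only [e1, e2] at key
  refine key.trans_lt ?_
  have : √(∑ i : Fin n, dist (E i).1 (E i).2) < ε / (K + 1) := by
    rw [Real.sqrt_lt' (by positivity)]; exact hlen
  calc K * √(∑ i : Fin n, dist (E i).1 (E i).2) ≤ K * (ε / (K + 1)) :=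
        mul_le_mul_of_nonneg_left this.le hK
    _ < ε := by
        rw [mul_div_assoc', div_lt_iff₀ (by linarith)]; nlinarith

theorem intervalIntegral_deriv (hh : EnergyLE h K) (a b : ℝ) :
    ∫ x in a..b, deriv h x = h b - h a := (hh.absolutelyContinuous a b).integral_deriv_eq_sub

theorem ae_differentiableAt (hh : EnergyLE h K) : ∀ᵐ x, DifferentiableAt ℝ h x := by
  have : ∀ n : ℕ, ∀ᵐ x, x ∈ uIcc (-(n : ℝ)) n → DifferentiableAt ℝ h x := fun n =>
    (hh.absolutelyContinuous _ _).ae_differentiableAt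
  filter_upwards [ae_all_iff.2 this] with x hx
  obtain ⟨n, hn⟩ := exists_nat_ge |x|
  refine hx n ?_
  rw [uIcc_of_le (by linarith [abs_nonneg x])]
  exact abs_le.1 hn

/-- A function with an `L²` weak derivative of norm at most `K` satisfies `EnergyLE`. -/
theorem of_weakDeriv {p : ℝ → ℝ} (hp : MemLp p 2 volume) (hint : ∀ a b, ∫ x in a..b, p x = h b - h a)
    (hK : 0 ≤ K) (hpK : eLpNorm p 2 volume ≤ ENNReal.ofReal K) : EnergyLE h K := by
  rw [eLpNorm_two_le_iff hp hK] at hpK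
  intro n a b hab hd
  refine abs_le_of_sq_le_sq' (?_ : _ ≤ K ^ 2) hK |>.2
  rw [norm_slopeVec_sq _ _ _ hab]
  calc ∑ i, (h (b i) - h (a i)) ^ 2 / (b i - a i) ≤ ∑ i, ∫ x in Ioc (a i) (b i), p x ^ 2 := by
        refine Finset.sum_le_sum fun i _ => ?_
        rw [← hint, ← intervalIntegral.integral_of_le (hab i)]
        rcases (hab i).eq_or_lt with he | hlt
        · simp [he]
        · rw [div_le_iff₀ (by linarith), mul_comm]
          exact sq_intervalIntegral_le hp (hab i)
    _ = ∫ x in ⋃ i, Ioc (a i) (b i), p x ^ 2 :=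
        (integral_iUnion_fintype (fun i => measurableSet_Ioc) hd
          (fun i => hp.integrable_sq.integrableOn)).symm
    _ ≤ ∫ x, p x ^ 2 := setIntegral_le_integral hp.integrable_sq (ae_of_all _ fun x => sq_nonneg _)
    _ ≤ K ^ 2 := hpK

end EnergyLE

namespace EnergyLE

variable {h g : ℝ → ℝ} {K L : ℝ}

theorem intervalIntegral_sq_diffQuotient_le (hh : EnergyLE h K) {N : ℕ} (hN : 0 < N) :
    ∫ x in (-(N : ℝ))..N, ((N : ℝ) * (h (x + 1 / N) - h x)) ^ 2 ≤ K ^ 2 := by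
  have hc := hh.continuous
  have hN' : (0 : ℝ) < N := by exact_mod_cast hN
  set F : ℝ → ℝ := fun x => ((N : ℝ) * (h (x + 1 / N) - h x)) ^ 2 with hF
  have hFc : Continuous F := by rw [hF]; fun_prop
  let c : ℕ → ℝ := fun i => -(N : ℝ) + i / N
  have hsum : ∑ i ∈ Finset.range (2 * N * N), ∫ x in (c i)..(c (i + 1)), F x
      = ∫ x in (-(N : ℝ))..N, F x := by
    rw [intervalIntegral.sum_integral_adjacent_intervals fun i _ => hFc.intervalIntegrable _ _]
    congr 1
    · simp [c]
    · simp only [c]; push_cast; field_simp; ring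
  rw [← hsum]
  have hshift : ∀ i : ℕ, ∫ x in (c i)..(c (i + 1)), F x = ∫ x in (0 : ℝ)..(1 / N), F (x + c i) := by
    intro i
    rw [intervalIntegral.integral_comp_add_right]
    congr 1
    · simp
    · simp only [c]; push_cast; field_simp; ring
  simp_rw [hshift]
  have hFi : ∀ i : ℕ, Continuous fun x => F (x + c i) := fun i => hFc.comp (by fun_prop)
  rw [← intervalIntegral.integral_finsetSum fun i _ => (hFi i).intervalIntegrable _ _]
  have hbound : ∀ x ∈ Icc (0 : ℝ) (1 / N),
      ∑ i ∈ Finset.range (2 * N * N), F (x + c i) ≤ N * K ^ 2 := by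
    intro x _
    have hdis : Pairwise fun i j : Fin (2 * N * N) =>
        Disjoint (Ioc (x + c i) (x + c i + 1 / N)) (Ioc (x + c j) (x + c j + 1 / N)) := by
      intro i j hij
      rw [Set.Ioc_disjoint_Ioc]
      have hne : (i : ℕ) ≠ j := fun e => hij (Fin.ext e)
      rcases lt_or_gt_of_ne hne with hl | hl
      · refine (min_le_left _ _).trans (le_trans ?_ (le_max_right _ _))
        have : ((i : ℕ) : ℝ) + 1 ≤ (j : ℕ) := by exact_mod_cast hl
        have := div_le_div_of_nonneg_right this hN'.le
        rw [add_div] at this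
        simp only [c]; linarith
      · refine (min_le_right _ _).trans (le_trans ?_ (le_max_left _ _))
        have : ((j : ℕ) : ℝ) + 1 ≤ (i : ℕ) := by exact_mod_cast hl
        have := div_le_div_of_nonneg_right this hN'.le
        rw [add_div] at this
        simp only [c]; linarith
    have hle : ∀ i : Fin (2 * N * N), x + c i ≤ x + c i + 1 / N := fun i => by
      have : (0 : ℝ) ≤ 1 / N := by positivity
      linarith
    have := hh _ (fun i : Fin (2 * N * N) => x + c i) (fun i => x + c i + 1 / N) hle hdis
    have h2 := pow_le_pow_left₀ (norm_nonneg _) this 2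
    rw [norm_slopeVec_sq _ _ _ hle] at h2
    rw [← Fin.sum_univ_eq_sum_range (fun i => F (x + c i))]
    calc ∑ i : Fin (2 * N * N), F (x + c i)
        = N * ∑ i : Fin (2 * N * N), (h (x + c i + 1 / N) - h (x + c i)) ^ 2
            / (x + c i + 1 / N - (x + c i)) := by
          rw [Finset.mul_sum]
          refine Finset.sum_congr rfl fun i _ => ?_
          rw [add_sub_cancel_left]
          simp only [hF]
          field_simp
      _ ≤ N * K ^ 2 := mul_le_mul_of_nonneg_left h2 hN'.le
  calc ∫ x in (0 : ℝ)..(1 / N), ∑ i ∈ Finset.range (2 * N * N), F (x + c i)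
      ≤ ∫ x in (0 : ℝ)..(1 / N), (N : ℝ) * K ^ 2 := by
        refine intervalIntegral.integral_mono_on (by positivity) ?_ (by simp) hbound
        exact (continuous_finsetSum _ fun i _ =>
          hFi i).intervalIntegrable _ _
    _ = K ^ 2 := by
        rw [intervalIntegral.integral_const, smul_eq_mul, sub_zero]; field_simp

theorem eLpNorm_deriv_le (hh : EnergyLE h K) :
    eLpNorm (deriv h) 2 volume ≤ ENNReal.ofReal K := by
  have hc := hh.continuous
  let F : ℕ → ℝ → ℝ := fun N => (Ioc (-(N : ℝ)) N).indicator
    fun x => (N : ℝ) * (h (x + 1 / N) - h x)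
  have hFm : ∀ N, AEStronglyMeasurable (F N) volume := fun N =>
    (by fun_prop : Continuous fun x => (N : ℝ) * (h (x + 1 / N) - h x)).aestronglyMeasurable.indicator
      measurableSet_Ioc
  have hlim : ∀ᵐ x, Tendsto (fun N => F N x) atTop (𝓝 (deriv h x)) := by
    filter_upwards [hh.ae_differentiableAt] with x hx
    have hd := hx.hasDerivAt
    have h1 : Tendsto (fun N : ℕ => (N : ℝ) * (h (x + 1 / N) - h x)) atTop (𝓝 (deriv h x)) := by
      have := hd.tendsto_slope_zero
      have h2 : Tendsto (fun N : ℕ => 1 / (N : ℝ)) atTop (𝓝[≠] 0) := by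
        refine tendsto_nhdsWithin_iff.2 ⟨tendsto_one_div_atTop_nhds_zero_nat, ?_⟩
        filter_upwards [eventually_gt_atTop 0] with N hN
        have : (N : ℝ) ≠ 0 := by positivity
        simp [hN.ne']
      simpa [Function.comp_def] using this.comp h2
    refine h1.congr' ?_
    obtain ⟨M, hM⟩ := exists_nat_gt |x|
    filter_upwards [eventually_ge_atTop M] with N hN
    have : |x| < N := hM.trans_le (by exact_mod_cast hN)
    simp only [F]
    rw [indicator_of_mem]
    exact ⟨(abs_lt.1 this).1, (abs_lt.1 this).2.le⟩
  refine (Lp.eLpNorm_lim_le_liminf_eLpNorm hFm _ hlim).trans ?_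
  refine liminf_le_of_frequently_le' (Eventually.frequently ?_)
  filter_upwards [eventually_gt_atTop 0] with N hN
  have hcont : Continuous fun x => (N : ℝ) * (h (x + 1 / N) - h x) := by fun_prop
  have hmem : MemLp (fun x => (N : ℝ) * (h (x + 1 / N) - h x)) 2
      (volume.restrict (Ioc (-(N : ℝ)) N)) := by
    rw [memLp_two_iff_integrable_sq hcont.aestronglyMeasurable]
    exact (hcont.pow 2).integrableOn_Ioc
  simp only [F]
  rw [eLpNorm_indicator_eq_eLpNorm_restrict measurableSet_Ioc, eLpNorm_two_le_iff hmem hh.nonneg,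
    ← intervalIntegral.integral_of_le (by have : (0:ℝ) ≤ N := by positivity
                                          linarith)]
  exact hh.intervalIntegral_sq_diffQuotient_le hN

theorem memLp_deriv (hh : EnergyLE h K) : MemLp (deriv h) 2 volume :=
  ⟨(measurable_deriv h).aestronglyMeasurable, hh.eLpNorm_deriv_le.trans_lt ENNReal.ofReal_lt_top⟩

theorem ae_deriv_sub (hh : EnergyLE h K) (hg : EnergyLE g L) :
    deriv (fun x => h x - g x) =ᵐ[volume] fun x => deriv h x - deriv g x := by
  filter_upwards [hh.ae_differentiableAt, hg.ae_differentiableAt] with x h1 h2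
  exact deriv_fun_sub h1 h2

/-- A weak derivative of `h` agrees a.e. with `deriv h`. -/
theorem _root_.HouLuo.weakDeriv_ae_eq {p : ℝ → ℝ} (hp : LocallyIntegrable p volume)
    (hint : ∀ a b, ∫ x in a..b, p x = h b - h a) : deriv h =ᵐ[volume] p := by
  have h1 : ∀ n : ℕ, ∀ᵐ x, x ∈ uIcc (-(n : ℝ)) n → HasDerivAt h (p x) x := by
    intro n
    have := (hp.integrableOn_isCompact (isCompact_uIcc
      (a := -(n : ℝ)) (b := n))).intervalIntegrable.ae_hasDerivAt_integral
    filter_upwards [this] with x hx hmem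
    have h2 := hx hmem (-(n : ℝ)) left_mem_uIcc
    have : h = fun y => h (-(n : ℝ)) + ∫ t in (-(n : ℝ))..y, p t := by
      ext y; rw [hint]; ring
    rw [this]
    exact h2.const_add _
  filter_upwards [ae_all_iff.2 h1] with x hx
  obtain ⟨n, hn⟩ := exists_nat_ge |x|
  refine (hx n ?_).deriv
  rw [uIcc_of_le (by linarith [abs_nonneg x])]
  exact abs_le.1 hn

/-- Mean value inequality for curves of functions, measured by the `H¹` seminorm. -/
theorem sub_of_hasDerivWithinAt {q V : ℝ → ℝ → ℝ} {a b : ℝ} (hab : a ≤ b)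
    (hq : ∀ s ∈ Icc a b, ∀ x, HasDerivWithinAt (fun r => q r x) (V s x) (Icc a b) s)
    (hV : ∀ s ∈ Icc a b, EnergyLE (V s) K) :
    EnergyLE (fun x => q b x - q a x) (K * (b - a)) := by
  intro n c d hcd hdis
  have hder : ∀ s ∈ Icc a b, HasDerivWithinAt (fun r => slopeVec (q r) c d)
      (slopeVec (V s) c d) (Icc a b) s := by
    intro s hs
    have : HasDerivWithinAt (fun r => fun i => (q r (d i) - q r (c i)) / √(d i - c i))
        (fun i => (V s (d i) - V s (c i)) / √(d i - c i)) (Icc a b) s :=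
      hasDerivWithinAt_pi.2 fun i => ((hq s hs _).sub (hq s hs _)).div_const _
    exact (((PiLp.continuousLinearEquiv 2 ℝ fun _ : Fin n => ℝ).symm :
      _ →L[ℝ] EuclideanSpace ℝ (Fin n)).hasFDerivAt).comp_hasDerivWithinAt s this
  have := norm_image_sub_le_of_norm_deriv_le_segment' hder
    (fun s hs => hV s ⟨hs.1, hs.2.le⟩ n c d hcd hdis) b (right_mem_Icc.2 hab)
  have e : slopeVec (fun x => q b x - q a x) c d = slopeVec (q b) c d - slopeVec (q a) c d := by
    ext i; simp [slopeVec]; ring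
  rwa [e]

theorem const (c : ℝ) : EnergyLE (fun _ => c) 0 := by
  intro n a b _ _
  have : slopeVec (fun _ => c) a b = 0 := by ext i; simp [slopeVec]
  simp [this]

/-- A Lipschitz function that is constant on both sides of `[-R, R]`. -/
theorem of_lipschitz_clamp {C R : ℝ} (hC : 0 ≤ C) (hR : 0 ≤ R)
    (hlip : ∀ x y, |h x - h y| ≤ C * |x - y|) (hclamp : ∀ x, h x = h (max (-R) (min R x))) :
    EnergyLE h (C * √(2 * R)) := by
  have key : EnergyLE (fun x : ℝ => max (-R) (min R x)) (√(2 * R)) := by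
    let p : ℝ → ℝ := (Ioc (-R) R).indicator fun _ => 1
    have hp : MemLp p 2 volume :=
      memLp_indicator_const 2 measurableSet_Ioc 1 (Or.inr (by simp))
    refine of_weakDeriv (p := p) hp ?_ (Real.sqrt_nonneg _) ?_
    · intro a b
      wlog hab : a ≤ b generalizing a b
      · rw [intervalIntegral.integral_symm, this b a (le_of_not_ge hab)]; ring
      rw [intervalIntegral.integral_of_le hab, setIntegral_indicator measurableSet_Ioc,
        Ioc_inter_Ioc]
      simp only [integral_const, MeasurableSet.univ, measureReal_restrict_apply, univ_inter,
        smul_eq_mul, mul_one, Real.volume_real_Ioc]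
      rcases le_total R b with h1 | h1 <;> rcases le_total (-R) a with h2 | h2 <;>
      rcases le_total R a with h3 | h3 <;> rcases le_total (-R) b with h4 | h4 <;>
      simp only [max_def, min_def] <;> split_ifs <;> linarith
    · rw [eLpNorm_two_le_iff hp (Real.sqrt_nonneg _), Real.sq_sqrt (by linarith)]
      have : ∀ x, p x ^ 2 = p x := by
        intro x; by_cases hx : x ∈ Ioc (-R) R <;> simp [p, hx]
      simp_rw [this]
      simp only [p]
      rw [integral_indicator measurableSet_Ioc]
      simp [Real.volume_real_Ioc]
      constructor <;> linarith
  refine of_abs_sub_le' hC key fun x y _ => ?_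
  rw [hclamp x, hclamp y]
  exact hlip _ _

end EnergyLE

/-! ### The conjugate Poisson kernel -/

/-- The conjugate Poisson kernel `s / (s² + η²)`, a regularisation of `1 / s`. -/
def conjPoisson (η s : ℝ) : ℝ := s / (s ^ 2 + η ^ 2)

theorem continuous_conjPoisson {η : ℝ} (hη : 0 < η) : Continuous (conjPoisson η) := by
  unfold conjPoisson
  exact continuous_id.div (by fun_prop) fun s => by positivity

theorem conjPoisson_neg (η s : ℝ) : conjPoisson η (-s) = -conjPoisson η s := by
  simp [conjPoisson, neg_div]

theorem abs_conjPoisson_le {η s : ℝ} (hs : 0 < s) : |conjPoisson η s| ≤ 1 / s := by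
  rw [conjPoisson, abs_of_nonneg (by positivity), div_le_div_iff₀ (by positivity) hs]
  nlinarith [sq_nonneg η]

theorem abs_conjPoisson_le' {η : ℝ} (hη : 0 < η) (s : ℝ) : |conjPoisson η s| ≤ 1 / η := by
  rw [conjPoisson, abs_div, abs_of_pos (by positivity : 0 < s ^ 2 + η ^ 2),
    div_le_div_iff₀ (by positivity) hη]
  nlinarith [sq_nonneg (|s| - η), sq_abs s, abs_nonneg s]

theorem tendsto_conjPoisson (s : ℝ) :
    Tendsto (fun η => conjPoisson η s) (𝓝[>] 0) (𝓝 (1 / s)) := by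
  rcases eq_or_ne s 0 with rfl | hs
  · simp [conjPoisson]
  have : ContinuousAt (fun η => conjPoisson η s) 0 := by
    unfold conjPoisson
    refine ContinuousAt.div (by fun_prop) (by fun_prop) (by positivity)
  have h2 : conjPoisson 0 s = 1 / s := by simp [conjPoisson]; field_simp
  rw [← h2]
  exact this.tendsto.mono_left nhdsWithin_le_nhds

theorem integrable_inv_sq_add_sq {η : ℝ} (hη : 0 < η) :
    Integrable (fun s : ℝ => 1 / (s ^ 2 + η ^ 2)) := by
  have := (integrable_inv_one_add_sq.comp_div hη.ne').const_mul (1 / η ^ 2)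
  refine this.congr (ae_of_all _ fun s => ?_)
  simp only
  field_simp
  ring

theorem integral_inv_sq_add_sq {η : ℝ} (hη : 0 < η) :
    ∫ s : ℝ, 1 / (s ^ 2 + η ^ 2) = Real.pi / η := by
  have h1 : ∀ s : ℝ, 1 / (s ^ 2 + η ^ 2) = (1 / η ^ 2) * (1 + (s / η) ^ 2)⁻¹ := by
    intro s; field_simp; ring
  simp_rw [h1]
  rw [integral_const_mul, Measure.integral_comp_div (fun s => (1 + s ^ 2)⁻¹) η,
    integral_univ_inv_one_add_sq, abs_of_pos hη, smul_eq_mul]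
  field_simp

theorem integrable_conjPoisson_sq {η : ℝ} (hη : 0 < η) :
    Integrable (fun s : ℝ => conjPoisson η s ^ 2) := by
  refine (integrable_inv_sq_add_sq hη).mono'
    ((continuous_conjPoisson hη).pow 2).aestronglyMeasurable (ae_of_all _ fun s => ?_)
  rw [Real.norm_of_nonneg (sq_nonneg _), conjPoisson, div_pow,
    div_le_div_iff₀ (by positivity) (by positivity)]
  nlinarith [sq_nonneg s, sq_nonneg η, mul_nonneg (sq_nonneg s) (sq_nonneg η), sq_nonneg (η ^ 2)]

theorem memLp_conjPoisson {η : ℝ} (hη : 0 < η) : MemLp (conjPoisson η) 2 volume :=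
  (memLp_two_iff_integrable_sq (continuous_conjPoisson hη).aestronglyMeasurable).2
    (integrable_conjPoisson_sq hη)

theorem memLp_conjPoisson_sub {η : ℝ} (hη : 0 < η) (c : ℝ) :
    MemLp (fun x => conjPoisson η (x - c)) 2 volume :=
  (memLp_conjPoisson hη).comp_measurePreserving (measurePreserving_sub_right volume c)

theorem integral_conjPoisson_mul {η c : ℝ} (hη : 0 < η) (hc : c ≠ 0) :
    ∫ x, conjPoisson η x * conjPoisson η (x - c) = 2 * Real.pi * η / (c ^ 2 + 4 * η ^ 2) := by
  set B : ℝ := η ^ 2 / (c ^ 2 + 4 * η ^ 2) with hB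
  set A : ℝ := -(c ^ 2 + 2 * η ^ 2) / (c * (c ^ 2 + 4 * η ^ 2)) with hA
  let G : ℝ → ℝ := fun x => A / 2 * (Real.log (x ^ 2 + η ^ 2) - Real.log ((x - c) ^ 2 + η ^ 2))
    + B / η * (Real.arctan (x / η) + Real.arctan ((x - c) / η))
  have hder : ∀ x, HasDerivAt G (conjPoisson η x * conjPoisson η (x - c)) x := by
    intro x
    have p1 : 0 < x ^ 2 + η ^ 2 := by positivity
    have p2 : 0 < (x - c) ^ 2 + η ^ 2 := by positivity
    have l1 : HasDerivAt (fun x : ℝ => Real.log (x ^ 2 + η ^ 2)) (2 * x / (x ^ 2 + η ^ 2)) x := by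
      have := ((hasDerivAt_pow 2 x).add_const (η ^ 2)).log p1.ne'
      simpa using this
    have l2 : HasDerivAt (fun x : ℝ => Real.log ((x - c) ^ 2 + η ^ 2))
        (2 * (x - c) / ((x - c) ^ 2 + η ^ 2)) x := by
      have := ((((hasDerivAt_id x).sub_const c).pow 2).add_const (η ^ 2)).log p2.ne'
      simpa using this
    have a1 : HasDerivAt (fun x : ℝ => Real.arctan (x / η)) (η / (x ^ 2 + η ^ 2)) x := by
      have := ((hasDerivAt_id x).div_const η).arctan
      convert! this using 1
      simp only [id]; field_simp; ring
    have a2 : HasDerivAt (fun x : ℝ => Real.arctan ((x - c) / η)) (η / ((x - c) ^ 2 + η ^ 2)) x := by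
      have := (((hasDerivAt_id x).sub_const c).div_const η).arctan
      convert! this using 1
      simp only [id]; field_simp; ring
    convert! ((l1.sub l2).const_mul (A / 2)).add ((a1.add a2).const_mul (B / η)) using 1
    have p3 : 0 < c ^ 2 + 4 * η ^ 2 := by positivity
    simp only [conjPoisson, hA, hB]
    field_simp
    ring
  have hint : Integrable fun x => conjPoisson η x * conjPoisson η (x - c) :=
    (memLp_conjPoisson hη).integrable_mul (memLp_conjPoisson_sub hη c)
  have hlog : ∀ l : Filter ℝ, Tendsto (fun x : ℝ => x⁻¹) l (𝓝 0) → (∀ᶠ x in l, x ≠ 0) →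
      Tendsto (fun x => Real.log (x ^ 2 + η ^ 2) - Real.log ((x - c) ^ 2 + η ^ 2)) l (𝓝 0) := by
    intro l hl hne
    have hr : ContinuousAt (fun u : ℝ => Real.log ((1 + η ^ 2 * u ^ 2) /
        ((1 - c * u) ^ 2 + η ^ 2 * u ^ 2))) 0 := by
      refine ContinuousAt.log ?_ (by simp)
      exact ContinuousAt.div (by fun_prop) (by fun_prop) (by simp)
    have := hr.tendsto.comp hl
    simp only [Function.comp_def] at this
    have h0 : Real.log ((1 + η ^ 2 * (0 : ℝ) ^ 2) / ((1 - c * 0) ^ 2 + η ^ 2 * 0 ^ 2)) = 0 := by simp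
    rw [h0] at this
    refine this.congr' ?_
    filter_upwards [hne] with x hx
    rw [← Real.log_div (by positivity) (by positivity)]
    congr 1
    field_simp
  have htop : Tendsto G atTop (𝓝 (A / 2 * 0 + B / η * (Real.pi / 2 + Real.pi / 2))) := by
    refine ((hlog _ tendsto_inv_atTop_zero (eventually_ne_atTop 0)).const_mul _).add
      (Tendsto.const_mul _ (Tendsto.add ?_ ?_))
    · exact (Real.tendsto_arctan_atTop.mono_right nhdsWithin_le_nhds).comp
        (tendsto_id.atTop_div_const hη)
    · exact (Real.tendsto_arctan_atTop.mono_right nhdsWithin_le_nhds).comp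
        ((tendsto_atTop_add_const_right _ (-c) tendsto_id).atTop_div_const hη)
  have hbot : Tendsto G atBot (𝓝 (A / 2 * 0 + B / η * (-(Real.pi / 2) + -(Real.pi / 2)))) := by
    refine ((hlog _ tendsto_inv_atBot_zero (eventually_ne_atBot 0)).const_mul _).add
      (Tendsto.const_mul _ (Tendsto.add ?_ ?_))
    · exact (Real.tendsto_arctan_atBot.mono_right nhdsWithin_le_nhds).comp
        (tendsto_id.atBot_div_const hη)
    · exact (Real.tendsto_arctan_atBot.mono_right nhdsWithin_le_nhds).comp
        ((tendsto_atBot_add_const_right _ (-c) tendsto_id).atBot_div_const hη)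
  rw [integral_of_hasDerivAt_of_tendsto hder hint hbot htop, hB]
  have p3 : 0 < c ^ 2 + 4 * η ^ 2 := by positivity
  field_simp
  ring

theorem integral_conjPoisson_sub_mul_sub {η y z : ℝ} (hη : 0 < η) (h : y ≠ z) :
    ∫ x, conjPoisson η (x - y) * conjPoisson η (x - z)
      = 2 * Real.pi * η / ((y - z) ^ 2 + 4 * η ^ 2) := by
  have := integral_conjPoisson_mul hη (c := z - y) (sub_ne_zero.2 h.symm)
  rw [← integral_sub_right_eq_self _ y] at this
  rw [show (y - z) ^ 2 = (z - y) ^ 2 by ring, ← this]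
  congr 1; ext x; congr 2; ring

/-! ### Convolution with the conjugate Poisson kernel on `L²` -/

/-- Convolution with the conjugate Poisson kernel: `π` times the regularised Hilbert transform. -/
def regHilbert (η : ℝ) (w : ℝ → ℝ) (z : ℝ) : ℝ := ∫ y, conjPoisson η (z - y) * w y

theorem MemLp.integrable_of_support {w : ℝ → ℝ} {R : ℝ} (hw : MemLp w 2 volume)
    (hR : ∀ x, R < |x| → w x = 0) : Integrable w := by
  have h1 : IntegrableOn w (Icc (-R) R) := by
    have : IsFiniteMeasure (volume.restrict (Icc (-R) R)) := ⟨by simp⟩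
    exact (hw.restrict _).integrable (by norm_num)
  refine (integrableOn_iff_integrable_of_support_subset ?_).1 h1
  intro x hx
  by_contra hx'
  exact hx (hR x (by by_contra hle; exact hx' (abs_le.1 (not_lt.1 hle))))

section L2

variable {η R : ℝ} {w : ℝ → ℝ}

theorem integrable_regHilbert_kernel (hη : 0 < η) (hw : Integrable w) :
    Integrable (fun q : ℝ × ℝ × ℝ => (conjPoisson η (q.1 - q.2.1) * w q.2.1) *
      (conjPoisson η (q.1 - q.2.2) * w q.2.2)) (volume.prod (volume.prod volume)) := by
  have hc := continuous_conjPoisson hη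
  have hm : AEStronglyMeasurable (fun q : ℝ × ℝ × ℝ => (conjPoisson η (q.1 - q.2.1) * w q.2.1) *
      (conjPoisson η (q.1 - q.2.2) * w q.2.2)) (volume.prod (volume.prod volume)) := by
    have m1 : AEStronglyMeasurable (fun p : ℝ × ℝ => w p.1) (volume.prod volume) :=
      hw.aestronglyMeasurable.comp_fst
    have m2 : AEStronglyMeasurable (fun p : ℝ × ℝ => w p.2) (volume.prod volume) :=
      hw.aestronglyMeasurable.comp_snd
    have m1' : AEStronglyMeasurable (fun q : ℝ × ℝ × ℝ => w q.2.1)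
      (volume.prod (volume.prod volume)) := m1.comp_snd
    have m2' : AEStronglyMeasurable (fun q : ℝ × ℝ × ℝ => w q.2.2)
      (volume.prod (volume.prod volume)) := m2.comp_snd
    have c1 : Continuous fun q : ℝ × ℝ × ℝ => conjPoisson η (q.1 - q.2.1) :=
      hc.comp (by fun_prop)
    have c2 : Continuous fun q : ℝ × ℝ × ℝ => conjPoisson η (q.1 - q.2.2) :=
      hc.comp (by fun_prop)
    exact (c1.aestronglyMeasurable.mul m1').mul (c2.aestronglyMeasurable.mul m2')
  rw [integrable_prod_iff' hm]
  have hprod : ∀ y z : ℝ, Integrable fun x => conjPoisson η (x - y) * conjPoisson η (x - z) :=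
    fun y z => (memLp_conjPoisson_sub hη y).integrable_mul (memLp_conjPoisson_sub hη z)
  constructor
  · refine ae_of_all _ fun p => ?_
    refine ((hprod p.1 p.2).const_mul (w p.1 * w p.2)).congr (ae_of_all _ fun x => ?_)
    simp only; ring
  · have hmaj : Integrable (fun p : ℝ × ℝ => (∫ x, conjPoisson η x ^ 2) * (|w p.1| * |w p.2|))
        (volume.prod volume) := ((hw.abs.mul_prod hw.abs)).const_mul _
    refine hmaj.mono' ?_ (ae_of_all _ fun p => ?_)
    · exact hm.norm.prod_swap.integral_prod_right'
    · have hs : ∀ c : ℝ, ∫ x, conjPoisson η (x - c) ^ 2 = ∫ x, conjPoisson η x ^ 2 := fun c =>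
        integral_sub_right_eq_self (fun x => conjPoisson η x ^ 2) c
      have hsi : ∀ c : ℝ, Integrable fun x => conjPoisson η (x - c) ^ 2 := fun c =>
        (memLp_conjPoisson_sub hη c).integrable_sq
      rw [Real.norm_of_nonneg (integral_nonneg fun _ => norm_nonneg _)]
      calc ∫ x, ‖(conjPoisson η (x - p.1) * w p.1) * (conjPoisson η (x - p.2) * w p.2)‖
          ≤ ∫ x, (|w p.1| * |w p.2| / 2) *
              (conjPoisson η (x - p.1) ^ 2 + conjPoisson η (x - p.2) ^ 2) := by
            refine integral_mono_of_nonneg (ae_of_all _ fun _ => norm_nonneg _)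
              (((hsi _).add (hsi _)).const_mul _) (ae_of_all _ fun x => ?_)
            simp only [Real.norm_eq_abs, abs_mul]
            have := two_mul_le_add_sq |conjPoisson η (x - p.1)| |conjPoisson η (x - p.2)|
            rw [sq_abs, sq_abs] at this
            nlinarith [mul_nonneg (abs_nonneg (w p.1)) (abs_nonneg (w p.2))]
        _ = _ := by
            rw [integral_const_mul, integral_add (hsi _) (hsi _), hs, hs]; ring

theorem regHilbert_sq (x : ℝ) : regHilbert η w x ^ 2
    = ∫ p : ℝ × ℝ, (conjPoisson η (x - p.1) * w p.1) * (conjPoisson η (x - p.2) * w p.2) := by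
  rw [sq, regHilbert]
  exact (integral_prod_mul (μ := volume) (ν := volume) (fun y => conjPoisson η (x - y) * w y)
    (fun y => conjPoisson η (x - y) * w y)).symm

theorem integrable_regHilbert_sq (hη : 0 < η) (hw : Integrable w) :
    Integrable fun x => regHilbert η w x ^ 2 := by
  simp_rw [regHilbert_sq]
  exact (integrable_regHilbert_kernel hη hw).integral_prod_left

theorem aestronglyMeasurable_regHilbert (hη : 0 < η) (hw : Integrable w) :
    AEStronglyMeasurable (regHilbert η w) volume := by
  have : AEStronglyMeasurable (fun q : ℝ × ℝ => conjPoisson η (q.1 - q.2) * w q.2)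
      (volume.prod volume) :=
    ((continuous_conjPoisson hη).comp (by fun_prop : Continuous fun q : ℝ × ℝ => q.1 - q.2)
      ).aestronglyMeasurable.mul hw.aestronglyMeasurable.comp_snd
  exact this.integral_prod_right'

theorem memLp_regHilbert (hη : 0 < η) (hw : Integrable w) : MemLp (regHilbert η w) 2 volume :=
  (memLp_two_iff_integrable_sq (aestronglyMeasurable_regHilbert hη hw)).2
    (integrable_regHilbert_sq hη hw)

theorem integral_regHilbert_sq_le (hη : 0 < η) (hw : Integrable w) (hw2 : MemLp w 2 volume) :
    ∫ x, regHilbert η w x ^ 2 ≤ Real.pi ^ 2 * ∫ x, w x ^ 2 := by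
  let κ : ℝ → ℝ := fun c => 2 * Real.pi * η / (c ^ 2 + 4 * η ^ 2)
  have hκ_eq : ∀ c, κ c = 2 * Real.pi * η * (1 / (c ^ 2 + (2 * η) ^ 2)) := by
    intro c; simp only [κ]; rw [mul_one_div]; congr 2; ring
  have hκ_nonneg : ∀ c, 0 ≤ κ c := fun c => by
    have := Real.pi_pos; simp only [κ]; positivity
  have hκ_int : Integrable κ := by
    refine ((integrable_inv_sq_add_sq (by positivity : 0 < 2 * η)).const_mul
      (2 * Real.pi * η)).congr (ae_of_all _ fun c => (hκ_eq c).symm)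
  have hκ_val : ∫ c, κ c = Real.pi ^ 2 := by
    simp_rw [hκ_eq]
    rw [integral_const_mul, integral_inv_sq_add_sq (by positivity)]
    field_simp
  have hw2i : Integrable fun x => w x ^ 2 := hw2.integrable_sq
  have i1 : Integrable (fun p : ℝ × ℝ => w p.1 ^ 2 * κ (p.2 - p.1)) (volume.prod volume) := by
    have := (hw2i.convolution_integrand (ContinuousLinearMap.mul ℝ ℝ) hκ_int).swap
    exact this
  have i2 : Integrable (fun p : ℝ × ℝ => w p.2 ^ 2 * κ (p.1 - p.2)) (volume.prod volume) :=
    hw2i.convolution_integrand (ContinuousLinearMap.mul ℝ ℝ) hκ_int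
  have v2 : ∫ p : ℝ × ℝ, w p.2 ^ 2 * κ (p.1 - p.2) = Real.pi ^ 2 * ∫ x, w x ^ 2 := by
    rw [Measure.volume_eq_prod, integral_prod_symm _ i2]
    simp_rw [integral_const_mul]
    have : ∀ y, ∫ x, κ (x - y) = Real.pi ^ 2 := fun y => by
      rw [integral_sub_right_eq_self κ y, hκ_val]
    simp_rw [this]
    rw [integral_mul_const]; ring
  have v1 : ∫ p : ℝ × ℝ, w p.1 ^ 2 * κ (p.2 - p.1) = Real.pi ^ 2 * ∫ x, w x ^ 2 := by
    rw [← v2, Measure.volume_eq_prod, ← integral_prod_swap]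
    rfl
  have hker := integrable_regHilbert_kernel hη hw
  have hswap : ∫ x, regHilbert η w x ^ 2 = ∫ p : ℝ × ℝ, ∫ x,
      (conjPoisson η (x - p.1) * w p.1) * (conjPoisson η (x - p.2) * w p.2) := by
    simp_rw [regHilbert_sq]
    exact integral_integral_swap hker
  have hdiag : ∀ᵐ p : ℝ × ℝ, p.1 ≠ p.2 := by
    have : (volume.prod volume) {p : ℝ × ℝ | p.1 = p.2} = 0 := by
      rw [Measure.measure_prod_null (measurableSet_eq_fun measurable_fst measurable_snd)]
      refine ae_of_all _ fun y => ?_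
      have : (Prod.mk y ⁻¹' {p : ℝ × ℝ | p.1 = p.2}) = {y} := by ext z; simp [eq_comm]
      change volume (Prod.mk y ⁻¹' {p : ℝ × ℝ | p.1 = p.2}) = 0
      rw [this]; simp
    rw [ae_iff]
    simpa [Measure.volume_eq_prod] using this
  rw [hswap]
  calc _ ≤ ∫ p : ℝ × ℝ, (1 / 2 * (w p.1 ^ 2 * κ (p.2 - p.1)) + 1 / 2 * (w p.2 ^ 2 * κ (p.1 - p.2))) := by
        refine integral_mono_ae ?_ ((i1.const_mul _).add (i2.const_mul _)) ?_
        · exact hker.integral_prod_right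
        · filter_upwards [hdiag] with p hp
          have : ∀ x, (conjPoisson η (x - p.1) * w p.1) * (conjPoisson η (x - p.2) * w p.2)
              = (w p.1 * w p.2) * (conjPoisson η (x - p.1) * conjPoisson η (x - p.2)) :=
            fun x => by ring
          simp_rw [this]
          rw [integral_const_mul, integral_conjPoisson_sub_mul_sub hη hp]
          have hsym : κ (p.2 - p.1) = κ (p.1 - p.2) := by
            simp only [κ]; congr 2; ring
          rw [hsym]
          change w p.1 * w p.2 * κ (p.1 - p.2) ≤ _
          nlinarith [mul_nonneg (hκ_nonneg (p.1 - p.2)) (sq_nonneg (w p.1 - w p.2))]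
    _ = _ := by
        rw [Measure.volume_eq_prod] at v1 v2 ⊢
        rw [integral_add (i1.const_mul _) (i2.const_mul _), integral_const_mul, integral_const_mul,
          v1, v2]
        ring

theorem eLpNorm_regHilbert_le (hη : 0 < η) (hw : Integrable w) (hw2 : MemLp w 2 volume) {K : ℝ}
    (hK : 0 ≤ K) (hwK : eLpNorm w 2 volume ≤ ENNReal.ofReal K) :
    eLpNorm (regHilbert η w) 2 volume ≤ ENNReal.ofReal (Real.pi * K) := by
  rw [eLpNorm_two_le_iff hw2 hK] at hwK
  rw [eLpNorm_two_le_iff (memLp_regHilbert hη hw) (by have := Real.pi_pos; positivity)]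
  refine (integral_regHilbert_sq_le hη hw hw2).trans ?_
  rw [mul_pow]
  exact mul_le_mul_of_nonneg_left hwK (sq_nonneg _)

end L2

/-! ### The Hilbert transform of compactly supported `H¹` functions -/

/-- `π` times the Hilbert transform, for Hölder continuous compactly supported functions. -/
def hilbert (w : ℝ → ℝ) (z : ℝ) : ℝ := ∫ s in Ioi (0 : ℝ), 1 / s * (w (z - s) - w (z + s))

/-- A function with `EnergyLE w K` that vanishes off `(-R, R)`. -/
structure CompactEnergy (R K : ℝ) (w : ℝ → ℝ) : Prop where
  energy : EnergyLE w K
  support : ∀ x, R ≤ |x| → w x = 0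

namespace CompactEnergy

variable {R K L : ℝ} {w v : ℝ → ℝ}

theorem sub (hw : CompactEnergy R K w) (hv : CompactEnergy R L v) :
    CompactEnergy R (K + L) fun x => w x - v x :=
  ⟨hw.energy.sub hv.energy, fun x hx => by simp [hw.support x hx, hv.support x hx]⟩

theorem mono (hw : CompactEnergy R K w) {R' K' : ℝ} (hR : R ≤ R') (hK : K ≤ K') :
    CompactEnergy R' K' w :=
  ⟨hw.energy.mono hK, fun x hx => hw.support x (hR.trans hx)⟩

theorem continuous (hw : CompactEnergy R K w) : Continuous w := hw.energy.continuous

theorem hasCompactSupport (hw : CompactEnergy R K w) : HasCompactSupport w := by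
  refine HasCompactSupport.intro (isCompact_Icc (a := -R) (b := R)) fun x hx => hw.support x ?_
  by_contra h
  exact hx (abs_le.1 (not_le.1 h).le)

theorem integrable (hw : CompactEnergy R K w) : Integrable w :=
  hw.continuous.integrable_of_hasCompactSupport hw.hasCompactSupport

theorem memLp (hw : CompactEnergy R K w) : MemLp w 2 volume :=
  hw.continuous.memLp_of_hasCompactSupport hw.hasCompactSupport

theorem nonneg (hw : CompactEnergy R K w) : 0 ≤ K := hw.energy.nonneg

theorem abs_le (hw : CompactEnergy R K w) (x : ℝ) : |w x| ≤ K * √R := by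
  have h1 : w R = 0 := hw.support R (le_abs_self R)
  have h2 : w (-R) = 0 := hw.support (-R) (by rw [abs_neg]; exact le_abs_self R)
  rcases le_or_gt R |x| with h | h
  · rw [hw.support x h, abs_zero]; exact mul_nonneg hw.nonneg (Real.sqrt_nonneg _)
  · have hx := abs_lt.1 h
    rcases le_total 0 x with h0 | h0
    · have := hw.energy.abs_sub_le R x
      rw [h1, sub_zero] at this
      refine this.trans (mul_le_mul_of_nonneg_left (Real.sqrt_le_sqrt ?_) hw.nonneg)
      rw [abs_of_neg (by linarith)]; linarith
    · have := hw.energy.abs_sub_le (-R) x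
      rw [h2, sub_zero] at this
      refine this.trans (mul_le_mul_of_nonneg_left (Real.sqrt_le_sqrt ?_) hw.nonneg)
      rw [abs_of_pos (by linarith)]; linarith

theorem setIntegral_eq (hw : CompactEnergy R K w) (hR : 0 ≤ R) (F : ℝ → ℝ) :
    ∫ x, F x * w x = ∫ x in (-R)..R, F x * w x := by
  rw [intervalIntegral.integral_of_le (by linarith), setIntegral_eq_integral_of_forall_compl_eq_zero]
  intro x hx
  rw [hw.support x, mul_zero]
  by_contra h
  have := abs_lt.1 (not_le.1 h)
  exact hx ⟨this.1, this.2.le⟩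

theorem integral_abs_le_of_bound (hw : CompactEnergy R K w) (hR : 0 ≤ R) {M : ℝ}
    (hM : ∀ x, |w x| ≤ M) : ∫ x, |w x| ≤ 2 * R * M := by
  have h1 : ∫ x, |w x| = ∫ x in (-R)..R, |w x| := by
    rw [intervalIntegral.integral_of_le (by linarith), setIntegral_eq_integral_of_forall_compl_eq_zero]
    intro x hx
    rw [hw.support x, abs_zero]
    by_contra h
    have := abs_lt.1 (not_le.1 h)
    exact hx ⟨this.1, this.2.le⟩
  rw [h1]
  calc ∫ x in (-R)..R, |w x| ≤ ∫ x in (-R)..R, M :=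
        intervalIntegral.integral_mono_on (by linarith) (hw.continuous.abs.intervalIntegrable _ _)
          (by simp) fun x _ => hM x
    _ = 2 * R * M := by rw [intervalIntegral.integral_const, smul_eq_mul]; ring

theorem abs_sub_le (hw : CompactEnergy R K w) {z s : ℝ} (hs : 0 ≤ s) :
    |w (z - s) - w (z + s)| ≤ K * √(2 * s) := by
  have := hw.energy.abs_sub_le (z + s) (z - s)
  rwa [show z - s - (z + s) = -(2 * s) by ring, abs_neg (2 * s),
    abs_of_nonneg (by linarith : 0 ≤ 2 * s)] at this

theorem deriv_support (hw : CompactEnergy R K w) {x : ℝ} (hx : R < |x|) : deriv w x = 0 := by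
  have : w =ᶠ[𝓝 x] fun _ => 0 := by
    filter_upwards [(isOpen_lt continuous_const continuous_abs).mem_nhds hx] with y hy
    exact hw.support y (le_of_lt hy)
  rw [this.deriv_eq]; simp

/-- The dominating function of the integrals defining Hilbert transforms. -/
def dominant (R K Z s : ℝ) : ℝ := (Ioc 0 (R + Z)).indicator (fun s => K * (√2 * s ^ (-(1 / 2) : ℝ))) s

theorem integrable_dominant (R K Z : ℝ) : Integrable (dominant R K Z) := by
  unfold dominant
  rw [integrable_indicator_iff measurableSet_Ioc]
  rcases le_total 0 (R + Z) with h | h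
  · rw [← intervalIntegrable_iff_integrableOn_Ioc_of_le h]
    exact ((intervalIntegral.intervalIntegrable_rpow' (by norm_num)).const_mul _).const_mul _
  · rw [Ioc_eq_empty (by linarith)]; simp

theorem one_div_mul_sqrt {s : ℝ} (hs : 0 < s) : 1 / s * √(2 * s) = √2 * s ^ (-(1 / 2) : ℝ) := by
  rw [Real.sqrt_mul (by norm_num), Real.rpow_neg hs.le, ← Real.sqrt_eq_rpow]
  have h := Real.mul_self_sqrt hs.le
  have : 0 < √s := Real.sqrt_pos.2 hs
  rw [div_mul_eq_mul_div, one_mul, div_eq_iff hs.ne']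
  field_simp
  nlinarith

theorem abs_kernel_mul_le (hw : CompactEnergy R K w) {k : ℝ → ℝ} (hk : ∀ s, 0 < s → |k s| ≤ 1 / s)
    {z Z : ℝ} (hz : |z| ≤ Z) {s : ℝ} (hs : 0 < s) :
    |k s * (w (z - s) - w (z + s))| ≤ dominant R K Z s := by
  unfold dominant
  by_cases h : s ≤ R + Z
  · rw [indicator_of_mem (show s ∈ Ioc 0 (R + Z) from ⟨hs, h⟩), abs_mul]
    calc |k s| * |w (z - s) - w (z + s)| ≤ 1 / s * (K * √(2 * s)) :=
          mul_le_mul (hk s hs) (hw.abs_sub_le hs.le) (abs_nonneg _) (by positivity)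
      _ = K * (1 / s * √(2 * s)) := by ring
      _ = _ := by rw [one_div_mul_sqrt hs]
  · have hz' := _root_.abs_le.1 hz
    rw [indicator_of_notMem (fun h' => h h'.2), hw.support (z - s), hw.support (z + s)]
    · simp
    · rw [le_abs]; left; linarith
    · rw [le_abs]; right; linarith

theorem integrableOn_kernel_mul (hw : CompactEnergy R K w) {k : ℝ → ℝ}
    (hkm : Measurable k) (hk : ∀ s, 0 < s → |k s| ≤ 1 / s) (z : ℝ) :
    IntegrableOn (fun s => k s * (w (z - s) - w (z + s))) (Ioi 0) := by
  refine (integrable_dominant R K |z|).integrableOn.mono' ?_ ?_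
  · have hc := hw.continuous
    exact (hkm.mul (by fun_prop : Continuous fun s => w (z - s) - w (z + s)).measurable
      ).aestronglyMeasurable
  · exact (ae_restrict_iff' measurableSet_Ioi).2 (ae_of_all _ fun s hs =>
      hw.abs_kernel_mul_le hk le_rfl hs)

/-- The basic pointwise bound for singular integrals with kernel bounded by `1 / s`. -/
theorem abs_integral_kernel_mul_le (hw : CompactEnergy R K w) {k : ℝ → ℝ}
    (hkm : Measurable k) (hk : ∀ s, 0 < s → |k s| ≤ 1 / s) (z : ℝ) {σ : ℝ} (hσ : 0 < σ) :
    |∫ s in Ioi (0 : ℝ), k s * (w (z - s) - w (z + s))| ≤ 4 * K * √σ + 2 / σ * ∫ x, |w x| := by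
  have hint := hw.integrableOn_kernel_mul hkm hk z
  rw [← Ioc_union_Ioi_eq_Ioi hσ.le, setIntegral_union (Ioc_disjoint_Ioi le_rfl) measurableSet_Ioi
    (hint.mono_set Ioc_subset_Ioi_self) (hint.mono_set (Ioi_subset_Ioi hσ.le))]
  refine (abs_add_le _ _).trans (add_le_add ?_ ?_)
  · have hi : IntegrableOn (fun s : ℝ => K * (√2 * s ^ (-(1 / 2) : ℝ))) (Ioc 0 σ) := by
      rw [← intervalIntegrable_iff_integrableOn_Ioc_of_le hσ.le]
      exact ((intervalIntegral.intervalIntegrable_rpow' (by norm_num)).const_mul _).const_mul _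
    have h1 : ‖∫ s in Ioc 0 σ, k s * (w (z - s) - w (z + s))‖
        ≤ ∫ s in Ioc 0 σ, K * (√2 * s ^ (-(1 / 2) : ℝ)) := by
      refine norm_integral_le_of_norm_le hi
        ((ae_restrict_iff' measurableSet_Ioc).2 (ae_of_all _ fun s hs => ?_))
      rw [Real.norm_eq_abs, abs_mul]
      calc |k s| * |w (z - s) - w (z + s)| ≤ 1 / s * (K * √(2 * s)) :=
            mul_le_mul (hk s hs.1) (hw.abs_sub_le hs.1.le) (abs_nonneg _) (by have := hs.1; positivity)
        _ = K * (1 / s * √(2 * s)) := by ring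
        _ = _ := by rw [one_div_mul_sqrt hs.1]
    refine h1.trans ?_
    rw [← intervalIntegral.integral_of_le hσ.le, intervalIntegral.integral_const_mul,
      intervalIntegral.integral_const_mul, integral_rpow (Or.inl (by norm_num))]
    norm_num
    rw [← Real.sqrt_eq_rpow]
    have h2 : √2 ≤ 2 := by
      rw [Real.sqrt_le_left (by norm_num)]; norm_num
    have := mul_nonneg hw.nonneg (Real.sqrt_nonneg σ)
    nlinarith
  · have hi1 : Integrable fun s => |w (z - s)| := (hw.integrable.comp_sub_left z).abs
    have hi2 : Integrable fun s => |w (z + s)| := (hw.integrable.comp_add_left z).abs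
    have h1 : ‖∫ s in Ioi σ, k s * (w (z - s) - w (z + s))‖
        ≤ ∫ s in Ioi σ, 1 / σ * (|w (z - s)| + |w (z + s)|) := by
      refine norm_integral_le_of_norm_le ((hi1.add hi2).const_mul _).integrableOn
        ((ae_restrict_iff' measurableSet_Ioi).2 (ae_of_all _ fun s hs => ?_))
      rw [Real.norm_eq_abs, abs_mul]
      have hs' : σ < s := hs
      refine mul_le_mul ((hk s (hσ.trans hs')).trans ?_) (abs_sub _ _) (abs_nonneg _) (by positivity)
      exact one_div_le_one_div_of_le hσ hs'.le
    refine h1.trans ?_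
    refine (setIntegral_le_integral ((hi1.add hi2).const_mul _) (ae_of_all _ fun s => ?_)).trans ?_
    · exact mul_nonneg (by positivity) (add_nonneg (abs_nonneg _) (abs_nonneg _))
    · rw [integral_const_mul, integral_add' hi1 hi2, integral_sub_left_eq_self (fun s => |w s|),
        integral_add_left_eq_self (fun s => |w s|)]
      apply le_of_eq; ring

theorem abs_hilbert_le (hw : CompactEnergy R K w) (z : ℝ) {σ : ℝ} (hσ : 0 < σ) :
    |hilbert w z| ≤ 4 * K * √σ + 2 / σ * ∫ x, |w x| :=
  hw.abs_integral_kernel_mul_le (by fun_prop) (fun s hs => by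
    rw [abs_of_pos (by positivity)]) z hσ

theorem integrableOn_hilbert (hw : CompactEnergy R K w) (z : ℝ) :
    IntegrableOn (fun s => 1 / s * (w (z - s) - w (z + s))) (Ioi 0) :=
  hw.integrableOn_kernel_mul (by fun_prop) (fun s hs => by rw [abs_of_pos (by positivity)]) z

theorem hilbert_sub (hw : CompactEnergy R K w) (hv : CompactEnergy R L v) (z : ℝ) :
    hilbert (fun x => w x - v x) z = hilbert w z - hilbert v z := by
  unfold hilbert
  rw [← integral_sub (hw.integrableOn_hilbert z) (hv.integrableOn_hilbert z)]
  congr 1; ext s; ring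

theorem continuous_hilbert (hw : CompactEnergy R K w) : Continuous (hilbert w) := by
  rw [continuous_iff_continuousAt]
  intro z0
  have hc := hw.continuous
  refine continuousAt_of_dominated (F := fun z s => 1 / s * (w (z - s) - w (z + s)))
    (bound := dominant R K (|z0| + 1)) ?_ ?_ (integrable_dominant _ _ _).integrableOn ?_
  · exact Eventually.of_forall fun z => (hw.integrableOn_hilbert z).aestronglyMeasurable
  · filter_upwards [Metric.ball_mem_nhds z0 one_pos] with z hz
    refine (ae_restrict_iff' measurableSet_Ioi).2 (ae_of_all _ fun s hs => ?_)
    refine hw.abs_kernel_mul_le (k := fun s => 1 / s) (fun s hs => by rw [abs_of_pos (by positivity)])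
      ?_ hs
    rw [Metric.mem_ball, Real.dist_eq] at hz
    have := abs_sub_abs_le_abs_sub z z0
    linarith
  · exact ae_of_all _ fun s => by fun_prop

theorem regHilbert_eq (hw : CompactEnergy R K w) {η : ℝ} (hη : 0 < η) (z : ℝ) :
    regHilbert η w z = ∫ s in Ioi (0 : ℝ), conjPoisson η s * (w (z - s) - w (z + s)) := by
  have hc := hw.continuous
  have hk := continuous_conjPoisson hη
  have hi : Integrable fun s => conjPoisson η s * w (z - s) := by
    refine (Continuous.integrable_of_hasCompactSupport (by fun_prop) ?_)
    exact (hw.hasCompactSupport.comp_homeomorph (Homeomorph.subLeft z)).mul_left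
  have hi2 : Integrable fun s => conjPoisson η s * w (z + s) := by
    refine (Continuous.integrable_of_hasCompactSupport (by fun_prop) ?_)
    exact (hw.hasCompactSupport.comp_homeomorph (Homeomorph.addLeft z)).mul_left
  have h1 : regHilbert η w z = ∫ s, conjPoisson η s * w (z - s) := by
    rw [regHilbert, ← integral_sub_left_eq_self _ _ z]
    congr 1; ext s; congr 2; ring
  rw [h1, ← intervalIntegral.integral_Iic_add_Ioi (b := (0 : ℝ)) hi.integrableOn hi.integrableOn]
  have h2 : ∫ s in Iic (0 : ℝ), conjPoisson η s * w (z - s)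
      = ∫ s in Ioi (0 : ℝ), -(conjPoisson η s * w (z + s)) := by
    rw [← neg_zero, ← integral_comp_neg_Ioi, neg_zero]
    congr 1; ext s
    rw [conjPoisson_neg]; simp
  rw [h2, integral_neg, neg_add_eq_sub, ← integral_sub hi.integrableOn hi2.integrableOn]
  congr 1; ext s; ring

theorem tendsto_regHilbert (hw : CompactEnergy R K w) (z : ℝ) :
    Tendsto (fun η => regHilbert η w z) (𝓝[>] 0) (𝓝 (hilbert w z)) := by
  have hc := hw.continuous
  have : Tendsto (fun η => ∫ s in Ioi (0 : ℝ), conjPoisson η s * (w (z - s) - w (z + s)))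
      (𝓝[>] 0) (𝓝 (hilbert w z)) := by
    refine tendsto_integral_filter_of_dominated_convergence (dominant R K |z|) ?_ ?_
      (integrable_dominant _ _ _).integrableOn ?_
    · filter_upwards [self_mem_nhdsWithin] with η hη
      have hk := continuous_conjPoisson hη
      exact (by fun_prop : Continuous fun s => conjPoisson η s * (w (z - s) - w (z + s))
        ).aestronglyMeasurable
    · filter_upwards with η
      exact (ae_restrict_iff' measurableSet_Ioi).2 (ae_of_all _ fun s hs =>
        hw.abs_kernel_mul_le (fun s hs => abs_conjPoisson_le hs) le_rfl hs)
    · exact ae_of_all _ fun s => (tendsto_conjPoisson s).mul_const _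
  refine this.congr' ?_
  filter_upwards [self_mem_nhdsWithin] with η hη
  exact (hw.regHilbert_eq hη z).symm

theorem abs_regHilbert_le (hw : CompactEnergy R K w) {η : ℝ} (hη : 0 < η) (z : ℝ) {σ : ℝ}
    (hσ : 0 < σ) : |regHilbert η w z| ≤ 4 * K * √σ + 2 / σ * ∫ x, |w x| := by
  rw [hw.regHilbert_eq hη]
  exact hw.abs_integral_kernel_mul_le (continuous_conjPoisson hη).measurable
    (fun s hs => abs_conjPoisson_le hs) z hσ

theorem continuous_regHilbert (hw : CompactEnergy R K w) {η : ℝ} (hη : 0 < η) :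
    Continuous (regHilbert η w) := by
  have hk := continuous_conjPoisson hη
  refine continuous_of_dominated (bound := fun y => 1 / η * |w y|) ?_ ?_
    (hw.integrable.abs.const_mul _) ?_
  · intro z
    exact (hk.comp (by fun_prop : Continuous fun y => z - y)).aestronglyMeasurable.mul
      hw.continuous.aestronglyMeasurable
  · intro z
    refine ae_of_all _ fun y => ?_
    rw [Real.norm_eq_abs, abs_mul]
    exact mul_le_mul_of_nonneg_right (abs_conjPoisson_le' hη _) (abs_nonneg _)
  · exact ae_of_all _ fun y => (hk.comp (by fun_prop)).mul continuous_const

theorem eLpNorm_hilbert_le (hw : CompactEnergy R K w) {M : ℝ} (hM : 0 ≤ M)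
    (hwM : eLpNorm w 2 volume ≤ ENNReal.ofReal M) :
    eLpNorm (hilbert w) 2 volume ≤ ENNReal.ofReal (Real.pi * M) := by
  let u : ℕ → ℝ := fun n => 1 / ((n : ℝ) + 1)
  have hu : ∀ n, 0 < u n := fun n => Nat.one_div_pos_of_nat
  have hu0 : Tendsto u atTop (𝓝[>] 0) :=
    tendsto_nhdsWithin_iff.2 ⟨tendsto_one_div_add_atTop_nhds_zero_nat, Eventually.of_forall hu⟩
  refine (Lp.eLpNorm_lim_le_liminf_eLpNorm
    (fun n => aestronglyMeasurable_regHilbert (hu n) hw.integrable) _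
    (ae_of_all _ fun z => (hw.tendsto_regHilbert z).comp hu0)).trans ?_
  exact liminf_le_of_frequently_le' (Eventually.frequently (Eventually.of_forall fun n =>
    eLpNorm_regHilbert_le (hu n) hw.integrable hw.memLp hM hwM))

theorem energyLE_regHilbert (hw : CompactEnergy R K w) {η : ℝ} (hη : 0 < η) :
    EnergyLE (regHilbert η w) (Real.pi * K) := by
  have hp2 := hw.energy.memLp_deriv
  have hp1 : Integrable (deriv w) := MemLp.integrable_of_support hp2 fun x hx => hw.deriv_support hx
  have hk := continuous_conjPoisson hη
  have hT := memLp_regHilbert hη hp1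
  refine EnergyLE.of_weakDeriv (p := regHilbert η (deriv w)) hT ?_
    (mul_nonneg Real.pi_pos.le hw.nonneg)
    (eLpNorm_regHilbert_le hη hp1 hp2 hw.nonneg hw.energy.eLpNorm_deriv_le)
  have hsub : ∀ (v : ℝ → ℝ) (z : ℝ), regHilbert η v z = ∫ s, conjPoisson η s * v (z - s) := by
    intro v z
    rw [regHilbert, ← integral_sub_left_eq_self _ _ z]
    congr 1; ext s; congr 2; ring
  intro a b
  wlog hab : a ≤ b generalizing a b
  · rw [intervalIntegral.integral_symm, this b a (le_of_not_ge hab)]; ring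
  have hi : ∀ z, Integrable fun s => conjPoisson η s * w (z - s) := by
    intro z
    have hc := hw.continuous
    refine (Continuous.integrable_of_hasCompactSupport (by fun_prop) ?_)
    exact (hw.hasCompactSupport.comp_homeomorph (Homeomorph.subLeft z)).mul_left
  have hker : Integrable (fun q : ℝ × ℝ => conjPoisson η q.2 * deriv w (q.1 - q.2))
      ((volume.restrict (Ioc a b)).prod volume) := by
    have hm : AEStronglyMeasurable (fun q : ℝ × ℝ => conjPoisson η q.2 * deriv w (q.1 - q.2))
        ((volume.restrict (Ioc a b)).prod volume) := by
      refine Measurable.aestronglyMeasurable ?_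
      exact (hk.measurable.comp measurable_snd).mul
        ((measurable_deriv w).comp (measurable_fst.sub measurable_snd))
    rw [integrable_prod_iff hm]
    have hb : ∀ z, Integrable fun s => 1 / η * |deriv w (z - s)| := fun z =>
      ((hp1.comp_sub_left z).abs).const_mul _
    have hle : ∀ z s, ‖conjPoisson η s * deriv w (z - s)‖ ≤ 1 / η * |deriv w (z - s)| := by
      intro z s
      rw [Real.norm_eq_abs, abs_mul]
      exact mul_le_mul_of_nonneg_right (abs_conjPoisson_le' hη _) (abs_nonneg _)
    constructor
    · refine ae_of_all _ fun z => (hb z).mono' ?_ (ae_of_all _ (hle z))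
      exact (hk.measurable.mul ((measurable_deriv w).comp (measurable_const.sub measurable_id))
        ).aestronglyMeasurable
    · have hfin : IsFiniteMeasure (volume.restrict (Ioc a b)) := ⟨by simp⟩
      refine Integrable.mono' (integrable_const (1 / η * ∫ s, |deriv w s|)) ?_
        (ae_of_all _ fun z => ?_)
      · exact hm.norm.integral_prod_right'
      · rw [Real.norm_of_nonneg (integral_nonneg fun _ => norm_nonneg _)]
        refine (integral_mono_of_nonneg (ae_of_all _ fun _ => norm_nonneg _) (hb z)
          (ae_of_all _ (hle z))).trans ?_
        rw [integral_const_mul, integral_sub_left_eq_self (fun s => |deriv w s|)]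
  calc ∫ z in a..b, regHilbert η (deriv w) z
      = ∫ z in Ioc a b, ∫ s, conjPoisson η s * deriv w (z - s) := by
        rw [intervalIntegral.integral_of_le hab]; simp_rw [hsub]
    _ = ∫ s, ∫ z in Ioc a b, conjPoisson η s * deriv w (z - s) := integral_integral_swap hker
    _ = ∫ s, conjPoisson η s * (w (b - s) - w (a - s)) := by
        congr 1; ext s
        rw [integral_const_mul, ← intervalIntegral.integral_of_le hab,
          intervalIntegral.integral_comp_sub_right (fun x => deriv w x) s,
          hw.energy.intervalIntegral_deriv]
    _ = regHilbert η w b - regHilbert η w a := by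
        rw [hsub, hsub, ← integral_sub (hi b) (hi a)]
        congr 1; ext s; ring

theorem energyLE_hilbert (hw : CompactEnergy R K w) : EnergyLE (hilbert w) (Real.pi * K) := by
  refine EnergyLE.of_tendsto (l := 𝓝[>] (0 : ℝ)) (F := fun η => regHilbert η w) ?_
    fun z => hw.tendsto_regHilbert z
  filter_upwards [self_mem_nhdsWithin] with η hη
  exact hw.energyLE_regHilbert hη

/-! ### The logarithmic potential -/

/-- The logarithmic potential of `w`. -/
def _root_.HouLuo.logPotential (w : ℝ → ℝ) (z : ℝ) : ℝ := ∫ y, Real.log |z - y| * w y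

theorem abs_log_le_sq_add {η s : ℝ} (hη : 0 < η) (hη1 : η ≤ 1) (hs : s ≠ 0) :
    |1 / 2 * Real.log (s ^ 2 + η ^ 2)| ≤ |Real.log (|s|)| + s ^ 2 := by
  have hs2 : 0 < s ^ 2 := by positivity
  have e1 : Real.log (s ^ 2) = 2 * Real.log |s| := by
    rw [← sq_abs, Real.log_pow]; norm_num
  rcases le_total 1 (s ^ 2 + η ^ 2) with h | h
  · rw [abs_of_nonneg (mul_nonneg (by norm_num) (Real.log_nonneg h))]
    have := Real.log_le_sub_one_of_pos (by positivity : 0 < s ^ 2 + η ^ 2)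
    nlinarith [abs_nonneg (Real.log |s|), sq_nonneg η]
  · have h1 : Real.log (s ^ 2 + η ^ 2) ≤ 0 := Real.log_nonpos (by positivity) h
    have h2 : Real.log (s ^ 2) ≤ Real.log (s ^ 2 + η ^ 2) :=
      Real.log_le_log hs2 (by nlinarith [sq_nonneg η])
    rw [abs_of_nonpos (by linarith)]
    have := neg_abs_le (Real.log |s|)
    nlinarith

theorem integrable_log_mul (hw : CompactEnergy R K w) (z : ℝ) :
    Integrable fun y => Real.log |z - y| * w y := by
  have h1 : IntegrableOn (fun y => Real.log |z - y| * w y) (uIcc (-R) R) := by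
    have : IntervalIntegrable (fun y => Real.log |z - y|) volume (-R) R := by
      have h := (intervalIntegral.intervalIntegrable_log' (a := z - R) (b := z - -R)).comp_sub_left z
      simp only [sub_sub_cancel] at h
      simpa using h.symm
    exact (intervalIntegrable_iff' (by finiteness)).1 (this.mul_continuousOn hw.continuous.continuousOn)
  refine (integrableOn_iff_integrable_of_support_subset ?_).1 h1
  intro y hy
  by_contra h
  refine hy ?_
  simp only
  rw [hw.support y, mul_zero]
  by_contra h'
  have := abs_lt.1 (not_le.1 h')
  exact h (by rw [mem_uIcc]; left; exact ⟨this.1.le, this.2.le⟩)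

theorem hasDerivAt_logPotential (hw : CompactEnergy R K w) (z : ℝ) :
    HasDerivAt (logPotential w) (hilbert w z) z := by
  have hc := hw.continuous
  let u : ℝ → ℝ → ℝ := fun η z => ∫ y, 1 / 2 * Real.log ((z - y) ^ 2 + η ^ 2) * w y
  have hpos : ∀ {η : ℝ}, 0 < η → ∀ x : ℝ, x ^ 2 + η ^ 2 ≠ 0 := fun hη x => by positivity
  have hlogc : ∀ {η : ℝ}, 0 < η → Continuous fun x : ℝ => Real.log (x ^ 2 + η ^ 2) := fun hη =>
    Continuous.log (by fun_prop) (hpos hη)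
  have hui : ∀ {η : ℝ}, 0 < η → ∀ z, Integrable fun y =>
      1 / 2 * Real.log ((z - y) ^ 2 + η ^ 2) * w y := by
    intro η hη z
    refine Continuous.integrable_of_hasCompactSupport ?_ hw.hasCompactSupport.mul_left
    have := (hlogc hη).comp (by fun_prop : Continuous fun y => z - y)
    simp only [Function.comp_def] at this
    fun_prop
  have hu' : ∀ {η : ℝ}, 0 < η → ∀ z, HasDerivAt (u η) (regHilbert η w z) z := by
    intro η hη z
    refine (hasDerivAt_integral_of_dominated_loc_of_deriv_le (μ := volume)
      (F := fun z y => 1 / 2 * Real.log ((z - y) ^ 2 + η ^ 2) * w y)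
      (F' := fun z y => conjPoisson η (z - y) * w y)
      (bound := fun y => 1 / η * |w y|) (s := univ) univ_mem ?_ (hui hη z) ?_ ?_
      (hw.integrable.abs.const_mul _) ?_).2
    · exact Eventually.of_forall fun z => (hui hη z).aestronglyMeasurable
    · exact (((continuous_conjPoisson hη).comp (by fun_prop : Continuous fun y => z - y)).mul
        hc).aestronglyMeasurable
    · refine ae_of_all _ fun y x _ => ?_
      rw [Real.norm_eq_abs, abs_mul]
      exact mul_le_mul_of_nonneg_right (abs_conjPoisson_le' hη _) (abs_nonneg _)
    · refine ae_of_all _ fun y x _ => ?_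
      have := (((((hasDerivAt_id x).sub_const y).pow 2).add_const (η ^ 2)).log
        (hpos hη _)).const_mul (1 / 2)
      convert! this.mul_const (w y) using 1
      have := hpos hη (x - y)
      simp only [conjPoisson, id, Pi.pow_apply]
      field_simp
      simp
      ring
  have hulim : ∀ z, Tendsto (fun η => u η z) (𝓝[>] 0) (𝓝 (logPotential w z)) := by
    intro z
    have hne : ∀ᵐ y : ℝ, y ≠ z := by simp [ae_iff]
    refine tendsto_integral_filter_of_dominated_convergence
      (fun y => |Real.log |z - y| * w y| + |(z - y) ^ 2 * w y|) ?_ ?_ ?_ ?_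
    · filter_upwards [self_mem_nhdsWithin] with η hη
      exact (hui hη z).aestronglyMeasurable
    · filter_upwards [Ioc_mem_nhdsGT (zero_lt_one' ℝ)] with η hη
      filter_upwards [hne] with y hy
      rw [Real.norm_eq_abs, abs_mul, abs_mul (Real.log _), abs_mul ((z - y) ^ 2), ← add_mul]
      refine mul_le_mul_of_nonneg_right ?_ (abs_nonneg _)
      rw [abs_of_nonneg (sq_nonneg (z - y))]
      exact abs_log_le_sq_add hη.1 hη.2 (sub_ne_zero.2 hy.symm)
    · refine (hw.integrable_log_mul z).abs.add (Integrable.abs ?_)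
      exact Continuous.integrable_of_hasCompactSupport (by fun_prop) hw.hasCompactSupport.mul_left
    · filter_upwards [hne] with y hy
      have hzy : z - y ≠ 0 := sub_ne_zero.2 hy.symm
      have : ContinuousAt (fun η : ℝ => 1 / 2 * Real.log ((z - y) ^ 2 + η ^ 2) * w y) 0 := by
        refine ((ContinuousAt.log (by fun_prop) (by positivity)).const_mul _).mul_const _
      have h2 := this.tendsto.mono_left (nhdsWithin_le_nhds (s := Ioi (0 : ℝ)))
      have e : 1 / 2 * Real.log ((z - y) ^ 2 + 0 ^ 2) * w y = Real.log |z - y| * w y := by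
        rw [← sq_abs (z - y)]; simp [Real.log_pow]
      rwa [e] at h2
  have hftc : ∀ a b, ∫ z in a..b, hilbert w z = logPotential w b - logPotential w a := by
    intro a b
    have h1 : Tendsto (fun η => ∫ z in a..b, regHilbert η w z) (𝓝[>] 0)
        (𝓝 (∫ z in a..b, hilbert w z)) := by
      refine intervalIntegral.tendsto_integral_filter_of_dominated_convergence
        (fun _ => 4 * K * √1 + 2 / 1 * ∫ x, |w x|) ?_ ?_ (by simp) ?_
      · filter_upwards [self_mem_nhdsWithin] with η hη
        exact (hw.continuous_regHilbert hη).aestronglyMeasurable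
      · filter_upwards [self_mem_nhdsWithin] with η hη
        exact ae_of_all _ fun z _ => hw.abs_regHilbert_le hη z one_pos
      · exact ae_of_all _ fun z _ => hw.tendsto_regHilbert z
    refine tendsto_nhds_unique h1 (((hulim b).sub (hulim a)).congr' ?_)
    filter_upwards [self_mem_nhdsWithin] with η hη
    exact (intervalIntegral.integral_eq_sub_of_hasDerivAt (fun x _ => hu' hη x)
      ((hw.continuous_regHilbert hη).intervalIntegrable _ _)).symm
  have e : logPotential w = fun x => logPotential w z + ∫ t in z..x, hilbert w t := by
    ext x; rw [hftc]; ring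
  rw [e]
  exact (hw.continuous_hilbert.integral_hasStrictDerivAt z z).hasDerivAt.const_add _

end CompactEnergy

/-! ### The perturbed Biot–Savart law -/

/-- `f1` is the derivative of `f` in the first variable, `f` and `f1` are bounded and `f1` is
Lipschitz with constant `C`, `f1` vanishes for `|x| ≥ 1`, and `f` is symmetric under
`(x, y) ↦ (-x, -y)`. -/
structure KernelReg (f f1 : ℝ → ℝ → ℝ) (C : ℝ) : Prop where
  nonneg : 0 ≤ C
  hasDerivAt : ∀ x y, HasDerivAt (fun x => f x y) (f1 x y) x
  continuous : Continuous (Function.uncurry f)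
  continuous₁ : Continuous (Function.uncurry f1)
  bound : ∀ x y, |f x y| ≤ C
  bound₁ : ∀ x y, |f1 x y| ≤ C
  lip_left : ∀ x x' y, |f1 x y - f1 x' y| ≤ C * |x - x'|
  lip_right : ∀ x y y', |f1 x y - f1 x y'| ≤ C * |y - y'|
  support₁ : ∀ x y, 1 ≤ |x| → f1 x y = 0
  symm : ∀ x y, f (-x) (-y) = f x y
  antisymm₁ : ∀ x y, f1 (-x) (-y) = -f1 x y

theorem exists_kernelReg (f : ℝ → ℝ → ℝ) (hf : ContDiff ℝ 2 (Function.uncurry f))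
    (hf_supp : Function.support (Function.uncurry f) ⊆ Icc (-1) 1 ×ˢ Icc (-1) 1)
    (hf_symm : ∀ x y : ℝ, f x y = f (-x) (-y)) : ∃ f1 C, KernelReg f f1 C := by
  have hcs : HasCompactSupport (Function.uncurry f) := by
    refine HasCompactSupport.intro ((isCompact_Icc (a := (-1 : ℝ)) (b := 1)).prod
      (isCompact_Icc (a := (-1 : ℝ)) (b := 1))) fun x hx => ?_
    by_contra h
    exact hx (hf_supp h)
  let f1 : ℝ → ℝ → ℝ := fun x y => fderiv ℝ (Function.uncurry f) (x, y) (1, 0)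
  have hd : ∀ x y, HasDerivAt (fun x => f x y) (f1 x y) x := by
    intro x y
    have h1 : HasFDerivAt (Function.uncurry f) (fderiv ℝ (Function.uncurry f) (x, y)) (x, y) :=
      (hf.differentiable (by norm_num) _).hasFDerivAt
    have h2 : HasDerivAt (fun x : ℝ => (x, y)) (1, 0) x := (hasDerivAt_id x).prodMk (hasDerivAt_const x y)
    exact h1.comp_hasDerivAt x h2
  have hf1 : ContDiff ℝ 1 (Function.uncurry f1) := by
    have : ContDiff ℝ 1 (fderiv ℝ (Function.uncurry f)) := hf.fderiv_right (by norm_num)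
    exact this.clm_apply contDiff_const
  have hcs1 : HasCompactSupport (Function.uncurry f1) :=
    (hcs.fderiv (𝕜 := ℝ)).comp_left (g := fun L : ℝ × ℝ →L[ℝ] ℝ => L (1, 0)) (by simp)
  obtain ⟨C0, hC0⟩ := hcs.exists_bound_of_continuous hf.continuous
  obtain ⟨C1, hC1⟩ := hcs1.exists_bound_of_continuous hf1.continuous
  obtain ⟨C2, hC2⟩ := hf1.lipschitzWith_of_hasCompactSupport hcs1 (by norm_num)
  have hz : ∀ x y, 1 < |x| → f x y = 0 := by
    intro x y hx
    by_contra h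
    have := (hf_supp (show (x, y) ∈ Function.support (Function.uncurry f) from h)).1
    exact absurd (abs_le.2 this) (not_le.2 hx)
  have hz1 : ∀ x y, 1 < |x| → f1 x y = 0 := by
    intro x y hx
    have : (fun x => f x y) =ᶠ[𝓝 x] fun _ => 0 := by
      filter_upwards [(isOpen_lt continuous_const continuous_abs).mem_nhds hx] with x' hx'
      exact hz x' y hx'
    rw [← (hd x y).deriv, this.deriv_eq]; simp
  have hc1 : Continuous (Function.uncurry f1) := hf1.continuous
  refine ⟨f1, max C0 (max C1 C2), ⟨?_, hd, hf.continuous, hc1, ?_, ?_, ?_, ?_, ?_, ?_, ?_⟩⟩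
  · exact le_trans C2.2 ((le_max_right _ _).trans (le_max_right _ _))
  · exact fun x y => (hC0 (x, y)).trans (le_max_left _ _)
  · exact fun x y => (hC1 (x, y)).trans ((le_max_left _ _).trans (le_max_right _ _))
  · intro x x' y
    have := hC2.dist_le_mul (x, y) (x', y)
    rw [Real.dist_eq, Prod.dist_eq, dist_self, max_eq_left dist_nonneg, Real.dist_eq] at this
    exact this.trans (mul_le_mul_of_nonneg_right ((le_max_right _ _).trans (le_max_right _ _))
      (abs_nonneg _))
  · intro x y y'
    have := hC2.dist_le_mul (x, y) (x, y')
    rw [Real.dist_eq, Prod.dist_eq, dist_self, max_eq_right dist_nonneg, Real.dist_eq] at this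
    exact this.trans (mul_le_mul_of_nonneg_right ((le_max_right _ _).trans (le_max_right _ _))
      (abs_nonneg _))
  · intro x y hx
    have hcl : IsClosed {x : ℝ | f1 x y = 0} :=
      isClosed_eq (hc1.comp (by fun_prop : Continuous fun x : ℝ => (x, y))) continuous_const
    have hx' : x ∈ closure {x : ℝ | 1 < |x|} := by
      rcases le_abs.1 hx with h | h
      · have : x ∈ closure (Ioi 1) := by rw [closure_Ioi]; exact h
        exact closure_mono (fun (t : ℝ) (ht : 1 < t) => ht.trans_le (le_abs_self t)) this
      · have : x ∈ closure (Iio (-1)) := by rw [closure_Iio]; simp only [mem_Iic]; linarith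
        exact closure_mono (fun (t : ℝ) (ht : t < -1) => (by linarith : 1 < -t).trans_le (neg_le_abs t)) this
    exact hcl.closure_subset_iff.2 (fun t ht => hz1 t y ht) hx'
  · exact fun x y => (hf_symm x y).symm
  · intro x y
    have h1 : HasDerivAt (fun x' => f (-x') (-y)) (f1 (-x) (-y) * (-1)) x :=
      HasDerivAt.comp x (hd (-x) (-y)) (hasDerivAt_neg x)
    have h2 : (fun x' => f (-x') (-y)) = fun x' => f x' y := by ext x'; rw [← hf_symm]
    rw [h2] at h1
    linarith [h1.unique (hd x y)]

/-- The derivative of `velocity f w`. -/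
def strain (f1 : ℝ → ℝ → ℝ) (w : ℝ → ℝ) (z : ℝ) : ℝ :=
  (1 / Real.pi) * (hilbert w z + ∫ y, f1 z y * w y)

theorem inv_pi_le_one : 1 / Real.pi ≤ 1 := by
  rw [div_le_one Real.pi_pos]; linarith [Real.pi_gt_three]

namespace KernelReg

variable {f f1 : ℝ → ℝ → ℝ} {C R K L : ℝ} {w v : ℝ → ℝ}

theorem continuous_right (hf : KernelReg f f1 C) (z : ℝ) : Continuous fun y => f z y :=
  hf.continuous.comp (by fun_prop : Continuous fun y : ℝ => (z, y))

theorem continuous₁_right (hf : KernelReg f f1 C) (z : ℝ) : Continuous fun y => f1 z y :=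
  hf.continuous₁.comp (by fun_prop : Continuous fun y : ℝ => (z, y))

theorem integrable_mul (hf : KernelReg f f1 C) (hw : CompactEnergy R K w) (z : ℝ) :
    Integrable fun y => f z y * w y :=
  ((hf.continuous_right z).mul hw.continuous).integrable_of_hasCompactSupport
    hw.hasCompactSupport.mul_left

theorem integrable₁_mul (hf : KernelReg f f1 C) (hw : CompactEnergy R K w) (z : ℝ) :
    Integrable fun y => f1 z y * w y :=
  ((hf.continuous₁_right z).mul hw.continuous).integrable_of_hasCompactSupport
    hw.hasCompactSupport.mul_left

theorem velocity_eq (hf : KernelReg f f1 C) (hw : CompactEnergy R K w) (z : ℝ) :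
    velocity f w z = (1 / Real.pi) * (logPotential w z + ∫ y, f z y * w y) := by
  rw [velocity, logPotential, ← integral_add (hw.integrable_log_mul z) (hf.integrable_mul hw z)]
  congr 2; ext y; ring

theorem hasDerivAt_integral (hf : KernelReg f f1 C) (hw : CompactEnergy R K w) (z : ℝ) :
    HasDerivAt (fun z => ∫ y, f z y * w y) (∫ y, f1 z y * w y) z := by
  refine (hasDerivAt_integral_of_dominated_loc_of_deriv_le (μ := volume)
      (F := fun z y => f z y * w y) (F' := fun z y => f1 z y * w y)
      (bound := fun y => C * |w y|) (s := univ) univ_mem ?_ (hf.integrable_mul hw z)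
      (hf.integrable₁_mul hw z).aestronglyMeasurable ?_ (hw.integrable.abs.const_mul _) ?_).2
  · exact Eventually.of_forall fun z => (hf.integrable_mul hw z).aestronglyMeasurable
  · refine ae_of_all _ fun y x _ => ?_
    rw [Real.norm_eq_abs, abs_mul]
    exact mul_le_mul_of_nonneg_right (hf.bound₁ _ _) (abs_nonneg _)
  · exact ae_of_all _ fun y x _ => (hf.hasDerivAt x y).mul_const _

theorem hasDerivAt_velocity (hf : KernelReg f f1 C) (hw : CompactEnergy R K w) (z : ℝ) :
    HasDerivAt (velocity f w) (strain f1 w z) z := by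
  have : velocity f w = fun z => (1 / Real.pi) * (logPotential w z + ∫ y, f z y * w y) := by
    ext z; exact hf.velocity_eq hw z
  rw [this]
  exact ((hw.hasDerivAt_logPotential z).add (hf.hasDerivAt_integral hw z)).const_mul _

theorem abs_integral₁_sub_le (hf : KernelReg f f1 C) (hw : CompactEnergy R K w) (z z' : ℝ) :
    |(∫ y, f1 z y * w y) - ∫ y, f1 z' y * w y| ≤ C * (∫ y, |w y|) * |z - z'| := by
  rw [← integral_sub (hf.integrable₁_mul hw z) (hf.integrable₁_mul hw z')]
  have : ‖∫ y, (f1 z y * w y - f1 z' y * w y)‖ ≤ ∫ y, C * |z - z'| * |w y| := by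
    refine norm_integral_le_of_norm_le (hw.integrable.abs.const_mul _) (ae_of_all _ fun y => ?_)
    rw [← sub_mul, norm_mul]
    exact mul_le_mul_of_nonneg_right (hf.lip_left z z' y) (abs_nonneg _)
  refine this.trans (le_of_eq ?_)
  rw [integral_const_mul]; ring

theorem abs_integral₁_le (hf : KernelReg f f1 C) (hw : CompactEnergy R K w) (z : ℝ) :
    |∫ y, f1 z y * w y| ≤ C * ∫ y, |w y| := by
  have : ‖∫ y, f1 z y * w y‖ ≤ ∫ y, C * |w y| := by
    refine norm_integral_le_of_norm_le (hw.integrable.abs.const_mul _) (ae_of_all _ fun y => ?_)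
    rw [norm_mul]
    exact mul_le_mul_of_nonneg_right (hf.bound₁ _ _) (abs_nonneg _)
  refine this.trans (le_of_eq ?_)
  rw [integral_const_mul]

theorem continuous_integral₁ (hf : KernelReg f f1 C) (hw : CompactEnergy R K w) :
    Continuous fun z => ∫ y, f1 z y * w y := by
  have hL : 0 ≤ C * ∫ y, |w y| := mul_nonneg hf.nonneg (integral_nonneg fun _ => abs_nonneg _)
  refine LipschitzWith.continuous (K := ⟨C * ∫ y, |w y|, hL⟩) ?_
  refine LipschitzWith.of_dist_le_mul fun z z' => ?_
  exact hf.abs_integral₁_sub_le hw z z'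

theorem continuous_strain (hf : KernelReg f f1 C) (hw : CompactEnergy R K w) :
    Continuous (strain f1 w) :=
  (hw.continuous_hilbert.add (hf.continuous_integral₁ hw)).const_mul _

theorem abs_strain_le (hf : KernelReg f f1 C) (hw : CompactEnergy R K w) (z : ℝ) {σ : ℝ}
    (hσ : 0 < σ) : |strain f1 w z| ≤ 4 * K * √σ + (2 / σ + C) * ∫ x, |w x| := by
  rw [strain, abs_mul, abs_of_pos (by have := Real.pi_pos; positivity)]
  refine (mul_le_of_le_one_left (abs_nonneg _) inv_pi_le_one).trans ?_
  refine (abs_add_le _ _).trans ?_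
  have := hw.abs_hilbert_le z hσ
  have := hf.abs_integral₁_le hw z
  linarith

theorem strain_sub (hf : KernelReg f f1 C) (hw : CompactEnergy R K w) (hv : CompactEnergy R L v)
    (z : ℝ) : strain f1 (fun x => w x - v x) z = strain f1 w z - strain f1 v z := by
  rw [strain, strain, strain, hw.hilbert_sub hv]
  have : ∫ y, f1 z y * (w y - v y) = (∫ y, f1 z y * w y) - ∫ y, f1 z y * v y := by
    rw [← integral_sub (hf.integrable₁_mul hw z) (hf.integrable₁_mul hv z)]
    congr 1; ext y; ring
  rw [this]; ring

theorem velocity_sub (hf : KernelReg f f1 C) (hw : CompactEnergy R K w) (hv : CompactEnergy R L v)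
    (z : ℝ) : velocity f (fun x => w x - v x) z = velocity f w z - velocity f v z := by
  rw [hf.velocity_eq hw, hf.velocity_eq hv, hf.velocity_eq (hw.sub hv)]
  have h1 : ∫ y, f z y * (w y - v y) = (∫ y, f z y * w y) - ∫ y, f z y * v y := by
    rw [← integral_sub (hf.integrable_mul hw z) (hf.integrable_mul hv z)]
    congr 1; ext y; ring
  have h2 : logPotential (fun x => w x - v x) z = logPotential w z - logPotential v z := by
    simp only [logPotential]
    rw [← integral_sub (hw.integrable_log_mul z) (hv.integrable_log_mul z)]
    congr 1; ext y; ring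
  rw [h1, h2]; ring

theorem energyLE_strain (hf : KernelReg f f1 C) (hw : CompactEnergy R K w) :
    EnergyLE (strain f1 w) (K + 2 * C * ∫ x, |w x|) := by
  have hL : 0 ≤ C * ∫ y, |w y| := mul_nonneg hf.nonneg (integral_nonneg fun _ => abs_nonneg _)
  have h1 : EnergyLE (fun z => ∫ y, f1 z y * w y) (C * (∫ y, |w y|) * √(2 * 1)) := by
    refine EnergyLE.of_lipschitz_clamp hL zero_le_one (hf.abs_integral₁_sub_le hw) fun z => ?_
    have h0 : ∀ z, 1 ≤ |z| → ∫ y, f1 z y * w y = 0 := fun z hz => by simp [hf.support₁ z _ hz]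
    rcases le_or_gt 1 |z| with h | h
    · rw [h0 z h, h0]
      rcases le_abs.1 h with h' | h'
      · rw [min_eq_left h']; norm_num
      · rw [min_eq_right (by linarith), max_eq_left (by linarith)]; norm_num
    · have := abs_lt.1 h
      rw [min_eq_right this.2.le, max_eq_right this.1.le]
  have hpi := Real.pi_pos
  refine ((hw.energyLE_hilbert.add h1).const_mul (1 / Real.pi)).mono ?_
  rw [abs_of_pos (by positivity), mul_add]
  refine add_le_add (le_of_eq (by field_simp)) ?_
  have h2 : √(2 * 1) ≤ 2 := by
    rw [Real.sqrt_le_left (by norm_num)]; norm_num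
  refine (mul_le_of_le_one_left (by positivity) inv_pi_le_one).trans ?_
  nlinarith

/-- The supremum of the velocity generated by vorticity supported in `(-R, R)` with values in
`[-1, 1]`. -/
def _root_.HouLuo.velocityConst (C R : ℝ) : ℝ :=
  (∫ s in (-(2 * R))..(2 * R), |Real.log (|s|)|) + 2 * R * C

theorem _root_.HouLuo.velocityConst_nonneg {C R : ℝ} (hC : 0 ≤ C) (hR : 0 ≤ R) :
    0 ≤ velocityConst C R :=
  add_nonneg (intervalIntegral.integral_nonneg (by linarith) fun _ _ => abs_nonneg _)
    (mul_nonneg (by linarith) hC)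

theorem abs_velocity_le (hf : KernelReg f f1 C) (hw : CompactEnergy R K w) (hR : 0 ≤ R) {M : ℝ}
    (hM : ∀ x, |w x| ≤ M) {z : ℝ} (hz : |z| ≤ R) :
    |velocity f w z| ≤ velocityConst C R * M := by
  have hM0 : 0 ≤ M := (abs_nonneg _).trans (hM 0)
  rw [hf.velocity_eq hw, abs_mul, abs_of_pos (by have := Real.pi_pos; positivity)]
  refine (mul_le_of_le_one_left (abs_nonneg _) inv_pi_le_one).trans ?_
  refine (abs_add_le _ _).trans ?_
  rw [velocityConst, add_mul]
  have hlogi : ∀ a b : ℝ, IntervalIntegrable (fun s => |Real.log (|s|)|) volume a b := fun a b => by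
    simpa using (intervalIntegral.intervalIntegrable_log' (a := a) (b := b)).abs
  refine add_le_add ?_ ?_
  · have hz' := abs_le.1 hz
    rw [logPotential, hw.setIntegral_eq hR]
    have hli : IntervalIntegrable (fun y => |Real.log (|z - y|)|) volume (-R) R := by
      have h := (hlogi (z - R) (z - -R)).comp_sub_left z
      simp only [sub_sub_cancel] at h
      exact h.symm
    have h1 : ‖∫ y in (-R)..R, Real.log |z - y| * w y‖ ≤ ∫ y in (-R)..R, |Real.log (|z - y|)| * M := by
      refine intervalIntegral.norm_integral_le_of_norm_le (by linarith) (ae_of_all _ fun y _ => ?_)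
        (hli.mul_const _)
      rw [norm_mul]
      exact mul_le_mul_of_nonneg_left (hM y) (abs_nonneg _)
    refine h1.trans ?_
    rw [intervalIntegral.integral_mul_const]
    refine mul_le_mul_of_nonneg_right ?_ hM0
    rw [intervalIntegral.integral_comp_sub_left (fun s => |Real.log (|s|)|) z]
    exact intervalIntegral.integral_mono_interval (by linarith) (by linarith) (by linarith)
      (ae_of_all _ fun _ => abs_nonneg _) (hlogi _ _)
  · have h1 : ‖∫ y, f z y * w y‖ ≤ ∫ y, C * |w y| := by
      refine norm_integral_le_of_norm_le (hw.integrable.abs.const_mul _) (ae_of_all _ fun y => ?_)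
      rw [norm_mul]
      exact mul_le_mul_of_nonneg_right (hf.bound _ _) (abs_nonneg _)
    refine h1.trans ?_
    rw [integral_const_mul]
    have := mul_le_mul_of_nonneg_left (hw.integral_abs_le_of_bound hR hM) hf.nonneg
    linarith

theorem strain_neg (hf : KernelReg f f1 C) (hodd : ∀ x, w (-x) = -w x) (z : ℝ) :
    strain f1 w (-z) = strain f1 w z := by
  have h1 : hilbert w (-z) = hilbert w z := by
    unfold hilbert
    congr 1; ext s
    rw [show -z - s = -(z + s) by ring, show -z + s = -(z - s) by ring, hodd, hodd]; ring
  have h2 : ∫ y, f1 (-z) y * w y = ∫ y, f1 z y * w y := by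
    rw [← integral_neg_eq_self]
    congr 1; ext y
    rw [hf.antisymm₁, hodd]; ring
  rw [strain, strain, h1, h2]

theorem velocity_neg (hf : KernelReg f f1 C) (hodd : ∀ x, w (-x) = -w x) (z : ℝ) :
    velocity f w (-z) = -velocity f w z := by
  rw [velocity, velocity, ← integral_neg_eq_self, ← mul_neg, ← integral_neg]
  congr 2; ext y
  rw [hf.symm, hodd, show -z - -y = -(z - y) by ring, abs_neg]; ring

end KernelReg

/-! ### Peano's theorem in a product of real lines -/

/-- Euler's scheme with step `h`. -/
def euler {ι : Type*} (F : (ι → ℝ) → ι → ℝ) (y₀ : ι → ℝ) (h : ℝ) : ℕ → ι → ℝ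
  | 0 => y₀
  | k + 1 => euler F y₀ h k + h • F (euler F y₀ h k)

/-- Peano's theorem in a product of lines: if the vector field takes values in a closed bounded convex
set `D ∋ 0` on `y₀ + T • D` and is continuous there, there is a solution on `[0, T]`. -/
theorem exists_solution_of_continuousOn {ι : Type*} {D : Set (ι → ℝ)} (hconv : Convex ℝ D)
    (hclosed : IsClosed D) (h0 : (0 : ι → ℝ) ∈ D) {b : ι → ℝ} (hb : ∀ d ∈ D, ∀ i, |d i| ≤ b i)
    (y₀ : ι → ℝ) {T : ℝ} (hT : 0 < T) {F : (ι → ℝ) → ι → ℝ}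
    (hF : ∀ d ∈ D, F (y₀ + T • d) ∈ D)
    (hc : ∀ i, ContinuousOn (fun y => F y i) ((fun d => y₀ + T • d) '' D)) :
    ∃ y : ℝ → ι → ℝ, y 0 = y₀ ∧ (∀ t ∈ Icc 0 T, y t ∈ (fun d => y₀ + T • d) '' D) ∧
      ∀ t ∈ Icc 0 T, ∀ i, HasDerivWithinAt (fun s => y s i) (F (y t) i) (Icc 0 T) t := by
  set K : Set (ι → ℝ) := (fun d => y₀ + T • d) '' D with hK
  have hDc : IsCompact D := by
    refine (isCompact_univ_pi fun i => isCompact_Icc (a := -b i) (b := b i)).of_isClosed_subset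
      hclosed fun d hd i _ => abs_le.1 (hb d hd i)
  have hKc : IsCompact K := hDc.image (by fun_prop)
  let e : ℕ → ℕ → ι → ℝ := fun N => euler F y₀ (T / N)
  have hsmul : ∀ {r : ℝ}, 0 ≤ r → r ≤ 1 → ∀ d ∈ D, r • d ∈ D := fun hr hr1 d hd => by
    have := hconv h0 hd (sub_nonneg.2 hr1) hr (by ring)
    simpa using this
  have hE1 : ∀ N : ℕ, 0 < N → ∀ k : ℕ, k ≤ N → ∃ d ∈ D, e N k = y₀ + ((k : ℝ) * (T / N)) • d := by
    intro N hN k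
    have hN' : (0 : ℝ) < N := by exact_mod_cast hN
    induction k with
    | zero => intro _; exact ⟨0, h0, by simp [e, euler]⟩
    | succ k ih =>
      intro hk
      obtain ⟨d, hd, he⟩ := ih (by omega)
      have hkN : (k : ℝ) / N ≤ 1 := by
        rw [div_le_one hN']; exact_mod_cast (by omega : k ≤ N)
      have hv : F (e N k) ∈ D := by
        have := hF _ (hsmul (by positivity) hkN d hd)
        rw [smul_smul, show T * ((k : ℝ) / N) = (k : ℝ) * (T / N) by ring, ← he] at this
        exact this
      have hk1 : (0 : ℝ) < (k : ℝ) + 1 := by positivity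
      refine ⟨((k : ℝ) / (k + 1)) • d + ((1 : ℝ) / (k + 1)) • F (e N k),
        hconv hd hv (by positivity) (by positivity) (by field_simp), ?_⟩
      change e N k + (T / N) • F (e N k) = _
      rw [smul_add, smul_smul, smul_smul, ← add_assoc]
      have e1 : ((k + 1 : ℕ) : ℝ) * (T / N) * ((k : ℝ) / (k + 1)) = (k : ℝ) * (T / N) := by
        push_cast; field_simp
      have e2 : ((k + 1 : ℕ) : ℝ) * (T / N) * (1 / ((k : ℝ) + 1)) = T / N := by
        push_cast; field_simp
      rw [e1, e2, ← he]
  have hEK : ∀ N : ℕ, 0 < N → ∀ k : ℕ, k ≤ N → e N k ∈ K := by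
    intro N hN k hk
    have hN' : (0 : ℝ) < N := by exact_mod_cast hN
    obtain ⟨d, hd, he⟩ := hE1 N hN k hk
    refine ⟨((k : ℝ) / N) • d, hsmul (by positivity) ?_ d hd, ?_⟩
    · rw [div_le_one hN']; exact_mod_cast hk
    · simp only [smul_smul]; rw [he]; congr 2; ring
  have hFD : ∀ N : ℕ, 0 < N → ∀ k : ℕ, k ≤ N → F (e N k) ∈ D := by
    intro N hN k hk
    obtain ⟨d, hd, he⟩ := hEK N hN k hk
    rw [← he]; exact hF d hd
  have hsum : ∀ (N : ℕ), 0 < N → ∀ (i : ι) (v ε : ℝ) (k l : ℕ), k ≤ l → l ≤ N →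
      (∀ m, k ≤ m → m < l → |F (e N m) i - v| ≤ ε) →
      |e N l i - e N k i - ((l : ℝ) - k) * (T / N) * v| ≤ ε * (((l : ℝ) - k) * (T / N)) := by
    intro N hN i v ε k l hkl
    induction l, hkl using Nat.le_induction with
    | base => intro _ _; simp
    | succ l hkl ih =>
      intro hl hm
      have h1 := ih (by omega) fun m h1 h2 => hm m h1 (by omega)
      have h2 := hm l hkl (by omega)
      have e1 : e N (l + 1) i = e N l i + T / N * F (e N l) i := by simp [e, euler]
      rw [e1]
      have hpos : 0 ≤ T / N := by positivity
      have : e N l i + T / N * F (e N l) i - e N k i - (((l + 1 : ℕ) : ℝ) - k) * (T / N) * v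
          = (e N l i - e N k i - ((l : ℝ) - k) * (T / N) * v) + T / N * (F (e N l) i - v) := by
        push_cast; ring
      rw [this]
      refine (abs_add_le _ _).trans ?_
      rw [abs_mul, abs_of_nonneg hpos]
      have := mul_le_mul_of_nonneg_left h2 hpos
      push_cast
      linarith
  have hE2 : ∀ N : ℕ, 0 < N → ∀ (i : ι) (k l : ℕ), k ≤ N → l ≤ N →
      |e N l i - e N k i| ≤ |(l : ℝ) - k| * (T / N) * b i := by
    intro N hN i k l hk hl
    wlog hkl : k ≤ l generalizing k l
    · rw [abs_sub_comm, abs_sub_comm (l : ℝ)]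
      exact this l k hl hk (le_of_not_ge hkl)
    have := hsum N hN i 0 (b i) k l hkl hl fun m _ hm => by
      simpa using hb _ (hFD N hN m (by omega)) i
    simp only [mul_zero, sub_zero] at this
    rw [abs_of_nonneg (sub_nonneg.2 (by exact_mod_cast hkl : (k : ℝ) ≤ l))]
    linarith
  let k : ℕ → ℝ → ℕ := fun N t => ⌊t * N / T⌋₊
  have hk_le : ∀ N : ℕ, ∀ t ∈ Icc 0 T, k N t ≤ N := by
    intro N t ht
    refine Nat.floor_le_of_le ?_
    rw [div_le_iff₀ hT]
    nlinarith [ht.2, (Nat.cast_nonneg N : (0 : ℝ) ≤ N)]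
  have hk_near : ∀ N : ℕ, 0 < N → ∀ t ∈ Icc 0 T, (k N t : ℝ) * (T / N) ≤ t ∧
      t < (k N t : ℝ) * (T / N) + T / N := by
    intro N hN t ht
    have hN' : (0 : ℝ) < N := by exact_mod_cast hN
    have h1 := Nat.floor_le (div_nonneg (mul_nonneg ht.1 hN'.le) hT.le)
    have h2 := Nat.lt_floor_add_one (t * N / T)
    constructor
    · calc (k N t : ℝ) * (T / N) ≤ (t * N / T) * (T / N) :=
            mul_le_mul_of_nonneg_right h1 (by positivity)
        _ = t := by field_simp
    · calc t = (t * N / T) * (T / N) := by field_simp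
        _ < ((k N t : ℝ) + 1) * (T / N) := mul_lt_mul_of_pos_right h2 (by positivity)
        _ = _ := by ring
  let U : Ultrafilter ℕ := hyperfilter ℕ
  have hU : (U : Filter ℕ) ≤ atTop := by
    rw [← Nat.cofinite_eq_atTop]; exact hyperfilter_le_cofinite
  have hUpos : ∀ᶠ N in (U : Filter ℕ), 0 < N := hU (eventually_gt_atTop 0)
  have hstep : Tendsto (fun N : ℕ => T / (N : ℝ)) U (𝓝 0) :=
    (tendsto_const_div_atTop_nhds_zero_nat T).mono_left hU
  have hex : ∀ t, ∃ z, t ∈ Icc 0 T → z ∈ K ∧ Tendsto (fun N : ℕ => e N (k N t)) U (𝓝 z) := by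
    intro t
    by_cases ht : t ∈ Icc 0 T
    · obtain ⟨z, hz, hlim⟩ := hKc.ultrafilter_le_nhds' (U.map fun N : ℕ => e N (k N t)) (by
        change ∀ᶠ N in (U : Filter ℕ), e N (k N t) ∈ K
        filter_upwards [hUpos] with N hN
        exact hEK N hN _ (hk_le N t ht))
      exact ⟨z, fun _ => ⟨hz, hlim⟩⟩
    · exact ⟨0, fun h => absurd h ht⟩
  choose y hy using hex
  refine ⟨y, ?_, fun t ht => (hy t ht).1, ?_⟩
  · have h := (hy 0 ⟨le_rfl, hT.le⟩).2
    refine tendsto_nhds_unique h (tendsto_const_nhds.congr fun N => ?_)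
    simp [k, e, euler]
  · intro t ht i
    have hunif : ∀ ε > 0, ∃ γ > 0, ∀ᶠ N : ℕ in (U : Filter ℕ), ∀ m : ℕ, m ≤ N → |(m : ℝ) * (T / N) - t| < γ →
        |F (e N m) i - F (y t) i| ≤ ε := by
      intro ε hε
      have hlim : Tendsto (fun p : ℕ × ℝ => e p.1 (k p.1 p.2)) ((U : Filter ℕ) ×ˢ 𝓝[Icc 0 T] t)
          (𝓝 (y t)) := by
        rw [tendsto_pi_nhds]
        intro j
        have h1 : Tendsto (fun p : ℕ × ℝ => e p.1 (k p.1 t) j) ((U : Filter ℕ) ×ˢ 𝓝[Icc 0 T] t)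
            (𝓝 (y t j)) := ((tendsto_pi_nhds.1 (hy t ht).2 j)).comp tendsto_fst
        have h2 : Tendsto (fun p : ℕ × ℝ => (|p.2 - t| + T / p.1) * b j)
            ((U : Filter ℕ) ×ˢ 𝓝[Icc 0 T] t) (𝓝 0) := by
          have a1 : Tendsto (fun p : ℕ × ℝ => |p.2 - t|) ((U : Filter ℕ) ×ˢ 𝓝[Icc 0 T] t) (𝓝 0) := by
            have : Tendsto (fun s : ℝ => |s - t|) (𝓝[Icc 0 T] t) (𝓝 |t - t|) :=
              (by fun_prop : Continuous fun s : ℝ => |s - t|).continuousWithinAt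
            rw [sub_self, abs_zero] at this
            exact this.comp tendsto_snd
          have a2 : Tendsto (fun p : ℕ × ℝ => T / (p.1 : ℝ)) ((U : Filter ℕ) ×ˢ 𝓝[Icc 0 T] t)
            (𝓝 0) := hstep.comp tendsto_fst
          simpa using (a1.add a2).mul_const (b j)
        have h3 : Tendsto (fun p : ℕ × ℝ => e p.1 (k p.1 p.2) j - e p.1 (k p.1 t) j)
            ((U : Filter ℕ) ×ˢ 𝓝[Icc 0 T] t) (𝓝 0) := by
          refine squeeze_zero_norm' ?_ h2
          have hp1 : ∀ᶠ p : ℕ × ℝ in (U : Filter ℕ) ×ˢ 𝓝[Icc 0 T] t, 0 < p.1 :=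
            tendsto_fst.eventually hUpos
          have hp2 : ∀ᶠ p : ℕ × ℝ in (U : Filter ℕ) ×ˢ 𝓝[Icc 0 T] t, p.2 ∈ Icc 0 T :=
            tendsto_snd.eventually self_mem_nhdsWithin
          filter_upwards [hp1, hp2] with p hN hs
          have hbj : 0 ≤ b j := by simpa using hb 0 h0 j
          refine (hE2 p.1 hN j _ _ (hk_le p.1 t ht) (hk_le p.1 p.2 hs)).trans ?_
          refine mul_le_mul_of_nonneg_right ?_ hbj
          have hpos : 0 ≤ T / (p.1 : ℝ) := by positivity
          rw [← abs_of_nonneg hpos, ← abs_mul, abs_of_nonneg hpos, abs_le]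
          have b1 := hk_near p.1 hN t ht
          have b2 := hk_near p.1 hN p.2 hs
          have b3 := abs_le.1 (le_refl |p.2 - t|)
          constructor <;> nlinarith [b1.1, b1.2, b2.1, b2.2, b3.1, b3.2]
        simpa using h1.add h3
      have hlim2 : Tendsto (fun p : ℕ × ℝ => F (e p.1 (k p.1 p.2)) i)
          ((U : Filter ℕ) ×ˢ 𝓝[Icc 0 T] t) (𝓝 (F (y t) i)) := by
        refine (hc i (y t) (hy t ht).1).tendsto.comp (tendsto_nhdsWithin_iff.2 ⟨hlim, ?_⟩)
        have hp1 : ∀ᶠ p : ℕ × ℝ in (U : Filter ℕ) ×ˢ 𝓝[Icc 0 T] t, 0 < p.1 :=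
          tendsto_fst.eventually hUpos
        have hp2 : ∀ᶠ p : ℕ × ℝ in (U : Filter ℕ) ×ˢ 𝓝[Icc 0 T] t, p.2 ∈ Icc 0 T :=
          tendsto_snd.eventually self_mem_nhdsWithin
        filter_upwards [hp1, hp2] with p hN hs
        exact hEK p.1 hN _ (hk_le _ _ hs)
      have hev := hlim2.eventually (Metric.ball_mem_nhds (F (y t) i) hε)
      obtain ⟨P, hP, Q, hQ, hPQ⟩ := eventually_prod_iff.1 hev
      obtain ⟨γ, hγ, hball⟩ := Metric.mem_nhdsWithin_iff.1 hQ
      refine ⟨γ, hγ, ?_⟩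
      filter_upwards [hP, hUpos] with N hPN hN m hm hmt
      have hN' : (0 : ℝ) < N := by exact_mod_cast hN
      have hs : (m : ℝ) * (T / N) ∈ Icc 0 T := by
        refine ⟨by positivity, ?_⟩
        have : (m : ℝ) ≤ N := by exact_mod_cast hm
        calc (m : ℝ) * (T / N) ≤ N * (T / N) := mul_le_mul_of_nonneg_right this (by positivity)
          _ = T := by field_simp
      have hkm : k N ((m : ℝ) * (T / N)) = m := by
        simp only [k]
        rw [show (m : ℝ) * (T / N) * N / T = m by field_simp, Nat.floor_natCast]
      have := hPQ hPN (hball ⟨by rwa [Metric.mem_ball, Real.dist_eq], hs⟩)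
      rw [hkm, Real.dist_eq] at this
      exact this.le
    rw [hasDerivWithinAt_iff_isLittleO, Asymptotics.isLittleO_iff]
    intro ε hε
    obtain ⟨γ, hγ, hev⟩ := hunif ε hε
    have hball : Metric.ball t (γ / 2) ∩ Icc 0 T ∈ 𝓝[Icc 0 T] t :=
      inter_mem (mem_nhdsWithin_of_mem_nhds (Metric.ball_mem_nhds t (by positivity)))
        self_mem_nhdsWithin
    filter_upwards [hball] with s hs
    obtain ⟨hs1, hs⟩ := hs
    rw [Metric.mem_ball, Real.dist_eq] at hs1
    have hsmall : ∀ᶠ N : ℕ in (U : Filter ℕ), T / (N : ℝ) < γ / 2 :=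
      hstep.eventually (gt_mem_nhds (by positivity))
    have hfin : ∀ᶠ N : ℕ in (U : Filter ℕ),
        |e N (k N s) i - e N (k N t) i - ((k N s : ℝ) - k N t) * (T / N) * F (y t) i|
          ≤ ε * |((k N s : ℝ) - k N t) * (T / N)| := by
      filter_upwards [hev, hsmall, hUpos] with N h1 h2 hN
      have hpos : 0 ≤ T / (N : ℝ) := by positivity
      have b1 := hk_near N hN t ht
      have b2 := hk_near N hN s hs
      have b3 := abs_lt.1 hs1
      have hmono : ∀ {m l : ℕ}, m ≤ l → (m : ℝ) * (T / N) ≤ l * (T / N) := fun h =>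
        mul_le_mul_of_nonneg_right (by exact_mod_cast h) hpos
      rcases le_total (k N t) (k N s) with h | h
      · have := hsum N hN i (F (y t) i) ε (k N t) (k N s) h (hk_le N s hs) fun m hm1 hm2 => by
          refine h1 m (hm2.le.trans (hk_le N s hs)) ?_
          have := hmono hm1
          have := hmono hm2.le
          rw [abs_lt]; constructor <;> linarith
        rwa [abs_of_nonneg (mul_nonneg (sub_nonneg.2 (by exact_mod_cast h)) hpos)]
      · have := hsum N hN i (F (y t) i) ε (k N s) (k N t) h (hk_le N t ht) fun m hm1 hm2 => by
          refine h1 m (hm2.le.trans (hk_le N t ht)) ?_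
          have := hmono hm1
          have := hmono hm2.le
          rw [abs_lt]; constructor <;> linarith
        rw [← neg_sub (k N t : ℝ), neg_mul, abs_neg,
          abs_of_nonneg (mul_nonneg (sub_nonneg.2 (by exact_mod_cast h)) hpos), ← abs_neg]
        convert this using 2; ring
    have hkl : ∀ r ∈ Icc 0 T, Tendsto (fun N : ℕ => (k N r : ℝ) * (T / N)) U (𝓝 r) := by
      intro r hr
      have h1 : Tendsto (fun N : ℕ => r - T / (N : ℝ)) U (𝓝 r) := by
        simpa using tendsto_const_nhds.sub hstep
      refine tendsto_of_tendsto_of_tendsto_of_le_of_le' h1 tendsto_const_nhds ?_ ?_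
      · filter_upwards [hUpos] with N hN
        linarith [(hk_near N hN r hr).2]
      · filter_upwards [hUpos] with N hN
        exact (hk_near N hN r hr).1
    have hkd : Tendsto (fun N : ℕ => ((k N s : ℝ) - k N t) * (T / N)) U (𝓝 (s - t)) := by
      refine ((hkl s hs).sub (hkl t ht)).congr fun N => by ring
    have l1 := tendsto_pi_nhds.1 (hy s hs).2 i
    have l2 := tendsto_pi_nhds.1 (hy t ht).2 i
    have hL := ((l1.sub l2).sub (hkd.mul_const (F (y t) i))).abs
    have hR := (hkd.abs).const_mul ε
    have := le_of_tendsto_of_tendsto hL hR hfin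
    simpa [smul_eq_mul] using this

/-! ### Flow maps with prescribed logarithmic Jacobian -/

/-- The diffeomorphism of the line fixing `0` with Jacobian `exp ∘ q`. -/
def flowMap (q : ℝ → ℝ) (x : ℝ) : ℝ := ∫ y in (0 : ℝ)..x, Real.exp (q y)

/-- The inverse of `flowMap q`. -/
def flowInv (q : ℝ → ℝ) : ℝ → ℝ := Function.invFun (flowMap q)

theorem flowMap_zero (q : ℝ → ℝ) : flowMap q 0 = 0 := by simp [flowMap]

section flow

variable {q : ℝ → ℝ} {B : ℝ}

theorem hasDerivAt_flowMap (hq : Continuous q) (x : ℝ) :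
    HasDerivAt (flowMap q) (Real.exp (q x)) x :=
  (Continuous.integral_hasStrictDerivAt (by fun_prop) 0 x).hasDerivAt

theorem flowMap_sub (hq : Continuous q) (x y : ℝ) :
    flowMap q y - flowMap q x = ∫ s in x..y, Real.exp (q s) := by
  have hi : ∀ a b, IntervalIntegrable (fun s => Real.exp (q s)) volume a b := fun a b =>
    Continuous.intervalIntegrable (by fun_prop) _ _
  rw [flowMap, flowMap, intervalIntegral.integral_interval_sub_left (hi _ _) (hi _ _)]

theorem continuous_flowMap (hq : Continuous q) : Continuous (flowMap q) :=
  continuous_iff_continuousAt.2 fun x => (hasDerivAt_flowMap hq x).continuousAt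

theorem flowMap_sub_le (hq : Continuous q) (hB : ∀ x, |q x| ≤ B) {x y : ℝ} (hxy : x ≤ y) :
    flowMap q y - flowMap q x ≤ Real.exp B * (y - x) := by
  rw [flowMap_sub hq]
  calc ∫ s in x..y, Real.exp (q s) ≤ ∫ s in x..y, Real.exp B :=
        intervalIntegral.integral_mono_on hxy (Continuous.intervalIntegrable (by fun_prop) _ _)
          (by simp) fun s _ => Real.exp_le_exp.2 (abs_le.1 (hB s)).2
    _ = _ := by rw [intervalIntegral.integral_const, smul_eq_mul]; ring

theorem le_flowMap_sub (hq : Continuous q) (hB : ∀ x, |q x| ≤ B) {x y : ℝ} (hxy : x ≤ y) :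
    Real.exp (-B) * (y - x) ≤ flowMap q y - flowMap q x := by
  rw [flowMap_sub hq]
  calc Real.exp (-B) * (y - x) = ∫ s in x..y, Real.exp (-B) := by
        rw [intervalIntegral.integral_const, smul_eq_mul]; ring
    _ ≤ ∫ s in x..y, Real.exp (q s) :=
        intervalIntegral.integral_mono_on hxy (by simp)
          (Continuous.intervalIntegrable (by fun_prop) _ _)
          fun s _ => Real.exp_le_exp.2 (abs_le.1 (hB s)).1

theorem strictMono_flowMap (hq : Continuous q) : StrictMono (flowMap q) :=
  strictMono_of_hasDerivAt_pos (fun x => hasDerivAt_flowMap hq x) fun _ => Real.exp_pos _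

theorem abs_flowMap_sub_le (hq : Continuous q) (hB : ∀ x, |q x| ≤ B) (x y : ℝ) :
    |flowMap q y - flowMap q x| ≤ Real.exp B * |y - x| := by
  wlog hxy : x ≤ y generalizing x y
  · rw [abs_sub_comm, abs_sub_comm y]; exact this y x (le_of_not_ge hxy)
  rw [abs_of_nonneg (sub_nonneg.2 ((strictMono_flowMap hq).monotone hxy)),
    abs_of_nonneg (sub_nonneg.2 hxy)]
  exact flowMap_sub_le hq hB hxy

theorem abs_sub_le_flowMap (hq : Continuous q) (hB : ∀ x, |q x| ≤ B) (x y : ℝ) :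
    |y - x| ≤ Real.exp B * |flowMap q y - flowMap q x| := by
  wlog hxy : x ≤ y generalizing x y
  · rw [abs_sub_comm, abs_sub_comm (flowMap q y)]; exact this y x (le_of_not_ge hxy)
  rw [abs_of_nonneg (sub_nonneg.2 ((strictMono_flowMap hq).monotone hxy)),
    abs_of_nonneg (sub_nonneg.2 hxy)]
  have h := mul_le_mul_of_nonneg_left (le_flowMap_sub hq hB hxy) (Real.exp_pos B).le
  rwa [← mul_assoc, ← Real.exp_add, add_neg_cancel, Real.exp_zero, one_mul] at h

theorem surjective_flowMap (hq : Continuous q) (hB : ∀ x, |q x| ≤ B) :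
    Function.Surjective (flowMap q) := by
  have hpos := Real.exp_pos (-B)
  refine (continuous_flowMap hq).surjective ?_ ?_
  · refine tendsto_atTop_mono' _ ?_ (tendsto_id.const_mul_atTop hpos)
    filter_upwards [eventually_ge_atTop 0] with x hx
    simpa [flowMap_zero] using le_flowMap_sub hq hB hx
  · refine tendsto_atBot_mono' _ ?_ (tendsto_id.const_mul_atBot hpos)
    filter_upwards [eventually_le_atBot 0] with x hx
    have := le_flowMap_sub hq hB hx
    simp only [flowMap_zero, id] at this ⊢
    linarith

theorem flowInv_flowMap (hq : Continuous q) (x : ℝ) : flowInv q (flowMap q x) = x :=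
  Function.leftInverse_invFun (strictMono_flowMap hq).injective x

theorem flowMap_flowInv (hq : Continuous q) (hB : ∀ x, |q x| ≤ B) (z : ℝ) :
    flowMap q (flowInv q z) = z :=
  Function.rightInverse_invFun (surjective_flowMap hq hB) z

theorem flowInv_zero (hq : Continuous q) : flowInv q 0 = 0 := by
  conv_lhs => rw [← flowMap_zero q]
  exact flowInv_flowMap hq 0

theorem abs_flowInv_sub_le (hq : Continuous q) (hB : ∀ x, |q x| ≤ B) (x y : ℝ) :
    |flowInv q y - flowInv q x| ≤ Real.exp B * |y - x| := by
  have := abs_sub_le_flowMap hq hB (flowInv q x) (flowInv q y)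
  rwa [flowMap_flowInv hq hB, flowMap_flowInv hq hB] at this

theorem strictMono_flowInv (hq : Continuous q) (hB : ∀ x, |q x| ≤ B) : StrictMono (flowInv q) := by
  intro x y hxy
  rw [← (strictMono_flowMap hq).lt_iff_lt, flowMap_flowInv hq hB, flowMap_flowInv hq hB]
  exact hxy

theorem continuous_flowInv (hq : Continuous q) (hB : ∀ x, |q x| ≤ B) : Continuous (flowInv q) := by
  refine LipschitzWith.continuous (K := ⟨Real.exp B, (Real.exp_pos B).le⟩) ?_
  exact LipschitzWith.of_dist_le_mul fun z z' => abs_flowInv_sub_le hq hB z' z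

theorem hasDerivAt_flowInv (hq : Continuous q) (hB : ∀ x, |q x| ≤ B) (z : ℝ) :
    HasDerivAt (flowInv q) (Real.exp (-q (flowInv q z))) z := by
  have := HasDerivAt.of_local_left_inverse (f := flowMap q) (g := flowInv q) (a := z)
    (continuous_flowInv hq hB).continuousAt (hasDerivAt_flowMap hq (flowInv q z))
    (Real.exp_pos _).ne' (Eventually.of_forall (flowMap_flowInv hq hB))
  rwa [← Real.exp_neg] at this

theorem flowMap_neg (heven : ∀ x, q (-x) = q x) (x : ℝ) : flowMap q (-x) = -flowMap q x := by
  have := intervalIntegral.integral_comp_neg (fun y => Real.exp (q y)) (a := 0) (b := x)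
  simp only [heven, neg_zero] at this
  rw [flowMap, flowMap, intervalIntegral.integral_symm, this]

theorem flowInv_neg (hq : Continuous q) (hB : ∀ x, |q x| ≤ B) (heven : ∀ x, q (-x) = q x) (z : ℝ) :
    flowInv q (-z) = -flowInv q z := by
  apply (strictMono_flowMap hq).injective
  rw [flowMap_neg heven, flowMap_flowInv hq hB, flowMap_flowInv hq hB]

theorem flowMap_pos (hq : Continuous q) {x : ℝ} (hx : 0 < x) : 0 < flowMap q x := by
  rw [← flowMap_zero q]; exact strictMono_flowMap hq hx

theorem le_abs_flowInv (hq : Continuous q) (hB : ∀ x, |q x| ≤ B) (heven : ∀ x, q (-x) = q x)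
    {δ z : ℝ} (hz : flowMap q δ ≤ |z|) : δ ≤ |flowInv q z| := by
  have hm := (strictMono_flowMap hq)
  rcases le_abs.1 hz with h | h
  · rw [le_abs]; left
    rwa [← hm.le_iff_le, flowMap_flowInv hq hB]
  · rw [le_abs]; right
    rwa [← flowInv_neg hq hB heven, ← hm.le_iff_le, flowMap_flowInv hq hB]

theorem flowMap_le_exp (hq : Continuous q) (hB : ∀ x, |q x| ≤ B) {δ : ℝ} (hδ : 0 ≤ δ) :
    flowMap q δ ≤ Real.exp B * δ := by
  simpa [flowMap_zero] using flowMap_sub_le hq hB hδ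

theorem abs_exp_sub_exp_le {a b B : ℝ} (ha : a ≤ B) (hb : b ≤ B) :
    |Real.exp a - Real.exp b| ≤ Real.exp B * |a - b| := by
  wlog hab : b ≤ a generalizing a b
  · rw [abs_sub_comm, abs_sub_comm a]; exact this hb ha (le_of_not_ge hab)
  rw [abs_of_nonneg (sub_nonneg.2 (Real.exp_le_exp.2 hab)), abs_of_nonneg (sub_nonneg.2 hab)]
  have h1 : Real.exp a - Real.exp b = Real.exp a * (1 - Real.exp (b - a)) := by
    rw [mul_sub, ← Real.exp_add]; ring_nf
  rw [h1]
  have h2 := Real.add_one_le_exp (b - a)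
  calc Real.exp a * (1 - Real.exp (b - a)) ≤ Real.exp a * (a - b) :=
        mul_le_mul_of_nonneg_left (by linarith) (Real.exp_pos _).le
    _ ≤ _ := mul_le_mul_of_nonneg_right (Real.exp_le_exp.2 ha) (by linarith)

theorem abs_flowMap_sub_flowMap_le {p : ℝ → ℝ} (hq : Continuous q) (hp : Continuous p)
    (hB : ∀ x, |q x| ≤ B) (hB' : ∀ x, |p x| ≤ B) {γ : ℝ} (h : ∀ x, |q x - p x| ≤ γ) (x : ℝ) :
    |flowMap q x - flowMap p x| ≤ Real.exp B * γ * |x| := by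
  rw [flowMap, flowMap, ← intervalIntegral.integral_sub
    (Continuous.intervalIntegrable (by fun_prop) _ _)
    (Continuous.intervalIntegrable (by fun_prop) _ _)]
  have := intervalIntegral.norm_integral_le_of_norm_le_const (a := 0) (b := x)
    (f := fun s => Real.exp (q s) - Real.exp (p s)) (C := Real.exp B * γ) fun s _ => by
      refine (abs_exp_sub_exp_le (abs_le.1 (hB s)).2 (abs_le.1 (hB' s)).2).trans ?_
      exact mul_le_mul_of_nonneg_left (h s) (Real.exp_pos _).le
  simpa using this

theorem abs_flowInv_sub_flowInv_le {p : ℝ → ℝ} (hq : Continuous q) (hp : Continuous p)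
    (hB : ∀ x, |q x| ≤ B) (hB' : ∀ x, |p x| ≤ B) {γ : ℝ} (hγ : 0 ≤ γ)
    (h : ∀ x, |q x - p x| ≤ γ) (z : ℝ) :
    |flowInv q z - flowInv p z| ≤ Real.exp (3 * B) * γ * |z| := by
  have h1 := abs_sub_le_flowMap hp hB' (flowInv p z) (flowInv q z)
  rw [flowMap_flowInv hp hB'] at h1
  have h2 := abs_flowMap_sub_flowMap_le hq hp hB hB' h (flowInv q z)
  rw [flowMap_flowInv hq hB, abs_sub_comm] at h2
  have h3 := abs_flowInv_sub_le hq hB 0 z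
  rw [flowInv_zero hq, sub_zero, sub_zero] at h3
  have hE := Real.exp_pos B
  calc |flowInv q z - flowInv p z| ≤ Real.exp B * (Real.exp B * γ * (Real.exp B * |z|)) := by
        refine h1.trans (mul_le_mul_of_nonneg_left (h2.trans ?_) hE.le)
        exact mul_le_mul_of_nonneg_left h3 (mul_nonneg hE.le hγ)
    _ = Real.exp (3 * B) * γ * |z| := by
        rw [show 3 * B = B + B + B by ring, Real.exp_add, Real.exp_add]; ring

/-- The push-forward of a compactly supported function along the flow. -/
theorem CompactEnergy.comp_flowInv {δ K : ℝ} {w : ℝ → ℝ} (hw : CompactEnergy δ K w)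
    (hq : Continuous q) (hB : ∀ x, |q x| ≤ B) (heven : ∀ x, q (-x) = q x) :
    CompactEnergy (flowMap q δ) (Real.exp (B / 2) * K) fun z => w (flowInv q z) := by
  refine ⟨hw.energy.comp_monotone (strictMono_flowInv hq hB).monotone (Real.exp_pos _).le ?_, ?_⟩
  · intro x y hxy
    have := abs_flowInv_sub_le hq hB x y
    rw [← Real.exp_nat_mul, show ((2 : ℕ) : ℝ) * (B / 2) = B by push_cast; ring]
    rw [abs_of_nonneg (sub_nonneg.2 hxy)] at this
    exact (le_abs_self _).trans this
  · exact fun z hz => hw.support _ (le_abs_flowInv hq hB heven hz)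

end flow

/-- A state in Lagrangian variables: `q` is the logarithm of the deformation of the flow map and `w`
the vorticity along particle paths. -/
structure LagState (δ A : ℝ) (q w : ℝ → ℝ) : Prop where
  even : ∀ x, q (-x) = q x
  const : ∀ x, δ ≤ |x| → q x = q δ
  center : |q 0| ≤ A
  energy : EnergyLE q A
  odd : ∀ x, w (-x) = -w x
  compact : CompactEnergy δ A w

/-- The projection onto `[-δ, δ]`. -/
def clamp (δ x : ℝ) : ℝ := max (-δ) (min δ x)

/-- The time derivative of `q` in Lagrangian variables. -/
def lagField (f1 : ℝ → ℝ → ℝ) (δ : ℝ) (q w : ℝ → ℝ) (x : ℝ) : ℝ :=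
  strain f1 (fun z => w (flowInv q z)) (flowMap q (clamp δ x))

section clamp

variable {δ : ℝ}

theorem clamp_mem (hδ : 0 ≤ δ) (x : ℝ) : |clamp δ x| ≤ δ :=
  abs_le.2 ⟨le_max_left _ _, max_le (by linarith) (min_le_left _ _)⟩

theorem clamp_of_abs_le {x : ℝ} (hx : |x| ≤ δ) : clamp δ x = x := by
  obtain ⟨h1, h2⟩ := abs_le.1 hx
  rw [clamp, min_eq_right h2, max_eq_right h1]

theorem clamp_neg (hδ : 0 ≤ δ) (x : ℝ) : clamp δ (-x) = -clamp δ x := by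
  rcases le_or_gt |x| δ with h | h
  · rw [clamp_of_abs_le h, clamp_of_abs_le (by rwa [abs_neg])]
  · rcases lt_abs.1 h with h | h
    · rw [clamp, clamp, min_eq_left h.le, min_eq_right (by linarith), max_eq_left (by linarith),
        max_eq_right (by linarith)]
    · rw [clamp, clamp, min_eq_left h.le, min_eq_right (by linarith), max_eq_right (by linarith),
        max_eq_left (by linarith), neg_neg]

theorem monotone_clamp : Monotone (clamp δ) := fun x y h => by
  unfold clamp; gcongr

theorem clamp_sub_le {x y : ℝ} (h : x ≤ y) : clamp δ y - clamp δ x ≤ y - x := by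
  unfold clamp
  rcases max_cases (-δ) (min δ x) with h1 | h1 <;> rcases max_cases (-δ) (min δ y) with h2 | h2 <;>
  rcases min_cases δ x with h3 | h3 <;> rcases min_cases δ y with h4 | h4 <;> linarith

theorem clamp_of_le (hδ : 0 ≤ δ) {x : ℝ} (hx : δ ≤ x) : clamp δ x = δ := by
  rw [clamp, min_eq_left hx, max_eq_right (by linarith)]

end clamp

namespace LagState

variable {δ A : ℝ} {q w : ℝ → ℝ}

theorem nonneg (h : LagState δ A q w) : 0 ≤ A := h.energy.nonneg

theorem continuous_left (h : LagState δ A q w) : Continuous q := h.energy.continuous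

theorem continuous_right (h : LagState δ A q w) : Continuous w := h.compact.continuous

theorem mono (h : LagState δ A q w) {A' : ℝ} (hA : A ≤ A') : LagState δ A' q w :=
  ⟨h.even, h.const, h.center.trans hA, h.energy.mono hA, h.odd, h.compact.mono le_rfl hA⟩

theorem abs_left_le (hδ : 0 < δ) (hδ1 : δ ≤ 1) (h : LagState δ A q w) (x : ℝ) : |q x| ≤ 2 * A := by
  wlog hx : |x| ≤ δ generalizing x
  · rw [h.const x (not_le.1 hx).le]
    exact this δ (abs_of_pos hδ).le
  have h1 := h.energy.abs_sub_le 0 x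
  have h2 : √|x - 0| ≤ 1 := by
    rw [sub_zero]; exact Real.sqrt_le_one.2 (hx.trans hδ1)
  have h3 := mul_le_mul_of_nonneg_left h2 h.nonneg
  have h4 : |q x| ≤ |q x - q 0| + |q 0| := by
    simpa using abs_add_le (q x - q 0) (q 0)
  linarith [h.center]

theorem abs_right_le (hδ1 : δ ≤ 1) (h : LagState δ A q w) (x : ℝ) : |w x| ≤ A := by
  refine (h.compact.abs_le x).trans (mul_le_of_le_one_right h.nonneg ?_)
  exact Real.sqrt_le_one.2 hδ1

theorem compactEnergy (hδ : 0 < δ) (hδ1 : δ ≤ 1) (h : LagState δ A q w) :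
    CompactEnergy (Real.exp (2 * A)) (Real.exp A * A) fun z => w (flowInv q z) := by
  have h1 := h.compact.comp_flowInv h.continuous_left (h.abs_left_le hδ hδ1) h.even
  rw [mul_div_cancel_left₀ _ two_ne_zero] at h1
  refine h1.mono ?_ le_rfl
  refine (flowMap_le_exp h.continuous_left (h.abs_left_le hδ hδ1) hδ.le).trans ?_
  exact mul_le_of_le_one_right (Real.exp_pos _).le hδ1

theorem integral_abs_le (hδ : 0 < δ) (hδ1 : δ ≤ 1) (h : LagState δ A q w) :
    ∫ z, |w (flowInv q z)| ≤ 2 * Real.exp (2 * A) * A :=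
  (h.compactEnergy hδ hδ1).integral_abs_le_of_bound (Real.exp_pos _).le
    fun _ => h.abs_right_le hδ1 _

variable {f f1 : ℝ → ℝ → ℝ} {C : ℝ}

theorem abs_strain_le (hf : KernelReg f f1 C) (hδ : 0 < δ) (hδ1 : δ ≤ 1) (h : LagState δ A q w)
    (z : ℝ) : |strain f1 (fun z => w (flowInv q z)) z| ≤
      4 * (Real.exp A * A) + (2 + C) * (2 * Real.exp (2 * A) * A) := by
  have h1 := hf.abs_strain_le (h.compactEnergy hδ hδ1) z one_pos
  rw [Real.sqrt_one, mul_one, div_one] at h1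
  refine h1.trans (add_le_add_right ?_ _)
  exact mul_le_mul_of_nonneg_left (h.integral_abs_le hδ hδ1) (by linarith [hf.nonneg])

theorem energyLE_strain (hf : KernelReg f f1 C) (hδ : 0 < δ) (hδ1 : δ ≤ 1)
    (h : LagState δ A q w) : EnergyLE (strain f1 fun z => w (flowInv q z))
      (Real.exp A * A + 2 * C * (2 * Real.exp (2 * A) * A)) := by
  refine (hf.energyLE_strain (h.compactEnergy hδ hδ1)).mono (add_le_add_right ?_ _)
  exact mul_le_mul_of_nonneg_left (h.integral_abs_le hδ hδ1) (by linarith [hf.nonneg])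

theorem energyLE_lagField (hf : KernelReg f f1 C) (hδ : 0 < δ) (hδ1 : δ ≤ 1)
    (h : LagState δ A q w) : EnergyLE (lagField f1 δ q w)
      (Real.exp A * (Real.exp A * A + 2 * C * (2 * Real.exp (2 * A) * A))) := by
  refine (h.energyLE_strain hf hδ hδ1).comp_monotone (Φ := fun x => flowMap q (clamp δ x))
    ((strictMono_flowMap h.continuous_left).monotone.comp monotone_clamp) (Real.exp_pos _).le ?_
  intro x y hxy
  have h1 := flowMap_sub_le h.continuous_left (h.abs_left_le hδ hδ1) (monotone_clamp (δ := δ) hxy)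
  rw [← Real.exp_nat_mul]
  push_cast
  exact h1.trans (mul_le_mul_of_nonneg_left (clamp_sub_le hxy) (Real.exp_pos _).le)

theorem odd_comp_flowInv (hδ : 0 < δ) (hδ1 : δ ≤ 1) (h : LagState δ A q w) (z : ℝ) :
    w (flowInv q (-z)) = -w (flowInv q z) := by
  rw [flowInv_neg h.continuous_left (h.abs_left_le hδ hδ1) h.even, h.odd]

theorem field (hf : KernelReg f f1 C) (hδ : 0 < δ) (hδ1 : δ ≤ 1) {g : ℝ → ℝ} {G : ℝ}
    (hg : CompactEnergy δ G g) (hgodd : ∀ x, g (-x) = -g x) (A : ℝ) :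
    ∃ M, 0 < M ∧ ∀ q w, LagState δ A q w →
      LagState δ M (lagField f1 δ q w) (fun x => g x * Real.exp (-q x)) := by
  set M1 := 4 * (Real.exp A * A) + (2 + C) * (2 * Real.exp (2 * A) * A) with hM1
  set M2 := Real.exp A * (Real.exp A * A + 2 * C * (2 * Real.exp (2 * A) * A)) with hM2
  set M3 := Real.exp (2 * A) * G + (G * Real.exp (2 * A)) * A with hM3
  refine ⟨|M1| + |M2| + |M3| + 1, by positivity, fun q w h => ?_⟩
  have b1 := le_abs_self M1
  have b2 := le_abs_self M2
  have b3 := le_abs_self M3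
  have b1' := abs_nonneg M1
  have b2' := abs_nonneg M2
  have b3' := abs_nonneg M3
  have hB := h.abs_left_le hδ hδ1
  refine ⟨fun x => ?_, fun x hx => ?_, ?_, (h.energyLE_lagField hf hδ hδ1).mono (by linarith),
    fun x => ?_, ?_⟩
  · rw [lagField, lagField, clamp_neg hδ.le, flowMap_neg h.even,
      KernelReg.strain_neg hf (h.odd_comp_flowInv hδ hδ1)]
  · rcases le_abs.1 hx with hx | hx
    · rw [lagField, lagField, clamp_of_le hδ.le hx, clamp_of_le hδ.le le_rfl]
    · rw [lagField, lagField, ← neg_neg x, clamp_neg hδ.le, clamp_of_le hδ.le hx,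
        clamp_of_le hδ.le le_rfl, flowMap_neg h.even,
        KernelReg.strain_neg hf (h.odd_comp_flowInv hδ hδ1)]
  · exact (h.abs_strain_le hf hδ hδ1 _).trans (by linarith)
  · show g (-x) * _ = -(g x * _)
    rw [h.even, hgodd]; ring
  · refine ⟨?_, fun x hx => by simp [hg.support x hx]⟩
    have hG : ∀ x, |g x| ≤ G := fun x => (hg.abs_le x).trans
      (mul_le_of_le_one_right hg.nonneg (Real.sqrt_le_one.2 hδ1))
    refine (hg.energy.of_abs_sub_le (Real.exp_pos (2 * A)).le
      (mul_nonneg hg.nonneg (Real.exp_pos (2 * A)).le) h.energy ?_).mono (by linarith)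
    intro x y _
    have e1 : g y * Real.exp (-q y) - g x * Real.exp (-q x) =
        Real.exp (-q y) * (g y - g x) + g x * (Real.exp (-q y) - Real.exp (-q x)) := by ring
    rw [e1]
    refine (abs_add_le _ _).trans (add_le_add ?_ ?_)
    · rw [abs_mul, Real.abs_exp]
      exact mul_le_mul_of_nonneg_right (Real.exp_le_exp.2 (by linarith [(abs_le.1 (hB y)).1]))
        (abs_nonneg _)
    · rw [abs_mul, mul_assoc]
      refine mul_le_mul (hG x) ?_ (abs_nonneg _) hg.nonneg
      have := abs_exp_sub_exp_le (a := -q y) (b := -q x) (B := 2 * A)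
        (by linarith [(abs_le.1 (hB y)).1]) (by linarith [(abs_le.1 (hB x)).1])
      rwa [show -q y - -q x = -(q y - q x) by ring, abs_neg] at this

theorem abs_vorticity_sub_le (hδ : 0 < δ) (hδ1 : δ ≤ 1) {q' w' : ℝ → ℝ} (h : LagState δ A q w)
    (h' : LagState δ A q' w') {γ : ℝ} (hγ : 0 ≤ γ) (hq : ∀ x, |q x - q' x| ≤ γ)
    (hw : ∀ x, |w x - w' x| ≤ γ) (z : ℝ) :
    |w (flowInv q z) - w' (flowInv q' z)| ≤ A * √(Real.exp (8 * A) * γ) + γ := by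
  have hA := h.nonneg
  rcases le_or_gt (Real.exp (2 * A)) |z| with hz | hz
  · have e1 := (h.compactEnergy hδ hδ1).support z hz
    have e2 := (h'.compactEnergy hδ hδ1).support z hz
    rw [show w (flowInv q z) = 0 from e1, show w' (flowInv q' z) = 0 from e2, sub_self, abs_zero]
    positivity
  have h1 := abs_flowInv_sub_flowInv_le h.continuous_left h'.continuous_left
    (h.abs_left_le hδ hδ1) (h'.abs_left_le hδ hδ1) hγ hq z
  have h2 : |flowInv q z - flowInv q' z| ≤ Real.exp (8 * A) * γ := by
    refine h1.trans ?_
    rw [show 8 * A = 3 * (2 * A) + 2 * A by ring, Real.exp_add, mul_assoc, mul_assoc, mul_comm γ]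
    gcongr
  have h3 := h.compact.energy.abs_sub_le (flowInv q' z) (flowInv q z)
  have h4 : A * √|flowInv q z - flowInv q' z| ≤ A * √(Real.exp (8 * A) * γ) := by gcongr
  have h5 := abs_sub_le (w (flowInv q z)) (w (flowInv q' z)) (w' (flowInv q' z))
  linarith [hw (flowInv q' z)]

theorem exists_lagField_modulus (hf : KernelReg f f1 C) (hδ : 0 < δ) (hδ1 : δ ≤ 1) (A : ℝ)
    {ε : ℝ} (hε : 0 < ε) : ∃ γ, 0 < γ ∧ ∀ q w q' w', LagState δ A q w → LagState δ A q' w' →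
      (∀ x, |q x - q' x| ≤ γ) → (∀ x, |w x - w' x| ≤ γ) →
      ∀ x, |lagField f1 δ q w x - lagField f1 δ q' w' x| ≤ ε := by
  set K := Real.exp A * A + Real.exp A * A with hK
  set K' := Real.exp A * A + 2 * C * (2 * Real.exp (2 * A) * A) with hK'
  have t1 : Tendsto (fun σ : ℝ => 4 * K * √σ) (𝓝[>] 0) (𝓝 0) := by
    have : Continuous fun σ : ℝ => 4 * K * √σ := by fun_prop
    have := (this.tendsto 0).mono_left (nhdsWithin_le_nhds (s := Ioi 0))
    simpa using this
  obtain ⟨σ, hσ1, hσ⟩ := ((t1.eventually (gt_mem_nhds (show 0 < ε / 3 by positivity))).and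
    self_mem_nhdsWithin).exists
  have hσ0 : 0 < σ := hσ
  have t2 : Tendsto (fun γ : ℝ => (2 / σ + C) * (2 * Real.exp (2 * A) *
      (A * √(Real.exp (8 * A) * γ) + γ))) (𝓝[>] 0) (𝓝 0) := by
    have : Continuous fun γ : ℝ => (2 / σ + C) * (2 * Real.exp (2 * A) *
      (A * √(Real.exp (8 * A) * γ) + γ)) := by fun_prop
    have := (this.tendsto 0).mono_left (nhdsWithin_le_nhds (s := Ioi 0))
    simpa using this
  have t3 : Tendsto (fun γ : ℝ => K' * √(Real.exp (2 * A) * γ)) (𝓝[>] 0) (𝓝 0) := by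
    have : Continuous fun γ : ℝ => K' * √(Real.exp (2 * A) * γ) := by fun_prop
    have := (this.tendsto 0).mono_left (nhdsWithin_le_nhds (s := Ioi 0))
    simpa using this
  obtain ⟨γ, ⟨hγ2, hγ3⟩, hγ⟩ := (((t2.eventually (gt_mem_nhds (show 0 < ε / 3 by positivity))).and
    (t3.eventually (gt_mem_nhds (show 0 < ε / 3 by positivity)))).and self_mem_nhdsWithin).exists
  have hγ0 : 0 < γ := hγ
  refine ⟨γ, hγ0, fun q w q' w' h h' hq hw x => ?_⟩
  have hc := h.compactEnergy hδ hδ1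
  have hc' := h'.compactEnergy hδ hδ1
  set z := flowMap q (clamp δ x)
  set z' := flowMap q' (clamp δ x)
  have s1 := hf.abs_strain_le (hc.sub hc') z hσ0
  rw [hf.strain_sub hc hc'] at s1
  have s2 := (hc.sub hc').integral_abs_le_of_bound (Real.exp_pos _).le
    (h.abs_vorticity_sub_le hδ hδ1 h' hγ0.le hq hw)
  have s3 := mul_le_mul_of_nonneg_left s2
    (show 0 ≤ 2 / σ + C by have := hf.nonneg; positivity)
  have s4 := (h'.energyLE_strain hf hδ hδ1).abs_sub_le z' z
  have s5 : |z - z'| ≤ Real.exp (2 * A) * γ := by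
    refine (abs_flowMap_sub_flowMap_le h.continuous_left h'.continuous_left
      (h.abs_left_le hδ hδ1) (h'.abs_left_le hδ hδ1) hq _).trans ?_
    exact mul_le_of_le_one_right (by positivity) ((clamp_mem hδ.le x).trans hδ1)
  have s6 : K' * √|z - z'| ≤ K' * √(Real.exp (2 * A) * γ) := by
    have : 0 ≤ K' := (h'.energyLE_strain hf hδ hδ1).nonneg
    gcongr
  have s7 := _root_.abs_sub_le (strain f1 (fun z => w (flowInv q z)) z)
    (strain f1 (fun z => w' (flowInv q' z)) z) (strain f1 (fun z => w' (flowInv q' z)) z')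
  show |strain f1 (fun z => w (flowInv q z)) z - strain f1 (fun z => w' (flowInv q' z)) z'| ≤ ε
  linarith

/-- Closeness of functions of bounded energy, constant outside `[-δ, δ]`, can be tested on finitely
many points. -/
theorem exists_finite_test (δ A : ℝ) {γ : ℝ} (hγ : 0 < γ) : ∃ t : Set ℝ, t.Finite ∧
    ∀ h g : ℝ → ℝ, EnergyLE h A → EnergyLE g A → (∀ x ∈ t, |h x - g x| ≤ γ / 2) →
      ∀ x, |x| ≤ δ → |h x - g x| ≤ γ := by
  have t1 : Tendsto (fun ρ : ℝ => 2 * A * √ρ) (𝓝[>] 0) (𝓝 0) := by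
    have : Continuous fun ρ : ℝ => 2 * A * √ρ := by fun_prop
    have := (this.tendsto 0).mono_left (nhdsWithin_le_nhds (s := Ioi 0))
    simpa using this
  obtain ⟨ρ, hρ1, hρ⟩ := ((t1.eventually (gt_mem_nhds (show 0 < γ / 2 by positivity))).and
    self_mem_nhdsWithin).exists
  obtain ⟨t, ht, hcov⟩ := Metric.totallyBounded_iff.1
    (isCompact_Icc (a := -δ) (b := δ)).totallyBounded ρ hρ
  refine ⟨t, ht, fun h g hh hg hclose x hx => ?_⟩
  obtain ⟨y, hy, hxy⟩ := mem_iUnion₂.1 (hcov (abs_le.1 hx))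
  rw [Metric.mem_ball, Real.dist_eq] at hxy
  have h1 := hh.abs_sub_le y x
  have h2 := hg.abs_sub_le y x
  have h3 : A * √|x - y| ≤ A * √ρ := by have := hh.nonneg; gcongr
  have h4 := hclose y hy
  have h5 := _root_.abs_sub_le (h x) (h y) (g x)
  have h6 := _root_.abs_sub_le (h y) (g y) (g x)
  rw [abs_sub_comm (g y)] at h6
  linarith

end LagState

/-- A curve of states solving the Lagrangian equations on `[a, b]`. -/
structure LagCurve (f1 : ℝ → ℝ → ℝ) (δ : ℝ) (g : ℝ → ℝ) (a b : ℝ) (q w : ℝ → ℝ → ℝ) : Prop where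
  hasDeriv_left : ∀ t ∈ Icc a b, ∀ x,
    HasDerivWithinAt (fun s => q s x) (lagField f1 δ (q t) (w t) x) (Icc a b) t
  hasDeriv_right : ∀ t ∈ Icc a b, ∀ x,
    HasDerivWithinAt (fun s => w s x) (g x * Real.exp (-q t x)) (Icc a b) t

section local_existence

variable {f f1 : ℝ → ℝ → ℝ} {C δ : ℝ} {g : ℝ → ℝ} {G : ℝ}

theorem exists_lagCurve (hf : KernelReg f f1 C) (hδ : 0 < δ) (hδ1 : δ ≤ 1)
    (hg : CompactEnergy δ G g) (hgodd : ∀ x, g (-x) = -g x) (A : ℝ) :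
    ∃ τ, 0 < τ ∧ ∀ q0 w0, LagState δ A q0 w0 → ∃ q w : ℝ → ℝ → ℝ, q 0 = q0 ∧ w 0 = w0 ∧
      (∀ t ∈ Icc 0 τ, LagState δ (A + 1) (q t) (w t)) ∧ LagCurve f1 δ g 0 τ q w := by
  obtain ⟨M, hM, hfield⟩ := LagState.field hf hδ hδ1 hg hgodd (A + 1)
  have hτ : 0 < 1 / M := by positivity
  refine ⟨1 / M, hτ, fun q0 w0 h0 => ?_⟩
  let D : Set (ℝ ⊕ ℝ → ℝ) := {d | LagState δ M (fun x => d (Sum.inl x)) fun x => d (Sum.inr x)}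
  have hconv : Convex ℝ D := by
    intro d hd e he a b ha hb hab
    have hd' : LagState δ M _ _ := hd
    have he' : LagState δ M _ _ := he
    have hM' : |a| * M + |b| * M = M := by
      rw [abs_of_nonneg ha, abs_of_nonneg hb, ← add_mul, hab, one_mul]
    refine ⟨fun x => ?_, fun x hx => ?_, ?_, ?_, fun x => ?_, ?_, fun x hx => ?_⟩
    · have := hd'.even x; have := he'.even x
      simp_all
    · have := hd'.const x hx; have := he'.const x hx
      simp_all
    · simp only [Pi.add_apply, Pi.smul_apply, smul_eq_mul]
      refine (abs_add_le _ _).trans ?_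
      rw [abs_mul, abs_mul]
      have h1 := mul_le_mul_of_nonneg_left hd'.center (abs_nonneg a)
      have h2 := mul_le_mul_of_nonneg_left he'.center (abs_nonneg b)
      linarith
    · have := (hd'.energy.const_mul a).add (he'.energy.const_mul b)
      rw [hM'] at this
      exact this
    · have h1 := hd'.odd x; have h2 := he'.odd x
      simp only [Pi.add_apply, Pi.smul_apply, smul_eq_mul, h1, h2]; ring
    · have := (hd'.compact.energy.const_mul a).add (he'.compact.energy.const_mul b)
      rw [hM'] at this
      exact this
    · have := hd'.compact.support x hx; have := he'.compact.support x hx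
      simp_all
  have hclosed : IsClosed D := by
    refine isClosed_of_closure_subset fun d hd => ?_
    have hne : (𝓝[D] d).NeBot := mem_closure_iff_nhdsWithin_neBot.1 hd
    have hmem : ∀ᶠ e in 𝓝[D] d, LagState δ M (fun x => e (Sum.inl x)) fun x => e (Sum.inr x) :=
      self_mem_nhdsWithin
    have hlim : ∀ i, Tendsto (fun e : ℝ ⊕ ℝ → ℝ => e i) (𝓝[D] d) (𝓝 (d i)) := fun i =>
      ((continuous_apply i).tendsto d).mono_left nhdsWithin_le_nhds
    have hEq : ∀ i j, (∀ᶠ e in 𝓝[D] d, (e : ℝ ⊕ ℝ → ℝ) i = e j) → d i = d j := fun i j h =>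
      tendsto_nhds_unique (hlim i) ((hlim j).congr' (h.mono fun _ h => h.symm))
    refine ⟨fun x => ?_, fun x hx => ?_, ?_, ?_, fun x => ?_, ?_, fun x hx => ?_⟩
    · exact hEq _ _ (hmem.mono fun e he => he.even x)
    · exact hEq _ _ (hmem.mono fun e he => he.const x hx)
    · exact le_of_tendsto (hlim _).abs (hmem.mono fun e he => he.center)
    · exact EnergyLE.of_tendsto (hmem.mono fun e he => he.energy) fun x => hlim _
    · exact tendsto_nhds_unique (hlim _)
        ((hlim (Sum.inr x)).neg.congr' (hmem.mono fun _ h => (h.odd x).symm))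
    · exact EnergyLE.of_tendsto (hmem.mono fun e he => he.compact.energy) fun x => hlim _
    · exact tendsto_nhds_unique (hlim _)
        (tendsto_const_nhds.congr' (hmem.mono fun _ h => (h.compact.support x hx).symm))
  have hzero : (0 : ℝ ⊕ ℝ → ℝ) ∈ D := by
    have h0 : EnergyLE (fun _ => (0 : ℝ)) M := (EnergyLE.const 0).mono hM.le
    exact ⟨fun x => rfl, fun x _ => rfl, by simpa using hM.le, h0, fun x => by simp,
      ⟨h0, fun _ _ => rfl⟩⟩
  let y0 : ℝ ⊕ ℝ → ℝ := Sum.elim q0 w0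
  let F : (ℝ ⊕ ℝ → ℝ) → ℝ ⊕ ℝ → ℝ := fun y =>
    Sum.elim (lagField f1 δ (fun x => y (Sum.inl x)) fun x => y (Sum.inr x))
      fun x => g x * Real.exp (-y (Sum.inl x))
  have hstate : ∀ t ∈ Icc 0 (1 / M), ∀ d ∈ D,
      LagState δ (A + 1) (fun x => (y0 + t • d) (Sum.inl x)) fun x => (y0 + t • d) (Sum.inr x) := by
    intro t ht d hd
    have hd' : LagState δ M _ _ := hd
    have htM : |t| * M ≤ 1 := by
      rw [abs_of_nonneg ht.1, ← le_div_iff₀ hM]; exact ht.2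
    refine ⟨fun x => ?_, fun x hx => ?_, ?_, ?_, fun x => ?_, ?_, fun x hx => ?_⟩
    · have := hd'.even x; have := h0.even x
      simp_all [y0]
    · have := hd'.const x hx; have := h0.const x hx
      simp_all [y0]
    · simp only [Pi.add_apply, Pi.smul_apply, smul_eq_mul, y0, Sum.elim_inl]
      refine (abs_add_le _ _).trans ?_
      rw [abs_mul]
      have h1 := mul_le_mul_of_nonneg_left hd'.center (abs_nonneg t)
      linarith [h0.center]
    · exact (h0.energy.add (hd'.energy.const_mul t)).mono (by linarith)
    · have h1 := hd'.odd x; have h2 := h0.odd x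
      simp only [Pi.add_apply, Pi.smul_apply, smul_eq_mul, h1, y0, Sum.elim_inr, h2]; ring
    · exact (h0.compact.energy.add (hd'.compact.energy.const_mul t)).mono (by linarith)
    · have := hd'.compact.support x hx; have := h0.compact.support x hx
      simp_all [y0]
  have hT : (1 / M) ∈ Icc 0 (1 / M) := ⟨hτ.le, le_rfl⟩
  have hc : ∀ i, ContinuousOn (fun y => F y i) ((fun d => y0 + (1 / M) • d) '' D) := by
    rintro (x | x)
    · rintro _ ⟨d, hd, rfl⟩
      have hs := hstate _ hT d hd
      rw [ContinuousWithinAt, Metric.tendsto_nhds]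
      intro ε hε
      obtain ⟨γ, hγ, hmod⟩ := LagState.exists_lagField_modulus hf hδ hδ1 (A + 1) (half_pos hε)
      obtain ⟨t, ht, htest⟩ := LagState.exists_finite_test δ (A + 1) hγ
      have htδ := ht
      have hev : ∀ i, ∀ᶠ y in 𝓝[(fun d => y0 + (1 / M) • d) '' D] (y0 + (1 / M) • d),
          |(y : ℝ ⊕ ℝ → ℝ) i - (y0 + (1 / M) • d) i| ≤ γ / 2 := by
        intro i
        have : Tendsto (fun y : ℝ ⊕ ℝ → ℝ => |y i - (y0 + (1 / M) • d) i|)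
            (𝓝[(fun d => y0 + (1 / M) • d) '' D] (y0 + (1 / M) • d)) (𝓝 0) := by
          have hcont : Continuous fun y : ℝ ⊕ ℝ → ℝ => |y i - (y0 + (1 / M) • d) i| := by fun_prop
          have := (hcont.tendsto (y0 + (1 / M) • d)).mono_left
            (nhdsWithin_le_nhds (s := (fun d => y0 + (1 / M) • d) '' D))
          simpa using this
        exact (this.eventually (gt_mem_nhds (half_pos hγ))).mono fun _ h => le_of_lt h
      have hl := (eventually_all_finite ht).2 fun p _ => hev (Sum.inl p)
      have hr := (eventually_all_finite ht).2 fun p _ => hev (Sum.inr p)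
      filter_upwards [hl, hr, hev (Sum.inl δ), self_mem_nhdsWithin] with y hyl hyr _ hy
      obtain ⟨e, he, rfl⟩ := hy
      have hs' := hstate _ hT e he
      have c1 := htest _ _ hs'.energy hs.energy hyl
      have c2 := htest _ _ hs'.compact.energy hs.compact.energy hyr
      refine lt_of_le_of_lt (hmod _ _ _ _ hs' hs (fun x => ?_) (fun x => ?_) x) (half_lt_self hε)
      · rcases le_or_gt |x| δ with hx | hx
        · exact c1 x hx
        · rw [hs'.const x hx.le, hs.const x hx.le]
          exact c1 δ (abs_of_pos hδ).le
      · rcases le_or_gt |x| δ with hx | hx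
        · exact c2 x hx
        · rw [hs'.compact.support x hx.le, hs.compact.support x hx.le, sub_zero, abs_zero]
          exact hγ.le
    · refine Continuous.continuousOn ?_
      show Continuous fun y : ℝ ⊕ ℝ → ℝ => g x * Real.exp (-y (Sum.inl x))
      fun_prop
  obtain ⟨y, hy0, hymem, hyder⟩ := exists_solution_of_continuousOn hconv hclosed hzero
    (b := fun _ => 2 * M) (fun d hd i => by
      have hd' : LagState δ M _ _ := hd
      rcases i with x | x
      · exact hd'.abs_left_le hδ hδ1 x
      · exact (hd'.abs_right_le hδ1 x).trans (by linarith)) y0 hτ (F := F)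
    (fun d hd => hfield _ _ (hstate _ hT d hd)) hc
  refine ⟨fun t x => y t (Sum.inl x), fun t x => y t (Sum.inr x), ?_, ?_, fun t ht => ?_,
    fun t ht x => hyder t ht (Sum.inl x), fun t ht x => hyder t ht (Sum.inr x)⟩
  · simp [hy0, y0]
  · simp [hy0, y0]
  · obtain ⟨d, hd, hdy⟩ := hymem t ht
    show LagState δ (A + 1) (fun x => y t (Sum.inl x)) fun x => y t (Sum.inr x)
    rw [← hdy]
    exact hstate _ hT d hd

end local_existence

theorem hasDerivWithinAt_glue {u v : ℝ → ℝ} {a b c d t : ℝ} (hab : a ≤ b) (hbc : b ≤ c)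
    (hu : t ∈ Icc a b → HasDerivWithinAt u d (Icc a b) t)
    (hv : t ∈ Icc b c → HasDerivWithinAt v d (Icc b c) t) (huv : v b = u b) :
    HasDerivWithinAt (fun s => if s ≤ b then u s else v s) d (Icc a c) t := by
  rw [← Icc_union_Icc_eq_Icc hab hbc]
  refine HasDerivWithinAt.union ?_ ?_
  · by_cases ht : t ∈ Icc a b
    · exact (hu ht).congr (fun s hs => if_pos hs.2) (if_pos ht.2)
    · exact HasFDerivWithinAt.of_notMem_closure (by rwa [isClosed_Icc.closure_eq])
  · by_cases ht : t ∈ Icc b c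
    · have key : ∀ s ∈ Icc b c, (if s ≤ b then u s else v s) = v s := by
        intro s hs
        split_ifs with h
        · rw [le_antisymm h hs.1, huv]
        · rfl
      exact (hv ht).congr key (key t ht)
    · exact HasFDerivWithinAt.of_notMem_closure (by rwa [isClosed_Icc.closure_eq])

variable {f f1 : ℝ → ℝ → ℝ} {C δ : ℝ} {g : ℝ → ℝ} {G : ℝ}

namespace LagCurve

variable {a b c : ℝ} {q w q' w' : ℝ → ℝ → ℝ}

theorem congr (h : LagCurve f1 δ g a b q w) (hq : ∀ t ∈ Icc a b, q' t = q t)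
    (hw : ∀ t ∈ Icc a b, w' t = w t) : LagCurve f1 δ g a b q' w' := by
  refine ⟨fun t ht x => ?_, fun t ht x => ?_⟩
  · rw [hq t ht, hw t ht]
    exact (h.hasDeriv_left t ht x).congr (fun s hs => by rw [hq s hs]) (by rw [hq t ht])
  · rw [hq t ht]
    exact (h.hasDeriv_right t ht x).congr (fun s hs => by rw [hw s hs]) (by rw [hw t ht])

theorem mono (h : LagCurve f1 δ g a b q w) {a' b' : ℝ} (ha : a ≤ a') (hb : b' ≤ b) :
    LagCurve f1 δ g a' b' q w :=
  ⟨fun t ht x => (h.hasDeriv_left t (Icc_subset_Icc ha hb ht) x).mono (Icc_subset_Icc ha hb),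
    fun t ht x => (h.hasDeriv_right t (Icc_subset_Icc ha hb ht) x).mono (Icc_subset_Icc ha hb)⟩

theorem shift (h : LagCurve f1 δ g 0 c q w) (b : ℝ) :
    LagCurve f1 δ g b (b + c) (fun t => q (t - b)) fun t => w (t - b) := by
  have hmaps : MapsTo (fun s => s - b) (Icc b (b + c)) (Icc 0 c) := fun s hs =>
    ⟨by linarith [hs.1], by linarith [hs.2]⟩
  have hsub : ∀ t, HasDerivWithinAt (fun s => s - b) 1 (Icc b (b + c)) t := fun t =>
    ((hasDerivAt_id t).sub_const b).hasDerivWithinAt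
  refine ⟨fun t ht x => ?_, fun t ht x => ?_⟩
  · have := (h.hasDeriv_left (t - b) (hmaps ht) x).scomp t (hsub t) hmaps
    rw [one_smul] at this
    exact this
  · have := (h.hasDeriv_right (t - b) (hmaps ht) x).scomp t (hsub t) hmaps
    rw [one_smul] at this
    exact this

theorem glue (hab : a ≤ b) (hbc : b ≤ c) (h : LagCurve f1 δ g a b q w)
    (h' : LagCurve f1 δ g b c q' w') (hq : q' b = q b) (hw : w' b = w b) :
    LagCurve f1 δ g a c (fun t => if t ≤ b then q t else q' t)
      fun t => if t ≤ b then w t else w' t := by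
  have key : ∀ t ∈ Icc b c, (if t ≤ b then q t else q' t) = q' t ∧
      (if t ≤ b then w t else w' t) = w' t := by
    intro s hs
    split_ifs with h
    · rw [le_antisymm h hs.1, hq, hw]; exact ⟨rfl, rfl⟩
    · exact ⟨rfl, rfl⟩
  have e : ∀ (p p' : ℝ → ℝ → ℝ) (x : ℝ), (fun s => (if s ≤ b then p s else p' s) x) =
      fun s => if s ≤ b then p s x else p' s x := by
    intro p p' x; ext s; split_ifs <;> rfl
  refine ⟨fun t ht x => ?_, fun t ht x => ?_⟩
  · rw [e]
    refine hasDerivWithinAt_glue hab hbc (fun ht => ?_) (fun ht => ?_) (by rw [hq])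
    · simp only [if_pos ht.2]; exact h.hasDeriv_left t ht x
    · simp only [key t ht]; exact h'.hasDeriv_left t ht x
  · rw [e]
    refine hasDerivWithinAt_glue hab hbc (fun ht => ?_) (fun ht => ?_) (by rw [hw])
    · simp only [if_pos ht.2]; exact h.hasDeriv_right t ht x
    · simp only [key t ht]; exact h'.hasDeriv_right t ht x

end LagCurve

theorem exists_extension (hf : KernelReg f f1 C) (hδ : 0 < δ) (hδ1 : δ ≤ 1)
    (hg : CompactEnergy δ G g) (hgodd : ∀ x, g (-x) = -g x) :
    ∃ τ : ℕ → ℝ, (∀ n, 0 < τ n) ∧ ∀ (T : ℝ) (q w : ℝ → ℝ → ℝ), 0 ≤ T → LagCurve f1 δ g 0 T q w →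
      (∃ A, ∀ t ∈ Icc 0 T, LagState δ A (q t) (w t)) →
      ∃ (T' : ℝ) (q' w' : ℝ → ℝ → ℝ), LagCurve f1 δ g 0 T' q' w' ∧
        (∃ A, ∀ t ∈ Icc 0 T', LagState δ A (q' t) (w' t)) ∧
        (∀ t ≤ T, q' t = q t ∧ w' t = w t) ∧
        ∀ A : ℕ, LagState δ A (q T) (w T) → ∃ n ≤ A, T' = T + τ n := by
  choose τ hτ hext using fun n : ℕ => exists_lagCurve hf hδ hδ1 hg hgodd n
  refine ⟨τ, hτ, fun T q w hT hc ⟨A, hA⟩ => ?_⟩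
  classical
  have hex : ∃ n : ℕ, LagState δ n (q T) (w T) := by
    obtain ⟨n, hn⟩ := exists_nat_ge A
    exact ⟨n, (hA T ⟨hT, le_rfl⟩).mono hn⟩
  obtain ⟨q', w', hq0, hw0, hs, hc'⟩ := hext _ _ _ (Nat.find_spec hex)
  set n := Nat.find hex with hn
  have hτn := hτ n
  refine ⟨T + τ n, _, _, hc.glue hT (by linarith) (hc'.shift T) (by simp [hq0]) (by simp [hw0]),
    ⟨max A (n + 1), fun t ht => ?_⟩, fun t ht => ⟨if_pos ht, if_pos ht⟩,
    fun B hB => ⟨n, Nat.find_min' hex hB, rfl⟩⟩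
  rcases le_or_gt t T with h | h
  · simp only [if_pos h]
    exact (hA t ⟨ht.1, h⟩).mono (le_max_left _ _)
  · simp only [if_neg (not_le.2 h)]
    exact (hs (t - T) ⟨by linarith, by linarith [ht.2]⟩).mono (le_max_right _ _)

theorem exists_maximal_lagCurve (hf : KernelReg f f1 C) (hδ : 0 < δ) (hδ1 : δ ≤ 1)
    (hg : CompactEnergy δ G g) (hgodd : ∀ x, g (-x) = -g x) {A0 : ℝ} {q0 w0 : ℝ → ℝ}
    (h0 : LagState δ A0 q0 w0) {Tmax : ℝ}
    (hmax : ∀ (T : ℝ) (q w : ℝ → ℝ → ℝ) (A : ℝ), 0 ≤ T → q 0 = q0 → w 0 = w0 →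
      (∀ t ∈ Icc 0 T, LagState δ A (q t) (w t)) → LagCurve f1 δ g 0 T q w → T ≤ Tmax) :
    ∃ (Tstar : ℝ) (q w : ℝ → ℝ → ℝ), 0 < Tstar ∧ q 0 = q0 ∧ w 0 = w0 ∧
      (∀ T < Tstar, ∃ A, ∀ t ∈ Icc 0 T, LagState δ A (q t) (w t)) ∧
      (∀ T < Tstar, LagCurve f1 δ g 0 T q w) ∧
      ∀ A, ∃ t ∈ Ico 0 Tstar, ¬ LagState δ A (q t) (w t) := by
  obtain ⟨τ, hτ, hext⟩ := exists_extension hf hδ hδ1 hg hgodd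
  obtain ⟨τ0, hτ0, hloc⟩ := exists_lagCurve hf hδ hδ1 hg hgodd A0
  obtain ⟨p, v, hp0, hv0, hps, hpc⟩ := hloc _ _ h0
  let P : ℝ × (ℝ → ℝ → ℝ) × (ℝ → ℝ → ℝ) → Prop := fun x => 0 < x.1 ∧ x.2.1 0 = q0 ∧ x.2.2 0 = w0 ∧
    LagCurve f1 δ g 0 x.1 x.2.1 x.2.2 ∧ ∃ A, ∀ t ∈ Icc 0 x.1, LagState δ A (x.2.1 t) (x.2.2 t)
  have hstep : ∀ x : {x // P x}, ∃ y : {x // P x},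
      (∀ t ≤ x.1.1, y.1.2.1 t = x.1.2.1 t ∧ y.1.2.2 t = x.1.2.2 t) ∧ x.1.1 < y.1.1 ∧
      ∀ A : ℕ, LagState δ A (x.1.2.1 x.1.1) (x.1.2.2 x.1.1) → ∃ n ≤ A, y.1.1 = x.1.1 + τ n := by
    rintro ⟨⟨T, q, w⟩, hT, hq, hw, hc, hA⟩
    obtain ⟨T', q', w', hc', hA', hag, hn⟩ := hext T q w hT.le hc hA
    have hlt : T < T' := by
      obtain ⟨A, hA⟩ := hA
      obtain ⟨n, hAn⟩ := exists_nat_ge A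
      obtain ⟨m, -, hm⟩ := hn n ((hA T ⟨hT.le, le_rfl⟩).mono hAn)
      rw [hm]; linarith [hτ m]
    exact ⟨⟨⟨T', q', w'⟩, lt_trans hT hlt, (hag 0 hT.le).1.trans hq, (hag 0 hT.le).2.trans hw,
      hc', hA'⟩, hag, hlt, hn⟩
  choose step hag hlt hn using hstep
  let X : ℕ → {x // P x} := fun n => step^[n] ⟨⟨τ0, p, v⟩, hτ0, hp0, hv0, hpc, A0 + 1, hps⟩
  have hXs : ∀ n, X (n + 1) = step (X n) := fun n => Function.iterate_succ_apply' _ _ _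
  have hmono : StrictMono fun n => (X n).1.1 := strictMono_nat_of_lt_succ fun n => by
    rw [hXs]; exact hlt _
  have hle : ∀ n, (X n).1.1 ≤ Tmax := fun n => by
    obtain ⟨hT, hq, hw, hc, A, hA⟩ := (X n).2
    exact hmax _ _ _ A hT.le hq hw hA hc
  have hagree : ∀ m n, m ≤ n → ∀ t ≤ (X m).1.1,
      (X n).1.2.1 t = (X m).1.2.1 t ∧ (X n).1.2.2 t = (X m).1.2.2 t := by
    intro m n hmn
    induction n, hmn using Nat.le_induction with
    | base => exact fun t _ => ⟨rfl, rfl⟩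
    | succ n hmn ih =>
      intro t ht
      have h1 := hag (X n) t (ht.trans (hmono.monotone hmn))
      rw [hXs]
      exact ⟨h1.1.trans (ih t ht).1, h1.2.trans (ih t ht).2⟩
  have hbdd : BddAbove (range fun n => (X n).1.1) := ⟨Tmax, by rintro _ ⟨n, rfl⟩; exact hle n⟩
  set Tstar := ⨆ n, (X n).1.1 with hTstar
  have hltT : ∀ n, (X n).1.1 < Tstar := fun n =>
    lt_of_lt_of_le (hmono (Nat.lt_succ_self n)) (le_ciSup hbdd (n + 1))
  have hexn : ∀ t < Tstar, ∃ n, t ≤ (X n).1.1 := fun t ht => by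
    obtain ⟨n, hn⟩ := exists_lt_of_lt_ciSup ht
    exact ⟨n, hn.le⟩
  classical
  let N : ℝ → ℕ := fun t => if h : ∃ n, t ≤ (X n).1.1 then Nat.find h else 0
  let q : ℝ → ℝ → ℝ := fun t => (X (N t)).1.2.1 t
  let w : ℝ → ℝ → ℝ := fun t => (X (N t)).1.2.2 t
  have hqw : ∀ n, ∀ t ≤ (X n).1.1, q t = (X n).1.2.1 t ∧ w t = (X n).1.2.2 t := by
    intro n t ht
    have hex : ∃ n, t ≤ (X n).1.1 := ⟨n, ht⟩
    have hN : N t = Nat.find hex := dif_pos hex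
    have h1 := hagree (N t) n (by rw [hN]; exact Nat.find_min' hex ht) t
      (by rw [hN]; exact Nat.find_spec hex)
    exact ⟨h1.1.symm, h1.2.symm⟩
  have hpos : 0 < Tstar := lt_trans (X 0).2.1 (hltT 0)
  refine ⟨Tstar, q, w, hpos, ?_, ?_, fun T hT => ?_, fun T hT => ?_, fun A => ?_⟩
  · exact (hqw 0 0 (X 0).2.1.le).1.trans (X 0).2.2.1
  · exact (hqw 0 0 (X 0).2.1.le).2.trans (X 0).2.2.2.1
  · obtain ⟨n, hn⟩ := hexn T hT
    obtain ⟨A, hA⟩ := (X n).2.2.2.2.2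
    refine ⟨A, fun t ht => ?_⟩
    have h1 := hqw n t (ht.2.trans hn)
    rw [h1.1, h1.2]
    exact hA t ⟨ht.1, ht.2.trans hn⟩
  · obtain ⟨n, hn⟩ := hexn T hT
    refine ((X n).2.2.2.2.1.mono le_rfl hn).congr (fun t ht => ?_) fun t ht => ?_
    · exact (hqw n t (ht.2.trans hn)).1
    · exact (hqw n t (ht.2.trans hn)).2
  · by_contra! hcon
    obtain ⟨k, hk⟩ := exists_nat_ge A
    obtain ⟨m, hm, hmin⟩ := (Finset.range (k + 1)).exists_min_image τ ⟨0, by simp⟩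
    have hstep' : ∀ n, (X n).1.1 + τ m ≤ (X (n + 1)).1.1 := by
      intro n
      have h1 := hcon (X n).1.1 ⟨(X n).2.1.le, hltT n⟩
      have h2 := hqw n _ le_rfl
      rw [h2.1, h2.2] at h1
      obtain ⟨j, hj, hjeq⟩ := hn (X n) k (h1.mono hk)
      rw [hXs, hjeq]
      exact add_le_add_right (hmin j (Finset.mem_range.2 (by omega))) _
    have hcontra : ∃ n, Tstar - τ m < (X n).1.1 :=
      exists_lt_of_lt_ciSup (by linarith [hτ m])
    obtain ⟨n, hn⟩ := hcontra
    linarith [hstep' n, hltT (n + 1)]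

/-- `D` is the time derivative at `t`, within `S`, of the curve of functions `p`, uniformly on
`[-L, L]`. -/
def UnifDeriv (S : Set ℝ) (t L : ℝ) (p : ℝ → ℝ → ℝ) (D : ℝ → ℝ) : Prop :=
  ∀ ε > 0, ∀ᶠ s in 𝓝[S] t, ∀ x, |x| ≤ L → |p s x - p t x - (s - t) * D x| ≤ ε * |s - t|

namespace UnifDeriv

variable {S : Set ℝ} {t L : ℝ} {p : ℝ → ℝ → ℝ} {D : ℝ → ℝ}

theorem of_hasDerivWithinAt {P : ℝ → ℝ → ℝ} (hS : Convex ℝ S) (ht : t ∈ S)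
    (hp : ∀ s ∈ S, ∀ x, HasDerivWithinAt (fun s => p s x) (P s x) S s)
    (hP : ∀ ε > 0, ∀ᶠ s in 𝓝[S] t, ∀ x, |P s x - P t x| ≤ ε) : UnifDeriv S t L p (P t) := by
  intro ε hε
  obtain ⟨ρ, hρ, hball⟩ := Metric.mem_nhdsWithin_iff.1 (hP ε hε)
  filter_upwards [inter_mem (mem_nhdsWithin_of_mem_nhds (Metric.ball_mem_nhds t hρ))
    self_mem_nhdsWithin] with s hs x _
  have hder : ∀ r ∈ Metric.ball t ρ ∩ S, HasDerivWithinAt (fun r => p r x - r * P t x)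
      (P r x - P t x) (Metric.ball t ρ ∩ S) r := by
    intro r hr
    have := (hp r hr.2 x).sub (((hasDerivAt_id r).mul_const (P t x)).hasDerivWithinAt (s := S))
    rw [one_mul] at this
    exact this.mono inter_subset_right
  have := ((convex_ball t ρ).inter hS).norm_image_sub_le_of_norm_hasDerivWithin_le hder
    (fun r hr => hball hr x) ⟨Metric.mem_ball_self hρ, ht⟩ hs
  rw [Real.norm_eq_abs, Real.norm_eq_abs] at this
  rwa [show p s x - p t x - (s - t) * P t x = p s x - s * P t x - (p t x - t * P t x) by ring]

theorem integral (h : UnifDeriv S t L p D) (hL : 0 ≤ L) (ht : t ∈ S)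
    (hp : ∀ s ∈ S, Continuous (p s)) (hD : Continuous D) :
    UnifDeriv S t L (fun s x => ∫ y in (0 : ℝ)..x, p s y) fun x => ∫ y in (0 : ℝ)..x, D y := by
  intro ε hε
  filter_upwards [h (ε / (L + 1)) (by positivity), self_mem_nhdsWithin] with s hs hsS x hx
  have hp1 := hp s hsS
  have hp2 := hp t ht
  rw [← intervalIntegral.integral_sub (hp1.intervalIntegrable _ _) (hp2.intervalIntegrable _ _),
    ← intervalIntegral.integral_const_mul, ← intervalIntegral.integral_sub
      (Continuous.intervalIntegrable (by fun_prop) _ _)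
      (Continuous.intervalIntegrable (by fun_prop) _ _)]
  have := intervalIntegral.norm_integral_le_of_norm_le_const (a := 0) (b := x)
    (f := fun y => p s y - p t y - (s - t) * D y) (C := ε / (L + 1) * |s - t|) (fun y hy => by
      refine hs y (le_trans ?_ hx)
      rcases le_total 0 x with h0 | h0
      · rw [uIoc_of_le h0] at hy
        rw [abs_of_pos hy.1, abs_of_nonneg h0]; exact hy.2
      · rw [uIoc_of_ge h0] at hy
        rw [abs_of_nonpos hy.2, abs_of_nonpos h0]; linarith [hy.1])
  rw [Real.norm_eq_abs, sub_zero] at this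
  refine this.trans ?_
  calc ε / (L + 1) * |s - t| * |x| ≤ ε / (L + 1) * |s - t| * (L + 1) := by gcongr; linarith
    _ = ε * |s - t| := by field_simp

theorem comp (h : UnifDeriv S t L p D) {x : ℝ → ℝ} (hx : ∀ s ∈ S, |x s| ≤ L)
    (hxc : ContinuousWithinAt x S t) (hD : Continuous D) :
    HasDerivWithinAt (fun s => p s (x s) - p t (x s)) (D (x t)) S t := by
  rw [hasDerivWithinAt_iff_isLittleO, Asymptotics.isLittleO_iff]
  intro ε hε
  have h1 : ∀ᶠ s in 𝓝[S] t, |D (x s) - D (x t)| < ε / 2 := by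
    have : Tendsto (fun s => |D (x s) - D (x t)|) (𝓝[S] t) (𝓝 |D (x t) - D (x t)|) :=
      ((hD.continuousAt.comp_continuousWithinAt hxc).tendsto.sub_const _).abs
    rw [sub_self, abs_zero] at this
    exact this.eventually (gt_mem_nhds (half_pos hε))
  filter_upwards [h1, h (ε / 2) (half_pos hε), self_mem_nhdsWithin] with s hs1 hs2 hsS
  have h3 := hs2 (x s) (hx s hsS)
  rw [Real.norm_eq_abs, Real.norm_eq_abs, smul_eq_mul, sub_self, sub_zero]
  have h4 : |(s - t) * (D (x s) - D (x t))| ≤ ε / 2 * |s - t| := by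
    rw [abs_mul, mul_comm]; gcongr
  calc |p s (x s) - p t (x s) - (s - t) * D (x t)|
      = |(p s (x s) - p t (x s) - (s - t) * D (x s)) + (s - t) * (D (x s) - D (x t))| := by ring_nf
    _ ≤ _ := abs_add_le _ _
    _ ≤ ε * |s - t| := by linarith

end UnifDeriv

theorem eLpNorm_two_le_of_support {h : ℝ → ℝ} {ε R : ℝ} (hm : MemLp h 2 volume) (hR : 0 ≤ R)
    (hε : ∀ x, |h x| ≤ ε) (hsupp : ∀ x, R ≤ |x| → h x = 0) :
    eLpNorm h 2 volume ≤ ENNReal.ofReal (ε * √(2 * R)) := by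
  have hε0 : 0 ≤ ε := (abs_nonneg _).trans (hε 0)
  rw [eLpNorm_two_le_iff hm (by positivity), mul_pow, Real.sq_sqrt (by linarith)]
  have h1 : ∫ x, h x ^ 2 = ∫ x in (-R)..R, h x ^ 2 := by
    rw [intervalIntegral.integral_of_le (by linarith), setIntegral_eq_integral_of_forall_compl_eq_zero]
    intro x hx
    rw [hsupp x, zero_pow two_ne_zero]
    by_contra hcon
    obtain ⟨h1, h2⟩ := abs_lt.1 (not_le.1 hcon)
    exact hx ⟨h1, h2.le⟩
  rw [h1]
  have hint : IntervalIntegrable (fun x => h x ^ 2) volume (-R) R := by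
    rw [intervalIntegrable_iff]; exact hm.integrable_sq.integrableOn
  calc ∫ x in (-R)..R, h x ^ 2 ≤ ∫ x in (-R)..R, ε ^ 2 :=
        intervalIntegral.integral_mono_on (by linarith) hint (by simp)
          fun x _ => sq_le_sq' (abs_le.1 (hε x)).1 (abs_le.1 (hε x)).2
    _ = ε ^ 2 * (2 * R) := by rw [intervalIntegral.integral_const, smul_eq_mul]; ring

theorem MemLp.mul_of_support {u p : ℝ → ℝ} {c R : ℝ} (hp : MemLp p 2 volume) (hu : Continuous u)
    (huc : ∀ x, |x| ≤ R → |u x| ≤ c) (hsupp : ∀ x, R < |x| → p x = 0) :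
    MemLp (fun x => u x * p x) 2 volume ∧
      eLpNorm (fun x => u x * p x) 2 volume ≤ ENNReal.ofReal c * eLpNorm p 2 volume := by
  have hle : ∀ x, ‖u x * p x‖ ≤ c * ‖p x‖ := by
    intro x
    rcases le_or_gt |x| R with h | h
    · rw [norm_mul]; exact mul_le_mul_of_nonneg_right (huc x h) (norm_nonneg _)
    · simp [hsupp x h]
  exact ⟨hp.of_le_mul (hu.aestronglyMeasurable.mul hp.aestronglyMeasurable) (ae_of_all _ hle),
    eLpNorm_le_mul_eLpNorm_of_ae_le_mul (ae_of_all _ hle) 2⟩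

theorem EnergyLE.of_hasDerivAt_of_support {h p : ℝ → ℝ} {ε R : ℝ} (hR : 0 ≤ R)
    (hp : Continuous p) (hh : ∀ x, HasDerivAt h (p x) x) (hε : ∀ x, |p x| ≤ ε)
    (hsupp : ∀ x, R ≤ |x| → p x = 0) : EnergyLE h (ε * √(2 * R)) := by
  have hε0 : 0 ≤ ε := (abs_nonneg _).trans (hε 0)
  have hm : MemLp p 2 volume := by
    refine hp.memLp_of_hasCompactSupport (HasCompactSupport.intro (isCompact_Icc (a := -R) (b := R))
      fun x hx => hsupp x ?_)
    by_contra hcon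
    exact hx (abs_le.1 (not_le.1 hcon).le)
  refine EnergyLE.of_weakDeriv hm (fun a b => ?_) (by positivity)
    (eLpNorm_two_le_of_support hm hR hε hsupp)
  exact intervalIntegral.integral_eq_sub_of_hasDerivAt (fun x _ => hh x) (hp.intervalIntegrable _ _)

namespace LagState

variable {δ A : ℝ} {q w : ℝ → ℝ}

theorem energyLE_comp (hδ : 0 < δ) (hδ1 : δ ≤ 1) (h : LagState δ A q w) {v : ℝ → ℝ} {K : ℝ}
    (hv : EnergyLE v K) : EnergyLE (fun z => v (flowInv q z)) (Real.exp A * K) := by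
  refine hv.comp_monotone (strictMono_flowInv h.continuous_left (h.abs_left_le hδ hδ1)).monotone
    (Real.exp_pos _).le fun x y hxy => ?_
  have := abs_flowInv_sub_le h.continuous_left (h.abs_left_le hδ hδ1) x y
  rw [← Real.exp_nat_mul]
  push_cast
  rw [abs_of_nonneg (sub_nonneg.2 hxy)] at this
  exact (le_abs_self _).trans this

/-- Composition with the inverse flow is continuous in the energy norm. -/
theorem exists_comp_modulus (hδ : 0 < δ) (hδ1 : δ ≤ 1) (A : ℝ) {v : ℝ → ℝ} {K : ℝ}
    (hv : EnergyLE v K) {ε : ℝ} (hε : 0 < ε) : ∃ γ, 0 < γ ∧ ∀ q w q' w', LagState δ A q w →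
      LagState δ A q' w' → (∀ x, |q x - q' x| ≤ γ) →
        EnergyLE (fun z => v (flowInv q z) - v (flowInv q' z)) ε := by
  rcases lt_or_ge A 0 with hA | hA
  · exact ⟨1, one_pos, fun q w q' w' h => absurd h.nonneg (not_le.2 hA)⟩
  set ε₁ := ε / (4 * Real.exp A) with hε₁
  have hε₁0 : 0 < ε₁ := by positivity
  obtain ⟨p, hpsupp, hpclose, hpc, hpm⟩ := hv.memLp_deriv.exists_hasCompactSupport_eLpNorm_sub_le
    (by norm_num) (ENNReal.ofReal_pos.2 hε₁0).ne'
  let V : ℝ → ℝ := fun x => ∫ y in (0 : ℝ)..x, p y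
  have hV : ∀ x, HasDerivAt V (p x) x := fun x =>
    (hpc.integral_hasStrictDerivAt 0 x).hasDerivAt
  have hrem : EnergyLE (fun x => v x - V x) ε₁ := by
    refine EnergyLE.of_weakDeriv (hv.memLp_deriv.sub hpm) (fun a b => ?_) hε₁0.le hpclose
    have e1 := hv.intervalIntegral_deriv a b
    have e2 : ∫ x in a..b, p x = V b - V a :=
      intervalIntegral.integral_eq_sub_of_hasDerivAt (fun x _ => hV x) (hpc.intervalIntegrable _ _)
    simp only [Pi.sub_apply]
    rw [intervalIntegral.integral_sub (MemLp.intervalIntegrable_of_two hv.memLp_deriv a b)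
      (hpc.intervalIntegrable _ _), e1, e2]
    ring
  obtain ⟨R, hRpos, hR⟩ : ∃ R, 0 < R ∧ ∀ x, R ≤ |x| → p x = 0 := by
    obtain ⟨R, hR⟩ := hpsupp.isCompact.isBounded.subset_closedBall 0
    refine ⟨|R| + 1, by positivity, fun x hx => ?_⟩
    by_contra hne
    have := hR (subset_tsupport _ hne)
    rw [Metric.mem_closedBall, dist_zero_right, Real.norm_eq_abs] at this
    linarith [le_abs_self R]
  obtain ⟨P, hP⟩ := hpsupp.exists_bound_of_continuous hpc
  have hP0 : 0 ≤ P := (norm_nonneg _).trans (hP 0)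
  set R' := Real.exp (2 * A) * R with hR'
  have hR'0 : 0 < R' := by positivity
  set η := ε / (2 * √(2 * R')) with hη
  have hs0 : 0 < √(2 * R') := Real.sqrt_pos.2 (by positivity)
  have hη0 : 0 < η := by positivity
  have huc := hpsupp.uniformContinuous_of_continuous hpc
  obtain ⟨ρ, hρ, huc⟩ := Metric.uniformContinuous_iff.1 huc (η / (2 * Real.exp (2 * A)))
    (by positivity)
  have t1 : Tendsto (fun γ : ℝ => Real.exp (3 * (2 * A)) * γ * R') (𝓝[>] 0) (𝓝 0) := by
    have : Continuous fun γ : ℝ => Real.exp (3 * (2 * A)) * γ * R' := by fun_prop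
    simpa using (this.tendsto 0).mono_left (nhdsWithin_le_nhds (s := Ioi 0))
  have t2 : Tendsto (fun γ : ℝ => P * (Real.exp (2 * A) *
      (A * √(Real.exp (3 * (2 * A)) * γ * R') + γ))) (𝓝[>] 0) (𝓝 0) := by
    have : Continuous fun γ : ℝ => P * (Real.exp (2 * A) *
      (A * √(Real.exp (3 * (2 * A)) * γ * R') + γ)) := by fun_prop
    simpa using (this.tendsto 0).mono_left (nhdsWithin_le_nhds (s := Ioi 0))
  obtain ⟨γ, ⟨hγ1, hγ2⟩, hγ⟩ := (((t1.eventually (gt_mem_nhds hρ)).and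
    (t2.eventually (gt_mem_nhds (half_pos hη0)))).and self_mem_nhdsWithin).exists
  have hγ0 : 0 < γ := hγ
  refine ⟨γ, hγ0, fun q w q' w' h h' hq => ?_⟩
  have hB := h.abs_left_le hδ hδ1
  have hB' := h'.abs_left_le hδ hδ1
  have hqc := h.continuous_left
  have hqc' := h'.continuous_left
  have hΨc := continuous_flowInv hqc hB
  have hΨc' := continuous_flowInv hqc' hB'
  have houtside : ∀ z, R' ≤ |z| → ∀ q : ℝ → ℝ, Continuous q → (∀ x, |q x| ≤ 2 * A) →
      p (flowInv q z) = 0 := by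
    intro z hz q hqc hB
    apply hR
    have := abs_flowMap_sub_le hqc hB 0 (flowInv q z)
    rw [flowMap_flowInv hqc hB, flowMap_zero, sub_zero, sub_zero] at this
    exact le_of_mul_le_mul_left (hz.trans this) (Real.exp_pos _)
  have main : EnergyLE (fun z => V (flowInv q z) - V (flowInv q' z)) (η * √(2 * R')) := by
    refine EnergyLE.of_hasDerivAt_of_support hR'0.le (p := fun z =>
      p (flowInv q z) * Real.exp (-q (flowInv q z)) -
        p (flowInv q' z) * Real.exp (-q' (flowInv q' z))) (by fun_prop) (fun z => ?_) ?_ ?_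
    · exact ((hV _).comp z (hasDerivAt_flowInv hqc hB z)).sub
        ((hV _).comp z (hasDerivAt_flowInv hqc' hB' z))
    · intro z
      rcases le_or_gt R' |z| with hz | hz
      · rw [houtside z hz q hqc hB, houtside z hz q' hqc' hB']; simpa using hη0.le
      have hΨ : |flowInv q z - flowInv q' z| ≤ Real.exp (3 * (2 * A)) * γ * R' := by
        refine (abs_flowInv_sub_flowInv_le hqc hqc' hB hB' hγ0.le hq z).trans ?_
        gcongr
      have e1 : |p (flowInv q z) - p (flowInv q' z)| ≤ η / (2 * Real.exp (2 * A)) :=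
        (huc (lt_of_le_of_lt hΨ hγ1)).le
      have e2 : |q (flowInv q z) - q' (flowInv q' z)| ≤
          A * √(Real.exp (3 * (2 * A)) * γ * R') + γ := by
        have e3 := h.energy.abs_sub_le (flowInv q' z) (flowInv q z)
        have e4 : A * √|flowInv q z - flowInv q' z| ≤
          A * √(Real.exp (3 * (2 * A)) * γ * R') := by gcongr
        have e5 := _root_.abs_sub_le (q (flowInv q z)) (q (flowInv q' z)) (q' (flowInv q' z))
        linarith [hq (flowInv q' z)]
      have e6 := abs_exp_sub_exp_le (a := -q (flowInv q z)) (b := -q' (flowInv q' z)) (B := 2 * A)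
        (by linarith [(abs_le.1 (hB (flowInv q z))).1])
        (by linarith [(abs_le.1 (hB' (flowInv q' z))).1])
      rw [show -q (flowInv q z) - -q' (flowInv q' z) = -(q (flowInv q z) - q' (flowInv q' z)) by
        ring, abs_neg] at e6
      rw [show p (flowInv q z) * Real.exp (-q (flowInv q z)) -
          p (flowInv q' z) * Real.exp (-q' (flowInv q' z)) =
          (p (flowInv q z) - p (flowInv q' z)) * Real.exp (-q (flowInv q z)) +
          p (flowInv q' z) * (Real.exp (-q (flowInv q z)) - Real.exp (-q' (flowInv q' z))) by ring]
      refine (abs_add_le _ _).trans ?_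
      rw [abs_mul, abs_mul, Real.abs_exp]
      have e7 : |p (flowInv q z) - p (flowInv q' z)| * Real.exp (-q (flowInv q z)) ≤
          η / (2 * Real.exp (2 * A)) * Real.exp (2 * A) := by
        gcongr
        linarith [(abs_le.1 (hB (flowInv q z))).1]
      have e8 : |p (flowInv q' z)| *
          |Real.exp (-q (flowInv q z)) - Real.exp (-q' (flowInv q' z))| ≤
          P * (Real.exp (2 * A) * (A * √(Real.exp (3 * (2 * A)) * γ * R') + γ)) := by
        refine mul_le_mul (hP _) (e6.trans ?_) (abs_nonneg _) hP0
        gcongr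
      have e9 : η / (2 * Real.exp (2 * A)) * Real.exp (2 * A) = η / 2 := by
        field_simp
      linarith
    · intro z hz
      simp [houtside z hz q hqc hB, houtside z hz q' hqc' hB']
  have hr1 := h.energyLE_comp hδ hδ1 hrem
  have hr2 := h'.energyLE_comp hδ hδ1 hrem
  have := main.add (hr1.sub hr2)
  have hsum : η * √(2 * R') + (Real.exp A * ε₁ + Real.exp A * ε₁) = ε := by
    rw [hη, hε₁]; field_simp; ring
  rw [hsum] at this
  convert this using 2
  ring

end LagState

/-- `P` is continuous in time at `t` within `S`, uniformly in space. -/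
def UnifCont (S : Set ℝ) (t : ℝ) (P : ℝ → ℝ → ℝ) : Prop :=
  ∀ ε > 0, ∀ᶠ s in 𝓝[S] t, ∀ x, |P s x - P t x| ≤ ε

namespace UnifCont

variable {S : Set ℝ} {t K : ℝ} {a b : ℝ → ℝ → ℝ}

theorem mul (ha : UnifCont S t a) (hb : UnifCont S t b) (ht : t ∈ S)
    (hK : ∀ s ∈ S, ∀ x, |a s x| ≤ K ∧ |b s x| ≤ K) : UnifCont S t fun s x => a s x * b s x := by
  intro ε hε
  have hK0 : 0 ≤ K := (abs_nonneg _).trans (hK t ht 0).1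
  have hη : 0 < ε / (2 * (K + 1)) := by positivity
  filter_upwards [ha _ hη, hb _ hη, self_mem_nhdsWithin] with s h1 h2 hs x
  rw [show a s x * b s x - a t x * b t x = (a s x - a t x) * b s x + a t x * (b s x - b t x) by ring]
  refine (abs_add_le _ _).trans ?_
  rw [abs_mul, abs_mul]
  have h3 := mul_le_mul (h1 x) (hK s hs x).2 (abs_nonneg _) hη.le
  have h4 := mul_le_mul (hK t ht x).1 (h2 x) (abs_nonneg _) hK0
  have h5 : ε / (2 * (K + 1)) * K + K * (ε / (2 * (K + 1))) ≤ ε := by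
    rw [show ε / (2 * (K + 1)) * K + K * (ε / (2 * (K + 1))) = ε * (K / (K + 1)) by field_simp; ring]
    exact mul_le_of_le_one_right hε.le ((div_le_one (by linarith)).2 (by linarith))
  linarith

theorem exp (ha : UnifCont S t a) (ht : t ∈ S) (hK : ∀ s ∈ S, ∀ x, a s x ≤ K) :
    UnifCont S t fun s x => Real.exp (a s x) := by
  intro ε hε
  filter_upwards [ha (ε / Real.exp K) (by positivity), self_mem_nhdsWithin] with s h1 hs x
  refine (abs_exp_sub_exp_le (hK s hs x) (hK t ht x)).trans ?_
  calc Real.exp K * |a s x - a t x| ≤ Real.exp K * (ε / Real.exp K) := by gcongr; exact h1 x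
    _ = ε := by field_simp

end UnifCont

/-- The data of the Lagrangian system together with a solution on `[0, T]` and bounds for it. -/
structure LagFlow (f f1 : ℝ → ℝ → ℝ) (C δ G : ℝ) (g : ℝ → ℝ) (T A : ℝ) (q w : ℝ → ℝ → ℝ) :
    Prop where
  kernel : KernelReg f f1 C
  pos : 0 < δ
  le_one : δ ≤ 1
  force : CompactEnergy δ G g
  force_odd : ∀ x, g (-x) = -g x
  curve : LagCurve f1 δ g 0 T q w
  state : ∀ t ∈ Icc 0 T, LagState δ A (q t) (w t)

/-- A curve with time derivative bounded in the uniform and the energy norm is continuous in these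
norms. -/
theorem eventually_close_of_hasDerivWithinAt {T M : ℝ} {p P : ℝ → ℝ → ℝ}
    (hp : ∀ s ∈ Icc 0 T, ∀ x, HasDerivWithinAt (fun s => p s x) (P s x) (Icc 0 T) s)
    (hb : ∀ s ∈ Icc 0 T, ∀ x, |P s x| ≤ M) (hE : ∀ s ∈ Icc 0 T, EnergyLE (P s) M) {t : ℝ}
    (ht : t ∈ Icc 0 T) {γ : ℝ} (hγ : 0 < γ) : ∀ᶠ s in 𝓝[Icc 0 T] t,
      (∀ x, |p s x - p t x| ≤ γ) ∧ EnergyLE (fun x => p s x - p t x) γ := by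
  have hM : 0 ≤ M := (hE t ht).nonneg
  have h1 : ∀ᶠ s in 𝓝[Icc 0 T] t, |s - t| * M < γ := by
    have : Tendsto (fun s : ℝ => |s - t| * M) (𝓝[Icc 0 T] t) (𝓝 (|t - t| * M)) :=
      ((by fun_prop : Continuous fun s : ℝ => |s - t| * M).tendsto t).mono_left nhdsWithin_le_nhds
    rw [sub_self, abs_zero, zero_mul] at this
    exact this.eventually (gt_mem_nhds hγ)
  filter_upwards [h1, self_mem_nhdsWithin] with s hs hsT
  refine ⟨fun x => ?_, ?_⟩
  · have := (convex_Icc 0 T).norm_image_sub_le_of_norm_hasDerivWithin_le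
      (fun r hr => hp r hr x) (fun r hr => hb r hr x) ht hsT
    rw [Real.norm_eq_abs, Real.norm_eq_abs, mul_comm] at this
    exact this.trans hs.le
  · have hord : ∀ a ∈ Icc 0 T, ∀ b ∈ Icc 0 T, a ≤ b →
        EnergyLE (fun x => p b x - p a x) (M * (b - a)) := by
      intro a ha b hb' hab
      have hsub : Icc a b ⊆ Icc 0 T := Icc_subset_Icc ha.1 hb'.2
      exact EnergyLE.sub_of_hasDerivWithinAt hab
        (fun r hr x => (hp r (hsub hr) x).mono hsub) fun r hr => hE r (hsub hr)
    rcases le_total t s with h | h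
    · refine (hord t ht s hsT h).mono ?_
      rw [abs_of_nonneg (sub_nonneg.2 h)] at hs; linarith
    · have := (hord s hsT t ht h).neg
      refine EnergyLE.mono (K := M * (t - s)) (by simpa using this) ?_
      rw [abs_of_nonpos (sub_nonpos.2 h)] at hs; linarith

namespace LagFlow

variable {f f1 : ℝ → ℝ → ℝ} {C δ G : ℝ} {g : ℝ → ℝ} {T A : ℝ} {q w : ℝ → ℝ → ℝ} {t : ℝ}

theorem exists_bound (h : LagFlow f f1 C δ G g T A q w) : ∃ M, A ≤ M ∧ ∀ t ∈ Icc 0 T,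
    LagState δ M (lagField f1 δ (q t) (w t)) (fun x => g x * Real.exp (-q t x)) ∧
    LagState δ M (q t) (w t) ∧ LagState δ M (q t) fun x => g x * Real.exp (-q t x) := by
  obtain ⟨M, hM, hfield⟩ := LagState.field h.kernel h.pos h.le_one h.force h.force_odd A
  refine ⟨max A M, le_max_left _ _, fun t ht => ?_⟩
  have h1 := (hfield _ _ (h.state t ht)).mono (le_max_right A M)
  have h2 := (h.state t ht).mono (le_max_left A M)
  exact ⟨h1, h2, h2.even, h2.const, h2.center, h2.energy, h1.odd, h1.compact⟩

theorem eventually_close (h : LagFlow f f1 C δ G g T A q w) (ht : t ∈ Icc 0 T) {γ : ℝ}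
    (hγ : 0 < γ) : ∀ᶠ s in 𝓝[Icc 0 T] t,
      ((∀ x, |q s x - q t x| ≤ γ) ∧ EnergyLE (fun x => q s x - q t x) γ) ∧
      ((∀ x, |w s x - w t x| ≤ γ) ∧ EnergyLE (fun x => w s x - w t x) γ) ∧
      ((∀ x, |g x * Real.exp (-q s x) - g x * Real.exp (-q t x)| ≤ γ) ∧
        EnergyLE (fun x => g x * Real.exp (-q s x) - g x * Real.exp (-q t x)) γ) := by
  obtain ⟨M, -, hM⟩ := h.exists_bound
  have hM0 : 0 ≤ M := (hM t ht).1.nonneg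
  have hV : ∀ s ∈ Icc 0 T, ∀ x, |lagField f1 δ (q s) (w s) x| ≤ 2 * M := fun s hs x =>
    (hM s hs).1.abs_left_le h.pos h.le_one x
  have hg : ∀ s ∈ Icc 0 T, ∀ x, |g x * Real.exp (-q s x)| ≤ M := fun s hs x =>
    (hM s hs).1.abs_right_le h.le_one x
  have e1 := eventually_close_of_hasDerivWithinAt h.curve.hasDeriv_left hV
    (fun s hs => (hM s hs).1.energy.mono (by linarith)) ht hγ
  have e2 := eventually_close_of_hasDerivWithinAt h.curve.hasDeriv_right hg
    (fun s hs => (hM s hs).1.compact.energy) ht hγ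
  have e3 := eventually_close_of_hasDerivWithinAt (p := fun s x => g x * Real.exp (-q s x))
    (P := fun s x => -(g x * Real.exp (-q s x) * lagField f1 δ (q s) (w s) x))
    (M := M * M + M * (2 * M) + M * M) (fun s hs x => ?_) (fun s hs x => ?_)
    (fun s hs => ?_) ht hγ
  · filter_upwards [e1, e2, e3] with s h1 h2 h3 using ⟨h1, h2, h3⟩
  · have := (h.curve.hasDeriv_left s hs x).neg.exp.const_mul (g x)
    exact this.congr_deriv (by rw [Pi.neg_apply]; ring)
  · rw [abs_neg, abs_mul]
    have := mul_le_mul (hg s hs x) (hV s hs x) (abs_nonneg _) hM0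
    have := mul_nonneg hM0 hM0
    linarith
  · refine (EnergyLE.mono (K := M * M + 2 * M * M) ?_ (by nlinarith [mul_nonneg hM0 hM0])).neg
    refine EnergyLE.of_abs_sub_le hM0 (by linarith) (hM s hs).1.energy (hM s hs).1.compact.energy ?_
    intro x y _
    set a := fun x => g x * Real.exp (-q s x)
    set b := lagField f1 δ (q s) (w s)
    show |a y * b y - a x * b x| ≤ M * |b y - b x| + 2 * M * |a y - a x|
    rw [show a y * b y - a x * b x = a y * (b y - b x) + b x * (a y - a x) by ring]
    refine (abs_add_le _ _).trans ?_
    rw [abs_mul (a y), abs_mul (b x)]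
    exact add_le_add (mul_le_mul_of_nonneg_right (hg s hs y) (abs_nonneg _))
      (mul_le_mul_of_nonneg_right (hV s hs x) (abs_nonneg _))

theorem unifCont_left (h : LagFlow f f1 C δ G g T A q w) (ht : t ∈ Icc 0 T) :
    UnifCont (Icc 0 T) t q := fun _ hε =>
  (h.eventually_close ht hε).mono fun _ hs => hs.1.1

theorem unifCont_right (h : LagFlow f f1 C δ G g T A q w) (ht : t ∈ Icc 0 T) :
    UnifCont (Icc 0 T) t w := fun _ hε =>
  (h.eventually_close ht hε).mono fun _ hs => hs.2.1.1

theorem unifCont_field (h : LagFlow f f1 C δ G g T A q w) (ht : t ∈ Icc 0 T) :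
    UnifCont (Icc 0 T) t fun s => lagField f1 δ (q s) (w s) := by
  intro ε hε
  obtain ⟨γ, hγ, hmod⟩ := LagState.exists_lagField_modulus h.kernel h.pos h.le_one A hε
  filter_upwards [h.eventually_close ht hγ, self_mem_nhdsWithin] with s hs hsT
  exact hmod _ _ _ _ (h.state s hsT) (h.state t ht) hs.1.1 hs.2.1.1

theorem abs_left_le (h : LagFlow f f1 C δ G g T A q w) (ht : t ∈ Icc 0 T) (x : ℝ) :
    |q t x| ≤ 2 * A := (h.state t ht).abs_left_le h.pos h.le_one x

theorem continuous_left (h : LagFlow f f1 C δ G g T A q w) (ht : t ∈ Icc 0 T) :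
    Continuous (q t) := (h.state t ht).continuous_left

theorem continuous_right (h : LagFlow f f1 C δ G g T A q w) (ht : t ∈ Icc 0 T) :
    Continuous (w t) := (h.state t ht).continuous_right

theorem continuous_field (h : LagFlow f f1 C δ G g T A q w) (ht : t ∈ Icc 0 T) :
    Continuous (lagField f1 δ (q t) (w t)) :=
  ((h.state t ht).energyLE_lagField h.kernel h.pos h.le_one).continuous

theorem unifDeriv_flowMap (h : LagFlow f f1 C δ G g T A q w) (ht : t ∈ Icc 0 T) {L : ℝ}
    (hL : 0 ≤ L) : UnifDeriv (Icc 0 T) t L (fun s => flowMap (q s)) fun x =>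
      ∫ y in (0 : ℝ)..x, Real.exp (q t y) * lagField f1 δ (q t) (w t) y := by
  obtain ⟨M, -, hM⟩ := h.exists_bound
  have hq := h.continuous_left ht
  have hV := h.continuous_field ht
  refine UnifDeriv.integral (p := fun s y => Real.exp (q s y)) ?_ hL ht
    (fun s hs => by have := h.continuous_left hs; fun_prop) (by fun_prop)
  refine UnifDeriv.of_hasDerivWithinAt
    (P := fun s y => Real.exp (q s y) * lagField f1 δ (q s) (w s) y) (convex_Icc 0 T) ht
    (fun s hs x => (h.curve.hasDeriv_left s hs x).exp) ?_
  refine UnifCont.mul (K := max (Real.exp (2 * A)) (2 * M)) ?_ (h.unifCont_field ht) ht ?_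
  · exact (h.unifCont_left ht).exp ht fun s hs x => (abs_le.1 (h.abs_left_le hs x)).2
  · intro s hs x
    refine ⟨le_max_of_le_left ?_, le_max_of_le_right ((hM s hs).1.abs_left_le h.pos h.le_one x)⟩
    rw [Real.abs_exp]
    exact Real.exp_le_exp.2 (abs_le.1 (h.abs_left_le hs x)).2

theorem unifDeriv_circulation (h : LagFlow f f1 C δ G g T A q w) (ht : t ∈ Icc 0 T) {L : ℝ}
    (hL : 0 ≤ L) : UnifDeriv (Icc 0 T) t L
      (fun s x => ∫ y in (0 : ℝ)..x, w s y * Real.exp (q s y)) fun x =>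
      ∫ y in (0 : ℝ)..x, (g y + w t y * (Real.exp (q t y) * lagField f1 δ (q t) (w t) y)) := by
  obtain ⟨M, hAM, hM⟩ := h.exists_bound
  have hq := h.continuous_left ht
  have hV := h.continuous_field ht
  have hw := h.continuous_right ht
  have hg := h.force.continuous
  have hM0 : 0 ≤ M := (hM t ht).1.nonneg
  refine UnifDeriv.integral (p := fun s y => w s y * Real.exp (q s y)) ?_ hL ht
    (fun s hs => by
      have := h.continuous_left hs
      have := h.continuous_right hs
      fun_prop) (by fun_prop)
  refine UnifDeriv.of_hasDerivWithinAt
    (P := fun s y => g y + w s y * (Real.exp (q s y) * lagField f1 δ (q s) (w s) y))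
    (convex_Icc 0 T) ht (fun s hs x => ?_) ?_
  · have := (h.curve.hasDeriv_right s hs x).mul (h.curve.hasDeriv_left s hs x).exp
    refine this.congr_deriv ?_
    rw [mul_assoc, ← Real.exp_add]; simp
  · have hexp : ∀ s ∈ Icc 0 T, ∀ x, |Real.exp (q s x)| ≤ Real.exp (2 * A) := fun s hs x => by
      rw [Real.abs_exp]
      exact Real.exp_le_exp.2 (abs_le.1 (h.abs_left_le hs x)).2
    have hVb := fun s hs x => (hM s hs).1.abs_left_le h.pos h.le_one x
    have h1 : UnifCont (Icc 0 T) t fun s y =>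
        w s y * (Real.exp (q s y) * lagField f1 δ (q s) (w s) y) := by
      refine UnifCont.mul (K := max M (Real.exp (2 * A) * (2 * M))) (h.unifCont_right ht) ?_ ht ?_
      · refine UnifCont.mul (K := max (Real.exp (2 * A)) (2 * M)) ?_ (h.unifCont_field ht) ht ?_
        · exact (h.unifCont_left ht).exp ht fun s hs x => (abs_le.1 (h.abs_left_le hs x)).2
        · exact fun s hs x => ⟨le_max_of_le_left (hexp s hs x), le_max_of_le_right (hVb s hs x)⟩
      · intro s hs x
        refine ⟨le_max_of_le_left ((hM s hs).2.1.abs_right_le h.le_one x), le_max_of_le_right ?_⟩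
        rw [abs_mul]
        exact mul_le_mul (hexp s hs x) (hVb s hs x) (abs_nonneg _) (Real.exp_pos _).le
    intro ε hε
    filter_upwards [h1 ε hε] with s hs x
    simpa using hs x

theorem abs_flowInv_le (h : LagFlow f f1 C δ G g T A q w) (ht : t ∈ Icc 0 T) (z : ℝ) :
    |flowInv (q t) z| ≤ Real.exp (2 * A) * |z| := by
  have := abs_flowInv_sub_le (h.continuous_left ht) (h.abs_left_le ht) 0 z
  rwa [flowInv_zero (h.continuous_left ht), sub_zero, sub_zero] at this

theorem continuousWithinAt_flowInv (h : LagFlow f f1 C δ G g T A q w) (ht : t ∈ Icc 0 T) (z : ℝ) :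
    ContinuousWithinAt (fun s => flowInv (q s) z) (Icc 0 T) t := by
  rw [ContinuousWithinAt, Metric.tendsto_nhds]
  intro ε hε
  filter_upwards [h.unifCont_left ht (ε / (Real.exp (3 * (2 * A)) * (|z| + 1))) (by positivity),
    self_mem_nhdsWithin] with s hs hsT
  rw [Real.dist_eq]
  refine lt_of_le_of_lt (abs_flowInv_sub_flowInv_le (h.continuous_left hsT) (h.continuous_left ht)
    (h.abs_left_le hsT) (h.abs_left_le ht) (by positivity) hs z) ?_
  rw [show Real.exp (3 * (2 * A)) * (ε / (Real.exp (3 * (2 * A)) * (|z| + 1))) * |z| =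
    ε * (|z| / (|z| + 1)) by field_simp]
  exact mul_lt_of_lt_one_right hε ((div_lt_one (by positivity)).2 (by linarith))

theorem hasDerivWithinAt_flowInv (h : LagFlow f f1 C δ G g T A q w) (ht : t ∈ Icc 0 T) (z : ℝ) :
    HasDerivWithinAt (fun s => flowInv (q s) z) (Real.exp (-q t (flowInv (q t) z)) *
      -∫ y in (0 : ℝ)..flowInv (q t) z, Real.exp (q t y) * lagField f1 δ (q t) (w t) y)
      (Icc 0 T) t := by
  have hq := h.continuous_left ht
  have hV := h.continuous_field ht
  have hD : Continuous fun x => ∫ y in (0 : ℝ)..x,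
      Real.exp (q t y) * lagField f1 δ (q t) (w t) y :=
    intervalIntegral.continuous_primitive (fun a b => Continuous.intervalIntegrable (by fun_prop) _ _) 0
  have h1 := (h.unifDeriv_flowMap ht (L := Real.exp (2 * A) * |z|) (by positivity)).comp
    (fun s hs => h.abs_flowInv_le hs z) (h.continuousWithinAt_flowInv ht z) hD
  have h2 : HasDerivWithinAt (fun s => flowMap (q t) (flowInv (q s) z))
      (-∫ y in (0 : ℝ)..flowInv (q t) z, Real.exp (q t y) * lagField f1 δ (q t) (w t) y)
      (Icc 0 T) t := by
    have hcongr : ∀ s ∈ Icc 0 T, flowMap (q t) (flowInv (q s) z) =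
        z - (flowMap (q s) (flowInv (q s) z) - flowMap (q t) (flowInv (q s) z)) := fun s hs => by
      rw [flowMap_flowInv (h.continuous_left hs) (h.abs_left_le hs)]; ring
    exact (h1.const_sub z).congr hcongr (hcongr t ht)
  have h3 : HasDerivAt (flowInv (q t)) (Real.exp (-q t (flowInv (q t) z)))
      (flowMap (q t) (flowInv (q t) z)) := by
    have := hasDerivAt_flowInv hq (h.abs_left_le ht) (flowMap (q t) (flowInv (q t) z))
    rwa [flowInv_flowMap hq] at this
  have h4 := h3.comp_hasDerivWithinAt t h2
  refine h4.congr (fun s _ => ?_) ?_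
  · exact (flowInv_flowMap hq _).symm
  · exact (flowInv_flowMap hq _).symm

theorem compactEnergy (h : LagFlow f f1 C δ G g T A q w) (ht : t ∈ Icc 0 T) :
    CompactEnergy (Real.exp (2 * A)) (Real.exp A * A) fun z => w t (flowInv (q t) z) :=
  (h.state t ht).compactEnergy h.pos h.le_one

theorem velocity_zero (h : LagFlow f f1 C δ G g T A q w) (ht : t ∈ Icc 0 T) :
    velocity f (fun z => w t (flowInv (q t) z)) 0 = 0 := by
  have := h.kernel.velocity_neg (w := fun z => w t (flowInv (q t) z))
    ((h.state t ht).odd_comp_flowInv h.pos h.le_one) 0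
  rw [neg_zero] at this
  linarith

theorem integral_field_eq (h : LagFlow f f1 C δ G g T A q w) (ht : t ∈ Icc 0 T) {x : ℝ}
    (hx : |x| ≤ δ) : ∫ y in (0 : ℝ)..x, Real.exp (q t y) * lagField f1 δ (q t) (w t) y =
      velocity f (fun z => w t (flowInv (q t) z)) (flowMap (q t) x) := by
  have hq := h.continuous_left ht
  have hV := h.continuous_field ht
  have hder : ∀ y ∈ uIcc 0 x, HasDerivAt
      (fun y => velocity f (fun z => w t (flowInv (q t) z)) (flowMap (q t) y))
      (Real.exp (q t y) * lagField f1 δ (q t) (w t) y) y := by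
    intro y hy
    have hy' : |y| ≤ δ := by
      have := abs_sub_left_of_mem_uIcc hy
      simp only [sub_zero] at this
      exact this.trans hx
    have := (h.kernel.hasDerivAt_velocity (h.compactEnergy ht) (flowMap (q t) y)).comp y
      (hasDerivAt_flowMap hq y)
    rw [mul_comm, lagField, clamp_of_abs_le hy']
    exact this
  rw [intervalIntegral.integral_eq_sub_of_hasDerivAt hder
    (Continuous.intervalIntegrable (by fun_prop) _ _), flowMap_zero, h.velocity_zero ht, sub_zero]

theorem hasDerivWithinAt_transport (h : LagFlow f f1 C δ G g T A q w) {θ₀ : ℝ → ℝ}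
    (hθ : ∀ x, HasDerivAt θ₀ (g x) x) (ht : t ∈ Icc 0 T) (z : ℝ) :
    HasDerivWithinAt (fun s => θ₀ (flowInv (q s) z))
      (-(velocity f (fun z => w t (flowInv (q t) z)) z *
        (g (flowInv (q t) z) * Real.exp (-q t (flowInv (q t) z))))) (Icc 0 T) t := by
  have h1 := (hθ (flowInv (q t) z)).comp_hasDerivWithinAt t (h.hasDerivWithinAt_flowInv ht z)
  refine h1.congr_deriv ?_
  rcases le_or_gt |flowInv (q t) z| δ with hx | hx
  · rw [h.integral_field_eq ht hx, flowMap_flowInv (h.continuous_left ht) (h.abs_left_le ht)]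
    ring
  · rw [h.force.support _ hx.le]; ring

theorem lipschitz_velocity (h : LagFlow f f1 C δ G g T A q w) (ht : t ∈ Icc 0 T) (a b : ℝ) :
    AbsolutelyContinuousOnInterval (velocity f fun z => w t (flowInv (q t) z)) a b := by
  have hb := (h.state t ht).abs_strain_le h.kernel h.pos h.le_one
  set K := 4 * (Real.exp A * A) + (2 + C) * (2 * Real.exp (2 * A) * A)
  have hK : 0 ≤ K := (abs_nonneg _).trans (hb 0)
  have : LipschitzWith ⟨K, hK⟩ (velocity f fun z => w t (flowInv (q t) z)) := by
    refine lipschitzWith_of_nnnorm_deriv_le (fun z =>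
      (h.kernel.hasDerivAt_velocity (h.compactEnergy ht) z).differentiableAt) fun z => ?_
    rw [(h.kernel.hasDerivAt_velocity (h.compactEnergy ht) z).deriv]
    exact hb z
  exact (this.lipschitzOnWith (s := uIcc a b)).absolutelyContinuousOnInterval

theorem integral_flowInv (h : LagFlow f f1 C δ G g T A q w) (ht : t ∈ Icc 0 T) {F : ℝ → ℝ}
    (hF : Continuous F) (z : ℝ) :
    ∫ y in (0 : ℝ)..flowInv (q t) z, F y * Real.exp (q t y) =
      ∫ ζ in (0 : ℝ)..z, F (flowInv (q t) ζ) := by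
  have hq := h.continuous_left ht
  have hΨ := continuous_flowInv hq (h.abs_left_le ht)
  have := intervalIntegral.integral_comp_mul_deriv (a := 0) (b := flowInv (q t) z)
    (f := flowMap (q t)) (f' := fun y => Real.exp (q t y)) (g := fun ζ => F (flowInv (q t) ζ))
    (fun x _ => hasDerivAt_flowMap hq x) (by fun_prop) (by fun_prop)
  rw [flowMap_zero, flowMap_flowInv hq (h.abs_left_le ht)] at this
  rw [← this]
  refine intervalIntegral.integral_congr fun y _ => ?_
  simp only [Function.comp_apply, flowInv_flowMap hq]

theorem hasDerivWithinAt_circulation (h : LagFlow f f1 C δ G g T A q w) (ht : t ∈ Icc 0 T)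
    (z : ℝ) : HasDerivWithinAt (fun s => ∫ ζ in (0 : ℝ)..z, w s (flowInv (q s) ζ))
      (∫ ζ in (0 : ℝ)..z, (g (flowInv (q t) ζ) * Real.exp (-q t (flowInv (q t) ζ)) -
        velocity f (fun z => w t (flowInv (q t) z)) ζ *
          deriv (fun z => w t (flowInv (q t) z)) ζ)) (Icc 0 T) t := by
  have hq := h.continuous_left ht
  have hV := h.continuous_field ht
  have hw := h.continuous_right ht
  have hg := h.force.continuous
  have hB := h.abs_left_le ht
  have hΨ := continuous_flowInv hq hB
  have hE := h.compactEnergy ht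
  set ω := fun z => w t (flowInv (q t) z) with hω
  have hD : Continuous fun x => ∫ y in (0 : ℝ)..x,
      (g y + w t y * (Real.exp (q t y) * lagField f1 δ (q t) (w t) y)) :=
    intervalIntegral.continuous_primitive (fun a b => Continuous.intervalIntegrable (by fun_prop) _ _) 0
  have h1 := (h.unifDeriv_circulation ht (L := Real.exp (2 * A) * |z|) (by positivity)).comp
    (fun s hs => h.abs_flowInv_le hs z) (h.continuousWithinAt_flowInv ht z) hD
  have h2 : HasDerivAt (fun x => ∫ y in (0 : ℝ)..x, w t y * Real.exp (q t y))
      (w t (flowInv (q t) z) * Real.exp (q t (flowInv (q t) z))) (flowInv (q t) z) :=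
    (Continuous.integral_hasStrictDerivAt (by fun_prop) 0 _).hasDerivAt
  have h3 := h1.add (h2.comp_hasDerivWithinAt t (h.hasDerivWithinAt_flowInv ht z))
  have hcongr : ∀ s ∈ Icc 0 T, ∫ ζ in (0 : ℝ)..z, w s (flowInv (q s) ζ) =
      (∫ y in (0 : ℝ)..flowInv (q s) z, w s y * Real.exp (q s y)) -
        (∫ y in (0 : ℝ)..flowInv (q s) z, w t y * Real.exp (q t y)) +
      ∫ y in (0 : ℝ)..flowInv (q s) z, w t y * Real.exp (q t y) := fun s hs => by
    rw [sub_add_cancel, h.integral_flowInv hs (h.continuous_right hs)]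
  refine (h3.congr hcongr (hcongr t ht)).congr_deriv ?_
  have e1 : ∫ y in (0 : ℝ)..flowInv (q t) z,
      (g y + w t y * (Real.exp (q t y) * lagField f1 δ (q t) (w t) y)) =
      ∫ ζ in (0 : ℝ)..z, (g (flowInv (q t) ζ) * Real.exp (-q t (flowInv (q t) ζ)) +
        strain f1 ω ζ * ω ζ) := by
    have hF : Continuous fun y => g y * Real.exp (-q t y) + lagField f1 δ (q t) (w t) y * w t y := by
      fun_prop
    rw [show (fun y => g y + w t y * (Real.exp (q t y) * lagField f1 δ (q t) (w t) y)) =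
      fun y => (g y * Real.exp (-q t y) + lagField f1 δ (q t) (w t) y * w t y) *
        Real.exp (q t y) by
        ext y
        have : Real.exp (-q t y) * Real.exp (q t y) = 1 := by rw [← Real.exp_add]; simp
        linear_combination (-g y) * this]
    rw [h.integral_flowInv ht hF]
    refine intervalIntegral.integral_congr fun ζ _ => ?_
    simp only [hω]
    rcases le_or_gt |flowInv (q t) ζ| δ with hx | hx
    · rw [lagField, clamp_of_abs_le hx, flowMap_flowInv hq hB]
    · rw [(h.state t ht).compact.support _ hx.le]; simp
  have hAC := h.lipschitz_velocity ht 0 z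
  have e2 := hAC.integral_mul_deriv_eq_deriv_mul (hE.energy.absolutelyContinuous 0 z)
  rw [h.velocity_zero ht, zero_mul, sub_zero] at e2
  have hderiv : deriv (velocity f ω) = strain f1 ω := by
    ext ζ; exact (h.kernel.hasDerivAt_velocity hE ζ).deriv
  rw [hderiv] at e2
  have hu : Continuous (velocity f ω) := continuous_iff_continuousAt.2 fun ζ =>
    (h.kernel.hasDerivAt_velocity hE ζ).continuousAt
  have hS := h.kernel.continuous_strain hE
  have hωc := hE.continuous
  have i1 : IntervalIntegrable (fun ζ => g (flowInv (q t) ζ) * Real.exp (-q t (flowInv (q t) ζ)))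
      volume 0 z := Continuous.intervalIntegrable (by fun_prop) _ _
  have i2 : IntervalIntegrable (fun ζ => velocity f ω ζ * deriv ω ζ) volume 0 z :=
    (MemLp.intervalIntegrable_of_two hE.energy.memLp_deriv 0 z).continuousOn_mul hu.continuousOn
  have i3 : IntervalIntegrable (fun ζ => strain f1 ω ζ * ω ζ) volume 0 z :=
    Continuous.intervalIntegrable (by fun_prop) _ _
  rw [intervalIntegral.integral_sub i1 i2, e2, e1, intervalIntegral.integral_add i1 i3]
  have e3 : w t (flowInv (q t) z) * Real.exp (q t (flowInv (q t) z)) *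
      (Real.exp (-q t (flowInv (q t) z)) * -∫ y in (0 : ℝ)..flowInv (q t) z,
        Real.exp (q t y) * lagField f1 δ (q t) (w t) y) = -(velocity f ω z * ω z) := by
    simp only [hω]
    rcases le_or_gt |flowInv (q t) z| δ with hx | hx
    · rw [h.integral_field_eq ht hx, flowMap_flowInv hq hB]
      have : Real.exp (q t (flowInv (q t) z)) * Real.exp (-q t (flowInv (q t) z)) = 1 := by
        rw [← Real.exp_add]; simp
      linear_combination (-w t (flowInv (q t) z) *
        velocity f (fun z => w t (flowInv (q t) z)) z) * this
    · rw [(h.state t ht).compact.support _ hx.le]; ring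
  rw [e3]
  ring

end LagFlow

theorem tendsto_zero_of_eventually_le_ofReal {α : Type*} {l : Filter α} {F : α → ℝ≥0∞}
    (h : ∀ ε : ℝ, 0 < ε → ∀ᶠ x in l, F x ≤ ENNReal.ofReal ε) : Tendsto F l (𝓝 0) := by
  rw [ENNReal.tendsto_nhds_zero]
  intro ε hε
  rcases eq_or_ne ε ⊤ with rfl | hne
  · exact Eventually.of_forall fun _ => le_top
  · have := h ε.toReal (ENNReal.toReal_pos hε.ne' hne)
    rwa [ENNReal.ofReal_toReal hne] at this

theorem CompactEnergy.isH1 {R K : ℝ} {w : ℝ → ℝ} (hw : CompactEnergy R K w) : IsH1 w (deriv w) :=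
  ⟨hw.memLp, hw.energy.memLp_deriv, hw.energy.intervalIntegral_deriv⟩

theorem CompactEnergy.eLpNorm_le {R K : ℝ} {w : ℝ → ℝ} (hR : 0 ≤ R) (hw : CompactEnergy R K w) :
    eLpNorm w 2 volume ≤ ENNReal.ofReal (K * (√R * √(2 * R))) := by
  rw [← mul_assoc]
  exact eLpNorm_two_le_of_support hw.memLp hR hw.abs_le hw.support

theorem isH1Curve_of_compactEnergy {T : ℝ} {v : ℝ → ℝ → ℝ}
    (hv : ∀ t ∈ Ico 0 T, ∃ R K, CompactEnergy R K (v t))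
    (hclose : ∀ t ∈ Ico 0 T, ∃ R, 0 < R ∧ ∀ ε > 0,
      ∀ᶠ s in 𝓝[Ico 0 T] t, CompactEnergy R ε fun x => v s x - v t x) :
    IsH1Curve T v fun t => deriv (v t) := by
  refine ⟨fun t ht => ?_, fun t ht => ?_, fun t ht => ?_⟩
  · obtain ⟨R, K, h⟩ := hv t ht
    exact h.isH1
  · obtain ⟨R, hR, h⟩ := hclose t ht
    refine tendsto_zero_of_eventually_le_ofReal fun ε hε => ?_
    have hc : 0 < √R * √(2 * R) := mul_pos (Real.sqrt_pos.2 hR) (Real.sqrt_pos.2 (by linarith))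
    filter_upwards [h (ε / (√R * √(2 * R))) (by positivity)] with s hs
    have := hs.eLpNorm_le hR.le
    rwa [div_mul_cancel₀ _ hc.ne'] at this
  · obtain ⟨R, hR, h⟩ := hclose t ht
    refine tendsto_zero_of_eventually_le_ofReal fun ε hε => ?_
    filter_upwards [h ε hε, self_mem_nhdsWithin] with s hs hsT
    obtain ⟨_, _, h1⟩ := hv s hsT
    obtain ⟨_, _, h2⟩ := hv t ht
    exact (eLpNorm_congr_ae (h1.energy.ae_deriv_sub h2.energy)).symm.trans_le
      hs.energy.eLpNorm_deriv_le

/-- A curve of functions with time derivative `N` that is continuous in the energy norm is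
differentiable in the energy norm. -/
theorem eventually_energyLE_sub {S : Set ℝ} (hS : Convex ℝ S) {t : ℝ} (ht : t ∈ S)
    {Y N : ℝ → ℝ → ℝ} (hY : ∀ s ∈ S, ∀ z, HasDerivWithinAt (fun s => Y s z) (N s z) S s)
    (hN : ∀ ε > 0, ∀ᶠ s in 𝓝[S] t, EnergyLE (fun z => N s z - N t z) ε) {ε : ℝ} (hε : 0 < ε) :
    ∀ᶠ s in 𝓝[S] t, EnergyLE (fun z => Y s z - Y t z - (s - t) * N t z) (ε * |s - t|) := by
  obtain ⟨ρ, hρ, hball⟩ := Metric.mem_nhdsWithin_iff.1 (hN ε hε)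
  filter_upwards [inter_mem (mem_nhdsWithin_of_mem_nhds (Metric.ball_mem_nhds t hρ))
    self_mem_nhdsWithin] with s hs
  have hseg : ∀ a ∈ Metric.ball t ρ ∩ S, ∀ b ∈ Metric.ball t ρ ∩ S, a ≤ b →
      EnergyLE (fun z => (Y b z - b * N t z) - (Y a z - a * N t z)) (ε * (b - a)) := by
    intro a ha b hb hab
    have hsub : Icc a b ⊆ Metric.ball t ρ ∩ S :=
      ((convex_ball t ρ).inter hS).ordConnected.out ha hb
    refine EnergyLE.sub_of_hasDerivWithinAt (q := fun r z => Y r z - r * N t z)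
      (V := fun r z => N r z - N t z) hab (fun r hr z => ?_) fun r hr => hball (hsub hr)
    have h1 := (hY r (hsub hr).2 z).mono (hsub.trans inter_subset_right)
    have h2 := ((hasDerivAt_id r).mul_const (N t z)).hasDerivWithinAt (s := Icc a b)
    rw [one_mul] at h2
    exact h1.sub h2
  have htmem : t ∈ Metric.ball t ρ ∩ S := ⟨Metric.mem_ball_self hρ, ht⟩
  rcases le_total t s with hle | hle
  · rw [abs_of_nonneg (sub_nonneg.2 hle)]
    convert hseg t htmem s hs hle using 2
    ring
  · rw [abs_of_nonpos (sub_nonpos.2 hle), neg_sub]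
    convert (hseg s hs t htmem hle).neg using 2
    ring

theorem eLpNorm_slope_le {ε a : ℝ} (ha : a ≠ 0) {p : ℝ → ℝ}
    (hp : eLpNorm p 2 volume ≤ ENNReal.ofReal (ε * |a|)) :
    eLpNorm (a⁻¹ • p) 2 volume ≤ ENNReal.ofReal ε := by
  rw [eLpNorm_const_smul]
  calc ‖a⁻¹‖ₑ * eLpNorm p 2 volume
      ≤ ENNReal.ofReal |a⁻¹| * ENNReal.ofReal (ε * |a|) := by
        rw [Real.enorm_eq_ofReal_abs]; gcongr
    _ = ENNReal.ofReal ε := by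
        rw [← ENNReal.ofReal_mul (abs_nonneg _), abs_inv]
        congr 1
        have : |a| ≠ 0 := abs_ne_zero.2 ha
        field_simp

namespace LagFlow

variable {f f1 : ℝ → ℝ → ℝ} {C δ G : ℝ} {g : ℝ → ℝ} {T A : ℝ} {q w : ℝ → ℝ → ℝ} {t : ℝ}

theorem eventually_energyLE_comp (h : LagFlow f f1 C δ G g T A q w) {M : ℝ} {v : ℝ → ℝ → ℝ}
    (hv : ∀ t ∈ Icc 0 T, LagState δ M (q t) (v t)) (ht : t ∈ Icc 0 T)
    (hclose : ∀ γ > 0, ∀ᶠ s in 𝓝[Icc 0 T] t, EnergyLE (fun x => v s x - v t x) γ)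
    {ε : ℝ} (hε : 0 < ε) : ∀ᶠ s in 𝓝[Icc 0 T] t,
      EnergyLE (fun z => v s (flowInv (q s) z) - v t (flowInv (q t) z)) ε := by
  obtain ⟨γ, hγ, hmod⟩ := LagState.exists_comp_modulus h.pos h.le_one M (hv t ht).compact.energy
    (half_pos hε)
  filter_upwards [hclose (ε / (2 * Real.exp M)) (by positivity), h.unifCont_left ht γ hγ,
    self_mem_nhdsWithin] with s h1 h2 hs
  have h3 := (hv s hs).energyLE_comp h.pos h.le_one h1
  have h4 := h3.add (hmod _ _ _ _ (hv s hs) (hv t ht) h2)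
  rw [show Real.exp M * (ε / (2 * Real.exp M)) + ε / 2 = ε by field_simp; ring] at h4
  convert h4 using 2
  ring

theorem exists_compactEnergy (h : LagFlow f f1 C δ G g T A q w) : ∃ R K, 0 < R ∧
    (∀ t ∈ Icc 0 T, CompactEnergy R K (fun z => w t (flowInv (q t) z)) ∧
      CompactEnergy R K fun z => g (flowInv (q t) z) * Real.exp (-q t (flowInv (q t) z))) ∧
    ∀ t ∈ Icc 0 T, ∀ ε > 0, ∀ᶠ s in 𝓝[Icc 0 T] t,
      CompactEnergy R ε (fun z => w s (flowInv (q s) z) - w t (flowInv (q t) z)) ∧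
      CompactEnergy R ε fun z => g (flowInv (q s) z) * Real.exp (-q s (flowInv (q s) z)) -
        g (flowInv (q t) z) * Real.exp (-q t (flowInv (q t) z)) := by
  obtain ⟨M, hAM, hM⟩ := h.exists_bound
  have hw := fun t ht => (hM t ht).2.1.compactEnergy h.pos h.le_one
  have hg := fun t ht => (hM t ht).2.2.compactEnergy h.pos h.le_one
  refine ⟨Real.exp (2 * M), Real.exp M * M, Real.exp_pos _, fun t ht => ⟨hw t ht, hg t ht⟩,
    fun t ht ε hε => ?_⟩
  have e1 := h.eventually_energyLE_comp (fun t ht => (hM t ht).2.1) ht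
    (fun γ hγ => (h.eventually_close ht hγ).mono fun s hs => hs.2.1.2) hε
  have e2 := h.eventually_energyLE_comp (v := fun t x => g x * Real.exp (-q t x))
    (fun t ht => (hM t ht).2.2) ht
    (fun γ hγ => (h.eventually_close ht hγ).mono fun s hs => hs.2.2.2) hε
  filter_upwards [e1, e2, self_mem_nhdsWithin] with s h1 h2 hs
  refine ⟨⟨h1, fun z hz => ?_⟩, ⟨h2, fun z hz => ?_⟩⟩
  · have a1 := (hw s hs).support z hz
    have a2 := (hw t ht).support z hz
    rw [a1, a2, sub_zero]
  · have a1 := (hg s hs).support z hz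
    have a2 := (hg t ht).support z hz
    rw [a1, a2, sub_zero]

/-- The right-hand side of the vorticity equation. -/
def vorticityRate (f : ℝ → ℝ → ℝ) (g : ℝ → ℝ) (q w : ℝ → ℝ → ℝ) (t z : ℝ) : ℝ :=
  g (flowInv (q t) z) * Real.exp (-q t (flowInv (q t) z)) -
    velocity f (fun z => w t (flowInv (q t) z)) z * deriv (fun z => w t (flowInv (q t) z)) z

theorem continuous_velocity (h : LagFlow f f1 C δ G g T A q w) (ht : t ∈ Icc 0 T) :
    Continuous (velocity f fun z => w t (flowInv (q t) z)) :=
  continuous_iff_continuousAt.2 fun ζ =>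
    (h.kernel.hasDerivAt_velocity (h.compactEnergy ht) ζ).continuousAt

theorem memLp_vorticityRate (h : LagFlow f f1 C δ G g T A q w) (ht : t ∈ Icc 0 T) :
    MemLp (vorticityRate f g q w t) 2 volume := by
  obtain ⟨R, K, hR, hc, -⟩ := h.exists_compactEnergy
  obtain ⟨c1, c2⟩ := hc t ht
  have hu := h.continuous_velocity ht
  obtain ⟨c, hcb⟩ := (isCompact_Icc (a := -R) (b := R)).exists_bound_of_continuousOn hu.continuousOn
  exact c2.memLp.sub (MemLp.mul_of_support c1.energy.memLp_deriv hu
    (fun x hx => hcb x (abs_le.1 hx)) fun x hx => c1.deriv_support hx).1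

theorem eventually_energyLE_vorticityRate (h : LagFlow f f1 C δ G g T A q w) (ht : t ∈ Icc 0 T)
    {ε : ℝ} (hε : 0 < ε) : ∀ᶠ s in 𝓝[Icc 0 T] t, EnergyLE (fun z =>
      (∫ ζ in (0 : ℝ)..z, vorticityRate f g q w s ζ) -
        ∫ ζ in (0 : ℝ)..z, vorticityRate f g q w t ζ) ε := by
  obtain ⟨R, K, hR, hc, hclose⟩ := h.exists_compactEnergy
  have hut := h.continuous_velocity ht
  obtain ⟨c, hcb⟩ := (isCompact_Icc (a := -R) (b := R)).exists_bound_of_continuousOn hut.continuousOn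
  have hc0 : 0 ≤ c := (norm_nonneg _).trans (hcb 0 ⟨by linarith, hR.le⟩)
  have hK0 : 0 ≤ K := (hc t ht).1.nonneg
  set D := velocityConst C R with hD
  have hD0 : 0 ≤ D := velocityConst_nonneg h.kernel.nonneg hR.le
  set B := √R * √(2 * R) + D * √R * K + c + 1 with hB
  have hB0 : 0 < B := by positivity
  have hη : 0 < ε / B := by positivity
  filter_upwards [hclose t ht _ hη, self_mem_nhdsWithin] with s hs hsT
  set η := ε / B with hηdef
  set ωs := fun z => w s (flowInv (q s) z) with hωs
  set ωt := fun z => w t (flowInv (q t) z) with hωt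
  obtain ⟨cs, cgs⟩ := hc s hsT
  obtain ⟨ct, cgt⟩ := hc t ht
  have hus := h.continuous_velocity hsT
  have b1 := hs.2.eLpNorm_le hR.le
  have m1 := hs.2.memLp
  have hvs : ∀ x, |x| ≤ R → |velocity f ωs x - velocity f ωt x| ≤ D * (η * √R) := by
    intro x hx
    rw [← h.kernel.velocity_sub cs ct]
    exact h.kernel.abs_velocity_le hs.1 hR.le hs.1.abs_le hx
  obtain ⟨m2, b2⟩ := MemLp.mul_of_support cs.energy.memLp_deriv (hus.sub hut) hvs
    fun x hx => cs.deriv_support hx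
  have hae := cs.energy.ae_deriv_sub ct.energy
  have m3' : MemLp (fun x => deriv ωs x - deriv ωt x) 2 volume :=
    cs.energy.memLp_deriv.sub ct.energy.memLp_deriv
  obtain ⟨m3, b3⟩ := MemLp.mul_of_support m3' hut
    (fun x hx => hcb x (abs_le.1 hx)) fun x hx => by
      rw [cs.deriv_support hx, ct.deriv_support hx, sub_zero]
  have b2' : eLpNorm (fun x => (velocity f ωs x - velocity f ωt x) * deriv ωs x) 2 volume ≤
      ENNReal.ofReal (D * (η * √R) * K) := by
    refine b2.trans ?_
    rw [ENNReal.ofReal_mul (p := D * (η * √R)) (by positivity)]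
    gcongr
    exact cs.energy.eLpNorm_deriv_le
  have b3' : eLpNorm (fun x => velocity f ωt x * (deriv ωs x - deriv ωt x)) 2 volume ≤
      ENNReal.ofReal (c * η) := by
    refine b3.trans ?_
    rw [ENNReal.ofReal_mul hc0, ← eLpNorm_congr_ae hae]
    gcongr
    exact hs.1.energy.eLpNorm_deriv_le
  have hsplit : (fun ζ => vorticityRate f g q w s ζ - vorticityRate f g q w t ζ) =
      (fun z => g (flowInv (q s) z) * Real.exp (-q s (flowInv (q s) z)) -
        g (flowInv (q t) z) * Real.exp (-q t (flowInv (q t) z))) -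
      ((fun x => (velocity f ωs x - velocity f ωt x) * deriv ωs x) +
        fun x => velocity f ωt x * (deriv ωs x - deriv ωt x)) := by
    ext ζ
    simp only [vorticityRate, Pi.sub_apply, Pi.add_apply]
    ring
  refine EnergyLE.of_weakDeriv (p := fun ζ => vorticityRate f g q w s ζ - vorticityRate f g q w t ζ)
    ((h.memLp_vorticityRate hsT).sub (h.memLp_vorticityRate ht)) (fun a b => ?_) hε.le ?_
  · have i1 := fun a b => MemLp.intervalIntegrable_of_two (h.memLp_vorticityRate hsT) a b
    have i2 := fun a b => MemLp.intervalIntegrable_of_two (h.memLp_vorticityRate ht) a b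
    rw [intervalIntegral.integral_sub (i1 a b) (i2 a b),
      ← intervalIntegral.integral_interval_sub_left (i1 0 b) (i1 0 a),
      ← intervalIntegral.integral_interval_sub_left (i2 0 b) (i2 0 a)]
    ring
  · rw [hsplit]
    refine (eLpNorm_sub_le m1.aestronglyMeasurable (m2.add m3).aestronglyMeasurable
      (by norm_num)).trans ?_
    refine (add_le_add b1 ((eLpNorm_add_le m2.aestronglyMeasurable m3.aestronglyMeasurable
      (by norm_num)).trans (add_le_add b2' b3'))).trans ?_
    rw [← ENNReal.ofReal_add (by positivity) (by positivity),
      ← ENNReal.ofReal_add (by positivity) (by positivity)]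
    refine ENNReal.ofReal_le_ofReal ?_
    have : η * B = ε := by rw [hηdef]; field_simp
    nlinarith [this]

theorem tendsto_vorticity_eq (h : LagFlow f f1 C δ G g T A q w) (ht : t ∈ Icc 0 T) :
    Tendsto (fun s => eLpNorm (fun x => (w s (flowInv (q s) x) - w t (flowInv (q t) x)) / (s - t) -
      vorticityRate f g q w t x) 2 volume) (𝓝[Icc 0 T \ {t}] t) (𝓝 0) := by
  refine tendsto_zero_of_eventually_le_ofReal fun ε hε => ?_
  let Y : ℝ → ℝ → ℝ := fun s z => ∫ ζ in (0 : ℝ)..z, w s (flowInv (q s) ζ)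
  let N : ℝ → ℝ → ℝ := fun s z => ∫ ζ in (0 : ℝ)..z, vorticityRate f g q w s ζ
  filter_upwards [(eventually_energyLE_sub (Y := Y) (N := N) (convex_Icc 0 T) ht
    (fun s hs z => h.hasDerivWithinAt_circulation hs z)
    (fun ε hε => h.eventually_energyLE_vorticityRate ht hε) hε).filter_mono
      (nhdsWithin_mono t sdiff_subset), self_mem_nhdsWithin] with s hE hs
  obtain ⟨hsT, hst⟩ := hs
  have hst' : s - t ≠ 0 := sub_ne_zero.2 hst
  let p : ℝ → ℝ := fun z => w s (flowInv (q s) z) - w t (flowInv (q t) z) -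
    (s - t) * vorticityRate f g q w t z
  have m1 := (h.compactEnergy hsT).memLp
  have m2 := (h.compactEnergy ht).memLp
  have m3 := (h.memLp_vorticityRate ht).const_mul (s - t)
  have hp : MemLp p 2 volume := (m1.sub m2).sub m3
  have hpint : ∀ a b, ∫ x in a..b, p x = (Y s b - Y t b - (s - t) * N t b) -
      (Y s a - Y t a - (s - t) * N t a) := by
    intro a b
    have i1 := fun a b => MemLp.intervalIntegrable_of_two m1 a b
    have i2 := fun a b => MemLp.intervalIntegrable_of_two m2 a b
    have i3 := fun a b => MemLp.intervalIntegrable_of_two (h.memLp_vorticityRate ht) a b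
    have i4 := fun a b => MemLp.intervalIntegrable_of_two m3 a b
    simp only [p]
    rw [intervalIntegral.integral_sub ((i1 a b).sub (i2 a b)) (i4 a b),
      intervalIntegral.integral_sub (i1 a b) (i2 a b), intervalIntegral.integral_const_mul,
      ← intervalIntegral.integral_interval_sub_left (i1 0 b) (i1 0 a),
      ← intervalIntegral.integral_interval_sub_left (i2 0 b) (i2 0 a),
      ← intervalIntegral.integral_interval_sub_left (i3 0 b) (i3 0 a)]
    simp only [Y, N]
    ring
  have hae := weakDeriv_ae_eq (hp.locallyIntegrable (by norm_num)) hpint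
  have hnorm := hE.eLpNorm_deriv_le
  rw [eLpNorm_congr_ae hae] at hnorm
  have hfun : (fun x => (w s (flowInv (q s) x) - w t (flowInv (q t) x)) / (s - t) -
      vorticityRate f g q w t x) = (s - t)⁻¹ • p := by
    ext x
    simp only [p, Pi.smul_apply, smul_eq_mul]
    field_simp
  rw [hfun]
  exact eLpNorm_slope_le hst' hnorm

theorem hasDerivAt_density (h : LagFlow f f1 C δ G g T A q w) {θ₀ : ℝ → ℝ}
    (hθ : ∀ x, HasDerivAt θ₀ (g x) x) (ht : t ∈ Icc 0 T) (z : ℝ) :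
    HasDerivAt (fun z => θ₀ (flowInv (q t) z))
      (g (flowInv (q t) z) * Real.exp (-q t (flowInv (q t) z))) z :=
  (hθ _).comp z (hasDerivAt_flowInv (h.continuous_left ht) (h.abs_left_le ht) z)

end LagFlow

theorem flowInv_zero_fun (z : ℝ) : flowInv 0 z = z := by
  have h1 : ∀ x, flowMap 0 x = x := fun x => by simp [flowMap]
  conv_lhs => rw [← h1 z]
  exact flowInv_flowMap (q := 0) continuous_const z

/-- A Lagrangian solution on `[0, Tstar)` gives a solution of the Eulerian system. -/
theorem isSolution_of_lagFlow {f f1 : ℝ → ℝ → ℝ} {C δ G : ℝ} {g : ℝ → ℝ} {Tstar : ℝ}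
    {q w : ℝ → ℝ → ℝ} (h : ∀ T < Tstar, ∃ A, LagFlow f f1 C δ G g T A q w) {ω₀ θ₀ : ℝ → ℝ}
    (hθ : ∀ x, HasDerivAt θ₀ (g x) x) (hq : q 0 = 0) (hw : w 0 = ω₀) :
    IsSolution f Tstar ω₀ θ₀ (fun t z => w t (flowInv (q t) z)) fun t z => θ₀ (flowInv (q t) z) := by
  have hloc : ∀ t ∈ Ico 0 Tstar, ∃ T A, t ∈ Icc 0 T ∧ LagFlow f f1 C δ G g T A q w ∧
      𝓝[Ico 0 Tstar] t = 𝓝[Icc 0 T] t ∧ 𝓝[Ico 0 Tstar \ {t}] t = 𝓝[Icc 0 T \ {t}] t := by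
    intro t ht
    obtain ⟨T, hT1, hT2⟩ := exists_between ht.2
    obtain ⟨A, hA⟩ := h T hT2
    have key : Ico 0 Tstar ∩ Iio T = Icc 0 T ∩ Iio T := by
      ext s
      simp only [mem_inter_iff, mem_Ico, mem_Iio, mem_Icc]
      constructor
      · rintro ⟨⟨h1, h2⟩, h3⟩; exact ⟨⟨h1, h3.le⟩, h3⟩
      · rintro ⟨⟨h1, h2⟩, h3⟩; exact ⟨⟨h1, h3.trans hT2⟩, h3⟩
    refine ⟨T, A, ⟨ht.1, hT1.le⟩, hA, nhdsWithin_eq_nhdsWithin hT1 isOpen_Iio key,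
      nhdsWithin_eq_nhdsWithin hT1 isOpen_Iio ?_⟩
    rw [sdiff_eq, sdiff_eq, inter_right_comm, key, inter_right_comm]
  have hdθ : ∀ t ∈ Ico 0 Tstar, deriv (fun z => θ₀ (flowInv (q t) z)) =
      fun z => g (flowInv (q t) z) * Real.exp (-q t (flowInv (q t) z)) := by
    intro t ht
    obtain ⟨T, A, htT, hA, -, -⟩ := hloc t ht
    ext z
    exact (hA.hasDerivAt_density hθ htT z).deriv
  refine ⟨?_, ?_, fun S hS => ?_, fun t ht z => ?_, ⟨_, isH1Curve_of_compactEnergy (fun t ht => ?_)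
    fun t ht => ?_⟩, fun t ht z => ?_, ⟨_, isH1Curve_of_compactEnergy (fun t ht => ?_)
    fun t ht => ?_, fun t ht => ?_⟩⟩
  · ext z
    simp only [hq, flowInv_zero_fun, hw]
  · ext z
    simp only [hq, flowInv_zero_fun]
  · obtain ⟨A, hA⟩ := h S hS
    obtain ⟨R, K, hR, hc, -⟩ := hA.exists_compactEnergy
    refine ⟨R, fun t ht x hx => ⟨(hc t ht).1.support x hx.le, ?_⟩⟩
    rw [hdθ t ⟨ht.1, lt_of_le_of_lt ht.2 hS⟩]
    exact (hc t ht).2.support x hx.le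
  · obtain ⟨T, A, htT, hA, -, -⟩ := hloc t ht
    exact (hA.hasDerivAt_density hθ htT z).differentiableAt
  · obtain ⟨T, A, htT, hA, -, -⟩ := hloc t ht
    obtain ⟨R, K, hR, hc, -⟩ := hA.exists_compactEnergy
    rw [hdθ t ht]
    exact ⟨R, K, (hc t htT).2⟩
  · obtain ⟨T, A, htT, hA, hn, -⟩ := hloc t ht
    obtain ⟨R, K, hR, hc, hcl⟩ := hA.exists_compactEnergy
    refine ⟨R, hR, fun ε hε => ?_⟩
    have h1 := hcl t htT ε hε
    rw [← hn] at h1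
    filter_upwards [h1, self_mem_nhdsWithin] with s hs hsT
    rw [hdθ t ht, hdθ s hsT]
    exact hs.2
  · obtain ⟨T, A, htT, hA, hn, -⟩ := hloc t ht
    rw [hdθ t ht]
    have := hA.hasDerivWithinAt_transport hθ htT z
    refine HasDerivWithinAt.mono_of_mem_nhdsWithin this ?_
    rw [hn]; exact self_mem_nhdsWithin
  · obtain ⟨T, A, htT, hA, -, -⟩ := hloc t ht
    obtain ⟨R, K, hR, hc, -⟩ := hA.exists_compactEnergy
    exact ⟨R, K, (hc t htT).1⟩
  · obtain ⟨T, A, htT, hA, hn, -⟩ := hloc t ht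
    obtain ⟨R, K, hR, hc, hcl⟩ := hA.exists_compactEnergy
    refine ⟨R, hR, fun ε hε => ?_⟩
    have h1 := hcl t htT ε hε
    rw [← hn] at h1
    exact h1.mono fun s hs => hs.1
  · obtain ⟨T, A, htT, hA, -, hn⟩ := hloc t ht
    rw [hn, hdθ t ht]
    exact hA.tendsto_vorticity_eq htT

theorem enorm_le_eLpNorm_top {h : ℝ → ℝ} (hh : Continuous h) (x : ℝ) :
    ‖h x‖ₑ ≤ eLpNorm h ∞ volume := by
  have hae : ∀ᵐ y, ‖h y‖ₑ ≤ eLpNorm h ∞ volume := by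
    rw [eLpNorm_exponent_top]; exact enorm_ae_le_eLpNormEssSup h volume
  have hcl : IsClosed {y | ‖h y‖ₑ ≤ eLpNorm h ∞ volume} :=
    isClosed_le hh.enorm continuous_const
  have hd : Dense {y | ‖h y‖ₑ ≤ eLpNorm h ∞ volume} := Measure.dense_of_ae hae
  have := hd.closure_eq
  rw [hcl.closure_eq] at this
  have hx : x ∈ {y | ‖h y‖ₑ ≤ eLpNorm h ∞ volume} := by rw [this]; exact mem_univ x
  exact hx

theorem gradientIntegral_mono (f : ℝ → ℝ → ℝ) (ω : ℝ → ℝ → ℝ) : Monotone (gradientIntegral f ω) :=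
  fun _ _ h => lintegral_mono_set (Ioc_subset_Ioc_right h)

theorem gradientIntegral_lt_top {f f1 : ℝ → ℝ → ℝ} {C R K : ℝ} (hf : KernelReg f f1 C)
    (hR : 0 ≤ R) {ω : ℝ → ℝ → ℝ} {t : ℝ} (hω : ∀ s ∈ Icc 0 t, CompactEnergy R K (ω s)) :
    gradientIntegral f ω t < ∞ := by
  set B := 4 * K + (2 + C) * (2 * R * (K * √R)) with hB
  have hb : ∀ s ∈ Ioc 0 t, eLpNorm (deriv (velocity f (ω s))) ∞ volume ≤ ENNReal.ofReal B := by
    intro s hs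
    have hc := hω s ⟨hs.1.le, hs.2⟩
    have hd : deriv (velocity f (ω s)) = strain f1 (ω s) := by
      ext z; exact (hf.hasDerivAt_velocity hc z).deriv
    rw [hd, eLpNorm_exponent_top]
    refine eLpNormEssSup_le_of_ae_bound (ae_of_all _ fun z => ?_)
    have h1 := hf.abs_strain_le hc z one_pos
    rw [Real.sqrt_one, mul_one, div_one] at h1
    have h2 := mul_le_mul_of_nonneg_left (hc.integral_abs_le_of_bound hR hc.abs_le)
      (show 0 ≤ 2 + C by linarith [hf.nonneg])
    rw [Real.norm_eq_abs]
    linarith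
  calc gradientIntegral f ω t ≤ ∫⁻ τ in Ioc 0 t, ENNReal.ofReal B :=
        setLIntegral_mono' measurableSet_Ioc hb
    _ = ENNReal.ofReal B * volume (Ioc 0 t) := by rw [setLIntegral_const]
    _ < ∞ := by
        rw [Real.volume_Ioc]
        exact ENNReal.mul_lt_top ENNReal.ofReal_lt_top ENNReal.ofReal_lt_top

theorem EnergyLE.of_tendsto_const {h : ℝ → ℝ} {K : ℕ → ℝ} {L : ℝ} (hh : ∀ n, EnergyLE h (K n))
    (hK : Tendsto K atTop (𝓝 L)) : EnergyLE h L :=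
  fun n a b hab hd => ge_of_tendsto' hK fun k => hh k n a b hab hd

namespace LagFlow

variable {f f1 : ℝ → ℝ → ℝ} {C δ G : ℝ} {g : ℝ → ℝ} {T A : ℝ} {q w : ℝ → ℝ → ℝ} {t : ℝ}

theorem ofReal_abs_left_le (h : LagFlow f f1 C δ G g T A q w) (hq0 : q 0 = 0) (ht : t ∈ Icc 0 T)
    (x : ℝ) :
    ENNReal.ofReal |q t x| ≤ gradientIntegral f (fun t z => w t (flowInv (q t) z)) t := by
  have hsub : Icc 0 t ⊆ Icc 0 T := Icc_subset_Icc_right ht.2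
  have hVc : ContinuousOn (fun s => lagField f1 δ (q s) (w s) x) (Icc 0 t) := by
    intro s hs
    rw [ContinuousWithinAt, Metric.tendsto_nhds]
    intro ε hε
    have := h.unifCont_field (hsub hs) (ε / 2) (half_pos hε)
    filter_upwards [nhdsWithin_mono s hsub this] with r hr
    rw [Real.dist_eq]
    exact lt_of_le_of_lt (hr x) (half_lt_self hε)
  have hint : ∫ s in (0 : ℝ)..t, lagField f1 δ (q s) (w s) x = q t x - q 0 x := by
    refine intervalIntegral.integral_eq_sub_of_hasDeriv_right_of_le (f := fun s => q s x) ht.1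
      (fun s hs => ?_) (fun s hs => ?_) ?_
    · exact ((h.curve.hasDeriv_left s (hsub hs) x).mono hsub).continuousWithinAt
    · refine (h.curve.hasDeriv_left s (hsub (Ioo_subset_Icc_self hs)) x).mono_of_mem_nhdsWithin ?_
      refine mem_nhdsWithin_of_mem_nhds (Icc_mem_nhds hs.1 (lt_of_lt_of_le hs.2 ht.2))
    · rw [← uIcc_of_le ht.1] at hVc
      exact hVc.intervalIntegrable
  rw [hq0, Pi.zero_apply, sub_zero, intervalIntegral.integral_of_le ht.1] at hint
  rw [← Real.enorm_eq_ofReal_abs, ← hint]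
  refine (enorm_integral_le_lintegral_enorm _).trans ?_
  refine setLIntegral_mono' measurableSet_Ioc fun s hs => ?_
  have hsT : s ∈ Icc 0 T := hsub ⟨hs.1.le, hs.2⟩
  have hd : deriv (velocity f fun z => w s (flowInv (q s) z)) =
      strain f1 fun z => w s (flowInv (q s) z) := by
    ext z; exact (h.kernel.hasDerivAt_velocity (h.compactEnergy hsT) z).deriv
  simp only
  rw [hd]
  exact enorm_le_eLpNorm_top (h.kernel.continuous_strain (h.compactEnergy hsT)) _

theorem energyLE_field_le (h : LagFlow f f1 C δ G g T A q w) (ht : t ∈ Icc 0 T) {B W K : ℝ}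
    (hB : ∀ x, |q t x| ≤ B) (hW : ∀ x, |w t x| ≤ W) (hw : EnergyLE (w t) K) :
    EnergyLE (lagField f1 δ (q t) (w t))
      (Real.exp (B / 2) * (Real.exp (B / 2) * K + 2 * C * (2 * Real.exp B * W))) := by
  have hq := h.continuous_left ht
  have hs := h.state t ht
  have hc : CompactEnergy (Real.exp B) (Real.exp (B / 2) * K) fun z => w t (flowInv (q t) z) := by
    have h1 := CompactEnergy.comp_flowInv (w := w t) ⟨hw, hs.compact.support⟩ hq hB hs.even
    refine h1.mono ((flowMap_le_exp hq hB h.pos.le).trans ?_) le_rfl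
    exact mul_le_of_le_one_right (Real.exp_pos _).le h.le_one
  have h2 : EnergyLE (strain f1 fun z => w t (flowInv (q t) z))
      (Real.exp (B / 2) * K + 2 * C * (2 * Real.exp B * W)) := by
    refine (h.kernel.energyLE_strain hc).mono (add_le_add_right ?_ _)
    exact mul_le_mul_of_nonneg_left (hc.integral_abs_le_of_bound (Real.exp_pos _).le
      fun _ => hW _) (by linarith [h.kernel.nonneg])
  refine h2.comp_monotone (Φ := fun x => flowMap (q t) (clamp δ x))
    ((strictMono_flowMap hq).monotone.comp monotone_clamp) (Real.exp_pos _).le ?_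
  intro x y hxy
  have h1 := flowMap_sub_le hq hB (monotone_clamp (δ := δ) hxy)
  rw [← Real.exp_nat_mul, show ((2 : ℕ) : ℝ) * (B / 2) = B by push_cast; ring]
  exact h1.trans (mul_le_mul_of_nonneg_left (clamp_sub_le hxy) (Real.exp_pos _).le)

theorem energyLE_force_le (h : LagFlow f f1 C δ G g T A q w) {B K : ℝ}
    (hB : ∀ x, |q t x| ≤ B) (hq : EnergyLE (q t) K) :
    EnergyLE (fun x => g x * Real.exp (-q t x)) (Real.exp B * G + G * Real.exp B * K) := by
  have hg := h.force
  have hG : ∀ x, |g x| ≤ G := fun x => (hg.abs_le x).trans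
    (mul_le_of_le_one_right hg.nonneg (Real.sqrt_le_one.2 h.le_one))
  refine hg.energy.of_abs_sub_le (Real.exp_pos B).le
    (mul_nonneg hg.nonneg (Real.exp_pos B).le) hq fun x y _ => ?_
  rw [show g y * Real.exp (-q t y) - g x * Real.exp (-q t x) =
      Real.exp (-q t y) * (g y - g x) + g x * (Real.exp (-q t y) - Real.exp (-q t x)) by ring]
  refine (abs_add_le _ _).trans (add_le_add ?_ ?_)
  · rw [abs_mul, Real.abs_exp]
    exact mul_le_mul_of_nonneg_right (Real.exp_le_exp.2 (by linarith [(abs_le.1 (hB y)).1]))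
      (abs_nonneg _)
  · rw [abs_mul, mul_assoc]
    refine mul_le_mul (hG x) ?_ (abs_nonneg _) hg.nonneg
    have := abs_exp_sub_exp_le (a := -q t y) (b := -q t x) (B := B)
      (by linarith [(abs_le.1 (hB y)).1]) (by linarith [(abs_le.1 (hB x)).1])
    rwa [show -q t y - -q t x = -(q t y - q t x) by ring, abs_neg] at this

theorem abs_right_sub_le (h : LagFlow f f1 C δ G g T A q w) (ht : t ∈ Icc 0 T) {B : ℝ}
    (hB : ∀ s ∈ Icc 0 T, ∀ x, |q s x| ≤ B) (x : ℝ) :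
    |w t x - w 0 x| ≤ G * Real.exp B * T := by
  have hG0 := h.force.nonneg
  have hbound : ∀ s ∈ Icc 0 T, ‖g x * Real.exp (-q s x)‖ ≤ G * Real.exp B := by
    intro s hs
    rw [Real.norm_eq_abs, abs_mul, Real.abs_exp]
    refine mul_le_mul ((h.force.abs_le x).trans
      (mul_le_of_le_one_right hG0 (Real.sqrt_le_one.2 h.le_one))) ?_ (Real.exp_pos _).le hG0
    exact Real.exp_le_exp.2 (by linarith [(abs_le.1 (hB s hs x)).1])
  have := (convex_Icc 0 T).norm_image_sub_le_of_norm_hasDerivWithin_le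
    (fun s hs => h.curve.hasDeriv_right s hs x) hbound ⟨le_rfl, ht.1.trans ht.2⟩ ht
  rw [Real.norm_eq_abs, Real.norm_eq_abs, sub_zero, abs_of_nonneg ht.1] at this
  exact this.trans (mul_le_mul_of_nonneg_left ht.2 (by positivity))

/-- Over a time step of length `1 / (2 c)` the energies at most double. -/
theorem energyLE_step (h : LagFlow f f1 C δ G g T A q w) {c k a : ℝ} (hc : 0 < c) (hk : 0 ≤ k)
    (ha : 0 ≤ a) (hrate : ∀ s ∈ Icc 0 T, ∀ K, 0 ≤ K → EnergyLE (q s) K → EnergyLE (w s) K →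
      EnergyLE (lagField f1 δ (q s) (w s)) (c * (1 + K)) ∧
      EnergyLE (fun x => g x * Real.exp (-q s x)) (c * (1 + K)))
    (hqa : EnergyLE (q a) k) (hwa : EnergyLE (w a) k) (hat : a ≤ t) (htT : t ≤ T)
    (hta : t - a ≤ 1 / (2 * c)) : EnergyLE (q t) (2 * k + 1) ∧ EnergyLE (w t) (2 * k + 1) := by
  have h0T : (0 : ℝ) ∈ Icc 0 T := ⟨le_rfl, ha.trans (hat.trans htT)⟩
  have hA : 0 ≤ A := (h.state 0 h0T).nonneg
  have hsub : Icc a t ⊆ Icc 0 T := Icc_subset_Icc ha htT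
  have key : ∀ n : ℕ, ∀ s ∈ Icc a t, EnergyLE (q s) (2 * k + 1 + A * (1 / 2) ^ n) ∧
      EnergyLE (w s) (2 * k + 1 + A * (1 / 2) ^ n) := by
    intro n
    induction n with
    | zero =>
      intro s hs
      have := h.state s (hsub hs)
      exact ⟨this.energy.mono (by simp; linarith), this.compact.energy.mono (by simp; linarith)⟩
    | succ n ih =>
      intro s hs
      have hsub' : Icc a s ⊆ Icc 0 T := (Icc_subset_Icc_right hs.2).trans hsub
      set K := 2 * k + 1 + A * (1 / 2) ^ n with hK
      have hK0 : 0 ≤ K := by positivity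
      have hr := fun r (hr : r ∈ Icc a s) => hrate r (hsub' hr) K hK0
        (ih r ⟨hr.1, hr.2.trans hs.2⟩).1 (ih r ⟨hr.1, hr.2.trans hs.2⟩).2
      have e1 := EnergyLE.sub_of_hasDerivWithinAt hs.1
        (fun r hr x => (h.curve.hasDeriv_left r (hsub' hr) x).mono hsub') fun r hr' => (hr r hr').1
      have e2 := EnergyLE.sub_of_hasDerivWithinAt hs.1
        (fun r hr x => (h.curve.hasDeriv_right r (hsub' hr) x).mono hsub') fun r hr' => (hr r hr').2
      have hle : k + c * (1 + K) * (s - a) ≤ 2 * k + 1 + A * (1 / 2) ^ (n + 1) := by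
        have h1 : c * (1 + K) * (s - a) ≤ c * (1 + K) * (1 / (2 * c)) := by
          gcongr
          linarith [hs.2]
        have h2 : c * (1 + K) * (1 / (2 * c)) = (1 + K) / 2 := by field_simp
        rw [h2] at h1
        rw [pow_succ]
        linarith
      exact ⟨EnergyLE.mono (by simpa using hqa.add e1) hle,
        EnergyLE.mono (by simpa using hwa.add e2) hle⟩
  have hlim : Tendsto (fun n : ℕ => 2 * k + 1 + A * (1 / 2 : ℝ) ^ n) atTop (𝓝 (2 * k + 1)) := by
    have := (tendsto_pow_atTop_nhds_zero_of_lt_one (r := (1 / 2 : ℝ)) (by norm_num)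
      (by norm_num)).const_mul A |>.const_add (2 * k + 1)
    simpa using this
  exact ⟨EnergyLE.of_tendsto_const (fun n => (key n t ⟨hat, le_rfl⟩).1) hlim,
    EnergyLE.of_tendsto_const (fun n => (key n t ⟨hat, le_rfl⟩).2) hlim⟩

end LagFlow

/-- If the integral of the velocity gradient stays bounded, so do the states. -/
theorem exists_bound_of_gradientIntegral_le {f f1 : ℝ → ℝ → ℝ} {C δ G : ℝ} {g : ℝ → ℝ} {Tstar : ℝ}
    {q w : ℝ → ℝ → ℝ} (hT : 0 < Tstar) (h : ∀ T < Tstar, ∃ A, LagFlow f f1 C δ G g T A q w)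
    (hq : q 0 = 0) {B : ℝ} (hB0 : 0 ≤ B)
    (hB : ∀ t < Tstar, gradientIntegral f (fun t z => w t (flowInv (q t) z)) t ≤
      ENNReal.ofReal B) :
    ∃ A, ∀ t ∈ Ico 0 Tstar, LagState δ A (q t) (w t) := by
  obtain ⟨A0, h0⟩ := h 0 hT
  have hs0 := h0.state 0 ⟨le_rfl, le_rfl⟩
  have hA0 := hs0.nonneg
  have hC := h0.kernel.nonneg
  have hG := h0.force.nonneg
  have hqB : ∀ t ∈ Ico 0 Tstar, ∀ x, |q t x| ≤ B := by
    intro t ht x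
    obtain ⟨A, hA⟩ := h t ht.2
    have := (hA.ofReal_abs_left_le hq ⟨ht.1, le_rfl⟩ x).trans (hB t ht.2)
    rwa [ENNReal.ofReal_le_ofReal_iff hB0] at this
  set W := A0 + G * Real.exp B * Tstar with hW
  have hW0 : 0 ≤ W := by positivity
  have hwW : ∀ t ∈ Ico 0 Tstar, ∀ x, |w t x| ≤ W := by
    intro t ht x
    obtain ⟨A, hA⟩ := h t ht.2
    have h1 := hA.abs_right_sub_le ⟨ht.1, le_rfl⟩
      (fun s hs => hqB s ⟨hs.1, lt_of_le_of_lt hs.2 ht.2⟩) x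
    have h2 := hs0.abs_right_le h0.le_one x
    have h3 : |w t x| ≤ |w t x - w 0 x| + |w 0 x| := by
      simpa using abs_add_le (w t x - w 0 x) (w 0 x)
    have h4 : G * Real.exp B * t ≤ G * Real.exp B * Tstar := by
      have := ht.2.le; gcongr
    linarith
  set c := Real.exp (B / 2) * Real.exp (B / 2) + Real.exp (B / 2) * (2 * C * (2 * Real.exp B * W))
    + Real.exp B * G + 1 with hc
  have hcpos : 0 < c := by positivity
  have hrate : ∀ s ∈ Ico 0 Tstar, ∀ K, 0 ≤ K → EnergyLE (q s) K → EnergyLE (w s) K →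
      EnergyLE (lagField f1 δ (q s) (w s)) (c * (1 + K)) ∧
      EnergyLE (fun x => g x * Real.exp (-q s x)) (c * (1 + K)) := by
    intro s hs K hK hqK hwK
    obtain ⟨A, hA⟩ := h s hs.2
    have e1 := hA.energyLE_field_le ⟨hs.1, le_rfl⟩ (hqB s hs) (hwW s hs) hwK
    have e2 := hA.energyLE_force_le (hqB s hs) hqK
    have p1 : 0 ≤ Real.exp (B / 2) * Real.exp (B / 2) := by positivity
    have p2 : 0 ≤ Real.exp (B / 2) * (2 * C * (2 * Real.exp B * W)) := by positivity
    have p3 : 0 ≤ Real.exp B * G := by positivity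
    have p4 := mul_nonneg p2 hK
    have p5 := mul_nonneg p3 hK
    have p6 := mul_nonneg p1 hK
    refine ⟨e1.mono ?_, e2.mono ?_⟩
    · rw [hc]; linarith
    · rw [hc]; linarith
  let k : ℕ → ℝ := fun n => n.rec A0 fun _ k => 2 * k + 1
  have hk0 : ∀ n, 0 ≤ k n := by
    intro n
    induction n with
    | zero => exact hA0
    | succ n ih => show 0 ≤ 2 * k n + 1; linarith
  have hkmono : Monotone k := monotone_nat_of_le_succ fun n => by
    show k n ≤ 2 * k n + 1; linarith [hk0 n]
  have hind : ∀ n : ℕ, ∀ t ∈ Ico 0 Tstar, t ≤ n * (1 / (2 * c)) →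
      EnergyLE (q t) (k n) ∧ EnergyLE (w t) (k n) := by
    intro n
    induction n with
    | zero =>
      intro t ht htn
      have : t = 0 := le_antisymm (by simpa using htn) ht.1
      rw [this]
      exact ⟨hs0.energy, hs0.compact.energy⟩
    | succ n ih =>
      intro t ht htn
      rcases le_or_gt t (n * (1 / (2 * c))) with hle | hgt
      · exact ⟨(ih t ht hle).1.mono (hkmono (Nat.le_succ n)),
          (ih t ht hle).2.mono (hkmono (Nat.le_succ n))⟩
      · obtain ⟨A, hA⟩ := h t ht.2
        have ha : (0 : ℝ) ≤ n * (1 / (2 * c)) := by positivity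
        have hi := ih (n * (1 / (2 * c))) ⟨ha, hgt.trans ht.2⟩ le_rfl
        refine hA.energyLE_step hcpos (hk0 n) ha
          (fun s hs => hrate s ⟨hs.1, lt_of_le_of_lt hs.2 ht.2⟩) hi.1 hi.2 hgt.le le_rfl ?_
        push_cast at htn
        linarith
  obtain ⟨N, hN⟩ := exists_nat_ge (Tstar / (1 / (2 * c)))
  refine ⟨max (k N) B, fun t ht => ?_⟩
  have htN : t ≤ N * (1 / (2 * c)) := by
    rw [div_le_iff₀ (by positivity)] at hN
    exact ht.2.le.trans hN
  obtain ⟨A, hA⟩ := h t ht.2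
  have hst := hA.state t ⟨ht.1, le_rfl⟩
  obtain ⟨e1, e2⟩ := hind N t ht htN
  exact ⟨hst.even, hst.const, (hqB t ht 0).trans (le_max_right _ _), e1.mono (le_max_left _ _),
    hst.odd, e2.mono (le_max_left _ _), hst.compact.support⟩

theorem tendsto_gradientIntegral {f f1 : ℝ → ℝ → ℝ} {C δ G : ℝ} {g : ℝ → ℝ} {Tstar : ℝ}
    {q w : ℝ → ℝ → ℝ} (hT : 0 < Tstar) (h : ∀ T < Tstar, ∃ A, LagFlow f f1 C δ G g T A q w)
    (hq : q 0 = 0) (hunb : ∀ A, ∃ t ∈ Ico 0 Tstar, ¬ LagState δ A (q t) (w t)) :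
    Tendsto (gradientIntegral f fun t z => w t (flowInv (q t) z)) (𝓝[<] Tstar) (𝓝 ∞) := by
  rw [ENNReal.tendsto_nhds_top_iff_nat]
  intro n
  by_contra hcon
  have hle : ∀ t < Tstar, gradientIntegral f (fun t z => w t (flowInv (q t) z)) t ≤
      ENNReal.ofReal n := by
    intro t ht
    by_contra hlt
    rw [not_le, ENNReal.ofReal_natCast] at hlt
    refine hcon ?_
    filter_upwards [Ioo_mem_nhdsLT ht] with s hs
    exact lt_of_lt_of_le hlt (gradientIntegral_mono _ _ hs.1.le)
  obtain ⟨A, hA⟩ := exists_bound_of_gradientIntegral_le hT h hq n.cast_nonneg hle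
  obtain ⟨t, ht, hnot⟩ := hunb A
  exact hnot (hA t ht)

/-- The square of the `L²` norm is differentiable along a curve that is differentiable in `L²`. -/
theorem hasDerivWithinAt_integral_sq {S : Set ℝ} {t : ℝ} {W : ℝ → ℝ → ℝ} {P : ℝ → ℝ}
    (hW : ∀ s, MemLp (W s) 2 volume) (hP : MemLp P 2 volume)
    (h : Tendsto (fun s => eLpNorm (fun x => (W s x - W t x) / (s - t) - P x) 2 volume)
      (𝓝[S \ {t}] t) (𝓝 0)) :
    HasDerivWithinAt (fun s => ∫ x, W s x ^ 2) (2 * ∫ x, W t x * P x) S t := by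
  let F : ℝ → Lp ℝ 2 (volume : Measure ℝ) := fun s => (hW s).toLp
  have hF : HasDerivWithinAt F hP.toLp S t := by
    rw [hasDerivWithinAt_iff_tendsto_slope, tendsto_iff_edist_tendsto_0]
    refine h.congr fun s => ?_
    rw [Lp.edist_def]
    refine eLpNorm_congr_ae ?_
    have e1 : (slope F t s : Lp ℝ 2 volume) = (s - t)⁻¹ • (F s - F t) := by
      rw [slope, vsub_eq_sub]
    rw [e1]
    filter_upwards [Lp.coeFn_smul (s - t)⁻¹ (F s - F t), Lp.coeFn_sub (F s) (F t),
      (hW s).coeFn_toLp, (hW t).coeFn_toLp, hP.coeFn_toLp] with x h1 h2 h3 h4 h5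
    rw [Pi.sub_apply, h1, Pi.smul_apply, h2, Pi.sub_apply, h3, h4, h5, smul_eq_mul, inv_mul_eq_div]
  have hn := hF.norm_sq
  have e2 : ∀ s, ‖F s‖ ^ 2 = ∫ x, W s x ^ 2 := by
    intro s
    rw [← real_inner_self_eq_norm_sq, L2.inner_def]
    refine integral_congr_ae ?_
    filter_upwards [(hW s).coeFn_toLp] with x hx
    simp only [F, hx, real_inner_self_eq_norm_sq, Real.norm_eq_abs, sq_abs]
  have e3 : inner ℝ (F t) hP.toLp = ∫ x, W t x * P x := by
    rw [L2.inner_def]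
    refine integral_congr_ae ?_
    filter_upwards [(hW t).coeFn_toLp, hP.coeFn_toLp] with x hx hy
    simp only [F, hx, hy]
    simp [mul_comm]
  simp only [e2, e3] at hn
  exact hn

theorem EnergyLE.mul {a b : ℝ → ℝ} {K L α β : ℝ} (ha : EnergyLE a K) (hb : EnergyLE b L)
    (hα : ∀ x, |a x| ≤ α) (hβ : ∀ x, |b x| ≤ β) : EnergyLE (fun x => a x * b x) (α * L + β * K) := by
  refine EnergyLE.of_abs_sub_le ((abs_nonneg _).trans (hα 0)) ((abs_nonneg _).trans (hβ 0)) hb ha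
    fun x y _ => ?_
  rw [show a y * b y - a x * b x = a y * (b y - b x) + b x * (a y - a x) by ring]
  refine (abs_add_le _ _).trans ?_
  rw [abs_mul (a y), abs_mul (b x)]
  exact add_le_add (mul_le_mul_of_nonneg_right (hα y) (abs_nonneg _))
    (mul_le_mul_of_nonneg_right (hβ x) (abs_nonneg _))

namespace CompactEnergy

variable {R K : ℝ} {w : ℝ → ℝ}

theorem continuous_mul_memLp (hw : CompactEnergy R K w) {u : ℝ → ℝ} (hu : Continuous u) :
    MemLp (fun x => u x * w x) 2 volume :=
  (hu.mul hw.continuous).memLp_of_hasCompactSupport hw.hasCompactSupport.mul_left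

theorem continuous_mul_deriv_memLp (hw : CompactEnergy R K w) {u : ℝ → ℝ} (hu : Continuous u) :
    MemLp (fun x => u x * deriv w x) 2 volume := by
  obtain ⟨c, hc⟩ := (isCompact_Icc (a := -R) (b := R)).exists_bound_of_continuousOn hu.continuousOn
  exact (MemLp.mul_of_support hw.energy.memLp_deriv hu (fun x hx => hc x (_root_.abs_le.1 hx))
    fun x hx => hw.deriv_support hx).1

/-- Integration by parts in the transport term. -/
theorem integral_mul_deriv_mul (hw : CompactEnergy R K w) (hR : 0 ≤ R) {u U : ℝ → ℝ}
    (hu : ∀ x, HasDerivAt u (U x) x) (hU : Continuous U) :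
    ∫ x, w x * (u x * deriv w x) = -(1 / 2) * ∫ x, U x * w x ^ 2 := by
  have huc : Continuous u := continuous_iff_continuousAt.2 fun x => (hu x).continuousAt
  have hAu : AbsolutelyContinuousOnInterval u (-R) R := by
    have hd : deriv u = U := funext fun x => (hu x).deriv
    have : ContDiff ℝ 1 u := contDiff_one_iff_deriv.2
      ⟨fun x => (hu x).differentiableAt, by rw [hd]; exact hU⟩
    exact this.contDiffOn.absolutelyContinuousOnInterval
  have hAw := hw.energy.absolutelyContinuous (-R) R
  have hsq := hAw.fun_mul hAw
  have hparts := hAu.integral_mul_deriv_eq_deriv_mul hsq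
  have z1 : w R = 0 := hw.support R (le_abs_self R)
  have z2 : w (-R) = 0 := hw.support (-R) (by rw [abs_neg]; exact le_abs_self R)
  simp only [z1, z2, mul_zero, sub_zero, zero_sub] at hparts
  have hd : deriv u = U := funext fun x => (hu x).deriv
  rw [hd] at hparts
  have e1 : ∫ x, w x * (u x * deriv w x) = ∫ x, (u x * deriv w x) * w x := by
    congr 1; ext x; ring
  have e2 : ∫ x, U x * w x ^ 2 = ∫ x, (U x * w x) * w x := by
    congr 1; ext x; ring
  rw [e1, e2, hw.setIntegral_eq hR, hw.setIntegral_eq hR]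
  have e3 : ∫ x in (-R)..R, u x * deriv (fun x => w x * w x) x =
      ∫ x in (-R)..R, 2 * ((u x * deriv w x) * w x) := by
    refine intervalIntegral.integral_congr_ae ?_
    filter_upwards [hw.energy.ae_differentiableAt] with x hx _
    rw [deriv_fun_mul hx hx]; ring
  have e4 : ∫ x in (-R)..R, U x * (w x * w x) = ∫ x in (-R)..R, (U x * w x) * w x := by
    congr 1; ext x; ring
  rw [e3, intervalIntegral.integral_const_mul, e4] at hparts
  linarith

end CompactEnergy

namespace KernelReg

variable {f f1 : ℝ → ℝ → ℝ} {C R K : ℝ} {w : ℝ → ℝ}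

theorem memLp_hilbert (hw : CompactEnergy R K w) : MemLp (hilbert w) 2 volume ∧
    ∫ x, hilbert w x ^ 2 ≤ Real.pi ^ 2 * ∫ x, w x ^ 2 := by
  have hI : 0 ≤ ∫ x, w x ^ 2 := integral_nonneg fun x => sq_nonneg _
  have h1 := hw.eLpNorm_hilbert_le (Real.sqrt_nonneg (∫ x, w x ^ 2)) (eLpNorm_two_eq hw.memLp).le
  have hm : MemLp (hilbert w) 2 volume :=
    ⟨hw.continuous_hilbert.aestronglyMeasurable, h1.trans_lt ENNReal.ofReal_lt_top⟩
  refine ⟨hm, ?_⟩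
  have := (eLpNorm_two_le_iff hm (mul_nonneg Real.pi_pos.le (Real.sqrt_nonneg _))).1 h1
  rwa [mul_pow, Real.sq_sqrt hI] at this

theorem sq_integral_mul_le (hw : CompactEnergy R K w) (hR : 0 ≤ R) {k : ℝ → ℝ} (hk : Continuous k)
    {c : ℝ} (hc : ∀ y, |y| ≤ R → |k y| ≤ c) :
    (∫ y, k y * w y) ^ 2 ≤ 2 * R * c ^ 2 * ∫ y, w y ^ 2 := by
  rw [hw.setIntegral_eq hR]
  have hm := hw.continuous_mul_memLp hk
  have h1 := sq_intervalIntegral_le hm (show -R ≤ R by linarith)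
  have h2 : ∫ y in (-R)..R, (k y * w y) ^ 2 ≤ ∫ y in (-R)..R, c ^ 2 * w y ^ 2 := by
    have hwc := hw.continuous
    refine intervalIntegral.integral_mono_on (by linarith)
      (Continuous.intervalIntegrable (by fun_prop) _ _)
      (Continuous.intervalIntegrable (by fun_prop) _ _) fun y hy => ?_
    rw [mul_pow]
    have := hc y (abs_le.2 hy)
    exact mul_le_mul_of_nonneg_right (sq_le_sq' (abs_le.1 this).1 (abs_le.1 this).2) (sq_nonneg _)
  have h3 : ∫ y, w y ^ 2 = ∫ y in (-R)..R, w y ^ 2 := by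
    have := hw.setIntegral_eq hR w
    simpa [sq] using this
  rw [intervalIntegral.integral_const_mul, ← h3] at h2
  calc _ ≤ _ := h1
    _ ≤ (R - -R) * (c ^ 2 * ∫ y, w y ^ 2) := by
        have : 0 ≤ R - -R := by linarith
        gcongr
    _ = _ := by ring

theorem memLp_strain (hf : KernelReg f f1 C) (hw : CompactEnergy R K w) (hR : 0 ≤ R) :
    MemLp (strain f1 w) 2 volume ∧
      ∫ x, strain f1 w x ^ 2 ≤ (2 + 8 * R * C ^ 2) * ∫ x, w x ^ 2 := by
  obtain ⟨m1, b1⟩ := memLp_hilbert hw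
  have hI : 0 ≤ ∫ x, w x ^ 2 := integral_nonneg fun x => sq_nonneg _
  set J : ℝ → ℝ := fun z => ∫ y, f1 z y * w y with hJ
  have hJc : Continuous J := hf.continuous_integral₁ hw
  have hJ0 : ∀ z, 1 ≤ |z| → J z = 0 := fun z hz => by simp [hJ, hf.support₁ z _ hz]
  have hJb : ∀ z, J z ^ 2 ≤ 2 * R * C ^ 2 * ∫ y, w y ^ 2 := fun z =>
    sq_integral_mul_le hw hR (hf.continuous₁_right z) fun y _ => hf.bound₁ z y
  have m2 : MemLp J 2 volume := by
    refine hJc.memLp_of_hasCompactSupport (HasCompactSupport.intro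
      (isCompact_Icc (a := (-1 : ℝ)) (b := 1)) fun x hx => hJ0 x ?_)
    by_contra hcon
    exact hx (abs_le.1 (not_le.1 hcon).le)
  have b2 : ∫ x, J x ^ 2 ≤ 4 * R * C ^ 2 * ∫ y, w y ^ 2 := by
    have := (eLpNorm_two_le_iff m2 (by positivity)).1 (eLpNorm_two_le_of_support m2 zero_le_one
      (fun x => Real.abs_le_sqrt (hJb x)) hJ0)
    rw [mul_pow, Real.sq_sqrt (by positivity), Real.sq_sqrt (by positivity)] at this
    linarith
  have hm : MemLp (strain f1 w) 2 volume := (m1.add m2).const_mul _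
  refine ⟨hm, ?_⟩
  have hle : ∀ x, strain f1 w x ^ 2 ≤ 2 * (1 / Real.pi) ^ 2 * hilbert w x ^ 2 + 2 * J x ^ 2 := by
    intro x
    have e : strain f1 w x = 1 / Real.pi * hilbert w x + 1 / Real.pi * J x := by
      rw [strain]; ring
    have h2 : (1 / Real.pi) ^ 2 * J x ^ 2 ≤ J x ^ 2 := by
      refine mul_le_of_le_one_left (sq_nonneg _) ?_
      exact pow_le_one₀ (by have := Real.pi_pos; positivity) inv_pi_le_one
    rw [e]
    nlinarith [sq_nonneg (1 / Real.pi * hilbert w x - 1 / Real.pi * J x)]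
  calc ∫ x, strain f1 w x ^ 2
      ≤ ∫ x, (2 * (1 / Real.pi) ^ 2 * hilbert w x ^ 2 + 2 * J x ^ 2) :=
        integral_mono hm.integrable_sq ((m1.integrable_sq.const_mul _).add
          (m2.integrable_sq.const_mul _)) hle
    _ = 2 * (1 / Real.pi) ^ 2 * (∫ x, hilbert w x ^ 2) + 2 * ∫ x, J x ^ 2 := by
        rw [integral_add (m1.integrable_sq.const_mul _) (m2.integrable_sq.const_mul _),
          integral_const_mul, integral_const_mul]
    _ ≤ 2 * (1 / Real.pi) ^ 2 * (Real.pi ^ 2 * ∫ x, w x ^ 2) +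
        2 * (4 * R * C ^ 2 * ∫ y, w y ^ 2) := by gcongr
    _ = _ := by have := Real.pi_pos.ne'; field_simp; ring

/-- The velocity is bounded on the support by the `L²` norm of the vorticity. -/
theorem sq_velocity_le (hf : KernelReg f f1 C) (hw : CompactEnergy R K w) (hR : 0 ≤ R) {z : ℝ}
    (hz : |z| ≤ R) : velocity f w z ^ 2 ≤ (2 * (2 * R * (2 * R + 1 + C) ^ 2) +
      2 * ((2 * R + 1) * (2 + 8 * R * C ^ 2))) * ∫ x, w x ^ 2 := by
  obtain ⟨m, b⟩ := hf.memLp_strain hw hR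
  have hI : 0 ≤ ∫ x, w x ^ 2 := integral_nonneg fun x => sq_nonneg _
  have hC := hf.nonneg
  obtain ⟨hz1, hz2⟩ := abs_le.1 hz
  have h0 : velocity f w (R + 1) ^ 2 ≤ 2 * R * (2 * R + 1 + C) ^ 2 * ∫ x, w x ^ 2 := by
    have e : velocity f w (R + 1) = (1 / Real.pi) *
        ∫ y, (Real.log (max 1 (R + 1 - y)) + f (R + 1) y) * w y := by
      rw [velocity]
      congr 2; ext y
      rcases le_or_gt R |y| with hy | hy
      · rw [hw.support y hy, mul_zero, mul_zero]
      · have := (abs_lt.1 hy).2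
        rw [max_eq_right (by linarith), abs_of_pos (by linarith)]
    have hk : Continuous fun y => Real.log (max 1 (R + 1 - y)) + f (R + 1) y := by
      refine Continuous.add (Continuous.log (by fun_prop) fun y => ?_) (hf.continuous_right _)
      have : (1 : ℝ) ≤ max 1 (R + 1 - y) := le_max_left _ _
      linarith
    have h1 := sq_integral_mul_le hw hR hk (c := 2 * R + 1 + C) fun y hy => by
      refine (abs_add_le _ _).trans (add_le_add ?_ (hf.bound _ _))
      have h1 : (1 : ℝ) ≤ max 1 (R + 1 - y) := le_max_left _ _
      rw [abs_of_nonneg (Real.log_nonneg h1)]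
      refine (Real.log_le_self (by linarith)).trans (max_le (by linarith) ?_)
      linarith [(abs_le.1 hy).1]
    rw [e, mul_pow]
    refine (mul_le_of_le_one_left (sq_nonneg _) ?_).trans h1
    exact pow_le_one₀ (by have := Real.pi_pos; positivity) inv_pi_le_one
  have hS := hf.continuous_strain hw
  have h1 : ∫ x in z..(R + 1), strain f1 w x = velocity f w (R + 1) - velocity f w z :=
    intervalIntegral.integral_eq_sub_of_hasDerivAt (fun x _ => hf.hasDerivAt_velocity hw x)
      (hS.intervalIntegrable _ _)
  have h2 := sq_intervalIntegral_le m (show z ≤ R + 1 by linarith)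
  have h3 : ∫ x in z..(R + 1), strain f1 w x ^ 2 ≤ ∫ x, strain f1 w x ^ 2 := by
    rw [intervalIntegral.integral_of_le (by linarith)]
    exact setIntegral_le_integral m.integrable_sq (ae_of_all _ fun x => sq_nonneg _)
  have h4 : (R + 1 - z) * ∫ x in z..(R + 1), strain f1 w x ^ 2 ≤
      (2 * R + 1) * ((2 + 8 * R * C ^ 2) * ∫ x, w x ^ 2) := by
    refine mul_le_mul (by linarith) (h3.trans b) ?_ (by linarith)
    exact intervalIntegral.integral_nonneg (by linarith) fun _ _ => sq_nonneg _
  rw [h1] at h2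
  nlinarith [sq_nonneg (2 * velocity f w (R + 1) - velocity f w z)]

end KernelReg

theorem IsH1.energyLE {w w' : ℝ → ℝ} (h : IsH1 w w') {K : ℝ} (hK : 0 ≤ K)
    (hw : eLpNorm w' 2 volume ≤ ENNReal.ofReal K) : EnergyLE w K :=
  EnergyLE.of_weakDeriv h.memLp_deriv h.integral_deriv hK hw

theorem IsH1.deriv_ae_eq {w w' : ℝ → ℝ} (h : IsH1 w w') : deriv w =ᵐ[volume] w' :=
  weakDeriv_ae_eq (h.memLp_deriv.locallyIntegrable (by norm_num)) h.integral_deriv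

namespace IsH1Curve

variable {T S : ℝ} {w w' : ℝ → ℝ → ℝ}

theorem exists_energyLE (h : IsH1Curve T w w') (hS : S < T) :
    ∃ K, 0 ≤ K ∧ ∀ t ∈ Icc 0 S, EnergyLE (w t) K := by
  have hsub : Icc 0 S ⊆ Ico 0 T := fun t ht => ⟨ht.1, lt_of_le_of_lt ht.2 hS⟩
  suffices ∃ K, 0 ≤ K ∧ ∀ t ∈ Icc 0 S, eLpNorm (w' t) 2 volume ≤ ENNReal.ofReal K by
    obtain ⟨K, hK, hb⟩ := this
    exact ⟨K, hK, fun t ht => (h.isH1 t (hsub ht)).energyLE hK (hb t ht)⟩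
  refine (isCompact_Icc (a := 0) (b := S)).induction_on
    (p := fun s => ∃ K : ℝ, 0 ≤ K ∧ ∀ t ∈ s, eLpNorm (w' t) 2 volume ≤ ENNReal.ofReal K)
    ⟨0, le_rfl, fun t ht => ht.elim⟩ ?_ ?_ ?_
  · rintro s s' hss ⟨K, hK, hb⟩
    exact ⟨K, hK, fun t ht => hb t (hss ht)⟩
  · rintro s s' ⟨K, hK, hb⟩ ⟨L, hL, hb'⟩
    refine ⟨max K L, le_max_of_le_left hK, ?_⟩
    rintro t (ht | ht)
    · exact (hb t ht).trans (ENNReal.ofReal_le_ofReal (le_max_left _ _))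
    · exact (hb' t ht).trans (ENNReal.ofReal_le_ofReal (le_max_right _ _))
  · intro t ht
    have hm := (h.isH1 t (hsub ht)).memLp_deriv
    have hev := (ENNReal.tendsto_nhds_zero.1 (h.continuous_deriv t (hsub ht))) 1 one_pos
    refine ⟨{s | s ∈ Ico 0 T ∧ eLpNorm (w' s - w' t) 2 volume ≤ 1},
      nhdsWithin_mono t hsub (inter_mem self_mem_nhdsWithin hev),
      (eLpNorm (w' t) 2 volume).toReal + 1, by positivity, fun s hs => ?_⟩
    have hms := (h.isH1 s hs.1).memLp_deriv
    have e : w' s = (w' s - w' t) + w' t := by simp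
    rw [e, ENNReal.ofReal_add (by positivity) zero_le_one, ENNReal.ofReal_toReal hm.2.ne,
      ENNReal.ofReal_one, add_comm _ (1 : ℝ≥0∞)]
    exact (eLpNorm_add_le (hms.sub hm).aestronglyMeasurable hm.aestronglyMeasurable
      (by norm_num)).trans (add_le_add_left hs.2 _)

theorem eventually_energyLE (h : IsH1Curve T w w') {t : ℝ} (ht : t ∈ Ico 0 T) {ε : ℝ}
    (hε : 0 < ε) : ∀ᶠ s in 𝓝[Ico 0 T] t, EnergyLE (fun x => w s x - w t x) ε := by
  have hev := (ENNReal.tendsto_nhds_zero.1 (h.continuous_deriv t ht)) (ENNReal.ofReal ε)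
    (ENNReal.ofReal_pos.2 hε)
  filter_upwards [hev, self_mem_nhdsWithin] with s hs hsT
  have h1 := h.isH1 s hsT
  have h2 := h.isH1 t ht
  refine EnergyLE.of_weakDeriv (h1.memLp_deriv.sub h2.memLp_deriv) (fun a b => ?_) hε.le hs
  simp only [Pi.sub_apply]
  rw [intervalIntegral.integral_sub (MemLp.intervalIntegrable_of_two h1.memLp_deriv a b)
    (MemLp.intervalIntegrable_of_two h2.memLp_deriv a b), h1.integral_deriv, h2.integral_deriv]
  ring

end IsH1Curve

namespace IsSolution

variable {f f1 : ℝ → ℝ → ℝ} {C T S : ℝ} {ω₀ θ₀ : ℝ → ℝ} {ω θ : ℝ → ℝ → ℝ}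

/-- Uniform bounds for a solution on a compact time interval. -/
theorem exists_compactEnergy (h : IsSolution f T ω₀ θ₀ ω θ) (hS : S < T) : ∃ R K, 0 < R ∧ 0 ≤ K ∧
    (∀ t ∈ Icc 0 S, CompactEnergy R K (ω t) ∧ CompactEnergy R K (deriv (θ t))) ∧
    ∀ t ∈ Icc 0 S, ∀ ε > 0, ∀ᶠ s in 𝓝[Icc 0 S] t, CompactEnergy R ε (fun x => ω s x - ω t x) ∧
      CompactEnergy R ε fun x => deriv (θ s) x - deriv (θ t) x := by
  obtain ⟨R, hR⟩ := h.compact_support S hS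
  obtain ⟨θxx, hθ⟩ := h.regular_density
  obtain ⟨ωx, hω, -⟩ := h.vorticity_eq
  obtain ⟨K, hK, hKb⟩ := hω.exists_energyLE hS
  obtain ⟨L, hL, hLb⟩ := hθ.exists_energyLE hS
  have hsub : Icc 0 S ⊆ Ico 0 T := fun t ht => ⟨ht.1, lt_of_le_of_lt ht.2 hS⟩
  have hlt : ∀ x : ℝ, |R| + 1 ≤ |x| → R < |x| := fun x hx => by linarith [le_abs_self R]
  refine ⟨|R| + 1, max K L, by positivity, le_max_of_le_left hK, fun t ht => ⟨⟨(hKb t ht).mono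
    (le_max_left _ _), fun x hx => (hR t ht x (hlt x hx)).1⟩, ⟨(hLb t ht).mono
    (le_max_right _ _), fun x hx => (hR t ht x (hlt x hx)).2⟩⟩, fun t ht ε hε => ?_⟩
  filter_upwards [nhdsWithin_mono t hsub (hω.eventually_energyLE (hsub ht) hε),
    nhdsWithin_mono t hsub (hθ.eventually_energyLE (hsub ht) hε), self_mem_nhdsWithin] with s h1 h2 hs
  refine ⟨⟨h1, fun x hx => ?_⟩, ⟨h2, fun x hx => ?_⟩⟩
  · rw [(hR s hs x (hlt x hx)).1, (hR t ht x (hlt x hx)).1, sub_zero]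
  · rw [(hR s hs x (hlt x hx)).2, (hR t ht x (hlt x hx)).2, sub_zero]

theorem tendsto_vorticity (h : IsSolution f T ω₀ θ₀ ω θ) (hS : S < T) {t : ℝ} (ht : t ∈ Icc 0 S) :
    Tendsto (fun s => eLpNorm (fun x => (ω s x - ω t x) / (s - t) -
      (deriv (θ t) x - velocity f (ω t) x * deriv (ω t) x)) 2 volume)
      (𝓝[Icc 0 S \ {t}] t) (𝓝 0) := by
  obtain ⟨ωx, hω, hlim⟩ := h.vorticity_eq
  have hsub : Icc 0 S ⊆ Ico 0 T := fun t ht => ⟨ht.1, lt_of_le_of_lt ht.2 hS⟩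
  refine ((hlim t (hsub ht)).mono_left (nhdsWithin_mono t (sdiff_subset_sdiff_left hsub))).congr
    fun s => eLpNorm_congr_ae ?_
  filter_upwards [(hω.isH1 t (hsub ht)).deriv_ae_eq] with x hx
  rw [hx]

theorem tendsto_density_gradient (h : IsSolution f T ω₀ θ₀ ω θ) (hf : KernelReg f f1 C)
    (hS : S < T) {t : ℝ} (ht : t ∈ Icc 0 S) :
    Tendsto (fun s => eLpNorm (fun x => (deriv (θ s) x - deriv (θ t) x) / (s - t) -
      -(strain f1 (ω t) x * deriv (θ t) x + velocity f (ω t) x * deriv (deriv (θ t)) x)) 2 volume)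
      (𝓝[Icc 0 S \ {t}] t) (𝓝 0) := by
  obtain ⟨R, K, hR, hK, hc, hcl⟩ := h.exists_compactEnergy hS
  have hsub : Icc 0 S ⊆ Ico 0 T := fun t ht => ⟨ht.1, lt_of_le_of_lt ht.2 hS⟩
  have hC := hf.nonneg
  let u : ℝ → ℝ → ℝ := fun s x => velocity f (ω s) (clamp R x)
  let N : ℝ → ℝ → ℝ := fun s x => -(velocity f (ω s) x * deriv (θ s) x)
  have hNu : ∀ s ∈ Icc 0 S, ∀ x, N s x = -(u s x * deriv (θ s) x) := by
    intro s hs x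
    simp only [N, u]
    rcases le_or_gt |x| R with hx | hx
    · rw [clamp_of_abs_le hx]
    · rw [(hc s hs).2.support x hx.le, mul_zero, mul_zero]
  have henergy : ∀ {v : ℝ → ℝ} {ε : ℝ}, CompactEnergy R ε v →
      EnergyLE (fun x => velocity f v (clamp R x))
        ((4 * ε + (2 + C) * (2 * R * (ε * √R))) * √(2 * R)) := by
    intro v ε hv
    have hb : ∀ z, |strain f1 v z| ≤ 4 * ε + (2 + C) * (2 * R * (ε * √R)) := by
      intro z
      have h1 := hf.abs_strain_le hv z one_pos
      rw [Real.sqrt_one, mul_one, div_one] at h1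
      have h2 := mul_le_mul_of_nonneg_left (hv.integral_abs_le_of_bound hR.le hv.abs_le)
        (show 0 ≤ 2 + C by linarith)
      linarith
    have hB0 := (abs_nonneg _).trans (hb 0)
    have hlip : ∀ x y, |velocity f v x - velocity f v y| ≤
        (4 * ε + (2 + C) * (2 * R * (ε * √R))) * |x - y| := fun x y =>
      convex_univ.norm_image_sub_le_of_norm_hasDerivWithin_le
        (fun z _ => (hf.hasDerivAt_velocity hv z).hasDerivWithinAt) (fun z _ => hb z)
        (mem_univ y) (mem_univ x)
    have hmono := monotone_clamp (δ := R)
    refine EnergyLE.of_lipschitz_clamp hB0 hR.le (fun x y => (hlip _ _).trans ?_) fun x => ?_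
    · refine mul_le_mul_of_nonneg_left ?_ hB0
      rcases le_total x y with hxy | hxy
      · rw [abs_of_nonpos (sub_nonpos.2 (hmono hxy)), abs_of_nonpos (sub_nonpos.2 hxy)]
        linarith [clamp_sub_le (δ := R) hxy]
      · rw [abs_of_nonneg (sub_nonneg.2 (hmono hxy)), abs_of_nonneg (sub_nonneg.2 hxy)]
        exact clamp_sub_le hxy
    · show _ = velocity f v (clamp R (clamp R x))
      rw [clamp_of_abs_le (clamp_mem hR.le x)]
  have hub : ∀ {v : ℝ → ℝ} {ε : ℝ}, CompactEnergy R ε v → ∀ x,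
      |velocity f v (clamp R x)| ≤ velocityConst C R * (ε * √R) := fun hv x =>
    hf.abs_velocity_le hv hR.le hv.abs_le (clamp_mem hR.le x)
  set D := velocityConst C R with hD
  have hD0 : 0 ≤ D := velocityConst_nonneg hC hR.le
  set Q := (4 + (2 + C) * (2 * R * √R)) * √(2 * R) with hQ
  have hQ0 : 0 ≤ Q := by positivity
  have hNcont : ∀ ε > 0, ∀ᶠ s in 𝓝[Icc 0 S] t, EnergyLE (fun z => N s z - N t z) ε := by
    intro ε hε
    set P := 2 * (D * √R * K + K * √R * Q) + 1 with hP
    have hP0 : 0 < P := by positivity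
    filter_upwards [hcl t ht (ε / P) (by positivity), self_mem_nhdsWithin] with s hs hsS
    set η := ε / P with hη
    have hη0 : 0 < η := by positivity
    obtain ⟨d1, d2⟩ := hs
    obtain ⟨s1, s2⟩ := hc s hsS
    obtain ⟨t1, t2⟩ := hc t ht
    have hdu : ∀ x, velocity f (fun x => ω s x - ω t x) (clamp R x) = u s x - u t x := fun x =>
      hf.velocity_sub s1 t1 _
    have a1 := henergy d1
    have a2 := hub d1
    simp only [hdu] at a1 a2
    have p1 := a1.mul s2.energy a2 s2.abs_le
    have p2 := (henergy t1).mul d2.energy (hub t1) d2.abs_le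
    have hsum := (p1.add p2).neg
    have hfun : (fun z => N s z - N t z) = fun x => -((u s x - u t x) * deriv (θ s) x +
        velocity f (ω t) (clamp R x) * (deriv (θ s) x - deriv (θ t) x)) := by
      ext x
      rw [hNu s hsS, hNu t ht]
      simp only [u]
      ring
    rw [hfun]
    refine hsum.mono ?_
    have hηP : η * P = ε := by rw [hη]; field_simp
    rw [← hηP, hP]
    have e1 : (4 * η + (2 + C) * (2 * R * (η * √R))) * √(2 * R) = η * Q := by rw [hQ]; ring
    have e2 : (4 * K + (2 + C) * (2 * R * (K * √R))) * √(2 * R) = K * Q := by rw [hQ]; ring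
    rw [e1, e2]
    nlinarith
  refine tendsto_zero_of_eventually_le_ofReal fun ε hε => ?_
  have hev := eventually_energyLE_sub (convex_Icc 0 S) ht (Y := θ) (N := N)
    (fun s hs z => (h.density_eq s (hsub hs) z).mono hsub) hNcont hε
  filter_upwards [nhdsWithin_mono t sdiff_subset hev, self_mem_nhdsWithin] with s hs hsS
  have hst : s - t ≠ 0 := sub_ne_zero.2 hsS.2
  obtain ⟨t1, t2⟩ := hc t ht
  have hae : deriv (fun z => θ s z - θ t z - (s - t) * N t z) =ᵐ[volume] fun x =>
      (deriv (θ s) x - deriv (θ t) x) - (s - t) * -(strain f1 (ω t) x * deriv (θ t) x +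
        velocity f (ω t) x * deriv (deriv (θ t)) x) := by
    filter_upwards [t2.energy.ae_differentiableAt] with x hx
    have h1 := (h.differentiable_density s (hsub hsS.1) x).hasDerivAt
    have h2 := (h.differentiable_density t (hsub ht) x).hasDerivAt
    have h3 := ((hf.hasDerivAt_velocity t1 x).mul hx.hasDerivAt).neg.const_mul (s - t)
    exact ((h1.sub h2).sub h3).deriv
  have hn := hs.eLpNorm_deriv_le
  rw [eLpNorm_congr_ae hae] at hn
  have := eLpNorm_slope_le hst hn
  convert this using 2
  ext x
  simp only [Pi.smul_apply, smul_eq_mul]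
  field_simp

end IsSolution

theorem abs_integral_mul_le {a b : ℝ → ℝ} (ha : MemLp a 2 volume) (hb : MemLp b 2 volume) :
    2 * |∫ x, a x * b x| ≤ (∫ x, a x ^ 2) + ∫ x, b x ^ 2 := by
  rw [← integral_add ha.integrable_sq hb.integrable_sq]
  have h1 : |∫ x, a x * b x| ≤ ∫ x, |a x * b x| := abs_integral_le_integral_abs
  have h2 : ∫ x, 2 * |a x * b x| ≤ ∫ x, (a x ^ 2 + b x ^ 2) := by
    refine integral_mono ((ha.integrable_mul hb).abs.const_mul 2)
      (ha.integrable_sq.add hb.integrable_sq) fun x => ?_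
    simp only [abs_mul]
    nlinarith [sq_nonneg (|a x| - |b x|), sq_abs (a x), sq_abs (b x)]
  rw [integral_const_mul] at h2
  linarith

theorem integral_sq_mul_le_of_support {u p : ℝ → ℝ} {c R : ℝ} (hp : MemLp p 2 volume)
    (hup : MemLp (fun x => u x * p x) 2 volume) (hu : ∀ x, |x| ≤ R → u x ^ 2 ≤ c)
    (hsupp : ∀ x, R < |x| → p x = 0) : ∫ x, (u x * p x) ^ 2 ≤ c * ∫ x, p x ^ 2 := by
  rw [← integral_const_mul]
  refine integral_mono hup.integrable_sq (hp.integrable_sq.const_mul c) fun x => ?_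
  simp only
  rcases le_or_gt |x| R with h | h
  · rw [mul_pow]; exact mul_le_mul_of_nonneg_right (hu x h) (sq_nonneg _)
  · simp [hsupp x h]

theorem EnergyLE.integral_deriv_sq_le {h : ℝ → ℝ} {K : ℝ} (hh : EnergyLE h K) :
    ∫ x, deriv h x ^ 2 ≤ K ^ 2 :=
  (eLpNorm_two_le_iff hh.memLp_deriv hh.nonneg).1 hh.eLpNorm_deriv_le

theorem exists_energy_rate_le {f f1 : ℝ → ℝ → ℝ} {C R K : ℝ} (hf : KernelReg f f1 C) (hR : 0 ≤ R) :
    ∃ κ, ∀ ω₁ ω₂ g₁ g₂ : ℝ → ℝ, CompactEnergy R K ω₁ → CompactEnergy R K ω₂ →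
      CompactEnergy R K g₁ → CompactEnergy R K g₂ →
      |2 * (∫ x, (ω₁ x - ω₂ x) * ((g₁ x - velocity f ω₁ x * deriv ω₁ x) -
          (g₂ x - velocity f ω₂ x * deriv ω₂ x))) +
        2 * ∫ x, (g₁ x - g₂ x) * (-(strain f1 ω₁ x * g₁ x + velocity f ω₁ x * deriv g₁ x) -
          -(strain f1 ω₂ x * g₂ x + velocity f ω₂ x * deriv g₂ x))| ≤
        κ * ((∫ x, (ω₁ x - ω₂ x) ^ 2) + ∫ x, (g₁ x - g₂ x) ^ 2) := by
  set B := 4 * K + (2 + C) * (2 * R * (K * √R)) with hB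
  set cu := 2 * (2 * R * (2 * R + 1 + C) ^ 2) + 2 * ((2 * R + 1) * (2 + 8 * R * C ^ 2)) with hcu
  set cs := 2 + 8 * R * C ^ 2 with hcs
  have hC := hf.nonneg
  refine ⟨4 + 4 * B + 2 * (cu * K ^ 2) + (K * √R) ^ 2 * cs, fun ω₁ ω₂ g₁ g₂ h1 h2 k1 k2 => ?_⟩
  set W := fun x => ω₁ x - ω₂ x with hW
  set V := fun x => g₁ x - g₂ x with hV
  have cW : CompactEnergy R (K + K) W := h1.sub h2
  have cV : CompactEnergy R (K + K) V := k1.sub k2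
  set IW := ∫ x, W x ^ 2 with hIW
  set IV := ∫ x, V x ^ 2 with hIV
  have hIW0 : 0 ≤ IW := integral_nonneg fun x => sq_nonneg _
  have hIV0 : 0 ≤ IV := integral_nonneg fun x => sq_nonneg _
  have hu1 : Continuous (velocity f ω₁) := continuous_iff_continuousAt.2 fun ζ =>
    (hf.hasDerivAt_velocity h1 ζ).continuousAt
  have huW : Continuous (velocity f W) := continuous_iff_continuousAt.2 fun ζ =>
    (hf.hasDerivAt_velocity cW ζ).continuousAt
  have hS1 := hf.continuous_strain h1
  have hSW := hf.continuous_strain cW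
  have hS1b : ∀ x, |strain f1 ω₁ x| ≤ B := by
    intro z
    have e1 := hf.abs_strain_le h1 z one_pos
    rw [Real.sqrt_one, mul_one, div_one] at e1
    have e2 := mul_le_mul_of_nonneg_left (h1.integral_abs_le_of_bound hR h1.abs_le)
      (show 0 ≤ 2 + C by linarith)
    linarith
  have hsq : ∀ v : ℝ → ℝ, CompactEnergy R (K + K) v →
      |∫ x, strain f1 ω₁ x * v x ^ 2| ≤ B * ∫ x, v x ^ 2 := by
    intro v hv
    have i1 : Integrable fun x => strain f1 ω₁ x * v x ^ 2 := by
      have := (hv.continuous_mul_memLp hS1).integrable_mul hv.memLp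
      refine this.congr (ae_of_all _ fun x => ?_)
      simp only [Pi.mul_apply]; ring
    refine abs_integral_le_integral_abs.trans ?_
    rw [← integral_const_mul]
    refine integral_mono i1.abs (hv.memLp.integrable_sq.const_mul _) fun x => ?_
    simp only [abs_mul, abs_sq]
    exact mul_le_mul_of_nonneg_right (hS1b x) (sq_nonneg _)
  have hδu : ∀ v : ℝ → ℝ, CompactEnergy R K v →
      ∫ x, (velocity f W x * deriv v x) ^ 2 ≤ cu * K ^ 2 * IW := by
    intro v hv
    refine (integral_sq_mul_le_of_support hv.energy.memLp_deriv (hv.continuous_mul_deriv_memLp huW)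
      (fun x hx => hf.sq_velocity_le cW hR hx) fun x hx => hv.deriv_support hx).trans ?_
    have hcu0 : 0 ≤ cu := by rw [hcu]; positivity
    calc cu * IW * ∫ x, deriv v x ^ 2 ≤ cu * IW * K ^ 2 := by
          gcongr; exact hv.energy.integral_deriv_sq_le
      _ = _ := by ring
  obtain ⟨mS, bS⟩ := hf.memLp_strain cW hR
  have hδU : ∫ x, (strain f1 W x * g₂ x) ^ 2 ≤ (K * √R) ^ 2 * cs * IW := by
    have hm := k2.continuous_mul_memLp hSW
    calc ∫ x, (strain f1 W x * g₂ x) ^ 2 ≤ ∫ x, (K * √R) ^ 2 * strain f1 W x ^ 2 := by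
          refine integral_mono hm.integrable_sq (mS.integrable_sq.const_mul _) fun x => ?_
          simp only
          rw [mul_pow, mul_comm]
          refine mul_le_mul_of_nonneg_right ?_ (sq_nonneg _)
          have := k2.abs_le x
          exact sq_le_sq' (_root_.abs_le.1 this).1 (_root_.abs_le.1 this).2
      _ = (K * √R) ^ 2 * ∫ x, strain f1 W x ^ 2 := integral_const_mul _ _
      _ ≤ (K * √R) ^ 2 * (cs * IW) := by gcongr
      _ = _ := by ring
  have mWuW := cW.continuous_mul_deriv_memLp hu1
  have mVuV := cV.continuous_mul_deriv_memLp hu1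
  have mu2 := h2.continuous_mul_deriv_memLp huW
  have mug2 := k2.continuous_mul_deriv_memLp huW
  have mSV := cV.continuous_mul_memLp hS1
  have mSg := k2.continuous_mul_memLp hSW
  have eW : ∫ x, W x * ((g₁ x - velocity f ω₁ x * deriv ω₁ x) -
      (g₂ x - velocity f ω₂ x * deriv ω₂ x)) = (∫ x, W x * V x) -
      (∫ x, W x * (velocity f ω₁ x * deriv W x)) - ∫ x, W x * (velocity f W x * deriv ω₂ x) := by
    have i1 : Integrable fun x => W x * V x := cW.memLp.integrable_mul cV.memLp
    have i2 : Integrable fun x => W x * (velocity f ω₁ x * deriv W x) :=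
      cW.memLp.integrable_mul mWuW
    have i3 : Integrable fun x => W x * (velocity f W x * deriv ω₂ x) := cW.memLp.integrable_mul mu2
    have i12 : Integrable fun x => W x * V x - W x * (velocity f ω₁ x * deriv W x) := i1.sub i2
    rw [← integral_sub i1 i2, ← integral_sub i12 i3]
    refine integral_congr_ae ?_
    filter_upwards [h1.energy.ae_deriv_sub h2.energy] with x hx
    rw [hf.velocity_sub h1 h2, hx]
    simp only [hV]
    ring
  have eV : ∫ x, V x * (-(strain f1 ω₁ x * g₁ x + velocity f ω₁ x * deriv g₁ x) -
      -(strain f1 ω₂ x * g₂ x + velocity f ω₂ x * deriv g₂ x)) =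
      -(∫ x, V x * (strain f1 ω₁ x * V x)) - (∫ x, V x * (velocity f ω₁ x * deriv V x)) -
      (∫ x, V x * (strain f1 W x * g₂ x)) - ∫ x, V x * (velocity f W x * deriv g₂ x) := by
    have i1 : Integrable fun x => V x * (strain f1 ω₁ x * V x) := cV.memLp.integrable_mul mSV
    have i2 : Integrable fun x => V x * (velocity f ω₁ x * deriv V x) :=
      cV.memLp.integrable_mul mVuV
    have i3 : Integrable fun x => V x * (strain f1 W x * g₂ x) := cV.memLp.integrable_mul mSg
    have i4 : Integrable fun x => V x * (velocity f W x * deriv g₂ x) :=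
      cV.memLp.integrable_mul mug2
    have i1n : Integrable fun x => -(V x * (strain f1 ω₁ x * V x)) := i1.neg
    have i12 : Integrable fun x => -(V x * (strain f1 ω₁ x * V x)) -
      V x * (velocity f ω₁ x * deriv V x) := i1n.sub i2
    have i123 : Integrable fun x => -(V x * (strain f1 ω₁ x * V x)) -
      V x * (velocity f ω₁ x * deriv V x) - V x * (strain f1 W x * g₂ x) := i12.sub i3
    rw [← integral_neg, ← integral_sub i1n i2, ← integral_sub i12 i3, ← integral_sub i123 i4]
    refine integral_congr_ae ?_
    filter_upwards [k1.energy.ae_deriv_sub k2.energy] with x hx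
    rw [hf.velocity_sub h1 h2, hf.strain_sub h1 h2, hx]
    simp only [hV]
    ring
  have hderiv := fun x => hf.hasDerivAt_velocity h1 x
  have pW := cW.integral_mul_deriv_mul hR hderiv hS1
  have pV := cV.integral_mul_deriv_mul hR hderiv hS1
  have q1 := abs_integral_mul_le cW.memLp cV.memLp
  have q2 := abs_integral_mul_le cW.memLp mu2
  have q3 := abs_integral_mul_le cV.memLp mSg
  have q4 := abs_integral_mul_le cV.memLp mug2
  have q5 := hsq W cW
  have q6 := hsq V cV
  have r1 := hδu ω₂ h2
  have r2 := hδu g₂ k2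
  have eSV : ∫ x, V x * (strain f1 ω₁ x * V x) = ∫ x, strain f1 ω₁ x * V x ^ 2 := by
    congr 1; ext x; ring
  rw [eW, eV, pW, pV, eSV]
  rw [← hIW] at q1 q2 q5
  rw [← hIV] at q1 q3 q4 q6
  set a1 := ∫ x, W x * V x
  set a2 := ∫ x, strain f1 ω₁ x * W x ^ 2
  set a3 := ∫ x, W x * (velocity f W x * deriv ω₂ x)
  set a4 := ∫ x, strain f1 ω₁ x * V x ^ 2
  set a5 := ∫ x, V x * (strain f1 W x * g₂ x)
  set a6 := ∫ x, V x * (velocity f W x * deriv g₂ x)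
  have hB0 : 0 ≤ B := (abs_nonneg _).trans (hS1b 0)
  have hcs0 : 0 ≤ cs := by rw [hcs]; positivity
  have hcu0 : 0 ≤ cu := by rw [hcu]; positivity
  have t1 : 0 ≤ cu * K ^ 2 * IV := by positivity
  have t2 : 0 ≤ (K * √R) ^ 2 * cs * IV := by positivity
  have t3 : 0 ≤ B * IW := by positivity
  have t4 : 0 ≤ B * IV := by positivity
  have t5 : 0 ≤ cu * K ^ 2 * IW := by positivity
  obtain ⟨x1, y1⟩ := abs_le.1 (le_refl |a1|)
  obtain ⟨x2, y2⟩ := abs_le.1 (le_refl |a2|)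
  obtain ⟨x3, y3⟩ := abs_le.1 (le_refl |a3|)
  obtain ⟨x4, y4⟩ := abs_le.1 (le_refl |a4|)
  obtain ⟨x5, y5⟩ := abs_le.1 (le_refl |a5|)
  obtain ⟨x6, y6⟩ := abs_le.1 (le_refl |a6|)
  rw [abs_le]
  constructor <;> linarith

theorem hasDerivWithinAt_integral_sq_of_mem {S : Set ℝ} {t : ℝ} {W : ℝ → ℝ → ℝ} {P : ℝ → ℝ}
    (ht : t ∈ S) (hW : ∀ s ∈ S, MemLp (W s) 2 volume) (hP : MemLp P 2 volume)
    (h : Tendsto (fun s => eLpNorm (fun x => (W s x - W t x) / (s - t) - P x) 2 volume)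
      (𝓝[S \ {t}] t) (𝓝 0)) :
    HasDerivWithinAt (fun s => ∫ x, W s x ^ 2) (2 * ∫ x, W t x * P x) S t := by
  classical
  let W' : ℝ → ℝ → ℝ := fun s => if s ∈ S then W s else 0
  have hW' : ∀ s ∈ S, W' s = W s := fun s hs => if_pos hs
  have := hasDerivWithinAt_integral_sq (S := S) (t := t) (W := W') (P := P) (fun s => ?_) hP ?_
  · rw [hW' t ht] at this
    exact this.congr (fun s hs => by rw [hW' s hs]) (by rw [hW' t ht])
  · by_cases hs : s ∈ S
    · rw [hW' s hs]; exact hW s hs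
    · simp only [W', if_neg hs]; exact MemLp.zero
  · refine h.congr' ?_
    filter_upwards [self_mem_nhdsWithin] with s hs
    rw [hW' s hs.1, hW' t ht]

theorem tendsto_eLpNorm_sub {l : Filter ℝ} {F H : ℝ → ℝ → ℝ}
    (hF : ∀ᶠ s in l, MemLp (F s) 2 volume) (hH : ∀ᶠ s in l, MemLp (H s) 2 volume)
    (hF0 : Tendsto (fun s => eLpNorm (F s) 2 volume) l (𝓝 0))
    (hH0 : Tendsto (fun s => eLpNorm (H s) 2 volume) l (𝓝 0)) :
    Tendsto (fun s => eLpNorm (F s - H s) 2 volume) l (𝓝 0) := by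
  have hsum := hF0.add hH0
  rw [add_zero] at hsum
  refine tendsto_of_tendsto_of_tendsto_of_le_of_le' tendsto_const_nhds hsum
    (Eventually.of_forall fun _ => zero_le) ?_
  filter_upwards [hF, hH] with s h1 h2
  exact eLpNorm_sub_le h1.aestronglyMeasurable h2.aestronglyMeasurable (by norm_num)

theorem eq_zero_of_integral_sq_eq_zero {h : ℝ → ℝ} (hc : Continuous h) (hm : MemLp h 2 volume)
    (h0 : ∫ x, h x ^ 2 = 0) : h = 0 := by
  rw [integral_eq_zero_iff_of_nonneg (fun x => sq_nonneg _) hm.integrable_sq] at h0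
  have : h =ᵐ[volume] 0 := by
    filter_upwards [h0] with x hx
    exact pow_eq_zero_iff two_ne_zero |>.1 hx
  exact (Continuous.ae_eq_iff_eq volume hc continuous_zero).1 this

namespace IsSolution

variable {f f1 : ℝ → ℝ → ℝ} {C T T' S : ℝ} {ω₀ θ₀ : ℝ → ℝ} {ω θ ω' θ' : ℝ → ℝ → ℝ}

/-- Uniqueness of solutions. -/
theorem unique (hf : KernelReg f f1 C) (h : IsSolution f T ω₀ θ₀ ω θ)
    (h' : IsSolution f T' ω₀ θ₀ ω' θ') (hS : S < T) (hS' : S < T') :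
    ∀ t ∈ Icc 0 S, ω t = ω' t ∧ θ t = θ' t := by
  obtain ⟨R₁, K₁, hR₁, hK₁, hc₁, -⟩ := h.exists_compactEnergy hS
  obtain ⟨R₂, K₂, hR₂, hK₂, hc₂, -⟩ := h'.exists_compactEnergy hS'
  set R := max R₁ R₂ with hR
  set K := max K₁ K₂ with hK
  have hR0 : 0 ≤ R := le_max_of_le_left hR₁.le
  have a1 : ∀ t ∈ Icc 0 S, CompactEnergy R K (ω t) := fun t ht =>
    (hc₁ t ht).1.mono (le_max_left _ _) (le_max_left _ _)
  have a2 : ∀ t ∈ Icc 0 S, CompactEnergy R K (ω' t) := fun t ht =>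
    (hc₂ t ht).1.mono (le_max_right _ _) (le_max_right _ _)
  have b1 : ∀ t ∈ Icc 0 S, CompactEnergy R K (deriv (θ t)) := fun t ht =>
    (hc₁ t ht).2.mono (le_max_left _ _) (le_max_left _ _)
  have b2 : ∀ t ∈ Icc 0 S, CompactEnergy R K (deriv (θ' t)) := fun t ht =>
    (hc₂ t ht).2.mono (le_max_right _ _) (le_max_right _ _)
  obtain ⟨κ, hκ⟩ := exists_energy_rate_le (K := K) hf hR0
  let e : ℝ → ℝ := fun t => (∫ x, (ω t x - ω' t x) ^ 2) + ∫ x, (deriv (θ t) x - deriv (θ' t) x) ^ 2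
  let e' : ℝ → ℝ := fun t => 2 * (∫ x, (ω t x - ω' t x) *
        ((deriv (θ t) x - velocity f (ω t) x * deriv (ω t) x) -
          (deriv (θ' t) x - velocity f (ω' t) x * deriv (ω' t) x))) +
      2 * ∫ x, (deriv (θ t) x - deriv (θ' t) x) *
        (-(strain f1 (ω t) x * deriv (θ t) x + velocity f (ω t) x * deriv (deriv (θ t)) x) -
          -(strain f1 (ω' t) x * deriv (θ' t) x + velocity f (ω' t) x * deriv (deriv (θ' t)) x))
  have hvel : ∀ {v : ℝ → ℝ}, CompactEnergy R K v → Continuous (velocity f v) := fun hv =>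
    continuous_iff_continuousAt.2 fun ζ => (hf.hasDerivAt_velocity hv ζ).continuousAt
  have mP : ∀ {v k : ℝ → ℝ}, CompactEnergy R K v → CompactEnergy R K k →
      MemLp (fun x => k x - velocity f v x * deriv v x) 2 volume := fun hv hk =>
    hk.memLp.sub (hv.continuous_mul_deriv_memLp (hvel hv))
  have mQ : ∀ {v k : ℝ → ℝ}, CompactEnergy R K v → CompactEnergy R K k →
      MemLp (fun x => -(strain f1 v x * k x + velocity f v x * deriv k x)) 2 volume := fun hv hk =>
    ((hk.continuous_mul_memLp (hf.continuous_strain hv)).add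
      (hk.continuous_mul_deriv_memLp (hvel hv))).neg
  have mD : ∀ {v k : ℝ → ℝ} (r : ℝ), CompactEnergy R K v → CompactEnergy R K k →
      MemLp (fun x => (v x - k x) / r) 2 volume := fun r hv hk => by
    have := (hv.memLp.sub hk.memLp).const_mul r⁻¹
    refine this.ae_eq (ae_of_all _ fun x => ?_)
    simp only [Pi.sub_apply]; rw [div_eq_inv_mul]
  have hderiv : ∀ t ∈ Icc 0 S, HasDerivWithinAt e (e' t) (Icc 0 S) t := by
    intro t ht
    have ev : ∀ᶠ s in 𝓝[Icc 0 S \ {t}] t, s ∈ Icc 0 S := by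
      filter_upwards [self_mem_nhdsWithin] with s hs using hs.1
    refine HasDerivWithinAt.add ?_ ?_
    · refine hasDerivWithinAt_integral_sq_of_mem (W := fun s x => ω s x - ω' s x) ht
        (fun s hs => (a1 s hs).memLp.sub (a2 s hs).memLp)
        ((mP (a1 t ht) (b1 t ht)).sub (mP (a2 t ht) (b2 t ht))) ?_
      refine (tendsto_eLpNorm_sub ?_ ?_ (h.tendsto_vorticity hS ht)
        (h'.tendsto_vorticity hS' ht)).congr fun s => ?_
      · filter_upwards [ev] with s hs using (mD _ (a1 s hs) (a1 t ht)).sub (mP (a1 t ht) (b1 t ht))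
      · filter_upwards [ev] with s hs using (mD _ (a2 s hs) (a2 t ht)).sub (mP (a2 t ht) (b2 t ht))
      · congr 1; ext x; simp only [Pi.sub_apply]; ring
    · refine hasDerivWithinAt_integral_sq_of_mem (W := fun s x => deriv (θ s) x - deriv (θ' s) x) ht
        (fun s hs => (b1 s hs).memLp.sub (b2 s hs).memLp)
        ((mQ (a1 t ht) (b1 t ht)).sub (mQ (a2 t ht) (b2 t ht))) ?_
      refine (tendsto_eLpNorm_sub ?_ ?_ (h.tendsto_density_gradient hf hS ht)
        (h'.tendsto_density_gradient hf hS' ht)).congr fun s => ?_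
      · filter_upwards [ev] with s hs using (mD _ (b1 s hs) (b1 t ht)).sub (mQ (a1 t ht) (b1 t ht))
      · filter_upwards [ev] with s hs using (mD _ (b2 s hs) (b2 t ht)).sub (mQ (a2 t ht) (b2 t ht))
      · congr 1; ext x; simp only [Pi.sub_apply]; ring
  have he0 : e 0 = 0 := by
    simp only [e, h.init_vorticity, h'.init_vorticity, h.init_density, h'.init_density, sub_self]
    simp
  have hnn : ∀ t, 0 ≤ e t := fun t =>
    add_nonneg (integral_nonneg fun _ => sq_nonneg _) (integral_nonneg fun _ => sq_nonneg _)
  have hzero : ∀ t ∈ Icc 0 S, e t = 0 := by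
    refine eq_zero_of_abs_deriv_le_mul_abs_self_of_eq_zero_right (K := κ) (f' := e')
      (fun t ht => (hderiv t ht).continuousWithinAt) (fun t ht => ?_) he0 (fun t ht => ?_)
    · refine (hderiv t (Ico_subset_Icc_self ht)).mono_of_mem_nhdsWithin ?_
      exact Icc_mem_nhdsGE_of_mem ht
    · have ht' := Ico_subset_Icc_self ht
      rw [Real.norm_eq_abs, Real.norm_eq_abs, abs_of_nonneg (hnn t)]
      exact hκ _ _ _ _ (a1 t ht') (a2 t ht') (b1 t ht') (b2 t ht')
  have hsplit : ∀ t ∈ Icc 0 S, ω t = ω' t ∧ deriv (θ t) = deriv (θ' t) := by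
    intro t ht
    have h0 := hzero t ht
    have i1 : 0 ≤ ∫ x, (ω t x - ω' t x) ^ 2 := integral_nonneg fun _ => sq_nonneg _
    have i2 : 0 ≤ ∫ x, (deriv (θ t) x - deriv (θ' t) x) ^ 2 := integral_nonneg fun _ => sq_nonneg _
    have j1 : ∫ x, (ω t x - ω' t x) ^ 2 = 0 := by simp only [e] at h0; linarith
    have j2 : ∫ x, (deriv (θ t) x - deriv (θ' t) x) ^ 2 = 0 := by simp only [e] at h0; linarith
    have z1 := eq_zero_of_integral_sq_eq_zero ((a1 t ht).sub (a2 t ht)).continuous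
      ((a1 t ht).sub (a2 t ht)).memLp j1
    have z2 := eq_zero_of_integral_sq_eq_zero ((b1 t ht).sub (b2 t ht)).continuous
      ((b1 t ht).sub (b2 t ht)).memLp j2
    exact ⟨funext fun x => sub_eq_zero.1 (congrFun z1 x),
      funext fun x => sub_eq_zero.1 (congrFun z2 x)⟩
  intro t ht
  refine ⟨(hsplit t ht).1, ?_⟩
  have hsub : Icc 0 S ⊆ Ico 0 T := fun t ht => ⟨ht.1, lt_of_le_of_lt ht.2 hS⟩
  have hsub' : Icc 0 S ⊆ Ico 0 T' := fun t ht => ⟨ht.1, lt_of_le_of_lt ht.2 hS'⟩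
  have hd := h.differentiable_density t (hsub ht)
  have hd' := h'.differentiable_density t (hsub' ht)
  have hconst : ∀ x y, θ t x - θ' t x = θ t y - θ' t y := by
    refine is_const_of_deriv_eq_zero (hd.sub hd') fun x => ?_
    rw [deriv_fun_sub (hd x) (hd' x), (hsplit t ht).2, sub_self]
  have hfar : θ t R = θ' t R := by
    have hfix : ∀ s ∈ Icc 0 S, HasDerivWithinAt (fun s => θ s R - θ' s R) 0 (Icc 0 S) s := by
      intro s hs
      have e1 := ((h.density_eq s (hsub hs) R).mono hsub).sub
        ((h'.density_eq s (hsub' hs) R).mono hsub')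
      rw [(b1 s hs).support R (le_abs_self R), (b2 s hs).support R (le_abs_self R)] at e1
      rw [mul_zero, mul_zero, sub_self] at e1
      exact e1
    have := (convex_Icc 0 S).norm_image_sub_le_of_norm_hasDerivWithin_le (C := 0) hfix
      (fun _ _ => by simp) ⟨le_rfl, ht.1.trans ht.2⟩ ht
    rw [zero_mul, norm_le_zero_iff, h.init_density, h'.init_density, sub_self, sub_zero] at this
    exact sub_eq_zero.1 this
  ext x
  have := hconst x R
  rw [hfar, sub_self] at this
  exact sub_eq_zero.1 this

theorem gradientIntegral_lt_top (h : IsSolution f T ω₀ θ₀ ω θ) (hf : KernelReg f f1 C)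
    (hS : S < T) : gradientIntegral f ω S < ∞ := by
  obtain ⟨R, K, hR, -, hc, -⟩ := h.exists_compactEnergy hS
  exact HouLuo.gradientIntegral_lt_top hf hR.le fun s hs => (hc s hs).1

/-- A solution along which the integral of the velocity gradient diverges is maximal. -/
theorem isMaximalSolution (hf : KernelReg f f1 C) (hT : 0 < T) (h : IsSolution f T ω₀ θ₀ ω θ)
    (hlim : Tendsto (gradientIntegral f ω) (𝓝[<] T) (𝓝 ∞)) :
    IsMaximalSolution f T ω₀ θ₀ ω θ := by
  have heq : ∀ (T' : ℝ) (ω' θ' : ℝ → ℝ → ℝ), IsSolution f T' ω₀ θ₀ ω' θ' →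
      ∀ t ∈ Ico 0 T', t < T → ω' t = ω t ∧ θ' t = θ t := fun T' ω' θ' h' t ht htT =>
    IsSolution.unique hf h' h ht.2 htT t ⟨ht.1, le_rfl⟩
  refine ⟨h, fun T' ω' θ' h' => ?_⟩
  have hle : T' ≤ T := by
    by_contra! hlt
    have hfin := h'.gradientIntegral_lt_top hf hlt
    have hbound : ∀ᶠ t in 𝓝[<] T, gradientIntegral f ω t ≤ gradientIntegral f ω' T := by
      filter_upwards [Ioo_mem_nhdsLT hT] with t ht
      have e : gradientIntegral f ω t = gradientIntegral f ω' t := by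
        refine setLIntegral_congr_fun measurableSet_Ioc fun s hs => ?_
        have hsT := lt_of_le_of_lt hs.2 ht.2
        rw [(heq T' ω' θ' h' s ⟨hs.1.le, hsT.trans hlt⟩ hsT).1]
      rw [e]
      exact gradientIntegral_mono _ _ ht.2.le
    exact absurd (le_of_tendsto hlim hbound) (not_le.2 hfin)
  exact ⟨hle, fun t ht => heq T' ω' θ' h' t ht (lt_of_lt_of_le ht.2 hle)⟩

end IsSolution

/-! ### Odd vorticity that is non-negative on the right half line -/

theorem log_abs_sub_sub_log_add_le {y z : ℝ} (hy : 0 < y) (hz : 0 < z) (hyz : y ≠ z) :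
    Real.log |z - y| - Real.log |z + y| ≤ -2 * (min z y / max z y) := by
  set r := min z y / max z y with hr
  have hM : 0 < max z y := lt_max_of_lt_left hz
  have hr0 : 0 < r := div_pos (lt_min hz hy) hM
  have hlt : min z y < max z y := by simpa using hyz
  have hr1 : r < 1 := (div_lt_one hM).2 hlt
  have h1 : |z - y| = max z y * (1 - r) := by
    rw [hr, mul_sub, mul_one, mul_div_cancel₀ _ hM.ne', max_sub_min_eq_abs']
  have h2 : |z + y| = max z y * (1 + r) := by
    rw [hr, mul_add, mul_one, mul_div_cancel₀ _ hM.ne', max_add_min, abs_of_pos (by linarith)]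
  have hs := Real.hasSum_log_sub_log_of_abs_lt_one (abs_lt.2 ⟨by linarith, hr1⟩)
  have h3 := le_hasSum hs 0 fun k _ => by positivity
  simp only [Nat.cast_zero, mul_zero, zero_add, pow_one, div_one, mul_one] at h3
  rw [h1, h2, Real.log_mul hM.ne' (by linarith), Real.log_mul hM.ne' (by linarith)]
  linarith

namespace CompactEnergy

variable {R K A : ℝ} {w : ℝ → ℝ}

theorem integral_eq_of_odd (hw : CompactEnergy R K w) (hR : 0 ≤ R) (hodd : ∀ x, w (-x) = -w x)
    {F : ℝ → ℝ} (hF : Integrable fun y => F y * w y) :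
    ∫ y, F y * w y = ∫ y in (0:ℝ)..R, (F y - F (-y)) * w y := by
  have hn : Integrable fun y => F (-y) * w y := by
    refine hF.comp_neg.neg.congr (ae_of_all _ fun y => ?_)
    simp [hodd]
  rw [hw.setIntegral_eq hR, ← intervalIntegral.integral_add_adjacent_intervals (b := 0)
    hF.intervalIntegrable hF.intervalIntegrable]
  have : ∫ y in (-R)..0, F y * w y = -∫ y in (0:ℝ)..R, F (-y) * w y := by
    have h := intervalIntegral.integral_comp_neg (a := 0) (b := R) fun y => F y * w y
    rw [neg_zero] at h
    rw [← h, ← intervalIntegral.integral_neg]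
    congr 1; ext y; rw [hodd]; ring
  rw [this]
  simp_rw [sub_mul]
  rw [intervalIntegral.integral_sub hF.intervalIntegrable hn.intervalIntegrable]
  ring

theorem integrable_conjPoisson_mul (hw : CompactEnergy R K w) {η : ℝ} (hη : 0 < η) (z : ℝ) :
    Integrable fun y => conjPoisson η (z - y) * w y :=
  (((continuous_conjPoisson hη).comp (by fun_prop : Continuous fun y : ℝ => z - y)).mul
    hw.continuous).integrable_of_hasCompactSupport hw.hasCompactSupport.mul_left

end CompactEnergy

/-- The odd part in `y` of the conjugate Poisson kernel. -/
def oddConjPoisson (η z y : ℝ) : ℝ := conjPoisson η (z - y) - conjPoisson η (z + y)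

theorem continuous_oddConjPoisson {η : ℝ} (hη : 0 < η) :
    Continuous fun p : ℝ × ℝ => oddConjPoisson η p.1 p.2 := by
  have := continuous_conjPoisson hη
  unfold oddConjPoisson
  fun_prop

theorem neg_two_div_le_oddConjPoisson {η z y : ℝ} (hη : 0 < η) (hz : 0 < z) (hy : 0 < y) :
    -2 / (z * y) ≤ oddConjPoisson η z y / z + oddConjPoisson η y z / y := by
  have e1 : oddConjPoisson η z y / z + oddConjPoisson η y z / y + 2 / (z * y)
      = (η ^ 2 / ((z - y) ^ 2 + η ^ 2) + η ^ 2 / ((z + y) ^ 2 + η ^ 2)) / (z * y) := by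
    have p1 : (z - y) ^ 2 + η ^ 2 ≠ 0 := by positivity
    have p2 : (z + y) ^ 2 + η ^ 2 ≠ 0 := by positivity
    simp only [oddConjPoisson, conjPoisson]
    rw [show (y - z) ^ 2 = (z - y) ^ 2 by ring, show (y + z) ^ 2 = (z + y) ^ 2 by ring]
    field_simp
    ring
  have e2 : 0 ≤ (η ^ 2 / ((z - y) ^ 2 + η ^ 2) + η ^ 2 / ((z + y) ^ 2 + η ^ 2)) / (z * y) := by
    positivity
  rw [← e1] at e2
  rw [neg_div]; linarith

theorem le_oddConjPoisson {η z y A : ℝ} (hη : 0 < η) (hA : 0 < A) (hy : 0 ≤ y) (hyA : y ≤ A)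
    (hAz : A ≤ z) : -(2 / A * η ^ 2) * (1 / ((z - y) ^ 2 + η ^ 2)) ≤ oddConjPoisson η z y := by
  have p1 : 0 < (z - y) ^ 2 + η ^ 2 := by positivity
  have p2 : 0 < (z + y) ^ 2 + η ^ 2 := by positivity
  have e : oddConjPoisson η z y + 2 / A * η ^ 2 * (1 / ((z - y) ^ 2 + η ^ 2))
      = (2 * y * (z ^ 2 - y ^ 2) + 2 / A * η ^ 2 * ((z + y) ^ 2 + η ^ 2 - A * y)) /
        (((z - y) ^ 2 + η ^ 2) * ((z + y) ^ 2 + η ^ 2)) := by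
    simp only [oddConjPoisson, conjPoisson]
    field_simp
    ring
  have h1 : 0 ≤ z ^ 2 - y ^ 2 := by nlinarith
  have h2 : 0 ≤ (z + y) ^ 2 + η ^ 2 - A * y := by nlinarith [sq_nonneg η]
  have : 0 ≤ oddConjPoisson η z y + 2 / A * η ^ 2 * (1 / ((z - y) ^ 2 + η ^ 2)) := by
    rw [e]; positivity
  linarith

namespace CompactEnergy

variable {R K A : ℝ} {w : ℝ → ℝ}

theorem neg_le_integral_oddConjPoisson (hw : CompactEnergy R K w) (hpos : ∀ x, 0 ≤ x → 0 ≤ w x)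
    {η z : ℝ} (hη : 0 < η) (hA : 0 < A) (hAz : A ≤ z) :
    -(2 * Real.pi / A * (K * √R) * η) ≤ ∫ y in (0:ℝ)..A, oddConjPoisson η z y * w y := by
  have hc := hw.continuous
  have hk := continuous_oddConjPoisson hη
  have hI : Integrable fun y : ℝ => 1 / ((z - y) ^ 2 + η ^ 2) :=
    (integrable_inv_sq_add_sq hη).comp_sub_left z
  have hB : 0 ≤ K * √R := mul_nonneg hw.nonneg (Real.sqrt_nonneg _)
  have h1 : ∫ y in (0:ℝ)..A, -(2 / A * η ^ 2 * (K * √R)) * (1 / ((z - y) ^ 2 + η ^ 2))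
      ≤ ∫ y in (0:ℝ)..A, oddConjPoisson η z y * w y := by
    refine intervalIntegral.integral_mono_on hA.le (hI.const_mul _).intervalIntegrable
      (((hk.comp (by fun_prop : Continuous fun y : ℝ => (z, y))).mul hc).intervalIntegrable _ _)
      fun y hy => ?_
    have h2 := mul_le_mul_of_nonneg_right (le_oddConjPoisson hη hA hy.1 hy.2 hAz) (hpos y hy.1)
    refine le_trans ?_ h2
    have h3 := (le_abs_self _).trans (hw.abs_le y)
    have h4 : 0 ≤ 2 / A * η ^ 2 * (1 / ((z - y) ^ 2 + η ^ 2)) := by positivity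
    nlinarith [mul_le_mul_of_nonneg_left h3 h4]
  refine le_trans ?_ h1
  rw [intervalIntegral.integral_const_mul]
  have h2 : ∫ y in (0:ℝ)..A, 1 / ((z - y) ^ 2 + η ^ 2) ≤ Real.pi / η := by
    rw [intervalIntegral.integral_of_le hA.le, ← integral_inv_sq_add_sq hη,
      ← integral_sub_left_eq_self (fun s : ℝ => 1 / (s ^ 2 + η ^ 2)) volume z]
    exact setIntegral_le_integral hI (ae_of_all _ fun y => by positivity)
  have h3 : 0 ≤ 2 / A * η ^ 2 * (K * √R) := by positivity
  have h4 := mul_le_mul_of_nonneg_left h2 h3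
  have h5 : 2 / A * η ^ 2 * (K * √R) * (Real.pi / η) = 2 * Real.pi / A * (K * √R) * η := by
    field_simp
  linarith

theorem neg_sq_le_integral_regHilbert (hw : CompactEnergy R K w) (hodd : ∀ x, w (-x) = -w x)
    (hpos : ∀ x, 0 ≤ x → 0 ≤ w x) {η : ℝ} (hη : 0 < η) (hA : 0 < A) (hAR : A ≤ R) :
    -(∫ z in A..R, w z / z) ^ 2 - (2 * Real.pi / A * (K * √R) * η) * ∫ z in A..R, w z / z
      ≤ ∫ z in A..R, w z / z * regHilbert η w z := by
  have hc := hw.continuous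
  have hk := continuous_oddConjPoisson hη
  have hz0 : ∀ z ∈ Icc A R, z ≠ 0 := fun z hz => (hA.trans_le hz.1).ne'
  have hcz : ContinuousOn (fun z => w z / z) (Icc A R) := hc.continuousOn.div continuousOn_id hz0
  have hcy : Continuous fun z => ∫ y in A..R, oddConjPoisson η z y * w y :=
    intervalIntegral.continuous_parametric_intervalIntegral_of_continuous' (by
      simp only [Function.uncurry_def]
      exact hk.mul (by fun_prop)) _ _
  have hint : ∀ {F : ℝ → ℝ}, ContinuousOn F (Icc A R) → IntervalIntegrable F volume A R :=
    fun hF => ContinuousOn.intervalIntegrable_of_Icc hAR hF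
  set B := 2 * Real.pi / A * (K * √R) * η with hB
  set Ω := ∫ z in A..R, w z / z with hΩ
  have hlow : ∀ z ∈ Icc A R,
      w z / z * (-B) + w z / z * ∫ y in A..R, oddConjPoisson η z y * w y
        ≤ w z / z * regHilbert η w z := by
    intro z hz
    have hwz : 0 ≤ w z / z := div_nonneg (hpos z (hA.le.trans hz.1)) (hA.le.trans hz.1)
    rw [← mul_add]
    refine mul_le_mul_of_nonneg_left ?_ hwz
    have e : regHilbert η w z = ∫ y in (0:ℝ)..R, oddConjPoisson η z y * w y := by
      rw [regHilbert, hw.integral_eq_of_odd (hA.le.trans hAR) hodd (hw.integrable_conjPoisson_mul hη z)]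
      simp [oddConjPoisson]
    have hi : ∀ a b : ℝ, IntervalIntegrable (fun y => oddConjPoisson η z y * w y) volume a b :=
      ((hk.comp (by fun_prop : Continuous fun y : ℝ => (z, y))).mul hc).intervalIntegrable
    rw [e, ← intervalIntegral.integral_add_adjacent_intervals (hi 0 A) (hi A R)]
    have := hw.neg_le_integral_oddConjPoisson hpos hη hA hz.1
    linarith
  have hmono := intervalIntegral.integral_mono_on hAR
    ((hint (hcz.mul continuousOn_const)).add (hint (hcz.mul hcy.continuousOn)))
    (hint (hcz.mul (hw.continuous_regHilbert hη).continuousOn)) hlow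
  have hadd : ∫ z in A..R, (w z / z * (-B) + w z / z * ∫ y in A..R, oddConjPoisson η z y * w y)
      = Ω * (-B) + ∫ z in A..R, w z / z * ∫ y in A..R, oddConjPoisson η z y * w y := by
    rw [← intervalIntegral.integral_mul_const]
    exact intervalIntegral.integral_add (hint (hcz.mul continuousOn_const))
      (hint (hcz.mul hcy.continuousOn))
  replace hmono := hadd.symm.le.trans hmono
  simp only [Pi.mul_apply] at hmono
  set I := ∫ z in A..R, w z / z * ∫ y in A..R, oddConjPoisson η z y * w y with hI
  suffices hsuff : -(Ω ^ 2) ≤ I by linarith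
  let F : ℝ → ℝ → ℝ := fun z y => w z * w y * (oddConjPoisson η z y / z)
  have hF : ContinuousOn (Function.uncurry F) (Icc A R ×ˢ Icc A R) := by
    have h1 : Continuous fun p : ℝ × ℝ => w p.1 * w p.2 := by fun_prop
    exact h1.continuousOn.mul (hk.continuousOn.div continuous_fst.continuousOn
      fun p hp => hz0 _ hp.1)
  have hFi : IntegrableOn (Function.uncurry F) (uIoc A R ×ˢ uIoc A R) := by
    rw [uIoc_of_le hAR]
    exact (hF.integrableOn_compact (isCompact_Icc.prod isCompact_Icc)).mono_set
      (prod_mono Ioc_subset_Icc_self Ioc_subset_Icc_self)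
  have hswap := intervalIntegral_intervalIntegral_swap hFi
  have hI1 : I = ∫ z in A..R, ∫ y in A..R, F z y := by
    rw [hI]
    congr 1; ext z
    rw [← intervalIntegral.integral_const_mul]
    congr 1; ext y; simp only [F]; ring
  have hin : ∀ z ∈ Icc A R, IntervalIntegrable (fun y => F z y) volume A R := fun z hz =>
    hint (hF.comp (by fun_prop : ContinuousOn (fun y : ℝ => (z, y)) (Icc A R))
      fun y hy => ⟨hz, hy⟩)
  have hin' : ∀ z ∈ Icc A R, IntervalIntegrable (fun y => F y z) volume A R := fun z hz =>
    hint (hF.comp (by fun_prop : ContinuousOn (fun y : ℝ => (y, z)) (Icc A R))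
      fun y hy => ⟨hy, hz⟩)
  have hcin : ContinuousOn (fun z => ∫ y in A..R, F z y) (Icc A R) := by
    refine (hcz.mul hcy.continuousOn).congr fun z _ => ?_
    simp only [Pi.mul_apply]
    rw [← intervalIntegral.integral_const_mul]
    congr 1; ext y; simp only [F]; ring
  have hcin' : ContinuousOn (fun z => ∫ y in A..R, F y z) (Icc A R) := by
    have hm : Continuous fun y : ℝ => w y / max A y :=
      hc.div (by fun_prop) fun y => (lt_max_of_lt_left hA).ne'
    have : Continuous fun z => w z * ∫ y in A..R, w y / max A y * oddConjPoisson η y z :=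
      hc.mul (intervalIntegral.continuous_parametric_intervalIntegral_of_continuous' (by
        simp only [Function.uncurry_def]
        exact (hm.comp continuous_snd).mul (hk.comp continuous_swap)) _ _)
    refine this.continuousOn.congr fun z _ => ?_
    simp only
    rw [← intervalIntegral.integral_const_mul]
    refine intervalIntegral.integral_congr fun y hy => ?_
    rw [uIcc_of_le hAR] at hy
    simp only [F, max_eq_right hy.1]
    ring
  have h2 : 2 * I = ∫ z in A..R, ∫ y in A..R, (F z y + F y z) := by
    rw [two_mul]
    nth_rewrite 2 [hI1]
    rw [hswap, hI1, ← intervalIntegral.integral_add (hint hcin) (hint hcin')]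
    refine intervalIntegral.integral_congr fun z hz => ?_
    rw [uIcc_of_le hAR] at hz
    exact (intervalIntegral.integral_add (hin z hz) (hin' z hz)).symm
  have h3 : ∫ z in A..R, ∫ y in A..R, -2 * (w z / z * (w y / y)) = 2 * -(Ω ^ 2) := by
    simp_rw [intervalIntegral.integral_const_mul]
    rw [intervalIntegral.integral_mul_const]
    ring
  have h4 : ∫ z in A..R, ∫ y in A..R, -2 * (w z / z * (w y / y))
      ≤ ∫ z in A..R, ∫ y in A..R, (F z y + F y z) := by
    refine intervalIntegral.integral_mono_on hAR ?_ ?_ fun z hz => ?_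
    · simp_rw [intervalIntegral.integral_const_mul]
      exact hint (continuousOn_const.mul (hcz.mul continuousOn_const))
    · refine (hint (hcin.add hcin')).congr fun z hz => ?_
      rw [uIoc_of_le hAR] at hz
      have hz' := Ioc_subset_Icc_self hz
      exact (intervalIntegral.integral_add (hin z hz') (hin' z hz')).symm
    · refine intervalIntegral.integral_mono_on hAR (hint ?_) ((hin z hz).add (hin' z hz))
        fun y hy => ?_
      · exact continuousOn_const.mul (continuousOn_const.mul hcz)
      · have hz1 := hA.trans_le hz.1
        have hy1 := hA.trans_le hy.1
        have h5 := mul_le_mul_of_nonneg_left (neg_two_div_le_oddConjPoisson hη hz1 hy1)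
          (mul_nonneg (hpos z hz1.le) (hpos y hy1.le))
        refine le_trans (le_of_eq ?_) (h5.trans (le_of_eq ?_))
        · field_simp
        · simp only [F]; ring
  linarith

theorem neg_sq_le_integral_hilbert (hw : CompactEnergy R K w) (hodd : ∀ x, w (-x) = -w x)
    (hpos : ∀ x, 0 ≤ x → 0 ≤ w x) (hA : 0 < A) (hAR : A ≤ R) :
    -(∫ z in A..R, w z / z) ^ 2 ≤ ∫ z in A..R, w z / z * hilbert w z := by
  have hz0 : ∀ z ∈ Icc A R, z ≠ 0 := fun z hz => (hA.trans_le hz.1).ne'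
  have hcz : ContinuousOn (fun z => w z / z) (Icc A R) :=
    hw.continuous.continuousOn.div continuousOn_id hz0
  have h1 : Tendsto (fun η => ∫ z in A..R, w z / z * regHilbert η w z) (𝓝[>] 0)
      (𝓝 (∫ z in A..R, w z / z * hilbert w z)) := by
    refine intervalIntegral.tendsto_integral_filter_of_dominated_convergence
      (fun z => |w z / z| * (4 * K * √1 + 2 / 1 * ∫ x, |w x|)) ?_ ?_ ?_ ?_
    · filter_upwards [self_mem_nhdsWithin] with η hη
      rw [uIoc_of_le hAR]
      exact ((hcz.mul (hw.continuous_regHilbert hη).continuousOn).mono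
        Ioc_subset_Icc_self).aestronglyMeasurable measurableSet_Ioc
    · filter_upwards [self_mem_nhdsWithin] with η hη
      refine ae_of_all _ fun z _ => ?_
      rw [norm_mul]
      exact mul_le_mul_of_nonneg_left (hw.abs_regHilbert_le hη z one_pos) (abs_nonneg _)
    · exact ContinuousOn.intervalIntegrable_of_Icc hAR (hcz.abs.mul continuousOn_const)
    · exact ae_of_all _ fun z _ => (hw.tendsto_regHilbert z).const_mul _
  have h2 : Tendsto (fun η => -(∫ z in A..R, w z / z) ^ 2
      - (2 * Real.pi / A * (K * √R) * η) * ∫ z in A..R, w z / z) (𝓝[>] 0)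
      (𝓝 (-(∫ z in A..R, w z / z) ^ 2)) := by
    have : Continuous fun η : ℝ => -(∫ z in A..R, w z / z) ^ 2
      - (2 * Real.pi / A * (K * √R) * η) * ∫ z in A..R, w z / z := by fun_prop
    have := (this.tendsto 0).mono_left (nhdsWithin_le_nhds (s := Ioi 0))
    simpa using this
  refine le_of_tendsto_of_tendsto h2 h1 ?_
  filter_upwards [self_mem_nhdsWithin] with η hη
  exact hw.neg_sq_le_integral_regHilbert hodd hpos hη hA hAR

end CompactEnergy

namespace KernelReg

variable {f f1 : ℝ → ℝ → ℝ} {C R K D : ℝ} {w : ℝ → ℝ}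

theorem sub_neg_right_le (hf : KernelReg f f1 C) {z y : ℝ} (hz : 0 ≤ z) (hy : 0 ≤ y) :
    f z y - f z (-y) ≤ 2 * C * z * y := by
  have h0 : f 0 y - f 0 (-y) = 0 := by
    have := hf.symm 0 y
    rw [neg_zero] at this; linarith
  have hb : ∀ x ∈ Icc 0 z, ‖f1 x y - f1 x (-y)‖ ≤ 2 * C * y := fun x _ => by
    have := hf.lip_right x y (-y)
    rw [sub_neg_eq_add, abs_of_nonneg (by linarith : 0 ≤ y + y)] at this
    rw [Real.norm_eq_abs]; linarith
  have := (convex_Icc 0 z).norm_image_sub_le_of_norm_hasDerivWithin_le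
    (f := fun x => f x y - f x (-y))
    (fun x _ => ((hf.hasDerivAt x y).sub (hf.hasDerivAt x (-y))).hasDerivWithinAt) hb
    (left_mem_Icc.2 hz) (right_mem_Icc.2 hz)
  rw [h0, sub_zero, sub_zero, Real.norm_eq_abs, Real.norm_eq_abs, abs_of_nonneg hz] at this
  have := (le_abs_self _).trans this
  linarith

theorem velocity_le (hf : KernelReg f f1 C) (hw : CompactEnergy R K w)
    (hodd : ∀ x, w (-x) = -w x) (hpos : ∀ x, 0 ≤ x → 0 ≤ w x) (hR : 0 ≤ R) (hRD : R ≤ D)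
    (hD : 4 * C * D ^ 2 ≤ 1) {z : ℝ} (hz : 0 < z) (hzD : z ≤ D) :
    velocity f w z ≤ -(3 / (2 * Real.pi) * ∫ y in (0:ℝ)..R, min z y / max z y * w y) := by
  have hpi := Real.pi_pos
  have hi : Integrable fun y => (Real.log |z - y| + f z y) * w y := by
    simp_rw [add_mul]
    exact (hw.integrable_log_mul z).add (hf.integrable_mul hw z)
  have hin : Integrable fun y => (Real.log |z - -y| + f z (-y)) * w y := by
    refine hi.comp_neg.neg.congr (ae_of_all _ fun y => ?_)
    simp [hodd]
  have hc : Continuous fun y => min z y / max z y * w y :=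
    ((by fun_prop : Continuous fun y => min z y).div (by fun_prop) fun y =>
      (lt_max_of_lt_left hz).ne').mul hw.continuous
  rw [velocity, hw.integral_eq_of_odd hR hodd hi]
  have key : ∫ y in (0:ℝ)..R, ((Real.log |z - y| + f z y) - (Real.log |z - -y| + f z (-y))) * w y
      ≤ ∫ y in (0:ℝ)..R, -(3 / 2) * (min z y / max z y * w y) := by
    refine intervalIntegral.integral_mono_ae_restrict hR ?_
      ((hc.const_mul _).intervalIntegrable _ _) ?_
    · simp_rw [sub_mul]
      exact (hi.sub hin).intervalIntegrable
    rw [EventuallyLE, ae_restrict_iff' measurableSet_Icc]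
    have hne : ∀ᵐ y : ℝ, y ∉ ({0, z} : Set ℝ) :=
      measure_eq_zero_iff_ae_notMem.1 ((toFinite ({0, z} : Set ℝ)).measure_zero _)
    filter_upwards [hne] with y hy hyR
    simp only [mem_insert_iff, mem_singleton_iff, not_or] at hy
    have hy0 : 0 < y := lt_of_le_of_ne hyR.1 (Ne.symm hy.1)
    have h1 := log_abs_sub_sub_log_add_le hy0 hz hy.2
    have h2 := hf.sub_neg_right_le hz.le hy0.le
    have hM : 0 < max z y := lt_max_of_lt_left hz
    have hMD : max z y ≤ D := max_le hzD (hyR.2.trans hRD)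
    have h3 : 2 * C * z * y ≤ 1 / 2 * (min z y / max z y) := by
      rw [← mul_div_assoc, le_div_iff₀ hM]
      have e : z * y = min z y * max z y := (min_mul_max z y).symm
      have h4 : max z y ^ 2 ≤ D ^ 2 := pow_le_pow_left₀ hM.le hMD 2
      have h5 : 4 * C * max z y ^ 2 ≤ 1 :=
        (mul_le_mul_of_nonneg_left h4 (by linarith [hf.nonneg])).trans hD
      calc 2 * C * z * y * max z y = 1 / 2 * min z y * (4 * C * max z y ^ 2) := by
            rw [mul_assoc (2 * C), e]; ring
        _ ≤ 1 / 2 * min z y * 1 := by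
            have : 0 < min z y := lt_min hz hy0
            gcongr
        _ = _ := by ring
    rw [sub_neg_eq_add, ← mul_assoc]
    refine mul_le_mul_of_nonneg_right ?_ (hpos y hyR.1)
    linarith
  rw [intervalIntegral.integral_const_mul] at key
  have := mul_le_mul_of_nonneg_left key (by positivity : 0 ≤ 1 / Real.pi)
  refine this.trans (le_of_eq ?_)
  field_simp

theorem velocity_nonpos (hf : KernelReg f f1 C) (hw : CompactEnergy R K w)
    (hodd : ∀ x, w (-x) = -w x) (hpos : ∀ x, 0 ≤ x → 0 ≤ w x) (hR : 0 ≤ R) (hRD : R ≤ D)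
    (hD : 4 * C * D ^ 2 ≤ 1) {z : ℝ} (hz : 0 < z) (hzD : z ≤ D) : velocity f w z ≤ 0 := by
  have hpi := Real.pi_pos
  refine (hf.velocity_le hw hodd hpos hR hRD hD hz hzD).trans (neg_nonpos.2 ?_)
  refine mul_nonneg (by positivity) (intervalIntegral.integral_nonneg hR fun y hy => ?_)
  exact mul_nonneg (div_nonneg (le_min hz.le hy.1) (hz.le.trans (le_max_left _ _))) (hpos y hy.1)

theorem integral_div_le_neg_velocity (hf : KernelReg f f1 C) (hw : CompactEnergy R K w)
    (hodd : ∀ x, w (-x) = -w x) (hpos : ∀ x, 0 ≤ x → 0 ≤ w x) (hRD : R ≤ D)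
    (hD : 4 * C * D ^ 2 ≤ 1) {z : ℝ} (hz : 0 < z) (hzR : z ≤ R) :
    1 / Real.pi * (z * ∫ y in z..R, w y / y) ≤ -velocity f w z := by
  have hpi := Real.pi_pos
  have h := hf.velocity_le hw hodd hpos (hz.le.trans hzR) hRD hD hz (hzR.trans hRD)
  have hc : Continuous fun y => min z y / max z y * w y :=
    ((by fun_prop : Continuous fun y => min z y).div (by fun_prop) fun y =>
      (lt_max_of_lt_left hz).ne').mul hw.continuous
  have hnn : ∀ y, 0 ≤ y → 0 ≤ min z y / max z y * w y := fun y hy =>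
    mul_nonneg (div_nonneg (le_min hz.le hy) (hz.le.trans (le_max_left _ _))) (hpos y hy)
  have h1 : z * ∫ y in z..R, w y / y = ∫ y in z..R, min z y / max z y * w y := by
    rw [← intervalIntegral.integral_const_mul]
    refine intervalIntegral.integral_congr fun y hy => ?_
    rw [uIcc_of_le hzR] at hy
    simp only [min_eq_left hy.1, max_eq_right hy.1]
    ring
  have h2 : 0 ≤ ∫ y in (0:ℝ)..z, min z y / max z y * w y :=
    intervalIntegral.integral_nonneg hz.le fun y hy => hnn y hy.1
  have h3 : 0 ≤ ∫ y in z..R, min z y / max z y * w y :=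
    intervalIntegral.integral_nonneg hzR fun y hy => hnn y (hz.le.trans hy.1)
  rw [← intervalIntegral.integral_add_adjacent_intervals (hc.intervalIntegrable 0 z)
    (hc.intervalIntegrable z R)] at h
  rw [h1]
  have e : 3 / (2 * Real.pi) = 3 / 2 * (1 / Real.pi) := by field_simp
  have hp : 0 ≤ 1 / Real.pi := by positivity
  rw [e] at h
  nlinarith [mul_nonneg hp h2, mul_nonneg hp h3]

theorem hilbert_div_le (hf : KernelReg f f1 C) (hw : CompactEnergy R K w)
    (hodd : ∀ x, w (-x) = -w x) (hpos : ∀ x, 0 ≤ x → 0 ≤ w x) (hR : 0 ≤ R) (hRD : R ≤ D)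
    (hD : 4 * C * D ^ 2 ≤ 1) {z : ℝ} (hz : 0 < z) (hzD : z ≤ D) :
    1 / Real.pi * (hilbert w z / z) ≤ strain f1 w z / z - velocity f w z / z ^ 2 := by
  have hpi := Real.pi_pos
  have hw' := hw.continuous
  have hDpos : 0 < D := hz.trans_le hzD
  have h := hf.velocity_le hw hodd hpos hR hRD hD hz hzD
  set J := ∫ y in (0:ℝ)..R, y * w y with hJ
  have hJ0 : 0 ≤ J := intervalIntegral.integral_nonneg hR fun y hy => mul_nonneg hy.1 (hpos y hy.1)
  have h1 : z / D ^ 2 * J ≤ ∫ y in (0:ℝ)..R, min z y / max z y * w y := by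
    rw [hJ, ← intervalIntegral.integral_const_mul]
    refine intervalIntegral.integral_mono_on hR
      ((by fun_prop : Continuous fun y => z / D ^ 2 * (y * w y)).intervalIntegrable _ _)
      (Continuous.intervalIntegrable (((by fun_prop : Continuous fun y => min z y).div
        (by fun_prop) fun y => (lt_max_of_lt_left hz).ne').mul hw') _ _) fun y hy => ?_
    rw [← mul_assoc]
    refine mul_le_mul_of_nonneg_right ?_ (hpos y hy.1)
    have hM : 0 < max z y := lt_max_of_lt_left hz
    have hMD : max z y ≤ D := max_le hzD (hy.2.trans hRD)
    rw [div_mul_eq_mul_div, div_le_div_iff₀ (by positivity) hM, ← min_mul_max z y]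
    have : max z y * max z y ≤ D ^ 2 := by nlinarith
    have h0 : 0 ≤ min z y := le_min hz.le hy.1
    nlinarith [mul_le_mul_of_nonneg_left this h0]
  have h2 : -(2 * C * J) ≤ ∫ y, f1 z y * w y := by
    rw [hw.integral_eq_of_odd hR hodd (hf.integrable₁_mul hw z), hJ,
      ← intervalIntegral.integral_const_mul, ← intervalIntegral.integral_neg]
    have hc1 := hf.continuous₁_right z
    refine intervalIntegral.integral_mono_on hR
      ((by fun_prop : Continuous fun y => -(2 * C * (y * w y))).intervalIntegrable _ _)
      (Continuous.intervalIntegrable (by fun_prop) _ _) fun y hy => ?_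
    have := hf.lip_right z y (-y)
    rw [sub_neg_eq_add, abs_of_nonneg (by linarith [hy.1] : 0 ≤ y + y)] at this
    have h3 := neg_le_of_abs_le this
    nlinarith [mul_le_mul_of_nonneg_right h3 (hpos y hy.1)]
  have e1 : strain f1 w z / z - velocity f w z / z ^ 2 - 1 / Real.pi * (hilbert w z / z)
      = 1 / (Real.pi * z) * (∫ y, f1 z y * w y) + -velocity f w z / z ^ 2 := by
    rw [strain]; field_simp; ring
  have h4 : 1 / (Real.pi * z) * (-(2 * C * J)) ≤ 1 / (Real.pi * z) * ∫ y, f1 z y * w y :=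
    mul_le_mul_of_nonneg_left h2 (by positivity)
  have h5 : 3 / (2 * Real.pi) * (z / D ^ 2 * J) / z ^ 2 ≤ -velocity f w z / z ^ 2 := by
    have h51 := mul_le_mul_of_nonneg_left h1 (by positivity : 0 ≤ 3 / (2 * Real.pi))
    exact div_le_div_of_nonneg_right (by linarith) (by positivity)
  have h6 : 0 ≤ 1 / (Real.pi * z) * (-(2 * C * J)) + 3 / (2 * Real.pi) * (z / D ^ 2 * J) / z ^ 2 := by
    have e2 : 1 / (Real.pi * z) * (-(2 * C * J)) + 3 / (2 * Real.pi) * (z / D ^ 2 * J) / z ^ 2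
        = J * (3 - 4 * C * D ^ 2) / (2 * Real.pi * z * D ^ 2) := by field_simp; ring
    rw [e2]
    exact div_nonneg (mul_nonneg hJ0 (by linarith)) (by positivity)
  linarith

end KernelReg

/-! ### Growth of the flow with positive odd data -/

theorem mul_sub_le_sub_of_le_hasDerivWithinAt {F F' : ℝ → ℝ} {a b c : ℝ} (hab : a ≤ b)
    (hF : ∀ t ∈ Icc a b, HasDerivWithinAt F (F' t) (Icc a b) t) (hc : ∀ t ∈ Icc a b, c ≤ F' t) :
    c * (b - a) ≤ F b - F a := by
  refine (convex_Icc a b).mul_sub_le_image_sub_of_le_deriv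
    (fun t ht => (hF t ht).continuousWithinAt) (fun t ht => ?_) (fun t ht => ?_)
    a (left_mem_Icc.2 hab) b (right_mem_Icc.2 hab) hab
  · have := (hF t (interior_subset ht)).hasDerivAt (mem_interior_iff_mem_nhds.1 ht)
    exact this.differentiableAt.differentiableWithinAt
  · rw [((hF t (interior_subset ht)).hasDerivAt (mem_interior_iff_mem_nhds.1 ht)).deriv]
    exact hc t (interior_subset ht)

/-- A Lagrangian flow with non-negative data on the right half line, supported so close to the
origin that the perturbation of the kernel is negligible. -/
structure PositiveFlow (f f1 : ℝ → ℝ → ℝ) (C δ G : ℝ) (g : ℝ → ℝ) (T A : ℝ) (q w : ℝ → ℝ → ℝ) :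
    Prop extends LagFlow f f1 C δ G g T A q w where
  init_left : q 0 = 0
  init_right : ∀ x, 0 ≤ x → 0 ≤ w 0 x
  force_nonneg : ∀ x, 0 ≤ x → 0 ≤ g x
  small : 4 * C * (2 * δ) ^ 2 ≤ 1

/-- The integral `∫ ω(z) / z dz` over the image of `[a, δ]`, in Lagrangian variables. -/
def moment (δ a : ℝ) (q w : ℝ → ℝ) : ℝ :=
  ∫ x in a..δ, w x * Real.exp (q x) / flowMap q x

theorem LagFlow.hasDerivWithinAt_flowMap {f f1 : ℝ → ℝ → ℝ} {C δ G : ℝ} {g : ℝ → ℝ} {T A : ℝ}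
    {q w : ℝ → ℝ → ℝ} {t : ℝ} (h : LagFlow f f1 C δ G g T A q w) (ht : t ∈ Icc 0 T) {x : ℝ}
    (hx : |x| ≤ δ) : HasDerivWithinAt (fun s => flowMap (q s) x)
      (velocity f (fun z => w t (flowInv (q t) z)) (flowMap (q t) x)) (Icc 0 T) t := by
  have hq := h.continuous_left ht
  have hV := h.continuous_field ht
  have hD : Continuous fun x => ∫ y in (0 : ℝ)..x,
      Real.exp (q t y) * lagField f1 δ (q t) (w t) y :=
    intervalIntegral.continuous_primitive (fun a b => Continuous.intervalIntegrable (by fun_prop) _ _) 0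
  have h1 := (h.unifDeriv_flowMap ht (abs_nonneg x)).comp (x := fun _ => x) (fun _ _ => le_rfl)
    continuousWithinAt_const hD
  rw [h.integral_field_eq ht hx] at h1
  simpa using h1.add_const (flowMap (q t) x)

namespace PositiveFlow

variable {f f1 : ℝ → ℝ → ℝ} {C δ G : ℝ} {g : ℝ → ℝ} {T A : ℝ} {q w : ℝ → ℝ → ℝ} {t : ℝ}

theorem right_nonneg (h : PositiveFlow f f1 C δ G g T A q w) (ht : t ∈ Icc 0 T) {x : ℝ}
    (hx : 0 ≤ x) : 0 ≤ w t x := by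
  have hsub : Icc 0 t ⊆ Icc 0 T := Icc_subset_Icc_right ht.2
  have := mul_sub_le_sub_of_le_hasDerivWithinAt (c := 0) ht.1
    (fun s hs => (h.curve.hasDeriv_right s (hsub hs) x).mono hsub)
    fun s _ => mul_nonneg (h.force_nonneg x hx) (Real.exp_pos _).le
  linarith [h.init_right x hx]

theorem vorticity_nonneg (h : PositiveFlow f f1 C δ G g T A q w) (ht : t ∈ Icc 0 T) (z : ℝ)
    (hz : 0 ≤ z) : 0 ≤ w t (flowInv (q t) z) := by
  refine h.right_nonneg ht ?_
  have := (strictMono_flowInv (h.continuous_left ht) (h.abs_left_le ht)).monotone hz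
  rwa [flowInv_zero (h.continuous_left ht)] at this

theorem vorticity_odd (h : PositiveFlow f f1 C δ G g T A q w) (ht : t ∈ Icc 0 T) (z : ℝ) :
    w t (flowInv (q t) (-z)) = -w t (flowInv (q t) z) :=
  (h.state t ht).odd_comp_flowInv h.pos h.le_one z

theorem compactEnergy_flowMap (h : PositiveFlow f f1 C δ G g T A q w) (ht : t ∈ Icc 0 T) :
    CompactEnergy (flowMap (q t) δ) (Real.exp A * A) fun z => w t (flowInv (q t) z) := by
  have h1 := (h.state t ht).compact.comp_flowInv (h.continuous_left ht) (h.abs_left_le ht)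
    (h.state t ht).even
  rwa [mul_div_cancel_left₀ _ two_ne_zero] at h1

theorem flowMap_le_two_mul (h : PositiveFlow f f1 C δ G g T A q w) (ht : t ∈ Icc 0 T) :
    flowMap (q t) δ ≤ 2 * δ := by
  have hδ := h.pos
  have hT : 0 ≤ T := ht.1.trans ht.2
  have hη : 0 < δ / (T + 1) := by positivity
  have hle : ∀ s ∈ Icc 0 T, δ + δ / (T + 1) * s ≤ 2 * δ := fun s hs => by
    have : δ / (T + 1) * s ≤ δ / (T + 1) * (T + 1) := by gcongr; linarith [hs.2]
    rw [div_mul_cancel₀ _ (by positivity)] at this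
    linarith
  have hd : ∀ s ∈ Icc 0 T, HasDerivWithinAt (fun s => flowMap (q s) δ)
      (velocity f (fun z => w s (flowInv (q s) z)) (flowMap (q s) δ)) (Icc 0 T) s := fun s hs =>
    h.hasDerivWithinAt_flowMap hs (abs_of_pos hδ).le
  refine (image_le_of_deriv_right_lt_deriv_boundary' (f := fun s => flowMap (q s) δ)
    (f' := fun s => velocity f (fun z => w s (flowInv (q s) z)) (flowMap (q s) δ))
    (B := fun s => δ + δ / (T + 1) * s) (B' := fun _ => δ / (T + 1))
    (fun s hs => (hd s hs).continuousWithinAt) (fun s hs => ?_) ?_ (by fun_prop)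
    (fun s _ => ?_) (fun s hs heq => ?_) ht).trans (hle t ht)
  · exact (hd s (Ico_subset_Icc_self hs)).mono_of_mem_nhdsWithin (Icc_mem_nhdsGE_of_mem hs)
  · simp [h.init_left, flowMap]
  · simpa using (((hasDerivAt_id s).const_mul (δ / (T + 1))).const_add δ).hasDerivWithinAt
  · have hs' := Ico_subset_Icc_self hs
    have hpos := flowMap_pos (h.continuous_left hs') hδ
    have hle' : flowMap (q s) δ ≤ 2 * δ := heq.le.trans (hle s hs')
    exact (h.kernel.velocity_nonpos (h.compactEnergy_flowMap hs') (h.vorticity_odd hs')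
      (h.vorticity_nonneg hs') hpos.le hle' h.small hpos hle').trans_lt hη

theorem flowMap_le (h : PositiveFlow f f1 C δ G g T A q w) (ht : t ∈ Icc 0 T) {x : ℝ}
    (hx : x ≤ δ) : flowMap (q t) x ≤ 2 * δ :=
  ((strictMono_flowMap (h.continuous_left ht)).monotone hx).trans (h.flowMap_le_two_mul ht)

theorem flowMap_anti (h : PositiveFlow f f1 C δ G g T A q w) {s : ℝ} (hs : 0 ≤ s) (hst : s ≤ t)
    (ht : t ≤ T) {x : ℝ} (hx : 0 < x) (hxδ : x ≤ δ) : flowMap (q t) x ≤ flowMap (q s) x := by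
  have hsub : Icc s t ⊆ Icc 0 T := Icc_subset_Icc hs ht
  have := mul_sub_le_sub_of_le_hasDerivWithinAt (c := 0) hst
    (fun r hr => ((h.hasDerivWithinAt_flowMap (hsub hr)
      ((abs_of_pos hx).trans_le hxδ)).mono hsub).neg) fun r hr => ?_
  · simp only [Pi.neg_apply] at this; linarith
  · have hr' := hsub hr
    exact neg_nonneg.2 (h.kernel.velocity_nonpos (h.compactEnergy_flowMap hr')
      (h.vorticity_odd hr') (h.vorticity_nonneg hr')
      (flowMap_pos (h.continuous_left hr') h.pos).le (h.flowMap_le_two_mul hr') h.small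
      (flowMap_pos (h.continuous_left hr') hx) (h.flowMap_le hr' hxδ))

theorem integral_comp_flowMap (h : PositiveFlow f f1 C δ G g T A q w) (ht : t ∈ Icc 0 T) {a : ℝ}
    (ha : 0 < a) (haδ : a ≤ δ) {F : ℝ → ℝ} (hF : ContinuousOn F (Ioi 0)) :
    ∫ x in a..δ, F (flowMap (q t) x) * Real.exp (q t x) =
      ∫ z in flowMap (q t) a..flowMap (q t) δ, F z := by
  have hq := h.continuous_left ht
  refine intervalIntegral.integral_comp_mul_deriv' (fun x _ => hasDerivAt_flowMap hq x)
    (by fun_prop) (hF.mono ?_)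
  rintro _ ⟨x, hx, rfl⟩
  rw [uIcc_of_le haδ] at hx
  exact flowMap_pos hq (ha.trans_le hx.1)

theorem moment_eq (h : PositiveFlow f f1 C δ G g T A q w) (ht : t ∈ Icc 0 T) {a : ℝ}
    (ha : 0 < a) (haδ : a ≤ δ) : moment δ a (q t) (w t) =
      ∫ z in flowMap (q t) a..flowMap (q t) δ, w t (flowInv (q t) z) / z := by
  have hq := h.continuous_left ht
  rw [← h.integral_comp_flowMap ht ha haδ (F := fun z => w t (flowInv (q t) z) / z)
    ((h.compactEnergy ht).continuous.continuousOn.div continuousOn_id fun z hz => (ne_of_gt hz)), moment]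
  congr 1; ext x
  rw [flowInv_flowMap hq]; ring

theorem moment_nonneg (h : PositiveFlow f f1 C δ G g T A q w) (ht : t ∈ Icc 0 T) {a : ℝ}
    (ha : 0 < a) (haδ : a ≤ δ) : 0 ≤ moment δ a (q t) (w t) :=
  intervalIntegral.integral_nonneg haδ fun _ hx =>
    div_nonneg (mul_nonneg (h.right_nonneg ht (ha.le.trans hx.1)) (Real.exp_pos _).le)
      (flowMap_pos (h.continuous_left ht) (ha.trans_le hx.1)).le

theorem moment_le_neg_velocity (h : PositiveFlow f f1 C δ G g T A q w) (ht : t ∈ Icc 0 T) {a : ℝ}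
    (ha : 0 < a) (haδ : a ≤ δ) : 1 / Real.pi * (flowMap (q t) a * moment δ a (q t) (w t)) ≤
      -velocity f (fun z => w t (flowInv (q t) z)) (flowMap (q t) a) := by
  have hq := h.continuous_left ht
  rw [h.moment_eq ht ha haδ]
  exact h.kernel.integral_div_le_neg_velocity (h.compactEnergy_flowMap ht) (h.vorticity_odd ht)
    (h.vorticity_nonneg ht) (h.flowMap_le_two_mul ht) h.small (flowMap_pos hq ha)
    ((strictMono_flowMap hq).monotone haδ)

/-- The time derivative of the integrand of `moment`. -/
def _root_.HouLuo.momentDensity (f f1 : ℝ → ℝ → ℝ) (δ : ℝ) (g q w : ℝ → ℝ) (x : ℝ) : ℝ :=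
  (g x + w x * Real.exp (q x) * (lagField f1 δ q w x -
    velocity f (fun z => w (flowInv q z)) (flowMap q x) / flowMap q x)) / flowMap q x

theorem continuousOn_momentDensity (h : PositiveFlow f f1 C δ G g T A q w) (ht : t ∈ Icc 0 T) :
    ContinuousOn (momentDensity f f1 δ g (q t) (w t)) (Ioi 0) := by
  have hq := h.continuous_left ht
  have hw := h.continuous_right ht
  have hV := h.continuous_field ht
  have hg := h.force.continuous
  have hΦ := continuous_flowMap hq
  have hu : Continuous (velocity f fun z => w t (flowInv (q t) z)) := continuous_iff_continuousAt.2
    fun ζ => (h.kernel.hasDerivAt_velocity (h.compactEnergy ht) ζ).continuousAt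
  have hne : ∀ x ∈ Ioi (0 : ℝ), flowMap (q t) x ≠ 0 := fun x hx => (flowMap_pos hq hx).ne'
  refine ContinuousOn.div (ContinuousOn.add hg.continuousOn (ContinuousOn.mul
    (by fun_prop) (ContinuousOn.sub hV.continuousOn
      (ContinuousOn.div (hu.comp hΦ).continuousOn hΦ.continuousOn hne)))) hΦ.continuousOn hne

theorem exists_momentDensity_bound (h : PositiveFlow f f1 C δ G g T A q w) {a : ℝ} (ha : 0 < a) :
    ∃ B, ∀ t ∈ Icc 0 T, ∀ x ∈ Icc a δ, |momentDensity f f1 δ g (q t) (w t) x| ≤ B := by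
  obtain ⟨M, -, hM⟩ := h.exists_bound
  set E := Real.exp (2 * A) with hE
  set c := Real.exp (-(2 * A)) * a with hc
  have hc0 : 0 < c := by positivity
  refine ⟨(G * √δ + M * E * (2 * M + E * (2 * M) / c)) / c, fun t ht x hx => ?_⟩
  have hq := h.continuous_left ht
  have hM0 : 0 ≤ M := (hM t ht).1.nonneg
  have hx0 : 0 < x := ha.trans_le hx.1
  have hΦ : c ≤ flowMap (q t) x := by
    have := le_flowMap_sub hq (h.abs_left_le ht) hx0.le
    rw [flowMap_zero, sub_zero, sub_zero] at this
    exact (mul_le_mul_of_nonneg_left hx.1 (Real.exp_pos _).le).trans this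
  have hV := fun y => (hM t ht).1.abs_left_le h.pos h.le_one y
  have hexp : ∀ y, Real.exp (q t y) ≤ E := fun y =>
    Real.exp_le_exp.2 (abs_le.1 (h.abs_left_le ht y)).2
  have hu : |velocity f (fun z => w t (flowInv (q t) z)) (flowMap (q t) x)| ≤ E * (2 * M) := by
    rw [← h.integral_field_eq ht ((abs_of_pos hx0).trans_le hx.2)]
    have := intervalIntegral.norm_integral_le_of_norm_le_const (a := 0) (b := x) (C := E * (2 * M))
      (f := fun y => Real.exp (q t y) * lagField f1 δ (q t) (w t) y) fun y _ => by
        rw [norm_mul, Real.norm_of_nonneg (Real.exp_pos _).le]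
        exact mul_le_mul (hexp y) (hV y) (abs_nonneg _) (Real.exp_pos _).le
    rw [sub_zero, abs_of_pos hx0] at this
    exact this.trans (mul_le_of_le_one_right (by positivity) (hx.2.trans h.le_one))
  rw [momentDensity, abs_div, abs_of_pos (hc0.trans_le hΦ)]
  refine div_le_div₀ (by have := h.force.nonneg; positivity) ?_ hc0 hΦ
  refine (abs_add_le _ _).trans (add_le_add (h.force.abs_le x) ?_)
  rw [abs_mul, abs_mul, Real.abs_exp]
  refine mul_le_mul (mul_le_mul ((hM t ht).2.1.abs_right_le h.le_one x) (hexp x) (Real.exp_pos _).le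
    hM0) ?_ (abs_nonneg _) (by positivity)
  refine (abs_sub _ _).trans (add_le_add (hV x) ?_)
  rw [abs_div, abs_of_pos (hc0.trans_le hΦ)]
  exact div_le_div₀ (by positivity) hu hc0 hΦ

theorem hasDerivAt_moment (h : PositiveFlow f f1 C δ G g T A q w) (ht : t ∈ Ioo 0 T) {a : ℝ}
    (ha : 0 < a) (haδ : a ≤ δ) : HasDerivAt (fun s => moment δ a (q s) (w s))
      (∫ x in a..δ, momentDensity f f1 δ g (q t) (w t) x) t := by
  obtain ⟨B, hB⟩ := h.exists_momentDensity_bound ha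
  have hpos : ∀ x ∈ Icc a δ, 0 < x := fun x hx => ha.trans_le hx.1
  have hcont : ∀ s ∈ Icc 0 T,
      ContinuousOn (fun x => w s x * Real.exp (q s x) / flowMap (q s) x) (Icc a δ) := fun s hs => by
    have hq := h.continuous_left hs
    have hw := h.continuous_right hs
    exact ContinuousOn.div (by fun_prop) (continuous_flowMap hq).continuousOn fun x hx =>
      (flowMap_pos hq (hpos x hx)).ne'
  have htc := Ioo_subset_Icc_self ht
  refine (intervalIntegral.hasDerivAt_integral_of_dominated_loc_of_deriv_le (μ := volume)
    (F := fun s x => w s x * Real.exp (q s x) / flowMap (q s) x)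
    (F' := fun s x => momentDensity f f1 δ g (q s) (w s) x) (bound := fun _ => B)
    (Ioo_mem_nhds ht.1 ht.2) ?_ ?_ ?_ ?_ intervalIntegrable_const ?_).2
  · filter_upwards [Ioo_mem_nhds ht.1 ht.2] with s hs
    rw [uIoc_of_le haδ]
    exact ((hcont s (Ioo_subset_Icc_self hs)).mono Ioc_subset_Icc_self).aestronglyMeasurable
      measurableSet_Ioc
  · exact (hcont t htc).intervalIntegrable_of_Icc haδ
  · rw [uIoc_of_le haδ]
    exact ((h.continuousOn_momentDensity htc).mono fun x hx =>
      hpos x (Ioc_subset_Icc_self hx)).aestronglyMeasurable measurableSet_Ioc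
  · refine ae_of_all _ fun x hx s hs => ?_
    rw [uIoc_of_le haδ] at hx
    exact hB s (Ioo_subset_Icc_self hs) x (Ioc_subset_Icc_self hx)
  · refine ae_of_all _ fun x hx s hs => ?_
    rw [uIoc_of_le haδ] at hx
    have hs' := Ioo_subset_Icc_self hs
    have hx0 := hpos x (Ioc_subset_Icc_self hx)
    have hnhds := Icc_mem_nhds hs.1 hs.2
    have d1 := (h.curve.hasDeriv_left s hs' x).hasDerivAt hnhds
    have d2 := (h.curve.hasDeriv_right s hs' x).hasDerivAt hnhds
    have d3 := (h.hasDerivWithinAt_flowMap hs' ((abs_of_pos hx0).trans_le hx.2)).hasDerivAt hnhds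
    have hΦ := flowMap_pos (h.continuous_left hs') hx0
    refine ((d2.mul d1.exp).div d3 hΦ.ne').congr_deriv ?_
    have e : Real.exp (-q s x) * Real.exp (q s x) = 1 := by rw [← Real.exp_add]; simp
    simp only [momentDensity, Pi.mul_apply]
    rw [mul_assoc (g x), e]
    field_simp
    ring

theorem le_integral_momentDensity (h : PositiveFlow f f1 C δ G g T A q w) (ht : t ∈ Icc 0 T)
    {a : ℝ} (ha : 0 < a) (haδ : a ≤ δ) :
    (∫ x in a..δ, g x / flowMap (q t) x) - 1 / Real.pi * moment δ a (q t) (w t) ^ 2 ≤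
      ∫ x in a..δ, momentDensity f f1 δ g (q t) (w t) x := by
  have hq := h.continuous_left ht
  have hΨ := continuous_flowInv hq (h.abs_left_le ht)
  have hE := h.compactEnergy_flowMap ht
  have hg := h.force.continuous
  have hpos : ∀ x ∈ Icc a δ, 0 < x := fun x hx => ha.trans_le hx.1
  set ω := fun z => w t (flowInv (q t) z) with hω
  have hωc : Continuous ω := hE.continuous
  have hH := hE.continuous_hilbert
  have hAa := flowMap_pos hq ha
  have hmono := (strictMono_flowMap hq).monotone
  have c1 : ContinuousOn (fun x => g x / flowMap (q t) x) (Icc a δ) :=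
    hg.continuousOn.div (continuous_flowMap hq).continuousOn fun x hx =>
      (flowMap_pos hq (hpos x hx)).ne'
  have c2 : ContinuousOn (fun z => 1 / Real.pi * (ω z / z * hilbert ω z)) (Ioi 0) :=
    continuousOn_const.mul ((hωc.continuousOn.div continuousOn_id fun z hz => (ne_of_gt hz)).mul
      hH.continuousOn)
  have c3 : ContinuousOn (fun x => 1 / Real.pi * (ω (flowMap (q t) x) / flowMap (q t) x *
      hilbert ω (flowMap (q t) x)) * Real.exp (q t x)) (Icc a δ) :=
    (c2.comp (continuous_flowMap hq).continuousOn fun x hx => flowMap_pos hq (hpos x hx)).mul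
      (by fun_prop)
  have h1 : -(1 / Real.pi * moment δ a (q t) (w t) ^ 2) ≤
      ∫ x in a..δ, 1 / Real.pi * (ω (flowMap (q t) x) / flowMap (q t) x *
        hilbert ω (flowMap (q t) x)) * Real.exp (q t x) := by
    rw [h.integral_comp_flowMap ht ha haδ (F := fun z => 1 / Real.pi * (ω z / z * hilbert ω z)) c2,
      intervalIntegral.integral_const_mul, h.moment_eq ht ha haδ, ← mul_neg]
    have hpi := Real.pi_pos
    exact mul_le_mul_of_nonneg_left (hE.neg_sq_le_integral_hilbert (h.vorticity_odd ht)
      (h.vorticity_nonneg ht) hAa (hmono haδ)) (by positivity)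
  have h2 : (∫ x in a..δ, g x / flowMap (q t) x) + (∫ x in a..δ, 1 / Real.pi *
      (ω (flowMap (q t) x) / flowMap (q t) x * hilbert ω (flowMap (q t) x)) * Real.exp (q t x)) ≤
      ∫ x in a..δ, momentDensity f f1 δ g (q t) (w t) x := by
    rw [← intervalIntegral.integral_add (c1.intervalIntegrable_of_Icc haδ)
      (c3.intervalIntegrable_of_Icc haδ)]
    refine intervalIntegral.integral_mono_on haδ ((c1.add c3).intervalIntegrable_of_Icc haδ)
      (((h.continuousOn_momentDensity ht).mono hpos).intervalIntegrable_of_Icc haδ) fun x hx => ?_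
    have hx0 := hpos x hx
    have hΦ := flowMap_pos hq hx0
    have h3 := h.kernel.hilbert_div_le hE (h.vorticity_odd ht) (h.vorticity_nonneg ht)
      (flowMap_pos hq h.pos).le (h.flowMap_le_two_mul ht) h.small hΦ (h.flowMap_le ht hx.2)
    have hwx := mul_nonneg (h.right_nonneg ht hx0.le) (Real.exp_pos (q t x)).le
    have h4 := mul_le_mul_of_nonneg_left h3 hwx
    simp only [momentDensity, lagField, clamp_of_abs_le ((abs_of_pos hx0).trans_le hx.2)]
    have e : ω (flowMap (q t) x) = w t x := by simp only [hω, flowInv_flowMap hq]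
    rw [add_div]
    refine add_le_add le_rfl (le_trans (le_of_eq ?_) (h4.trans (le_of_eq ?_)))
    · rw [e]; ring
    · rw [← hω]
      field_simp
  linarith

end PositiveFlow

namespace PositiveFlow

variable {f f1 : ℝ → ℝ → ℝ} {C δ G : ℝ} {g : ℝ → ℝ} {T A : ℝ} {q w : ℝ → ℝ → ℝ} {t : ℝ}

theorem le_integral_force_div (h : PositiveFlow f f1 C δ G g T A q w) (ht : t ∈ Icc 0 T)
    {a b m : ℝ} (ha : 0 < a) (hab : a ≤ b) (hbδ : b ≤ δ) (hm0 : 0 ≤ m)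
    (hm : ∀ x ∈ Icc a b, m ≤ g x) :
    m * (b - a) / flowMap (q t) b ≤ ∫ x in a..δ, g x / flowMap (q t) x := by
  have hq := h.continuous_left ht
  have hg := h.force.continuous
  have hc : ContinuousOn (fun x => g x / flowMap (q t) x) (Ioi 0) :=
    hg.continuousOn.div (continuous_flowMap hq).continuousOn fun x hx => (flowMap_pos hq hx).ne'
  have hi : ∀ c d, 0 < c → c ≤ d →
      IntervalIntegrable (fun x => g x / flowMap (q t) x) volume c d := fun c d hc0 hcd =>
    (hc.mono fun x hx => hc0.trans_le hx.1).intervalIntegrable_of_Icc hcd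
  have hb := ha.trans_le hab
  rw [← intervalIntegral.integral_add_adjacent_intervals (hi a b ha hab) (hi b δ hb hbδ)]
  have h1 : 0 ≤ ∫ x in b..δ, g x / flowMap (q t) x :=
    intervalIntegral.integral_nonneg hbδ fun x hx => div_nonneg
      (h.force_nonneg x (hb.le.trans hx.1)) (flowMap_pos hq (hb.trans_le hx.1)).le
  have h2 : ∫ x in a..b, m / flowMap (q t) b ≤ ∫ x in a..b, g x / flowMap (q t) x :=
    intervalIntegral.integral_mono_on hab intervalIntegrable_const (hi a b ha hab) fun x hx =>
      div_le_div₀ (hm0.trans (hm x hx)) (hm x hx) (flowMap_pos hq (ha.trans_le hx.1))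
        ((strictMono_flowMap hq).monotone hx.2)
  rw [intervalIntegral.integral_const, smul_eq_mul] at h2
  calc m * (b - a) / flowMap (q t) b = (b - a) * (m / flowMap (q t) b) := by ring
    _ ≤ _ := by linarith

theorem flowMap_mul_le (h : PositiveFlow f f1 C δ G g T A q w) {s τ a b m : ℝ} (hs : 0 < s)
    (hτ : 0 < τ) (hT : s + 2 * τ < T) (ha : 0 < a) (hab : a ≤ b) (hbδ : b ≤ δ) (hm0 : 0 ≤ m)
    (hm : ∀ x ∈ Icc a b, m ≤ g x) :
    flowMap (q (s + 2 * τ)) a * (m * (b - a) * τ ^ 2) ≤ Real.pi * flowMap (q s) b ^ 2 := by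
  have hpi := Real.pi_pos
  have haδ := hab.trans hbδ
  have hb := ha.trans_le hab
  have hmem : ∀ t ∈ Icc s (s + 2 * τ), t ∈ Ioo 0 T := fun t ht =>
    ⟨hs.trans_le ht.1, ht.2.trans_lt hT⟩
  have hsb : 0 < flowMap (q s) b := flowMap_pos (h.continuous_left
    (Ioo_subset_Icc_self (hmem s ⟨le_rfl, by linarith⟩))) hb
  set K := m * (b - a) / flowMap (q s) b ^ 2 with hK
  have hmb : 0 ≤ m * (b - a) := mul_nonneg hm0 (sub_nonneg.2 hab)
  have hK0 : 0 ≤ K := by positivity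
  set Ω := fun t => moment δ a (q t) (w t) with hΩ
  set Φ := fun t => flowMap (q t) a with hΦ
  set u := fun t => velocity f (fun z => w t (flowInv (q t) z)) (flowMap (q t) a) with hu
  have hΦpos : ∀ t ∈ Icc s (s + 2 * τ), 0 < Φ t := fun t ht =>
    flowMap_pos (h.continuous_left (Ioo_subset_Icc_self (hmem t ht))) ha
  have dΦ : ∀ t ∈ Icc s (s + 2 * τ), HasDerivAt Φ (u t) t := fun t ht =>
    (h.hasDerivWithinAt_flowMap (Ioo_subset_Icc_self (hmem t ht))
      ((abs_of_pos ha).trans_le haδ)).hasDerivAt (Icc_mem_nhds (hmem t ht).1 (hmem t ht).2)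
  have hul : ∀ t ∈ Icc s (s + 2 * τ), 1 / Real.pi * (Φ t * Ω t) ≤ -u t := fun t ht =>
    h.moment_le_neg_velocity (Ioo_subset_Icc_self (hmem t ht)) ha haδ
  have hΩ0 : ∀ t ∈ Icc s (s + 2 * τ), 0 ≤ Ω t := fun t ht =>
    h.moment_nonneg (Ioo_subset_Icc_self (hmem t ht)) ha haδ
  have hX : ∀ t ∈ Icc s (s + 2 * τ), K * (t - s) ≤ Ω t / Φ t := by
    intro t ht
    have hsub : Icc s t ⊆ Icc s (s + 2 * τ) := Icc_subset_Icc_right ht.2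
    have h0 : 0 ≤ Ω s / Φ s := div_nonneg (hΩ0 s ⟨le_rfl, by linarith⟩)
      (hΦpos s ⟨le_rfl, by linarith⟩).le
    have := mul_sub_le_sub_of_le_hasDerivWithinAt (F := fun t => Ω t / Φ t) (c := K) ht.1
      (fun r hr => ((h.hasDerivAt_moment (hmem r (hsub hr)) ha haδ).div (dΦ r (hsub hr))
        (hΦpos r (hsub hr)).ne').hasDerivWithinAt) fun r hr => ?_
    · linarith
    have hr' := hsub hr
    have hrT := Ioo_subset_Icc_self (hmem r hr')
    have hrb : 0 < flowMap (q r) b := flowMap_pos (h.continuous_left hrT) hb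
    have e1 := h.le_integral_momentDensity hrT ha haδ
    have e2 := h.le_integral_force_div hrT ha hab hbδ hm0 hm
    have e3 : flowMap (q r) b ≤ flowMap (q s) b := h.flowMap_anti hs.le hr.1 hrT.2 hb hbδ
    have e4 : Φ r ≤ flowMap (q r) b := (strictMono_flowMap (h.continuous_left hrT)).monotone hab
    have p := hΦpos r hr'
    change K ≤ ((∫ x in a..δ, momentDensity f f1 δ g (q r) (w r) x) * Φ r - Ω r * u r) / Φ r ^ 2
    rw [le_div_iff₀ (by positivity)]
    have e5 : K * Φ r ≤ m * (b - a) / flowMap (q r) b := by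
      rw [hK, div_mul_eq_mul_div, div_le_div_iff₀ (by positivity) hrb, mul_assoc]
      refine mul_le_mul_of_nonneg_left ?_ hmb
      nlinarith [e4.trans e3]
    have e6 := mul_le_mul_of_nonneg_right (e5.trans e2) p.le
    have e7 := mul_le_mul_of_nonneg_right e1 p.le
    have e8 := mul_le_mul_of_nonneg_left (hul r hr') (hΩ0 r hr')
    simp only [hΩ] at e8 ⊢
    nlinarith
  have hend : s + 2 * τ ∈ Icc s (s + 2 * τ) := ⟨by linarith, le_rfl⟩
  have hY : K * τ / Real.pi * (s + 2 * τ - (s + τ)) ≤ (Φ (s + 2 * τ))⁻¹ - (Φ (s + τ))⁻¹ := by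
    have hsub : Icc (s + τ) (s + 2 * τ) ⊆ Icc s (s + 2 * τ) := Icc_subset_Icc_left (by linarith)
    refine mul_sub_le_sub_of_le_hasDerivWithinAt (F := fun t => (Φ t)⁻¹) (by linarith)
      (fun r hr => ((dΦ r (hsub hr)).inv (hΦpos r (hsub hr)).ne').hasDerivWithinAt) fun r hr => ?_
    have p := hΦpos r (hsub hr)
    have e1 := hX r (hsub hr)
    have e2 := hul r (hsub hr)
    have e3 : K * τ ≤ Ω r / Φ r :=
      (mul_le_mul_of_nonneg_left (by linarith [hr.1]) hK0).trans e1
    rw [le_div_iff₀ p] at e3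
    rw [div_le_div_iff₀ hpi (by positivity)]
    rw [div_mul_eq_mul_div, one_mul, div_le_iff₀ hpi] at e2
    nlinarith [mul_le_mul_of_nonneg_right e3 p.le]
  have hp1 := hΦpos _ hend
  have hp2 := inv_pos.2 (hΦpos (s + τ) ⟨by linarith, by linarith⟩)
  have hZ : K * τ ^ 2 / Real.pi ≤ (Φ (s + 2 * τ))⁻¹ := by
    have : K * τ / Real.pi * (s + 2 * τ - (s + τ)) = K * τ ^ 2 / Real.pi := by ring
    linarith
  rw [← one_div, div_le_div_iff₀ hpi hp1, one_mul, hK, div_mul_eq_mul_div, div_mul_eq_mul_div,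
    div_le_iff₀ (by positivity)] at hZ
  linarith

theorem time_le (h : PositiveFlow f f1 C δ G g T A q w) (hδ : δ ≤ 1 / 32) {m : ℝ} (hm : 0 < m)
    (hg : ∀ x ∈ Icc (δ / 4) (δ / 2), m ≤ g x) : T ≤ 4 * √(8 * Real.pi / (m * δ)) := by
  have hδ0 := h.pos
  have hpi := Real.pi_pos
  set S := √(8 * Real.pi / (m * δ)) with hS
  have hS2 : S ^ 2 = 8 * Real.pi / (m * δ) := Real.sq_sqrt (by positivity)
  have hS0 : 0 < S := Real.sqrt_pos.2 (by positivity)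
  by_contra! hT
  let p : ℕ → ℝ := fun n => (1 / 2) ^ n
  have hp0 : ∀ n, 0 < p n := fun n => by positivity
  have hp1 : ∀ n, p n ≤ 1 := fun n => pow_le_one₀ (by norm_num) (by norm_num)
  have hps : ∀ n, p (n + 1) = p n / 2 := fun n => by simp only [p, pow_succ]; ring
  let a : ℕ → ℝ := fun n => δ / 4 + δ / 4 * p n
  let θ : ℕ → ℝ := fun n => (T - 4 * S) / 2 + 4 * S * (1 - p n)
  have hθ : ∀ n, 0 < θ n ∧ θ n < T := fun n => by
    have := mul_pos hS0 (hp0 n)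
    have := mul_nonneg hS0.le (sub_nonneg.2 (hp1 n))
    constructor <;> simp only [θ] <;> nlinarith
  have ha : ∀ n, δ / 4 ≤ a n ∧ a n ≤ δ / 2 := fun n => by
    have := mul_pos hδ0 (hp0 n)
    have := mul_nonneg hδ0.le (sub_nonneg.2 (hp1 n))
    constructor <;> simp only [a] <;> nlinarith
  have hstep : ∀ n, flowMap (q (θ (n + 1))) (a (n + 1)) ≤ 8 ^ n * flowMap (q (θ n)) (a n) ^ 2 := by
    intro n
    have hθs : θ (n + 1) = θ n + 2 * (S * p n) := by simp only [θ, hps]; ring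
    have has : a n - a (n + 1) = δ / 8 * p n := by simp only [a, hps]; ring
    have hpn := hp0 n
    have := h.flowMap_mul_le (s := θ n) (τ := S * p n) (a := a (n + 1)) (b := a n) (m := m)
      (hθ n).1 (by positivity) (hθs ▸ (hθ (n + 1)).2) (by linarith [(ha (n + 1)).1])
      (by nlinarith [mul_pos hδ0 hpn]) (by linarith [(ha n).2]) hm.le
      fun x hx => hg x ⟨(ha (n + 1)).1.trans hx.1, hx.2.trans (ha n).2⟩
    rw [← hθs, has, mul_pow, hS2] at this
    have e : m * (δ / 8 * p n) * (8 * Real.pi / (m * δ) * p n ^ 2) = Real.pi * p n ^ 3 := by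
      field_simp
    rw [e] at this
    have e8 : (8:ℝ) ^ n * p n ^ 3 = 1 := by
      simp only [p, ← pow_mul]
      rw [mul_comm n 3, pow_mul, ← mul_pow]; norm_num
    have h1 : flowMap (q (θ (n + 1))) (a (n + 1)) * p n ^ 3 ≤ flowMap (q (θ n)) (a n) ^ 2 := by
      nlinarith
    calc flowMap (q (θ (n + 1))) (a (n + 1))
        = 8 ^ n * (flowMap (q (θ (n + 1))) (a (n + 1)) * p n ^ 3) := by
          linear_combination (-flowMap (q (θ (n + 1))) (a (n + 1))) * e8
      _ ≤ _ := by gcongr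
  have hmem : ∀ n, θ n ∈ Icc 0 T := fun n => ⟨(hθ n).1.le, (hθ n).2.le⟩
  have hpos : ∀ n, 0 < flowMap (q (θ n)) (a n) := fun n =>
    flowMap_pos (h.continuous_left (hmem n)) (by linarith [(ha n).1])
  have hdecay : ∀ n, flowMap (q (θ n)) (a n) ≤ (1 / 8) ^ (n + 2) := by
    intro n
    induction n with
    | zero =>
      have h1 := h.flowMap_anti le_rfl (hθ 0).1.le (hθ 0).2.le (x := a 0)
        (by linarith [(ha 0).1]) (by linarith [(ha 0).2])
      have h2 : flowMap (q 0) (a 0) = a 0 := by simp [h.init_left, flowMap]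
      have := (ha 0).2
      norm_num
      linarith
    | succ n ih =>
      have h1 := pow_le_pow_left₀ (hpos n).le ih 2
      have e8 : (8:ℝ) ^ n * (1 / 8) ^ n = 1 := by rw [← mul_pow]; norm_num
      calc flowMap (q (θ (n + 1))) (a (n + 1)) ≤ 8 ^ n * ((1 / 8) ^ (n + 2)) ^ 2 :=
            (hstep n).trans (by gcongr)
        _ = (8 ^ n * (1 / 8) ^ n) * ((1 / 8) ^ (n + 3) * (1 / 8)) := by ring
        _ ≤ (1 / 8) ^ (n + 1 + 2) := by
          rw [e8, one_mul]
          exact mul_le_of_le_one_right (by positivity) (by norm_num)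
  have hlow : ∀ n, Real.exp (-(2 * A)) * (δ / 4) ≤ (1 / 8 : ℝ) ^ n := fun n => by
    have hn := ha n
    have h1 := le_flowMap_sub (h.continuous_left (hmem n)) (h.abs_left_le (hmem n))
      (x := 0) (y := a n) (by linarith)
    rw [flowMap_zero, sub_zero, sub_zero] at h1
    have h2 := mul_le_mul_of_nonneg_left hn.1 (Real.exp_pos (-(2 * A))).le
    have h3 : (1 / 8 : ℝ) ^ (n + 2) ≤ (1 / 8) ^ n :=
      pow_le_pow_of_le_one (by norm_num) (by norm_num) (by omega)
    linarith [hdecay n]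
  have hlim : Tendsto (fun n : ℕ => (1 / 8 : ℝ) ^ n) atTop (𝓝 0) :=
    tendsto_pow_atTop_nhds_zero_of_lt_one (by norm_num) (by norm_num)
  have := ge_of_tendsto' hlim hlow
  have hpos' : 0 < Real.exp (-(2 * A)) * (δ / 4) := by positivity
  linarith

end PositiveFlow

/-! ### Initial data -/

theorem exists_smooth_odd_profile {δ M : ℝ} (hδ : 0 < δ) (hM : 0 < M) :
    ∃ g : ℝ → ℝ, ContDiff ℝ (⊤ : ℕ∞) g ∧ (∀ x, g (-x) = -g x) ∧ (∀ x, 0 ≤ x → 0 ≤ g x) ∧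
      (∀ x, |g x| ≤ M * δ) ∧ (∃ G, CompactEnergy δ G g) ∧
      ∀ x ∈ Icc (δ / 4) (δ / 2), M * δ / 4 ≤ g x := by
  let φ : ContDiffBump (0 : ℝ) := ⟨δ / 2, δ, by linarith, by linarith⟩
  have hsupp : ∀ x : ℝ, δ ≤ |x| → φ x = 0 := fun x hx => φ.zero_of_le_dist (by simpa using hx)
  have hφ : ContDiff ℝ (⊤ : ℕ∞) φ := φ.contDiff
  have hg : ContDiff ℝ (⊤ : ℕ∞) fun x => M * x * φ x := by fun_prop
  have hz : ∀ x, δ ≤ |x| → M * x * φ x = 0 := fun x hx => by rw [hsupp x hx, mul_zero]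
  have hcs : HasCompactSupport fun x => M * x * φ x := φ.hasCompactSupport.mul_left
  obtain ⟨L, hL⟩ := hg.lipschitzWith_of_hasCompactSupport hcs (by simp)
  refine ⟨fun x => M * x * φ x, hg, fun x => ?_, fun x hx => ?_, fun x => ?_,
    ⟨L * √(2 * δ), ⟨EnergyLE.of_lipschitz_clamp L.2 hδ.le (fun x y => hL.dist_le_mul x y)
      fun x => ?_, hz⟩⟩, fun x hx => ?_⟩
  · simp only [φ.neg]; ring
  · exact mul_nonneg (mul_nonneg hM.le hx) φ.nonneg
  · simp only
    rcases le_or_gt δ |x| with h | h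
    · rw [hz x h, abs_zero]; positivity
    · rw [abs_mul, abs_mul, abs_of_pos hM, abs_of_nonneg φ.nonneg]
      exact (mul_le_of_le_one_right (by positivity) φ.le_one).trans (by gcongr)
  · rcases le_or_gt δ |x| with h | h
    · rw [hz x h]
      refine (hz _ ?_).symm
      rcases le_abs.1 h with h' | h'
      · rw [min_eq_left h', max_eq_right (by linarith)]; exact le_abs_self δ
      · rw [min_eq_right (by linarith), max_eq_left (by linarith), abs_neg]; exact le_abs_self δ
    · obtain ⟨h1, h2⟩ := abs_lt.1 h
      rw [min_eq_right h2.le, max_eq_right h1.le]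
  · have h1 : φ x = 1 := φ.one_of_mem_closedBall (by
      rw [Metric.mem_closedBall, dist_zero_right, Real.norm_eq_abs,
        abs_of_nonneg (by linarith [hx.1])]
      exact hx.2)
    simp only [h1, mul_one]
    nlinarith [hx.1]

theorem isAdmissible_of_profile {δ ε M : ℝ} {g : ℝ → ℝ} {G : ℝ} (hδ : 0 < δ) (hδ1 : δ ≤ 1 / 2)
    (hδε : δ ≤ ε) (hM : 0 < M) (hsmooth : ContDiff ℝ (⊤ : ℕ∞) g) (hodd : ∀ x, g (-x) = -g x)
    (hpos : ∀ x, 0 ≤ x → 0 ≤ g x) (hle : ∀ x, |g x| ≤ M * δ) (hg : CompactEnergy δ G g) :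
    IsAdmissible ε M g fun x => ∫ y in (0 : ℝ)..x, g y := by
  have hder : ∀ x, HasDerivAt (fun x => ∫ y in (0 : ℝ)..x, g y) (g x) x := fun x =>
    (hg.continuous.integral_hasStrictDerivAt 0 x).hasDerivAt
  have hd : deriv (fun x => ∫ y in (0 : ℝ)..x, g y) = g := funext fun x => (hder x).deriv
  have hsupp : Function.support g ⊆ Icc (-ε) ε := fun x hx => by
    rw [mem_Icc, ← abs_le]
    by_contra h
    exact hx (hg.support x (hδε.trans (not_le.1 h).le))
  refine ⟨hsmooth, ?_, hodd, by rwa [hd], hsupp, by rwa [hd], fun x hx => hpos x hx.1,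
    fun x hx => by rw [hd]; exact hpos x hx.1, by simp, fun x => ?_⟩
  · rw [contDiff_infty_iff_deriv, hd]
    exact ⟨fun x => (hder x).differentiableAt, hsmooth⟩
  · have h1 : |∫ y in (0 : ℝ)..x, g y| ≤ ∫ y, |g y| := by
      refine (intervalIntegral.norm_integral_le_integral_norm_uIoc (f := g) (a := 0) (b := x)).trans ?_
      exact setIntegral_le_integral hg.integrable.abs (ae_of_all _ fun y => abs_nonneg _)
    refine h1.trans ((hg.integral_abs_le_of_bound hδ.le hle).trans ?_)
    have h2 : δ * δ ≤ 1 / 2 * (1 / 2) := mul_le_mul hδ1 hδ1 hδ.le (by norm_num)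
    nlinarith

theorem exists_pos_le_of_small {C ε : ℝ} (hC : 0 ≤ C) (hε : 0 < ε) :
    ∃ δ, 0 < δ ∧ δ ≤ ε ∧ δ ≤ 1 / 32 ∧ 4 * C * (2 * δ) ^ 2 ≤ 1 := by
  have h1 : 0 < 1 / (16 * (C + 1)) := by positivity
  refine ⟨min ε (min (1 / 32) (1 / (16 * (C + 1)))), by positivity, min_le_left _ _,
    (min_le_right _ _).trans (min_le_left _ _), ?_⟩
  set δ := min ε (min (1 / 32) (1 / (16 * (C + 1))))
  have h0 : 0 < δ := by positivity
  have h2 : δ ≤ 1 / 32 := (min_le_right _ _).trans (min_le_left _ _)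
  have h3 : δ ≤ 1 / (16 * (C + 1)) := (min_le_right _ _).trans (min_le_right _ _)
  rw [le_div_iff₀ (by positivity)] at h3
  nlinarith [mul_nonneg hC h0.le]

end HouLuo

open HouLuo

theorem mainTheorem4 (f : ℝ → ℝ → ℝ)
    (hf : ContDiff ℝ 2 (Function.uncurry f))
    (hf_supp : Function.support (Function.uncurry f) ⊆ Icc (-1) 1 ×ˢ Icc (-1) 1)
    (hf_symm : ∀ x y : ℝ, f x y = f (-x) (-y))
    (ε M : ℝ) (hε : 0 < ε) (hε' : ε ≤ 1) (hM : 0 < M) :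
    ∃ ω₀ θ₀ : ℝ → ℝ, HouLuo.IsAdmissible ε M ω₀ θ₀ ∧
      ∃ Tstar : ℝ, 0 < Tstar ∧ ∃ ω θ : ℝ → ℝ → ℝ,
        HouLuo.IsMaximalSolution f Tstar ω₀ θ₀ ω θ ∧
        (∀ t ∈ Ico 0 Tstar, Function.support (ω t) ⊆ Icc (-1) 1 ∧
          Function.support (deriv (θ t)) ⊆ Icc (-1) 1) ∧
        (∀ t ∈ Ico 0 Tstar, HouLuo.gradientIntegral f ω t < ∞) ∧
        Tendsto (HouLuo.gradientIntegral f ω) (𝓝[<] Tstar) (𝓝 ∞) := by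
  obtain ⟨f1, C, hker⟩ := exists_kernelReg f hf hf_supp hf_symm
  obtain ⟨δ, hδ, hδε, hδ32, hsmall⟩ := exists_pos_le_of_small hker.nonneg hε
  have hδ1 : δ ≤ 1 := hδ32.trans (by norm_num)
  obtain ⟨g, hsmooth, hodd, hpos, hle, ⟨G, hg⟩, hm⟩ := exists_smooth_odd_profile hδ hM
  have hG := hg.nonneg
  set θ₀ : ℝ → ℝ := fun x => ∫ y in (0 : ℝ)..x, g y with hθ₀
  have hθ : ∀ x, HasDerivAt θ₀ (g x) x := fun x =>
    (hg.continuous.integral_hasStrictDerivAt 0 x).hasDerivAt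
  have h0 : LagState δ G 0 g := by
    refine ⟨fun _ => rfl, fun _ _ => rfl, by simpa using hG, ?_, hodd, hg⟩
    refine (EnergyLE.of_lipschitz_clamp (R := 0) le_rfl le_rfl (fun x y => ?_)
      fun x => rfl).mono (K := 0 * √(2 * 0)) (by simpa using hG)
    simp
  have hflow : ∀ (T : ℝ) (q w : ℝ → ℝ → ℝ) (A : ℝ), q 0 = 0 → w 0 = g →
      (∀ t ∈ Icc 0 T, LagState δ A (q t) (w t)) → LagCurve f1 δ g 0 T q w →
      PositiveFlow f f1 C δ G g T A q w := fun T q w A hq hw hs hc =>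
    ⟨⟨hker, hδ, hδ1, hg, hodd, hc, hs⟩, hq, by rwa [hw], hpos, hsmall⟩
  obtain ⟨Tstar, q, w, hT, hq, hw, hstate, hcurve, hunb⟩ :=
    exists_maximal_lagCurve hker hδ hδ1 hg hodd h0
      (Tmax := 4 * √(8 * Real.pi / (M * δ / 4 * δ)))
      fun T q w A _ hq hw hs hc =>
        (hflow T q w A hq hw hs hc).time_le hδ32 (by positivity) hm
  have hP : ∀ T < Tstar, ∃ A, PositiveFlow f f1 C δ G g T A q w := fun T hT => by
    obtain ⟨A, hA⟩ := hstate T hT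
    exact ⟨A, hflow T q w A hq hw hA (hcurve T hT)⟩
  have hL : ∀ T < Tstar, ∃ A, LagFlow f f1 C δ G g T A q w := fun T hT => by
    obtain ⟨A, hA⟩ := hP T hT
    exact ⟨A, hA.toLagFlow⟩
  have hsol := isSolution_of_lagFlow hL hθ hq hw
  have hlim := tendsto_gradientIntegral hT hL hq hunb
  refine ⟨g, θ₀, isAdmissible_of_profile hδ (hδ32.trans (by norm_num)) hδε hM hsmooth hodd hpos hle
    hg, Tstar, hT, _, _, hsol.isMaximalSolution hker hT hlim, fun t ht => ?_,
    fun t ht => hsol.gradientIntegral_lt_top hker ht.2, hlim⟩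
  obtain ⟨A, hA⟩ := hP t ht.2
  have htT : t ∈ Icc 0 t := ⟨ht.1, le_rfl⟩
  have hout : ∀ z : ℝ, z ∉ Icc (-1 : ℝ) 1 → δ ≤ |flowInv (q t) z| := fun z hz => by
    rw [mem_Icc, ← abs_le, not_le] at hz
    refine le_abs_flowInv (hA.continuous_left htT) (hA.abs_left_le htT) (hA.state t htT).even ?_
    linarith [hA.flowMap_le_two_mul htT]
  refine ⟨fun z hz => ?_, fun z hz => ?_⟩
  · by_contra h
    exact hz ((hA.state t htT).compact.support _ (hout z h))
  · by_contra h
    refine hz ?_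
    rw [(hA.hasDerivAt_density hθ htT z).deriv, hg.support _ (hout z h), zero_mul]

end
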